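/- **Setting.** Let $\Omega=(0,1)^2$ and let $\lambda_n>0$, $\delta_n>0$, $J_{2,n}$ be real sequences with $\lambda_n\to0$, $\delta_n\to0$ and $$\frac{\lambda_n}{\sqrt{\delta_n}}\to0,\qquad J_{2,n}\frac{\lambda_n}{\sqrt{\delta_n}}\ge c>0\quad\text{for all }n .$$ Let $q_1,\dots,q_k\in S^2\subset\mathbb R^3$ ($k\ge1$) be distinct, $Q_k=\{\pm q_1,\dots,\pm q_k\}$ and $L_k=\bigcup_{l}\operatorname{span}(q_l)$. Let $G:\mathbb R^3\to[0,\infty)$ be continuous on $\mathbb R^3\setminus\{0\}$ with $G(tx)=G(x)$ for $t>0$ and $\{G=0\}=L_k$ (in particular $G(0)=0$). **Discrete energies.** Let $Z_n=\{i\in\mathbb Z^2:\lambda_n i\in\Omega\}$ and $R_n=\{i\in Z_n: i+2e_1\in Z_n,\ i+e_2\in Z_n\}$. A spin field is a map $u:Z_n\to S^2$ such that, if $a$ and $b$ are the smallest and largest $j\in\mathbb Z$ with $\lambda_nj\in(0,1)$, then $(u^{(a+1,m)},u^{(a,m)})=(u^{(b,m)},u^{(b-1,m)})$ for all $m\in\mathbb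 Z$ with $\lambda_n m\in(0,1)$. For such $u$ put $$H_n(u)=\frac12\Big(\sum_{i\in R_n}\lambda_n^2\big|u^i-2(1-\delta_n)u^{i+e_1}+u^{i+2e_1}\big|^2+J_{2,n}\sum_{i\in R_n}\lambda_n^2|u^{i+e_2}-u^i|^2\Big),$$ $$P_n^G(u)=\delta_n^2\sum_{i\in R_n}\lambda_n^2\,G(u^i\times u^{i+e_1}).$$ Let $T_2(u):\Omega\to\mathbb R^3$ be the piecewise constant function equal to $\frac{u^i\times u^{i+e_1}}{\sqrt{2\delta_n}}$ on $\Omega\cap\lambda_n(i+[0,1)^2)$ whenever $i,i+e_1\in Z_n$, and equal to $0$ on the rest of $\Omega$ (strips along $\partial\Omega$ of width at most $2\lambda_n$). For $z\in L^1(\Omega,\mathbb R^3)$ let $$H_n^G(z)=\inf\{H_n(u)+P_n^G(u): u\text{ a spin field with }T_2(u)=z\text{ a.e. in }\Omega\},\qquad \inf\emptyset=+\infty .$$ **Limit energy.** For $q_\pm\in Q_k$ let $H^\times_{q_-,q_+}$ be the set of all $w=u\times u'$ with $u\in H^2_{loc}(\mathbb R,S^2)$ and $\lim_{t\to\pm\infty}w(t)=q_\pm$,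 and $$h_G(q_-,q_+)=\inf\Big\{\int_{\mathbb R}(|w|^2-1)^2+\frac{G(w)}2\,dt+\int_{\mathbb R}|w'|^2\,dt:\ w\in H^\times_{q_-,q_+}\Big\}.$$ Points of $\Omega$ are written $(x,y)$. For $z\in L^1(\Omega,\mathbb R^3)$ let $S(z)$ be the set of points of $\Omega$ at which $z$ has no approximate limit, and let $z_-$, $z_+$ be the approximate one-sided limits of $z$ from the left and from the right in the $x$-direction. Define $$H^G(z)=\begin{cases}\displaystyle\int_{S(z)}h_G(z_-,z_+)\,d\mathcal H^1&\text{if }z\in BV(\Omega,Q_k)\text{ does not depend on }y,\\ +\infty&\text{otherwise in }L^1(\Omega,\mathbb R^3).\end{cases}$$ **Theorem.** The functionals $\dfrac{H_n^G}{\sqrt2\,\lambda_n\delta_n^{3/2}}$ $\Gamma$-converge to $H^G$ with respect to the strong topology of $L^1(\Omega,\mathbb R^3)$: for every $z_n\to z$ in $L^1$ one has $H^G(z)\le\liminf_n\frac{H_n^G(z_n)}{\sqrt2\lambda_n\delta_n^{3/2}}$, and every $z\in L^1$ admits $z_n\to z$ in $L^1$ with $\limsup_n\frac{H_n^G(z_n)}{\sqrt2\lambda_n\delta_n^{3/2}}\le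 H^G(z)$. -/

import Mathlib

open Set Filter Topology MeasureTheory
open scoped ENNReal ContDiff

noncomputable section

namespace HelicalXY

/-- The plane, with its Euclidean norm. -/
abbrev E2 := EuclideanSpace ℝ (Fin 2)

/-- Three-dimensional space, with its Euclidean norm. -/
abbrev E3 := EuclideanSpace ℝ (Fin 3)

/-- The open unit square `(0,1)²`. -/
def Omega : Set E2 := {p | ∀ j, p j ∈ Ioo (0 : ℝ) 1}

/-- Lebesgue measure on the unit square. -/
def volOmega : Measure E2 := volume.restrict Omega

/-- The Banach space `L¹(Ω, ℝ³)`, with its norm topology. -/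
abbrev L1Omega := Lp E3 1 volOmega

/-- The cross product of `ℝ³`. -/
def cross (a b : E3) : E3 := WithLp.toLp 2 (crossProduct a.ofLp b.ofLp)

/-! ### Sequential Gamma-convergence -/

/-- Gamma-convergence of `F n` to `F₀` (sequential form, for a metric space `X`): the liminf
inequality along every convergent sequence, and a recovery sequence at every point. -/
def GammaConverges {X : Type*} [TopologicalSpace X] (F : ℕ → X → ℝ≥0∞) (F₀ : X → ℝ≥0∞) : Prop :=
  (∀ (x : X) (xs : ℕ → X), Tendsto xs atTop (𝓝 x) →
      F₀ x ≤ liminf (fun n => F n (xs n)) atTop) ∧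
  (∀ x : X, ∃ xs : ℕ → X, Tendsto xs atTop (𝓝 x) ∧
      limsup (fun n => F n (xs n)) atTop ≤ F₀ x)

/-! ### The discrete energies -/

/-- `ℤ²_n(Ω)`: the integer points `i` with `lam * i ∈ Ω`. -/
def lattice (lam : ℝ) : Set (ℤ × ℤ) :=
  {i | lam * i.1 ∈ Ioo (0 : ℝ) 1 ∧ lam * i.2 ∈ Ioo (0 : ℝ) 1}

/-- `R_n(Ω)`: the lattice points `i` such that `i + 2e₁` and `i + e₂` are lattice points. -/
def bulk (lam : ℝ) : Set (ℤ × ℤ) :=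
  {i | i ∈ lattice lam ∧ (i.1 + 2, i.2) ∈ lattice lam ∧ (i.1, i.2 + 1) ∈ lattice lam}

/-- `u` restricts to a spin field on the lattice: it is `S²`-valued there and satisfies the
horizontal boundary condition
`(u^(a+1,m), u^(a,m)) = (u^(b,m), u^(b-1,m))` on each row `m`, where `a` and `b` are the smallest
and the largest horizontal index. Values of `u` off the lattice play no role. -/
def IsSpinField (lam : ℝ) (u : ℤ × ℤ → E3) : Prop :=
  (∀ i ∈ lattice lam, ‖u i‖ = 1) ∧
  ∀ a b m : ℤ,
    IsLeast {j : ℤ | lam * j ∈ Ioo (0 : ℝ) 1} a →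
    IsGreatest {j : ℤ | lam * j ∈ Ioo (0 : ℝ) 1} b →
    lam * m ∈ Ioo (0 : ℝ) 1 →
    inner ℝ (u (a + 1, m)) (u (a, m)) = inner ℝ (u (b, m)) (u (b - 1, m))

/-- The renormalized helical XY energy `H_n(u)`. -/
def energyH (lam del J₂ : ℝ) (u : ℤ × ℤ → E3) : ℝ :=
  (1 / 2) *
    ((∑ᶠ i ∈ bulk lam,
        lam ^ 2 * ‖u i - (2 * (1 - del)) • u (i.1 + 1, i.2) + u (i.1 + 2, i.2)‖ ^ 2) +
      J₂ * ∑ᶠ i ∈ bulk lam, lam ^ 2 * ‖u (i.1, i.2 + 1) - u i‖ ^ 2)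

/-- The soft penalization `P_n^G(u)`. -/
def penalty (lam del : ℝ) (G : E3 → ℝ) (u : ℤ × ℤ → E3) : ℝ :=
  del ^ 2 * ∑ᶠ i ∈ bulk lam, lam ^ 2 * G (cross (u i) (u (i.1 + 1, i.2)))

open Classical in
/-- The chirality `T₂(u)`: the function with value `z^i = (u^i × u^(i+e₁)) / √(2 δ)` on the cell
`lam * (i + [0,1)²)`, for each `i` for which both spins are defined, and `0` on the remaining
strip along the boundary, whose width is at most `2 * lam`. -/
def chirality (lam del : ℝ) (u : ℤ × ℤ → E3) (p : E2) : E3 :=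
  if (⌊p 0 / lam⌋, ⌊p 1 / lam⌋) ∈ lattice lam ∧ (⌊p 0 / lam⌋ + 1, ⌊p 1 / lam⌋) ∈ lattice lam then
    (Real.sqrt (2 * del))⁻¹ •
      cross (u (⌊p 0 / lam⌋, ⌊p 1 / lam⌋)) (u (⌊p 0 / lam⌋ + 1, ⌊p 1 / lam⌋))
  else 0

/-- The energy `H_n^G` on `L¹(Ω, ℝ³)`: the infimum of `H_n(u) + P_n^G(u)` over the spin fields `u`
with `T₂(u) = z`; it is `⊤` if there is none. -/
def energyHG (lam del J₂ : ℝ) (G : E3 → ℝ) (z : L1Omega) : ℝ≥0∞ :=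
  ⨅ (u : ℤ × ℤ → E3) (_ : IsSpinField lam u) (_ : chirality lam del u =ᵐ[volOmega] z),
    ENNReal.ofReal (energyH lam del J₂ u + penalty lam del G u)

/-! ### The wells -/

/-- `Q_k = {±q₁, …, ±q_k}`. -/
def wells {k : ℕ} (q : Fin k → E3) : Set E3 := {x | ∃ l, x = q l ∨ x = -q l}

/-- `L_k`, the union of the lines spanned by `q₁, …, q_k`. -/
def lines {k : ℕ} (q : Fin k → E3) : Set E3 := ⋃ l, (Submodule.span ℝ {q l} : Set E3)

/-! ### The optimal profile problem -/

/-- `g` is the weak (distributional) derivative of `f` on the real line. -/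
def IsWeakDeriv (f g : ℝ → E3) : Prop :=
  LocallyIntegrable f ∧ LocallyIntegrable g ∧
  ∀ φ : ℝ → ℝ, ContDiff ℝ ∞ φ → HasCompactSupport φ →
    ∫ t, deriv φ t • f t = -∫ t, φ t • g t

/-- `f ∈ L²_loc(ℝ, ℝ³)`. -/
def MemL2Loc (f : ℝ → E3) : Prop := ∀ K : Set ℝ, IsCompact K → MemLp f 2 (volume.restrict K)

/-- `f ∈ H¹_loc(ℝ, ℝ³)`. -/
def MemH1Loc (f : ℝ → E3) : Prop := MemL2Loc f ∧ ∃ g, IsWeakDeriv f g ∧ MemL2Loc g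

/-- `f ∈ H²_loc(ℝ, ℝ³)`. -/
def MemH2Loc (f : ℝ → E3) : Prop := MemL2Loc f ∧ ∃ g, IsWeakDeriv f g ∧ MemH1Loc g

/-- `H^×_{q₁,q₂}`: the functions `w = u × u'` with `u ∈ H²_loc(ℝ, S²)`, `w → q₁` at `-∞` and
`w → q₂` at `+∞`. An element of `H²_loc` is represented by its unique `C¹` representative. -/
def profiles (q₁ q₂ : E3) : Set (ℝ → E3) :=
  {w | (∃ u : ℝ → E3, ContDiff ℝ 1 u ∧ MemH2Loc u ∧ (∀ t, ‖u t‖ = 1) ∧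
          ∀ t, w t = cross (u t) (deriv u t)) ∧
        Tendsto w atBot (𝓝 q₁) ∧ Tendsto w atTop (𝓝 q₂)}

/-- The transition energy `h_G(q₁, q₂)`; here `dw` is the (a.e. unique) weak derivative of `w`. -/
def transition (G : E3 → ℝ) (q₁ q₂ : E3) : ℝ≥0∞ :=
  ⨅ (w : ℝ → E3) (_ : w ∈ profiles q₁ q₂) (dw : ℝ → E3) (_ : IsWeakDeriv w dw),
    (∫⁻ t, ENNReal.ofReal ((‖w t‖ ^ 2 - 1) ^ 2 + G (w t) / 2)) +
      ∫⁻ t, ENNReal.ofReal (‖dw t‖ ^ 2)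

/-! ### The limit energy -/

/-- The divergence of a `C¹` vector field on the plane. -/
def divergence (φ : E2 → E2) (p : E2) : ℝ :=
  ∑ j, (fderiv ℝ φ p (EuclideanSpace.single j 1)) j

/-- The total variation of `z` in `Ω`: the supremum of `∑_α ∫_Ω z_α div φ_α` over the
`φ ∈ C¹_c(Ω, ℝ^{3×2})` with `|φ| ≤ 1`. -/
def totalVariation (z : E2 → E3) : ℝ≥0∞ :=
  ⨆ (φ : Fin 3 → E2 → E2)
    (_ : ∀ α, ContDiff ℝ 1 (φ α) ∧ HasCompactSupport (φ α) ∧ tsupport (φ α) ⊆ Omega)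
    (_ : ∀ p, ∑ α, ‖φ α p‖ ^ 2 ≤ 1),
    ENNReal.ofReal (∑ α, ∫ p, z p α * divergence (φ α) p ∂volOmega)

/-- `z ∈ BV(Ω, Q)`, for an integrable `z`. -/
def MemBV (Q : Set E3) (z : L1Omega) : Prop :=
  totalVariation z < ⊤ ∧ ∀ᵐ p ∂volOmega, z p ∈ Q

/-- `z` does not depend on the second variable. -/
def IndepOfY (z : L1Omega) : Prop := ∃ z₀ : ℝ → E3, ∀ᵐ p ∂volOmega, z p = z₀ (p 0)

/-- `a` is the approximate limit at `p` of the restriction of `z` to `A`. -/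
def IsApproxLim (z : E2 → E3) (A : E2 → Set E2) (p : E2) (a : E3) : Prop :=
  Tendsto (fun r : ℝ => ⨍ x in Metric.ball p r ∩ A p, ‖z x - a‖) (𝓝[>] 0) (𝓝 0)

/-- `S(z)`: the points of `Ω` at which `z` has no approximate limit. -/
def discontinuitySet (z : E2 → E3) : Set E2 :=
  {p | p ∈ Omega ∧ ¬ ∃ a, IsApproxLim z (fun _ => univ) p a}

open Classical in
/-- The one-sided limit of `z` at `p` along `A` (`0` if it does not exist). -/
def approxLim (z : E2 → E3) (A : E2 → Set E2) (p : E2) : E3 :=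
  if h : ∃ a, IsApproxLim z A p a then h.choose else 0

/-- `z_-(p)`, the limit of `z` at `p` from the left half-plane. -/
def leftLim (z : E2 → E3) (p : E2) : E3 := approxLim z (fun p => {x | x 0 < p 0}) p

/-- `z_+(p)`, the limit of `z` at `p` from the right half-plane. -/
def rightLim (z : E2 → E3) (p : E2) : E3 := approxLim z (fun p => {x | p 0 < x 0}) p

open Classical in
/-- The limit functional `H^G`. -/
def limitEnergy {k : ℕ} (q : Fin k → E3) (G : E3 → ℝ) (z : L1Omega) : ℝ≥0∞ :=
  if MemBV (wells q) z ∧ IndepOfY z then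
    ∫⁻ p in discontinuitySet z, transition G (leftLim z p) (rightLim z p)
      ∂(Measure.hausdorffMeasure 1)
  else ⊤

end HelicalXY

end

open Set Filter Topology MeasureTheory
open scoped ENNReal ContDiff

noncomputable section

section

namespace HelicalXY

/-! ### The cross product -/

/-! Put `h = √(2δ)`. After division by `√2 λ δ^(3/2)` every row of the grid becomes a chain of spins
with time step `h` (`energy_eq`). For unit spins the energy of three consecutive sites is exactly
`h` times a discretization of `|w'|² + (|w|² - 1)² + G(w)/2`, where `w = u × u'` (`siteE_eq`). As
`λ/h → 0`, the unit interval becomes infinitely long in this time scale. The chirality must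
therefore sit at the zeros `±q_l` of the potential, where the spin rotates uniformly at no cost, and
a jump is a transition between two wells on the time scale one.

Lower bound. Along a subsequence the chiralities converge almost everywhere. By Fatou the limit
takes values in the wells (`LowEnergy.ae_mem`). The vertical energy makes the limit Hölder
continuous in `y` on almost every column; the wells being finitely many, it does not depend on `y`
(`LowEnergy.indepOfY`). A good row (`LowEnergy.exists_row`) is then cut at points where its
chirality converges, and each piece is bounded below by `exists_chain_bound`. That bound rests on
compactness: a chain that stays away from all wells between its end points has bounded length, so
such chains converge to a curve in the sphere, with lower semicontinuous energy
(`exists_limit_curve`). The curve starts and ends with chirality close to a well and is completed to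
an admissible profile by short cheap arcs (`exists_bend`, `exists_connects`). A general chain is a
succession of such transits, whence the need for the triangle inequality `transition_triangle`:
rotations about a common axis sweep the same circle, so two profiles can be joined after waiting for
their phases to agree. Since distinct wells have transition energy bounded below
(`IsWells.exists_le_transition`), the limit has finitely many jumps. It is then a step function, and
its limit energy is the sum of the transition energies (`IsStep.limitEnergy_eq`).

Upper bound. A function of finite energy is a step function (`exists_isStep_of_totalVariation`).
Each jump is realized by an almost optimal curve that is a rotation outside a compact time interval,
and these curves are joined in succession at prescribed times (`exists_pulse`). The result is
sampled with spacing `θ`, where `2 sin (θ/2) = h`, equally in all rows. With this choice sampled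
rotations have zero energy, so only compact windows contribute, and there the sampled energy
converges (`IsCurve.eventually_chainE_sample_le`). The vertical energy vanishes.

The penalty is homogeneous of degree zero, hence discontinuous at the origin in general. For the
lower bound `G ≥ 0 = G 0` suffices there. For the upper bound the time a curve spends at rest is cut
out first (`Connects.exists_moving`). -/

lemma cross_apply_zero (a b : E3) : cross a b 0 = a 1 * b 2 - a 2 * b 1 := by
  simp [cross, crossProduct]

lemma cross_apply_one (a b : E3) : cross a b 1 = a 2 * b 0 - a 0 * b 2 := by
  simp [cross, crossProduct]

lemma cross_apply_two (a b : E3) : cross a b 2 = a 0 * b 1 - a 1 * b 0 := by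
  simp [cross, crossProduct]

lemma inner_eq (a b : E3) : inner ℝ a b = a 0 * b 0 + a 1 * b 1 + a 2 * b 2 := by
  simp [PiLp.inner_apply, Fin.sum_univ_three]; ring

lemma norm_sq_eq (a : E3) : ‖a‖ ^ 2 = a 0 ^ 2 + a 1 ^ 2 + a 2 ^ 2 := by
  simp [EuclideanSpace.norm_sq_eq, Fin.sum_univ_three]

lemma E3_ext {a b : E3} (h0 : a 0 = b 0) (h1 : a 1 = b 1) (h2 : a 2 = b 2) : a = b := by
  ext i; fin_cases i <;> assumption

lemma cross_add_left (a b c : E3) : cross (a + b) c = cross a c + cross b c := by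
  simp [cross]

lemma cross_add_right (a b c : E3) : cross a (b + c) = cross a b + cross a c := by
  simp [cross]

lemma cross_smul_left (r : ℝ) (a b : E3) : cross (r • a) b = r • cross a b := by
  simp [cross]

lemma cross_smul_right (r : ℝ) (a b : E3) : cross a (r • b) = r • cross a b := by
  simp [cross]

lemma cross_self (a : E3) : cross a a = 0 := by
  simp [cross]

lemma cross_neg_right (a b : E3) : cross a (-b) = -cross a b := by
  simpa using cross_smul_right (-1) a b

lemma cross_sub_left (a b c : E3) : cross (a - b) c = cross a c - cross b c := by
  simp [cross]

lemma cross_sub_right (a b c : E3) : cross a (b - c) = cross a b - cross a c := by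
  simp [cross]

lemma cross_anticomm (a b : E3) : cross a b = -cross b a := by
  apply E3_ext <;> simp [cross_apply_zero, cross_apply_one, cross_apply_two] <;> ring

lemma norm_cross_sq (a b : E3) :
    ‖cross a b‖ ^ 2 = ‖a‖ ^ 2 * ‖b‖ ^ 2 - (inner ℝ a b) ^ 2 := by
  simp only [norm_sq_eq, inner_eq, cross_apply_zero, cross_apply_one, cross_apply_two]; ring

lemma norm_cross_le (a b : E3) : ‖cross a b‖ ≤ ‖a‖ * ‖b‖ := by
  have h := norm_cross_sq a b
  apply abs_le_of_sq_le_sq' _ (by positivity) |>.2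
  nlinarith [sq_nonneg (inner ℝ a b : ℝ)]

lemma inner_cross_left (a b : E3) : inner ℝ (cross a b) a = (0 : ℝ) := by
  simp only [inner_eq, cross_apply_zero, cross_apply_one, cross_apply_two]; ring

lemma inner_cross_right (a b : E3) : inner ℝ (cross a b) b = (0 : ℝ) := by
  simp only [inner_eq, cross_apply_zero, cross_apply_one, cross_apply_two]; ring

lemma cross_cross_left (a b : E3) :
    cross (cross a b) a = ‖a‖ ^ 2 • b - (inner ℝ a b : ℝ) • a := by
  apply E3_ext <;> simp [cross_apply_zero, cross_apply_one, cross_apply_two, norm_sq_eq, inner_eq] <;> ring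

lemma cross_cross_right (a b : E3) :
    cross (cross a b) b = (inner ℝ a b : ℝ) • b - ‖b‖ ^ 2 • a := by
  apply E3_ext <;> simp [cross_apply_zero, cross_apply_one, cross_apply_two, norm_sq_eq, inner_eq] <;> ring

/-- The cross product as a bilinear map. -/
def crossLM : E3 →ₗ[ℝ] E3 →ₗ[ℝ] E3 :=
  LinearMap.mk₂ ℝ cross cross_add_left cross_smul_left cross_add_right cross_smul_right

lemma crossLM_apply (a b : E3) : crossLM a b = cross a b := rfl

/-- The cross product as a continuous bilinear map. -/
def crossL : E3 →L[ℝ] E3 →L[ℝ] E3 :=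
  LinearMap.mkContinuous₂ crossLM 1 (fun a b => by
    rw [crossLM_apply, one_mul]; exact norm_cross_le a b)

lemma crossL_apply (a b : E3) : crossL a b = cross a b := crossLM_apply a b

lemma continuous_cross : Continuous fun p : E3 × E3 => cross p.1 p.2 := by
  have h := crossL.isBoundedBilinearMap.continuous
  simpa only [crossL_apply] using h

lemma tendsto_cross {α : Type*} {l : Filter α} {f g : α → E3} {a b : E3}
    (hf : Tendsto f l (𝓝 a)) (hg : Tendsto g l (𝓝 b)) :
    Tendsto (fun x => cross (f x) (g x)) l (𝓝 (cross a b)) := by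
  have h := (continuous_cross.tendsto (a, b)).comp (hf.prodMk_nhds hg)
  exact h

lemma hasDerivAt_cross {f g : ℝ → E3} {f' g' : E3} {t : ℝ}
    (hf : HasDerivAt f f' t) (hg : HasDerivAt g g' t) :
    HasDerivAt (fun x => cross (f x) (g x)) (cross (f t) g' + cross f' (g t)) t := by
  have h := crossL.hasDerivAt_of_bilinear (u := f) (v := g) (fun _ => hf) (fun _ => hg)
  simpa only [crossL_apply] using h

/-- For a unit vector `a` and `b ⟂ a`, the cross product keeps norms. -/
lemma norm_cross_of_orth {a b : E3} (ha : ‖a‖ = 1) (hab : inner ℝ a b = (0 : ℝ)) :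
    ‖cross a b‖ = ‖b‖ := by
  have h := norm_cross_sq a b
  rw [ha, hab] at h
  have : ‖cross a b‖ ^ 2 = ‖b‖ ^ 2 := by rw [h]; ring
  exact (sq_eq_sq₀ (norm_nonneg _) (norm_nonneg _)).1 this

/-- The velocity is recovered from the chirality. -/
lemma cross_cross_of_orth {a b : E3} (ha : ‖a‖ = 1) (hab : inner ℝ a b = (0 : ℝ)) :
    cross (cross a b) a = b := by
  rw [cross_cross_left, ha, hab]; simp

/-! ### The energy of one site -/

/-- The rescaled energy of three consecutive spins, with `h = √(2 δ)`. -/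
def siteE (h : ℝ) (G : E3 → ℝ) (a b c : E3) : ℝ :=
  (2 / h ^ 3) * ((1 / 2) * ‖a - (2 * (1 - h ^ 2 / 2)) • b + c‖ ^ 2) + (h / 2) * G (cross a b)

/-- The difference quotient `(b - a) / h`. -/
def dq (h : ℝ) (a b : E3) : E3 := h⁻¹ • (b - a)

lemma normSq_sub_unit {a b : E3} (ha : ‖a‖ = 1) (hb : ‖b‖ = 1) :
    ‖b - a‖ ^ 2 = 2 - 2 * inner ℝ a b := by
  rw [norm_sub_sq_real, ha, hb, real_inner_comm]; ring

/-- For unit spins every scalar product of neighbours is a function of `‖dq‖²`. The part of the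
second difference orthogonal to the middle spin gives the kinetic term, the part along it gives the
double well. The identity is exact, so no error terms appear later. -/
lemma siteE_eq {h : ℝ} (hh : 0 < h) (G : E3 → ℝ) {a b c : E3} (ha : ‖a‖ = 1) (hb : ‖b‖ = 1)
    (hc : ‖c‖ = 1) :
    siteE h G a b c = h * (‖cross b (dq h b c - dq h a b)‖ ^ 2 / h ^ 2 +
      (1 - (‖dq h a b‖ ^ 2 + ‖dq h b c‖ ^ 2) / 2) ^ 2 + G (cross a b) / 2) := by
  have h1 : ‖cross b (dq h b c - dq h a b)‖ ^ 2 =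
      (‖a + c‖ ^ 2 - (inner ℝ b (a + c)) ^ 2) / h ^ 2 := by
    have : cross b (dq h b c - dq h a b) = h⁻¹ • cross b (a + c) := by
      have hb0 := cross_self b
      simp only [dq, cross_sub_right, cross_smul_right, cross_add_right, hb0]
      module
    rw [this, norm_smul, mul_pow, norm_cross_sq, hb]
    simp only [norm_inv, Real.norm_eq_abs, inv_pow, sq_abs]
    field_simp
  have h2 : ‖dq h a b‖ ^ 2 = (2 - 2 * inner ℝ a b) / h ^ 2 := by
    rw [dq, norm_smul, mul_pow, normSq_sub_unit ha hb]
    simp only [norm_inv, Real.norm_eq_abs, inv_pow, sq_abs]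
    field_simp
  have h3 : ‖dq h b c‖ ^ 2 = (2 - 2 * inner ℝ b c) / h ^ 2 := by
    rw [dq, norm_smul, mul_pow, normSq_sub_unit hb hc]
    simp only [norm_inv, Real.norm_eq_abs, inv_pow, sq_abs]
    field_simp
  have h4 : ‖a - (2 * (1 - h ^ 2 / 2)) • b + c‖ ^ 2 =
      ‖a + c‖ ^ 2 - 2 * (2 - h ^ 2) * inner ℝ b (a + c) + (2 - h ^ 2) ^ 2 := by
    have : a - (2 * (1 - h ^ 2 / 2)) • b + c = (a + c) - (2 - h ^ 2) • b := by module
    rw [this, norm_sub_sq_real, norm_smul, inner_smul_right, hb, real_inner_comm]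
    simp only [Real.norm_eq_abs, mul_pow, sq_abs]
    ring
  have h5 : inner ℝ b (a + c) = inner ℝ a b + (inner ℝ b c : ℝ) := by
    rw [inner_add_right, real_inner_comm]
  rw [siteE, h1, h2, h3, h4, h5]
  field_simp
  ring

end HelicalXY

end

section

namespace HelicalXY

/-! ### Weak derivatives and absolutely continuous functions -/

lemma memL2Loc_of_continuous {f : ℝ → E3} (hf : Continuous f) : MemL2Loc f := by
  intro K hK
  have : IsFiniteMeasure (volume.restrict K) := ⟨by simpa using hK.measure_lt_top⟩
  obtain ⟨C, hC⟩ := hK.exists_bound_of_continuousOn hf.continuousOn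
  refine MemLp.of_bound hf.aestronglyMeasurable C ?_
  exact (ae_restrict_iff' hK.measurableSet).2 (ae_of_all _ hC)

lemma MemL2Loc.locallyIntegrable {f : ℝ → E3} (hf : MemL2Loc f) : LocallyIntegrable f := by
  rw [locallyIntegrable_iff]
  intro K hK
  have : IsFiniteMeasure (volume.restrict K) := ⟨by simpa using hK.measure_lt_top⟩
  exact (hf K hK).integrable (by norm_num)

lemma E3.integral_apply {μ : Measure ℝ} {f : ℝ → E3} (hf : Integrable f μ) (i : Fin 3) :
    (∫ t, f t ∂μ) i = ∫ t, f t i ∂μ := by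
  have := (EuclideanSpace.proj (𝕜 := ℝ) i : E3 →L[ℝ] ℝ).integral_comp_comm hf
  simpa using this.symm

lemma E3.integrable_apply {μ : Measure ℝ} {f : ℝ → E3} (hf : Integrable f μ) (i : Fin 3) :
    Integrable (fun t => f t i) μ := by
  have := (EuclideanSpace.proj (𝕜 := ℝ) i : E3 →L[ℝ] ℝ).integrable_comp hf
  simpa using this

lemma E3.intervalIntegral_apply {f : ℝ → E3} {a b : ℝ} (hf : IntervalIntegrable f volume a b)
    (i : Fin 3) : (∫ t in a..b, f t) i = ∫ t in a..b, f t i := by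
  simp only [intervalIntegral, PiLp.sub_apply]
  rw [E3.integral_apply hf.1, E3.integral_apply hf.2]

lemma E3.locallyIntegrable_apply {f : ℝ → E3} (hf : LocallyIntegrable f) (i : Fin 3) :
    LocallyIntegrable (fun t => f t i) := by
  rw [locallyIntegrable_iff] at hf ⊢
  exact fun K hK => E3.integrable_apply (hf K hK) i

lemma intervalIntegrable_of_locallyIntegrable {E : Type*} [NormedAddCommGroup E] {f : ℝ → E}
    (hf : LocallyIntegrable f) (a b : ℝ) : IntervalIntegrable f volume a b :=
  intervalIntegrable_iff.mpr <|
    (hf.integrableOn_isCompact isCompact_uIcc).mono_set uIoc_subset_uIcc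

lemma continuous_of_integral {E : Type*} [NormedAddCommGroup E] [NormedSpace ℝ E]
    {F V : ℝ → E} (hF : LocallyIntegrable F)
    (hV : ∀ x y, V y - V x = ∫ t in x..y, F t) : Continuous V := by
  have : V = fun y => V 0 + ∫ t in (0 : ℝ)..y, F t := by
    funext y; rw [← hV 0 y]; abel
  rw [this]
  exact continuous_const.add
    (intervalIntegral.continuous_primitive (fun a b => intervalIntegrable_of_locallyIntegrable hF a b) 0)

/-- Both factors are absolutely continuous, and `V' = F` almost everywhere by Lebesgue
differentiation, so the product is the integral of its almost everywhere derivative. -/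
lemma integral_parts {V F g : ℝ → ℝ} (hF : LocallyIntegrable F)
    (hV : ∀ x y, V y - V x = ∫ t in x..y, F t) (hg : ContDiff ℝ 1 g) (a b : ℝ) :
    ∫ t in a..b, (F t * g t + V t * deriv g t) = V b * g b - V a * g a := by
  have hVeq : V = fun y => V 0 + ∫ t in (0 : ℝ)..y, F t := by
    funext y; rw [← hV 0 y]; ring
  have hI := fun a b => intervalIntegrable_of_locallyIntegrable hF a b
  have hVac : AbsolutelyContinuousOnInterval V a b := by
    have h1 : AbsolutelyContinuousOnInterval (fun y => ∫ t in a..y, F t) a b :=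
      (hI a b).absolutelyContinuousOnInterval_intervalIntegral (c := a) (by simp)
    have h2 : V = (fun _ => V a) + fun y => ∫ t in a..y, F t := by
      funext y; simp only [Pi.add_apply]; rw [← hV a y]; ring
    rw [h2]
    exact AbsolutelyContinuousOnInterval.add
      (contDiff_const.contDiffOn (n := 1)).absolutelyContinuousOnInterval h1
  have hgac : AbsolutelyContinuousOnInterval g a b :=
    hg.contDiffOn.absolutelyContinuousOnInterval
  rw [← hVac.integral_deriv_mul_eq_sub hgac]
  apply intervalIntegral.integral_congr_ae
  filter_upwards [LocallyIntegrable.ae_hasDerivAt_integral hF] with x hx _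
  have : HasDerivAt V (F x) x := by
    rw [hVeq]; exact (hx 0).const_add _
  rw [this.deriv]

lemma integral_parts_compact {V F g : ℝ → ℝ} (hF : LocallyIntegrable F)
    (hV : ∀ x y, V y - V x = ∫ t in x..y, F t) (hg : ContDiff ℝ 1 g) (hs : HasCompactSupport g) :
    ∫ t, deriv g t * V t = -∫ t, g t * F t := by
  have hVc := continuous_of_integral hF hV
  obtain ⟨R, hR⟩ := hs.isCompact.isBounded.subset_closedBall 0
  have hR' : tsupport g ⊆ Ioc (-(|R| + 1)) (|R| + 1) := by
    intro t ht
    have h1 := hR ht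
    rw [Metric.mem_closedBall, dist_zero_right, Real.norm_eq_abs] at h1
    have h2 := abs_le.1 (h1.trans (le_abs_self R))
    exact ⟨by linarith, by linarith⟩
  set A := |R| + 1 with hA
  have hA0 : -A ≤ A := by have := abs_nonneg R; linarith
  have hzero : ∀ t, t ∉ Ioo (-A) A → g t = 0 := by
    intro t ht
    by_contra h
    have h3 := hR (subset_tsupport g h)
    rw [Metric.mem_closedBall, dist_zero_right, Real.norm_eq_abs] at h3
    have h4 := abs_le.1 (h3.trans (le_abs_self R))
    exact ht ⟨by linarith, by linarith⟩
  have hp := integral_parts hF hV hg (-A) A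
  rw [hzero A (by simp), hzero (-A) (by simp)] at hp
  have hi1 : IntervalIntegrable (fun t => F t * g t) volume (-A) A :=
    (intervalIntegrable_of_locallyIntegrable hF _ _).mul_continuousOn hg.continuous.continuousOn
  have hi2 : IntervalIntegrable (fun t => V t * deriv g t) volume (-A) A :=
    (hVc.mul (hg.continuous_deriv le_rfl)).intervalIntegrable _ _
  rw [intervalIntegral.integral_add hi1 hi2] at hp
  have e1 : ∫ t, deriv g t * V t = ∫ t in (-A)..A, V t * deriv g t := by
    rw [intervalIntegral.integral_of_le hA0, ← setIntegral_eq_integral_of_forall_compl_eq_zero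
      (s := Ioc (-A) A)]
    · simp_rw [mul_comm]
    · intro t ht
      have : t ∉ tsupport (deriv g) := fun h => ht (hR' (tsupport_deriv_subset h))
      rw [image_eq_zero_of_notMem_tsupport this, zero_mul]
  have e2 : ∫ t, g t * F t = ∫ t in (-A)..A, F t * g t := by
    rw [intervalIntegral.integral_of_le hA0, ← setIntegral_eq_integral_of_forall_compl_eq_zero
      (s := Ioc (-A) A)]
    · simp_rw [mul_comm]
    · intro t ht
      rw [image_eq_zero_of_notMem_tsupport (fun h => ht (hR' h)), zero_mul]
  rw [e1, e2]; linarith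

lemma integrable_mul_of_compact {g F : ℝ → ℝ} (hF : LocallyIntegrable F) (hg : Continuous g)
    (hs : HasCompactSupport g) : Integrable (fun t => g t * F t) := by
  simpa using hF.integrable_smul_left_of_hasCompactSupport hg hs

lemma isWeakDeriv_of_apply {f g : ℝ → E3} (hf : LocallyIntegrable f) (hg : LocallyIntegrable g)
    (h : ∀ (i : Fin 3) (φ : ℝ → ℝ), ContDiff ℝ ∞ φ → HasCompactSupport φ →
      ∫ t, deriv φ t * f t i = -∫ t, φ t * g t i) : IsWeakDeriv f g := by
  refine ⟨hf, hg, fun φ hφ hs => ?_⟩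
  have h1 : Integrable (fun t => deriv φ t • f t) :=
    hf.integrable_smul_left_of_hasCompactSupport (hφ.continuous_deriv (by simp)) hs.deriv
  have h2 : Integrable (fun t => φ t • g t) :=
    hg.integrable_smul_left_of_hasCompactSupport hφ.continuous hs
  ext i
  rw [E3.integral_apply h1, PiLp.neg_apply, E3.integral_apply h2]
  simpa using h i φ hφ hs

lemma isWeakDeriv_of_integral {V F : ℝ → E3} (hF : LocallyIntegrable F)
    (hV : ∀ x y, V y - V x = ∫ t in x..y, F t) : IsWeakDeriv V F := by
  refine isWeakDeriv_of_apply (continuous_of_integral hF hV).locallyIntegrable hF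
    fun i φ hφ hs => ?_
  refine integral_parts_compact (E3.locallyIntegrable_apply hF i) (fun x y => ?_)
    (hφ.of_le (by simp)) hs
  rw [← E3.intervalIntegral_apply (intervalIntegrable_of_locallyIntegrable hF x y), ← hV]; rfl

lemma IsWeakDeriv.ae_eq {f g₁ g₂ : ℝ → E3} (h₁ : IsWeakDeriv f g₁) (h₂ : IsWeakDeriv f g₂) :
    g₁ =ᵐ[volume] g₂ := by
  refine ae_eq_of_integral_contDiff_smul_eq h₁.2.1 h₂.2.1 fun φ hφ hs => ?_
  have := (h₁.2.2 φ hφ hs).symm.trans (h₂.2.2 φ hφ hs)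
  exact neg_injective this

lemma IsWeakDeriv.congr_left {f f' g : ℝ → E3} (h : IsWeakDeriv f g) (hff : f =ᵐ[volume] f') :
    IsWeakDeriv f' g := by
  refine ⟨h.1.congr hff, h.2.1, fun φ hφ hs => ?_⟩
  rw [← h.2.2 φ hφ hs]
  exact integral_congr_ae (by filter_upwards [hff] with t ht; rw [ht])

/-- Du Bois-Reymond: testing with translated bumps shows that every mollification of `D` has zero
derivative, and the mollifications converge pointwise to the continuous `D`. -/
lemma eq_of_integral_deriv_smul_eq_zero {D : ℝ → E3} (hD : Continuous D)
    (h : ∀ φ : ℝ → ℝ, ContDiff ℝ ∞ φ → HasCompactSupport φ → ∫ t, deriv φ t • D t = 0)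
    (a b : ℝ) : D a = D b := by
  let B : ℕ → ContDiffBump (0 : ℝ) := fun n =>
    ⟨1 / ((n : ℝ) + 1) / 2, 1 / ((n : ℝ) + 1), by positivity,
      by have : (0 : ℝ) < 1 / ((n : ℝ) + 1) := by positivity
         linarith⟩
  have hB : Tendsto (fun n => (B n).rOut) atTop (𝓝 0) := tendsto_one_div_add_atTop_nhds_zero_nat
  have key : ∀ n x, (convolution ((B n).normed volume) D (ContinuousLinearMap.lsmul ℝ ℝ) volume) x
      = (convolution ((B n).normed volume) D (ContinuousLinearMap.lsmul ℝ ℝ) volume) 0 := by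
    intro n x
    have hd : ∀ x, HasDerivAt
        (convolution ((B n).normed volume) D (ContinuousLinearMap.lsmul ℝ ℝ) volume) 0 x := by
      intro x
      have hcd : ContDiff ℝ 1 ((B n).normed volume) := (B n).contDiff_normed
      have h1 := HasCompactSupport.hasDerivAt_convolution_left (ContinuousLinearMap.lsmul ℝ ℝ)
        ((B n).hasCompactSupport_normed (μ := volume)) hcd (hD.locallyIntegrable (μ := volume)) x
      suffices h0 : convolution (deriv ((B n).normed volume)) D (ContinuousLinearMap.lsmul ℝ ℝ)
          volume x = 0 by rwa [h0] at h1
      rw [convolution_eq_swap]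
      have hc : HasCompactSupport (fun t => (B n).normed volume (x - t)) :=
        ((B n).hasCompactSupport_normed (μ := volume)).comp_homeomorph (Homeomorph.subLeft x)
      have h2 := h (fun t => (B n).normed volume (x - t))
        (((B n).contDiff_normed (μ := volume)).comp (contDiff_const.sub contDiff_id)) hc
      have h3 : ∀ t, deriv (fun t => (B n).normed volume (x - t)) t =
          - deriv ((B n).normed volume) (x - t) := fun t => by
        rw [deriv_comp_const_sub]
      simp only [h3, neg_smul, integral_neg, neg_eq_zero] at h2
      simpa using h2
    exact is_const_of_deriv_eq_zero (fun x => (hd x).differentiableAt) (fun x => (hd x).deriv) x 0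
  have ha := fun x => ContDiffBump.convolution_tendsto_right_of_continuous (μ := volume) hB hD x
  have e : ∀ x, D x = D 0 := fun x =>
    tendsto_nhds_unique (ha x) (by simpa only [key _ x] using ha 0)
  rw [e a, e b]

/-- `F` minus the primitive of `f` is continuous with vanishing weak derivative, hence constant
everywhere, not only almost everywhere. -/
lemma IsWeakDeriv.integral_eq {F f : ℝ → E3} (hF : Continuous F) (h : IsWeakDeriv F f)
    (a b : ℝ) : F b - F a = ∫ t in a..b, f t := by
  have hI := fun a b => intervalIntegrable_of_locallyIntegrable h.2.1 a b
  let P : ℝ → E3 := fun y => ∫ t in (0 : ℝ)..y, f t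
  have hP : ∀ x y, P y - P x = ∫ t in x..y, f t := fun x y =>
    intervalIntegral.integral_interval_sub_left (hI _ _) (hI _ _)
  have hPc := continuous_of_integral h.2.1 hP
  have hPw := isWeakDeriv_of_integral h.2.1 hP
  have := eq_of_integral_deriv_smul_eq_zero (hF.sub hPc) (fun φ hφ hs => by
    have h1 : Integrable (fun t => deriv φ t • F t) :=
      h.1.integrable_smul_left_of_hasCompactSupport (hφ.continuous_deriv (by simp)) hs.deriv
    have h2 : Integrable (fun t => deriv φ t • P t) :=
      hPw.1.integrable_smul_left_of_hasCompactSupport (hφ.continuous_deriv (by simp)) hs.deriv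
    simp only [Pi.sub_apply, smul_sub]
    rw [integral_sub h1 h2, h.2.2 φ hφ hs, hPw.2.2 φ hφ hs, sub_self]) a b
  simp only [Pi.sub_apply] at this
  rw [← hP]
  have h3 : F b - F a - (P b - P a) = (F b - P b) - (F a - P a) := by abel
  rw [← sub_eq_zero, h3, this, sub_self]

end HelicalXY

end

section

namespace HelicalXY

/-! ### Curves in the sphere with square integrable second derivative -/

/-- `u` is a curve in `S²` on `s` with velocity `v` and acceleration `f ∈ L²`. -/
structure IsCurve (u v f : ℝ → E3) (s : Set ℝ) : Prop where
  memLp : ∀ a b, Icc a b ⊆ s → MemLp f 2 (volume.restrict (Icc a b))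
  cont : ContinuousOn v s
  int_v : ∀ a b, a ≤ b → Icc a b ⊆ s → v b - v a = ∫ t in a..b, f t
  int_u : ∀ a b, a ≤ b → Icc a b ⊆ s → u b - u a = ∫ t in a..b, v t
  unit : ∀ t ∈ s, ‖u t‖ = 1
  orth : ∀ t ∈ s, inner ℝ (u t) (v t) = (0 : ℝ)

/-- The energy density of a curve. -/
def dens (G : E3 → ℝ) (u v f : ℝ → E3) (t : ℝ) : ℝ≥0∞ :=
  ENNReal.ofReal ((‖cross (u t) (v t)‖ ^ 2 - 1) ^ 2 + G (cross (u t) (v t)) / 2) +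
    -- The chirality `u × v` has derivative `u × f`, because `v × v = 0`.
    ENNReal.ofReal (‖cross (u t) (f t)‖ ^ 2)

namespace IsCurve

variable {u v f u' v' f' : ℝ → E3} {s s' : Set ℝ}

lemma mono (h : IsCurve u v f s) (hs : s' ⊆ s) : IsCurve u v f s' where
  memLp a b hab := h.memLp a b (hab.trans hs)
  cont := h.cont.mono hs
  int_v a b hab hs' := h.int_v a b hab (hs'.trans hs)
  int_u a b hab hs' := h.int_u a b hab (hs'.trans hs)
  unit t ht := h.unit t (hs ht)
  orth t ht := h.orth t (hs ht)

lemma congr (h : IsCurve u v f s) (hu : EqOn u' u s) (hv : EqOn v' v s)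
    (hf : ∀ᵐ t, t ∈ s → f' t = f t) : IsCurve u' v' f' s where
  memLp a b hab := by
    refine (memLp_congr_ae ?_).1 (h.memLp a b hab)
    rw [EventuallyEq, ae_restrict_iff' measurableSet_Icc]
    filter_upwards [hf] with t ht hts
    exact (ht (hab hts)).symm
  cont := h.cont.congr hv
  int_v a b hab hs := by
    rw [hv (hs (left_mem_Icc.2 hab)), hv (hs (right_mem_Icc.2 hab)), h.int_v a b hab hs]
    apply intervalIntegral.integral_congr_ae
    filter_upwards [hf] with t ht hts
    rw [uIoc_of_le hab] at hts
    exact (ht (hs (Ioc_subset_Icc_self hts))).symm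
  int_u a b hab hs := by
    rw [hu (hs (left_mem_Icc.2 hab)), hu (hs (right_mem_Icc.2 hab)), h.int_u a b hab hs]
    apply intervalIntegral.integral_congr
    intro t ht
    rw [uIcc_of_le hab] at ht
    exact (hv (hs ht)).symm
  unit t ht := by rw [hu ht]; exact h.unit t ht
  orth t ht := by rw [hu ht, hv ht]; exact h.orth t ht

lemma intervalIntegrable_f (h : IsCurve u v f s) {a b : ℝ} (hab : a ≤ b) (hs : Icc a b ⊆ s) :
    IntervalIntegrable f volume a b := by
  rw [intervalIntegrable_iff_integrableOn_Icc_of_le hab]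
  exact (h.memLp a b hs).integrable (by norm_num)

lemma intervalIntegrable_v (h : IsCurve u v f s) {a b : ℝ} (hab : a ≤ b) (hs : Icc a b ⊆ s) :
    IntervalIntegrable v volume a b :=
  (h.cont.mono (by rwa [uIcc_of_le hab])).intervalIntegrable

/-- Both pieces are restrictions of a single triple, so each integral is cut at `t₀`. Closedness of
`s` makes both pieces closed, as needed to glue continuity of `v`. -/
lemma glue_aux (h : IsCurve u v f (s ∩ Iic t₀)) (h' : IsCurve u v f (s ∩ Ici t₀))
    (hs : IsClosed s) : IsCurve u v f s where
  memLp a b hab := by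
    have h1 := h.memLp a (min b t₀) (fun t ht => ⟨hab ⟨ht.1, ht.2.trans (min_le_left _ _)⟩,
      ht.2.trans (min_le_right _ _)⟩)
    have h2 := h'.memLp (max a t₀) b (fun t ht => ⟨hab ⟨(le_max_left _ _).trans ht.1, ht.2⟩,
      (le_max_right a t₀).trans ht.1⟩)
    have h3 : Icc a b ⊆ Icc a (min b t₀) ∪ Icc (max a t₀) b := by
      intro t ht
      rcases le_total t t₀ with h | h
      · exact Or.inl ⟨ht.1, le_min ht.2 h⟩
      · exact Or.inr ⟨max_le ht.1 h, ht.2⟩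
    refine MemLp.mono_measure (Measure.restrict_mono h3 le_rfl) ?_
    have hae := aestronglyMeasurable_union_iff.2 ⟨h1.1, h2.1⟩
    rw [memLp_two_iff_integrable_sq_norm hae]
    exact IntegrableOn.union ((memLp_two_iff_integrable_sq_norm h1.1).1 h1)
      ((memLp_two_iff_integrable_sq_norm h2.1).1 h2)
  cont := by
    have h1 : s = (s ∩ Iic t₀) ∪ (s ∩ Ici t₀) := by
      rw [← inter_union_distrib_left, Iic_union_Ici, inter_univ]
    rw [h1]
    exact h.cont.union_of_isClosed h'.cont (hs.inter isClosed_Iic) (hs.inter isClosed_Ici)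
  int_v a b hab hs' := by
    rcases le_total b t₀ with hb | hb
    · exact h.int_v a b hab fun t ht => ⟨hs' ht, ht.2.trans hb⟩
    rcases le_total t₀ a with ha | ha
    · exact h'.int_v a b hab fun t ht => ⟨hs' ht, ha.trans ht.1⟩
    have s1 : Icc a t₀ ⊆ s ∩ Iic t₀ := fun t ht => ⟨hs' ⟨ht.1, ht.2.trans hb⟩, ht.2⟩
    have s2 : Icc t₀ b ⊆ s ∩ Ici t₀ := fun t ht => ⟨hs' ⟨ha.trans ht.1, ht.2⟩, ht.1⟩
    rw [← intervalIntegral.integral_add_adjacent_intervals (h.intervalIntegrable_f ha s1)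
      (h'.intervalIntegrable_f hb s2), ← h.int_v a t₀ ha s1, ← h'.int_v t₀ b hb s2]
    abel
  int_u a b hab hs' := by
    rcases le_total b t₀ with hb | hb
    · exact h.int_u a b hab fun t ht => ⟨hs' ht, ht.2.trans hb⟩
    rcases le_total t₀ a with ha | ha
    · exact h'.int_u a b hab fun t ht => ⟨hs' ht, ha.trans ht.1⟩
    have s1 : Icc a t₀ ⊆ s ∩ Iic t₀ := fun t ht => ⟨hs' ⟨ht.1, ht.2.trans hb⟩, ht.2⟩
    have s2 : Icc t₀ b ⊆ s ∩ Ici t₀ := fun t ht => ⟨hs' ⟨ha.trans ht.1, ht.2⟩, ht.1⟩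
    rw [← intervalIntegral.integral_add_adjacent_intervals (h.intervalIntegrable_v ha s1)
      (h'.intervalIntegrable_v hb s2), ← h.int_u a t₀ ha s1, ← h'.int_u t₀ b hb s2]
    abel
  unit t ht := by
    rcases le_total t t₀ with h1 | h1
    · exact h.unit t ⟨ht, h1⟩
    · exact h'.unit t ⟨ht, h1⟩
  orth t ht := by
    rcases le_total t t₀ with h1 | h1
    · exact h.orth t ⟨ht, h1⟩
    · exact h'.orth t ⟨ht, h1⟩

end IsCurve

/-- The function equal to `g` up to `t₀` and to `g'` after `t₀`. -/
def glue {α : Type*} (t₀ : ℝ) (g g' : ℝ → α) (t : ℝ) : α := if t ≤ t₀ then g t else g' t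

lemma glue_of_le {α : Type*} {t₀ t : ℝ} {g g' : ℝ → α} (h : t ≤ t₀) : glue t₀ g g' t = g t :=
  if_pos h

lemma glue_of_lt {α : Type*} {t₀ t : ℝ} {g g' : ℝ → α} (h : t₀ < t) : glue t₀ g g' t = g' t :=
  if_neg (not_le.2 h)

lemma glue_of_ge {α : Type*} {t₀ t : ℝ} {g g' : ℝ → α} (h0 : g t₀ = g' t₀) (h : t₀ ≤ t) :
    glue t₀ g g' t = g' t := by
  rcases h.eq_or_lt with rfl | h
  · rw [glue_of_le le_rfl, h0]
  · exact glue_of_lt h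

namespace IsCurve

variable {u v f u' v' f' : ℝ → E3} {s s' : Set ℝ}

/-- Only position and velocity have to match: the acceleration is merely square integrable and may
jump at `t₀`. -/
lemma glue {t₀ : ℝ} (h : IsCurve u v f (s ∩ Iic t₀)) (h' : IsCurve u' v' f' (s ∩ Ici t₀))
    (hs : IsClosed s) (hu : u t₀ = u' t₀) (hv : v t₀ = v' t₀) :
    IsCurve (glue t₀ u u') (glue t₀ v v') (glue t₀ f f') s := by
  refine glue_aux (t₀ := t₀) ?_ ?_ hs
  · exact h.congr (fun t ht => glue_of_le ht.2) (fun t ht => glue_of_le ht.2)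
      (ae_of_all _ fun t ht => glue_of_le ht.2)
  · refine h'.congr (fun t ht => glue_of_ge hu ht.2) (fun t ht => glue_of_ge hv ht.2) ?_
    have : ∀ᵐ t : ℝ, t ≠ t₀ := by simp [ae_iff, measure_singleton]
    filter_upwards [this] with t ht hts
    exact glue_of_lt (lt_of_le_of_ne hts.2 ht.symm)

lemma shift (h : IsCurve u v f s) (τ : ℝ) :
    IsCurve (fun t => u (t - τ)) (fun t => v (t - τ)) (fun t => f (t - τ))
      ((fun t => t - τ) ⁻¹' s) where
  memLp a b hab := by
    have h1 := h.memLp (a - τ) (b - τ) (fun t ht => by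
      have : t + τ ∈ Icc a b := ⟨by linarith [ht.1], by linarith [ht.2]⟩
      simpa using hab this)
    have hmp : MeasurePreserving (fun t : ℝ => t - τ) (volume.restrict (Icc a b))
        (volume.restrict (Icc (a - τ) (b - τ))) := by
      have := (measurePreserving_sub_right volume τ).restrict_preimage
        (measurableSet_Icc (a := a - τ) (b := b - τ))
      convert this using 2
      ext t; simp
    exact h1.comp_measurePreserving hmp
  cont := h.cont.comp (by fun_prop) (fun t ht => ht)
  int_v a b hab hs := by
    rw [intervalIntegral.integral_comp_sub_right (fun t => f t) τ]
    refine h.int_v _ _ (by linarith) (fun t ht => ?_)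
    have : t + τ ∈ Icc a b := ⟨by linarith [ht.1], by linarith [ht.2]⟩
    simpa using hs this
  int_u a b hab hs := by
    rw [intervalIntegral.integral_comp_sub_right (fun t => v t) τ]
    refine h.int_u _ _ (by linarith) (fun t ht => ?_)
    have : t + τ ∈ Icc a b := ⟨by linarith [ht.1], by linarith [ht.2]⟩
    simpa using hs this
  unit t ht := h.unit _ ht
  orth t ht := h.orth _ ht

/-- Time reversal changes the sign of the chirality. It serves to obtain arcs before a given time
from arcs after it. -/
lemma reverse (h : IsCurve u v f s) :
    IsCurve (fun t => u (-t)) (fun t => -v (-t)) (fun t => f (-t)) ((fun t => -t) ⁻¹' s) where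
  memLp a b hab := by
    have h1 := h.memLp (-b) (-a) (fun t ht => by
      have : -t ∈ Icc a b := ⟨by linarith [ht.2], by linarith [ht.1]⟩
      simpa using hab this)
    have hmp : MeasurePreserving (fun t : ℝ => -t) (volume.restrict (Icc a b))
        (volume.restrict (Icc (-b) (-a))) := by
      have := (Measure.measurePreserving_neg (volume : Measure ℝ)).restrict_preimage
        (measurableSet_Icc (a := -b) (b := -a))
      convert this using 2
      ext t; simp
    exact h1.comp_measurePreserving hmp
  cont := (h.cont.comp (f := fun t : ℝ => -t) (by fun_prop) (fun t ht => ht)).neg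
  int_v a b hab hs := by
    rw [intervalIntegral.integral_comp_neg (fun t => f t)]
    rw [← h.int_v _ _ (by linarith) (fun t ht => ?_)]
    · abel
    have : -t ∈ Icc a b := ⟨by linarith [ht.2], by linarith [ht.1]⟩
    simpa using hs this
  int_u a b hab hs := by
    rw [intervalIntegral.integral_comp_neg (fun t => -v t), intervalIntegral.integral_neg]
    rw [← h.int_u _ _ (by linarith) (fun t ht => ?_)]
    · abel
    have : -t ∈ Icc a b := ⟨by linarith [ht.2], by linarith [ht.1]⟩
    simpa using hs this
  unit t ht := h.unit _ ht
  orth t ht := by rw [inner_neg_right, h.orth _ ht, neg_zero]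

/-- A curve can be prescribed by a `C²` function with values in the sphere. -/
lemma of_contDiff (hu : ContDiff ℝ 2 u) (h1 : ∀ t, ‖u t‖ = 1) :
    IsCurve u (deriv u) (deriv (deriv u)) univ := by
  have hu1 : ContDiff ℝ 1 (deriv u) := by
    have : ContDiff ℝ (1 + 1) u := by norm_num; exact hu
    exact (contDiff_succ_iff_deriv.1 this).2.2
  have hc : Continuous (deriv (deriv u)) := hu1.continuous_deriv le_rfl
  have hd : Differentiable ℝ u := hu.differentiable (by norm_num)
  have hd1 : Differentiable ℝ (deriv u) := hu1.differentiable (by norm_num)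
  refine ⟨fun a b _ => memL2Loc_of_continuous hc _ isCompact_Icc, hu1.continuous.continuousOn,
    fun a b _ _ => ?_, fun a b _ _ => ?_, fun t _ => h1 t, fun t _ => ?_⟩
  · exact (intervalIntegral.integral_deriv_eq_sub (fun t _ => hd1 t)
      (hc.intervalIntegrable _ _)).symm
  · exact (intervalIntegral.integral_deriv_eq_sub (fun t _ => hd t)
      (hu1.continuous.intervalIntegrable _ _)).symm
  · have h2 := ((hd t).hasDerivAt.norm_sq)
    have h3 : (fun t => ‖u t‖ ^ 2) = fun _ => (1 : ℝ) := by funext t; rw [h1]; norm_num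
    rw [h3] at h2
    have := h2.unique (hasDerivAt_const t (1 : ℝ))
    linarith

end IsCurve

/-! ### Global curves and admissible profiles -/

section Univ

variable {u v f : ℝ → E3}

lemma IsCurve.memL2Loc (h : IsCurve u v f univ) : MemL2Loc f := by
  intro K hK
  obtain ⟨R, hR⟩ := hK.isBounded.subset_closedBall 0
  rw [Real.closedBall_eq_Icc] at hR
  exact (h.memLp _ _ (subset_univ _)).mono_measure (Measure.restrict_mono hR le_rfl)

lemma IsCurve.locallyIntegrable (h : IsCurve u v f univ) : LocallyIntegrable f :=
  h.memL2Loc.locallyIntegrable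

lemma IsCurve.continuous_v (h : IsCurve u v f univ) : Continuous v :=
  continuousOn_univ.1 h.cont

lemma integral_all {V F : ℝ → E3} (h : ∀ a b, a ≤ b → V b - V a = ∫ t in a..b, F t) (a b : ℝ) :
    V b - V a = ∫ t in a..b, F t := by
  rcases le_total a b with hab | hab
  · exact h a b hab
  · rw [intervalIntegral.integral_symm, ← h b a hab]; abel

lemma IsCurve.hasDerivAt (h : IsCurve u v f univ) (t : ℝ) : HasDerivAt u (v t) t := by
  have hu : u = fun y => u 0 + ∫ s in (0 : ℝ)..y, v s := by
    funext y
    rw [← integral_all (fun a b hab => h.int_u a b hab (subset_univ _)) 0 y]; abel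
  rw [hu]
  exact (intervalIntegral.integral_hasDerivAt_right (h.continuous_v.intervalIntegrable _ _)
    h.continuous_v.aestronglyMeasurable.stronglyMeasurableAtFilter
    h.continuous_v.continuousAt).const_add _

lemma IsCurve.continuous_u (h : IsCurve u v f univ) : Continuous u :=
  continuous_iff_continuousAt.2 fun t => (h.hasDerivAt t).continuousAt

lemma IsCurve.deriv_u (h : IsCurve u v f univ) : deriv u = v :=
  funext fun t => (h.hasDerivAt t).deriv

lemma IsCurve.contDiff (h : IsCurve u v f univ) : ContDiff ℝ 1 u := by
  rw [contDiff_one_iff_deriv, h.deriv_u]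
  exact ⟨fun t => (h.hasDerivAt t).differentiableAt, h.continuous_v⟩

lemma contDiff_apply {u : ℝ → E3} (h : ContDiff ℝ 1 u) (i : Fin 3) :
    ContDiff ℝ 1 (fun t => u t i) :=
  (EuclideanSpace.proj (𝕜 := ℝ) i : E3 →L[ℝ] ℝ).contDiff.comp h

lemma IsCurve.hasDerivAt_apply (h : IsCurve u v f univ) (t : ℝ) (i : Fin 3) :
    HasDerivAt (fun t => u t i) (v t i) t :=
  (EuclideanSpace.proj (𝕜 := ℝ) i : E3 →L[ℝ] ℝ).hasFDerivAt.comp_hasDerivAt t (h.hasDerivAt t)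

lemma continuous_apply' {u : ℝ → E3} (h : Continuous u) (i : Fin 3) :
    Continuous (fun t => u t i) :=
  (EuclideanSpace.proj (𝕜 := ℝ) i : E3 →L[ℝ] ℝ).continuous.comp h

/-- The product rule for a component of `u` and a component of `u'`, tested with `φ`. -/
lemma IsCurve.integral_parts_mul (h : IsCurve u v f univ) {φ : ℝ → ℝ} (hφ : ContDiff ℝ ∞ φ)
    (hs : HasCompactSupport φ) (i j : Fin 3) :
    ∫ t, deriv φ t * (u t i * v t j) =
      -(∫ t, φ t * (u t i * f t j)) - ∫ t, φ t * (v t i * v t j) := by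
  have hV : ∀ x y, v y j - v x j = ∫ t in x..y, f t j := fun x y => by
    rw [← E3.intervalIntegral_apply (intervalIntegrable_of_locallyIntegrable
      h.locallyIntegrable x y),
      ← integral_all (fun a b hab => h.int_v a b hab (subset_univ _)) x y]; rfl
  have hφ1 : ContDiff ℝ 1 φ := hφ.of_le (by simp)
  have hsu : HasCompactSupport (fun t => φ t * u t i) := hs.mul_right
  have hp := integral_parts_compact (E3.locallyIntegrable_apply h.locallyIntegrable j) hV
    (hφ1.mul (contDiff_apply h.contDiff i)) hsu
  have hd : ∀ t, deriv (fun t => φ t * u t i) t = deriv φ t * u t i + φ t * v t i := fun t =>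
    ((hφ1.differentiable (by norm_num) t).hasDerivAt.mul (h.hasDerivAt_apply t i)).deriv
  have hvc := fun k => continuous_apply' h.continuous_v k
  have huc := fun k => continuous_apply' h.continuous_u k
  have i1 : Integrable (fun t => deriv φ t * (u t i * v t j)) :=
    integrable_mul_of_compact ((huc i).mul (hvc j)).locallyIntegrable
      (hφ1.continuous_deriv le_rfl) hs.deriv
  have i2 : Integrable (fun t => φ t * (v t i * v t j)) :=
    integrable_mul_of_compact ((hvc i).mul (hvc j)).locallyIntegrable hφ1.continuous hs
  have e1 : ∫ t, deriv (fun t => φ t * u t i) t * v t j =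
      (∫ t, deriv φ t * (u t i * v t j)) + ∫ t, φ t * (v t i * v t j) := by
    rw [← integral_add i1 i2]
    congr 1; funext t; rw [hd]; ring
  have e2 : ∫ t, (φ t * u t i) * f t j = ∫ t, φ t * (u t i * f t j) := by
    congr 1; funext t; ring
  change ∫ t, deriv (fun t => φ t * u t i) t * v t j = -∫ t, (φ t * u t i) * f t j at hp
  rw [e1, e2] at hp
  linarith

lemma IsCurve.locallyIntegrable_mul (h : IsCurve u v f univ) (i j : Fin 3) :
    LocallyIntegrable (fun t => u t i * f t j) := by
  rw [locallyIntegrable_iff]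
  intro K hK
  have h1 := (E3.locallyIntegrable_apply h.locallyIntegrable j)
  rw [locallyIntegrable_iff] at h1
  exact (h1 K hK).continuousOn_mul (continuous_apply' h.continuous_u i).continuousOn hK

lemma E3.locallyIntegrable_of_apply {g : ℝ → E3}
    (h : ∀ i, LocallyIntegrable (fun t => g t i)) : LocallyIntegrable g := by
  rw [locallyIntegrable_iff]
  intro K hK
  have h1 : ∀ i, IntegrableOn (fun t => g t i) K := fun i => by
    have := h i; rw [locallyIntegrable_iff] at this; exact this K hK
  have h2 : Integrable (fun t => (g t).ofLp) (volume.restrict K) := Integrable.of_eval h1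
  exact ((PiLp.continuousLinearEquiv 2 ℝ (fun _ : Fin 3 => ℝ)).symm :
    (Fin 3 → ℝ) →L[ℝ] E3).integrable_comp h2

/-- In each component the two products `v i * v j` coming from `integral_parts_mul` cancel by
antisymmetry. -/
lemma IsCurve.isWeakDeriv_cross (h : IsCurve u v f univ) :
    IsWeakDeriv (fun t => cross (u t) (v t)) (fun t => cross (u t) (f t)) := by
  have hvc := fun k => continuous_apply' h.continuous_v k
  have huc := fun k => continuous_apply' h.continuous_u k
  have hl : LocallyIntegrable (fun t => cross (u t) (f t)) := by
    refine E3.locallyIntegrable_of_apply fun i => ?_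
    fin_cases i
    · simp only [Fin.zero_eta, cross_apply_zero]
      exact (h.locallyIntegrable_mul 1 2).sub (h.locallyIntegrable_mul 2 1)
    · simp only [Fin.mk_one, cross_apply_one]
      exact (h.locallyIntegrable_mul 2 0).sub (h.locallyIntegrable_mul 0 2)
    · simp only [Fin.reduceFinMk, cross_apply_two]
      exact (h.locallyIntegrable_mul 0 1).sub (h.locallyIntegrable_mul 1 0)
  have hc : Continuous fun t => cross (u t) (v t) :=
    continuous_cross.comp (h.continuous_u.prodMk h.continuous_v)
  refine isWeakDeriv_of_apply hc.locallyIntegrable hl fun i φ hφ hs => ?_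
  have key : ∀ i j : Fin 3, ∫ t, deriv φ t * (u t i * v t j - u t j * v t i) =
      -∫ t, φ t * (u t i * f t j - u t j * f t i) := by
    intro i j
    have i1 : ∀ i j, Integrable (fun t => deriv φ t * (u t i * v t j)) := fun i j =>
      integrable_mul_of_compact ((huc i).mul (hvc j)).locallyIntegrable
        (hφ.continuous_deriv (by simp)) hs.deriv
    have i2 : ∀ i j, Integrable (fun t => φ t * (u t i * f t j)) := fun i j =>
      integrable_mul_of_compact (h.locallyIntegrable_mul i j) hφ.continuous hs
    simp only [mul_sub]
    rw [integral_sub (i1 i j) (i1 j i), integral_sub (i2 i j) (i2 j i),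
      h.integral_parts_mul hφ hs, h.integral_parts_mul hφ hs]
    have : ∫ t, φ t * (v t i * v t j) = ∫ t, φ t * (v t j * v t i) := by
      congr 1; funext t; ring
    rw [this]; ring
  fin_cases i
  · simpa only [Fin.zero_eta, cross_apply_zero] using key 1 2
  · simpa only [Fin.mk_one, cross_apply_one] using key 2 0
  · simpa only [Fin.reduceFinMk, cross_apply_two] using key 0 1

lemma measurable_of_continuousOn {G : E3 → ℝ} (hG : ContinuousOn G {0}ᶜ) : Measurable G := by
  refine measurable_of_continuousOn_compl_singleton 0 hG

lemma dens_lintegral (G : E3 → ℝ) (hG : ContinuousOn G {0}ᶜ) (hu : Continuous u)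
    (hv : Continuous v) :
    ∫⁻ t, dens G u v f t = (∫⁻ t, ENNReal.ofReal ((‖cross (u t) (v t)‖ ^ 2 - 1) ^ 2 +
      G (cross (u t) (v t)) / 2)) + ∫⁻ t, ENNReal.ofReal (‖cross (u t) (f t)‖ ^ 2) := by
  have hc : Continuous fun t => cross (u t) (v t) := continuous_cross.comp (hu.prodMk hv)
  refine lintegral_add_left ?_ _
  refine ENNReal.measurable_ofReal.comp ?_
  exact ((hc.norm.pow 2).sub continuous_const |>.pow 2).measurable.add
    (((measurable_of_continuousOn hG).comp hc.measurable).div_const 2)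

/-- Global curves bound the transition energy from above. -/
lemma IsCurve.transition_le (h : IsCurve u v f univ) (G : E3 → ℝ) (hG : ContinuousOn G {0}ᶜ)
    {p p' : E3} (h1 : Tendsto (fun t => cross (u t) (v t)) atBot (𝓝 p))
    (h2 : Tendsto (fun t => cross (u t) (v t)) atTop (𝓝 p')) :
    transition G p p' ≤ ∫⁻ t, dens G u v f t := by
  rw [dens_lintegral G hG h.continuous_u h.continuous_v]
  refine iInf_le_of_le (fun t => cross (u t) (v t)) (iInf_le_of_le ⟨⟨u, h.contDiff,
    ⟨memL2Loc_of_continuous h.continuous_u, v, ?_, memL2Loc_of_continuous h.continuous_v, f, ?_,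
      h.memL2Loc⟩, fun t => h.unit t trivial, fun t => by rw [h.deriv_u]⟩, h1, h2⟩
    (iInf_le_of_le (fun t => cross (u t) (f t)) (iInf_le_of_le h.isWeakDeriv_cross le_rfl)))
  · exact isWeakDeriv_of_integral h.continuous_v.locallyIntegrable
      (integral_all fun a b hab => h.int_u a b hab (subset_univ _))
  · exact isWeakDeriv_of_integral h.locallyIntegrable
      (integral_all fun a b hab => h.int_v a b hab (subset_univ _))

/-- The transition energy is approximated by global curves. -/
lemma exists_curve_of_transition_lt (G : E3 → ℝ) (hG : ContinuousOn G {0}ᶜ) {p p' : E3}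
    {E : ℝ≥0∞} (hE : transition G p p' < E) :
    ∃ u v f, IsCurve u v f univ ∧ Tendsto (fun t => cross (u t) (v t)) atBot (𝓝 p) ∧
      Tendsto (fun t => cross (u t) (v t)) atTop (𝓝 p') ∧ ∫⁻ t, dens G u v f t < E := by
  simp only [transition, iInf_lt_iff] at hE
  obtain ⟨w, ⟨⟨u, hu1, ⟨_, g, hg, _, f, hf, hf2⟩, hunit, hw⟩, hbot, htop⟩, dw, hdw, hE⟩ := hE
  have hv : Continuous (deriv u) := hu1.continuous_deriv le_rfl
  have hder : ∀ t, HasDerivAt u (deriv u t) t := fun t =>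
    (hu1.differentiable (by norm_num) t).hasDerivAt
  have hint : ∀ a b, u b - u a = ∫ t in a..b, deriv u t := fun a b =>
    (intervalIntegral.integral_eq_sub_of_hasDerivAt (fun t _ => hder t)
      (hv.intervalIntegrable _ _)).symm
  have hgv : g =ᵐ[volume] deriv u :=
    hg.ae_eq (isWeakDeriv_of_integral hv.locallyIntegrable hint)
  have hvf := (hf.congr_left hgv)
  have hc : IsCurve u (deriv u) f univ := by
    refine ⟨fun a b _ => hf2 _ isCompact_Icc, hv.continuousOn,
      fun a b _ _ => hvf.integral_eq hv a b, fun a b _ _ => hint a b, fun t _ => hunit t,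
      fun t _ => ?_⟩
    have h2 := (hder t).norm_sq
    have h3 : (fun t => ‖u t‖ ^ 2) = fun _ => (1 : ℝ) := by funext t; rw [hunit]; norm_num
    rw [h3] at h2
    have := h2.unique (hasDerivAt_const t (1 : ℝ))
    linarith
  have hwe : w = fun t => cross (u t) (deriv u t) := funext hw
  subst hwe
  refine ⟨u, deriv u, f, hc, hbot, htop, ?_⟩
  rw [dens_lintegral G hG hc.continuous_u hc.continuous_v]
  convert hE using 2
  apply lintegral_congr_ae
  -- Any weak derivative `dw` of the chirality is `u × f` almost everywhere, by uniqueness.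
  filter_upwards [hdw.ae_eq hc.isWeakDeriv_cross] with t ht
  rw [ht]

end Univ

end HelicalXY

end

section

namespace HelicalXY

/-! ### Bending a curve into a rotation -/

/-- The remainder `y` of the expansion in the frame `c`, `p × c`, `p` is orthogonal to all three
vectors. Then `d × y` vanishes for `d = p × c`, and `‖d × y‖² = ‖d‖² ‖y‖² - ⟨d, y⟩²` forces `y = 0`.
-/
lemma smul_frame {p c x : E3} (hp : ‖p‖ = 1) (hc : ‖c‖ = 1) (hpc : inner ℝ p c = (0 : ℝ)) :
    x = (inner ℝ x c : ℝ) • c + (inner ℝ x (cross p c) : ℝ) • cross p c + (inner ℝ x p : ℝ) • p := by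
  have hd : ‖cross p c‖ = 1 := by rw [norm_cross_of_orth hp hpc, hc]
  set d := cross p c with hdd
  have hdc : inner ℝ d c = (0 : ℝ) := inner_cross_right p c
  have hdp : inner ℝ d p = (0 : ℝ) := inner_cross_left p c
  set y := x - ((inner ℝ x c : ℝ) • c + (inner ℝ x d : ℝ) • d + (inner ℝ x p : ℝ) • p) with hy
  have hcc : inner ℝ c c = (1 : ℝ) := by rw [real_inner_self_eq_norm_sq, hc]; norm_num
  have hpp : inner ℝ p p = (1 : ℝ) := by rw [real_inner_self_eq_norm_sq, hp]; norm_num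
  have hdd' : inner ℝ d d = (1 : ℝ) := by rw [real_inner_self_eq_norm_sq, hd]; norm_num
  have hcp : inner ℝ c p = (0 : ℝ) := by rw [real_inner_comm]; exact hpc
  have hcd : inner ℝ c d = (0 : ℝ) := by rw [real_inner_comm]; exact hdc
  have hpd : inner ℝ p d = (0 : ℝ) := by rw [real_inner_comm]; exact hdp
  have yc : inner ℝ c y = (0 : ℝ) := by
    simp only [hy, inner_sub_right, inner_add_right, inner_smul_right, hcc, hcd, hcp]
    rw [real_inner_comm]; ring
  have yp : inner ℝ p y = (0 : ℝ) := by
    simp only [hy, inner_sub_right, inner_add_right, inner_smul_right, hpp, hpd, hpc]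
    rw [real_inner_comm]; ring
  have yd : inner ℝ d y = (0 : ℝ) := by
    simp only [hy, inner_sub_right, inner_add_right, inner_smul_right, hdd', hdc, hdp]
    rw [real_inner_comm]; ring
  have h1 : cross d y = 0 := by
    have : cross d y = (inner ℝ p y : ℝ) • c - (inner ℝ c y : ℝ) • p := by
      rw [hdd]
      apply E3_ext <;>
        simp [cross_apply_zero, cross_apply_one, cross_apply_two, inner_eq] <;> ring
    rw [this, yc, yp]; simp
  have h2 := norm_cross_sq d y
  rw [h1, yd, hd] at h2
  have h3 : y = 0 := by simpa using h2.symm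
  exact sub_eq_zero.1 h3

/-- The curve with longitude `φ` and latitude `ψ` with respect to the axis `p`. -/
def polarCurve (p c : E3) (φ ψ : ℝ → ℝ) (t : ℝ) : E3 :=
  Real.cos (ψ t) • (Real.cos (φ t) • c + Real.sin (φ t) • cross p c) + Real.sin (ψ t) • p

section Polar

variable {p c : E3} {φ φ' φ'' ψ ψ' ψ'' : ℝ → ℝ}

lemma polarCurve_contDiff (hφ : ContDiff ℝ 2 φ) (hψ : ContDiff ℝ 2 ψ) :
    ContDiff ℝ 2 (polarCurve p c φ ψ) := by
  unfold polarCurve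
  have h1 := hφ.cos; have h2 := hφ.sin; have h3 := hψ.cos; have h4 := hψ.sin
  exact (h3.smul ((h1.smul contDiff_const).add (h2.smul contDiff_const))).add
    (h4.smul contDiff_const)

lemma norm_polarCurve (hp : ‖p‖ = 1) (hc : ‖c‖ = 1) (hpc : inner ℝ p c = (0 : ℝ)) (t : ℝ) :
    ‖polarCurve p c φ ψ t‖ = 1 := by
  have hd : inner ℝ (cross p c) (cross p c) = (1 : ℝ) := by
    rw [real_inner_self_eq_norm_sq, norm_cross_of_orth hp hpc, hc]; norm_num
  have hdc : inner ℝ (cross p c) c = (0 : ℝ) := inner_cross_right p c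
  have hdp : inner ℝ (cross p c) p = (0 : ℝ) := inner_cross_left p c
  have hcc : inner ℝ c c = (1 : ℝ) := by rw [real_inner_self_eq_norm_sq, hc]; norm_num
  have hpp : inner ℝ p p = (1 : ℝ) := by rw [real_inner_self_eq_norm_sq, hp]; norm_num
  have hcp : inner ℝ c p = (0 : ℝ) := by rw [real_inner_comm]; exact hpc
  have hcd : inner ℝ c (cross p c) = (0 : ℝ) := by rw [real_inner_comm]; exact hdc
  have hpd : inner ℝ p (cross p c) = (0 : ℝ) := by rw [real_inner_comm]; exact hdp
  have h : ‖polarCurve p c φ ψ t‖ ^ 2 = 1 := by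
    rw [← real_inner_self_eq_norm_sq]
    simp only [polarCurve, inner_add_left, inner_add_right, inner_smul_left, inner_smul_right, hcc,
      hpp, hpc, hcp, hd, hdc, hdp, hcd, hpd, conj_trivial]
    have e1 := Real.sin_sq_add_cos_sq (φ t)
    have e2 := Real.sin_sq_add_cos_sq (ψ t)
    linear_combination (Real.cos (ψ t)) ^ 2 * e1 + e2
  exact (sq_eq_sq₀ (norm_nonneg _) zero_le_one).1 (by rw [h]; norm_num)

lemma hasDerivAt_frame_cos (hφ : ∀ t, HasDerivAt φ (φ' t) t) (t : ℝ) :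
    HasDerivAt (fun t => Real.cos (φ t) • c + Real.sin (φ t) • cross p c)
      (φ' t • (-Real.sin (φ t) • c + Real.cos (φ t) • cross p c)) t := by
  have := ((hφ t).cos.smul_const c).add ((hφ t).sin.smul_const (cross p c))
  exact this.congr_deriv (by module)

lemma hasDerivAt_frame_sin (hφ : ∀ t, HasDerivAt φ (φ' t) t) (t : ℝ) :
    HasDerivAt (fun t => -Real.sin (φ t) • c + Real.cos (φ t) • cross p c)
      (-φ' t • (Real.cos (φ t) • c + Real.sin (φ t) • cross p c)) t := by
  have := ((hφ t).sin.neg.smul_const c).add ((hφ t).cos.smul_const (cross p c))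
  exact this.congr_deriv (by module)

lemma hasDerivAt_polarCurve (hφ : ∀ t, HasDerivAt φ (φ' t) t) (hψ : ∀ t, HasDerivAt ψ (ψ' t) t)
    (t : ℝ) : HasDerivAt (polarCurve p c φ ψ)
      ((-(ψ' t * Real.sin (ψ t))) • (Real.cos (φ t) • c + Real.sin (φ t) • cross p c) +
        (Real.cos (ψ t) * φ' t) • (-Real.sin (φ t) • c + Real.cos (φ t) • cross p c) +
        (ψ' t * Real.cos (ψ t)) • p) t := by
  have := ((hψ t).cos.smul (hasDerivAt_frame_cos (p := p) (c := c) hφ t)).add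
    ((hψ t).sin.smul_const p)
  exact this.congr_deriv (by module)

/-- The chirality of a curve in polar coordinates. -/
lemma cross_polarCurve (hp : ‖p‖ = 1) (hc : ‖c‖ = 1) (hpc : inner ℝ p c = (0 : ℝ))
    (hφ : ∀ t, HasDerivAt φ (φ' t) t) (hψ : ∀ t, HasDerivAt ψ (ψ' t) t) (t : ℝ) :
    cross (polarCurve p c φ ψ t) (deriv (polarCurve p c φ ψ) t) =
      (Real.cos (ψ t) ^ 2 * φ' t) • p -
        ψ' t • (-Real.sin (φ t) • c + Real.cos (φ t) • cross p c) -
        (Real.sin (ψ t) * Real.cos (ψ t) * φ' t) •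
          (Real.cos (φ t) • c + Real.sin (φ t) • cross p c) := by
  rw [(hasDerivAt_polarCurve hφ hψ t).deriv, polarCurve]
  have hcd : cross c (cross p c) = p := by
    rw [cross_anticomm, cross_cross_right, hpc, hc]; simp
  have hdc : cross (cross p c) c = -p := by rw [cross_anticomm, hcd]
  have hdp : cross (cross p c) p = c := cross_cross_of_orth hp hpc
  have hpd : cross p (cross p c) = -c := by rw [cross_anticomm, hdp]
  have hcp : cross c p = -cross p c := cross_anticomm c p
  simp only [cross_add_left, cross_add_right, cross_smul_left, cross_smul_right, cross_self,
    hcd, hdc, hdp, hpd, hcp]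
  have e1 := Real.sin_sq_add_cos_sq (φ t)
  have e2 := Real.sin_sq_add_cos_sq (ψ t)
  match_scalars
  · linear_combination (Real.cos (ψ t) ^ 2 * φ' t) * e1
  · linear_combination (-Real.cos (φ t) * ψ' t) * e2
  · linear_combination (Real.sin (φ t) * ψ' t) * e2

lemma isCurve_polarCurve (hp : ‖p‖ = 1) (hc : ‖c‖ = 1) (hpc : inner ℝ p c = (0 : ℝ))
    (hφ : ContDiff ℝ 2 φ) (hψ : ContDiff ℝ 2 ψ) :
    IsCurve (polarCurve p c φ ψ) (deriv (polarCurve p c φ ψ))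
      (deriv (deriv (polarCurve p c φ ψ))) univ :=
  IsCurve.of_contDiff (polarCurve_contDiff hφ hψ) (norm_polarCurve hp hc hpc)

lemma contDiff_two_differentiable {g : ℝ → E3} (h : ContDiff ℝ 2 g) :
    Differentiable ℝ g ∧ Differentiable ℝ (deriv g) := by
  have : ContDiff ℝ (1 + 1) g := by norm_num; exact h
  exact ⟨h.differentiable (by norm_num),
    (contDiff_succ_iff_deriv.1 this).2.2.differentiable (by norm_num)⟩

/-- Since `g' × g' = 0`, the vector `g × g''` can be read off from any differentiable formula for
the chirality. -/
lemma cross_deriv_deriv {g : ℝ → E3} (h : ContDiff ℝ 2 g) {W' : E3} {t : ℝ}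
    (hW : HasDerivAt (fun t => cross (g t) (deriv g t)) W' t) :
    cross (g t) (deriv (deriv g) t) = W' := by
  obtain ⟨h1, h2⟩ := contDiff_two_differentiable h
  have := hasDerivAt_cross (h1 t).hasDerivAt (h2 t).hasDerivAt
  rw [cross_self, add_zero] at this
  exact this.unique hW

/-- The derivative of the chirality of a curve in polar coordinates. -/
lemma cross_polarCurve_second (hp : ‖p‖ = 1) (hc : ‖c‖ = 1) (hpc : inner ℝ p c = (0 : ℝ))
    (hφc : ContDiff ℝ 2 φ) (hψc : ContDiff ℝ 2 ψ)
    (hφ : ∀ t, HasDerivAt φ (φ' t) t) (hψ : ∀ t, HasDerivAt ψ (ψ' t) t)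
    (hφ' : ∀ t, HasDerivAt φ' (φ'' t) t) (hψ' : ∀ t, HasDerivAt ψ' (ψ'' t) t) (t : ℝ) :
    cross (polarCurve p c φ ψ t) (deriv (deriv (polarCurve p c φ ψ)) t) =
      (Real.cos (ψ t) ^ 2 * φ'' t - 2 * Real.sin (ψ t) * Real.cos (ψ t) * ψ' t * φ' t) • p +
      (-ψ'' t - Real.sin (ψ t) * Real.cos (ψ t) * φ' t ^ 2) •
        (-Real.sin (φ t) • c + Real.cos (φ t) • cross p c) +
      (ψ' t * φ' t - (Real.cos (ψ t) ^ 2 - Real.sin (ψ t) ^ 2) * ψ' t * φ' t -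
        Real.sin (ψ t) * Real.cos (ψ t) * φ'' t) •
          (Real.cos (φ t) • c + Real.sin (φ t) • cross p c) := by
  apply cross_deriv_deriv (polarCurve_contDiff hφc hψc)
  have hW : (fun t => cross (polarCurve p c φ ψ t) (deriv (polarCurve p c φ ψ) t)) = fun t =>
      (Real.cos (ψ t) ^ 2 * φ' t) • p -
        ψ' t • (-Real.sin (φ t) • c + Real.cos (φ t) • cross p c) -
        (Real.sin (ψ t) * Real.cos (ψ t) * φ' t) •
          (Real.cos (φ t) • c + Real.sin (φ t) • cross p c) :=
    funext (cross_polarCurve hp hc hpc hφ hψ)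
  rw [hW]
  have h1 := ((((hψ t).cos.pow 2).mul (hφ' t)).smul_const p)
  have h2 := (hψ' t).smul (hasDerivAt_frame_sin (p := p) (c := c) hφ t)
  have h3 := (((hψ t).sin.mul (hψ t).cos).mul (hφ' t)).smul
    (hasDerivAt_frame_cos (p := p) (c := c) hφ t)
  refine ((h1.sub h2).sub h3).congr_deriv ?_
  simp only [Pi.mul_apply, Pi.pow_apply]
  module

lemma norm_frame_cos_le (hp : ‖p‖ = 1) (hc : ‖c‖ = 1) (hpc : inner ℝ p c = (0 : ℝ)) (x : ℝ) :
    ‖Real.cos x • c + Real.sin x • cross p c‖ = 1 := by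
  have := norm_polarCurve (φ := fun _ => x) (ψ := fun _ => 0) hp hc hpc 0
  simpa [polarCurve] using this

lemma norm_frame_sin_le (hp : ‖p‖ = 1) (hc : ‖c‖ = 1) (hpc : inner ℝ p c = (0 : ℝ)) (x : ℝ) :
    ‖-Real.sin x • c + Real.cos x • cross p c‖ = 1 := by
  have := norm_frame_cos_le hp hc hpc (x + Real.pi / 2)
  rwa [Real.cos_add_pi_div_two, Real.sin_add_pi_div_two] at this

end Polar

end HelicalXY

end

section

namespace HelicalXY

/-! ### Estimates in polar coordinates and the bend. -/

lemma norm_smul_add_three_le {e₁ e₂ e₃ : E3} (h₁ : ‖e₁‖ = 1) (h₂ : ‖e₂‖ = 1) (h₃ : ‖e₃‖ = 1)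
    (a b c : ℝ) : ‖a • e₁ + b • e₂ + c • e₃‖ ≤ |a| + |b| + |c| := by
  calc _ ≤ ‖a • e₁‖ + ‖b • e₂‖ + ‖c • e₃‖ := norm_add₃_le
    _ = _ := by simp [norm_smul, h₁, h₂, h₃]

lemma abs_sub_le_add (a b : ℝ) : |a - b| ≤ |a| + |b| := by
  simpa [sub_eq_add_neg] using abs_add_le a (-b)

lemma abs_mul_le_of {a b x y : ℝ} (ha : |a| ≤ x) (hb : |b| ≤ y) : |a * b| ≤ x * y := by
  rw [abs_mul]; exact mul_le_mul ha hb (abs_nonneg _) ((abs_nonneg _).trans ha)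

section Polar

variable {p c : E3} {φ φ' φ'' ψ ψ' ψ'' : ℝ → ℝ}

/-- The rotation about `p` is `ψ = 0`, `φ' = 1`. The deviations of `w` from `p` and of `w'` from
zero are explicit in the deviations of latitude and longitude, and all of them are linear up to
bounded factors. -/
lemma polarCurve_bounds (hp : ‖p‖ = 1) (hc : ‖c‖ = 1) (hpc : inner ℝ p c = (0 : ℝ))
    (hφc : ContDiff ℝ 2 φ) (hψc : ContDiff ℝ 2 ψ)
    (hφ : ∀ t, HasDerivAt φ (φ' t) t) (hψ : ∀ t, HasDerivAt ψ (ψ' t) t)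
    (hφ' : ∀ t, HasDerivAt φ' (φ'' t) t) (hψ' : ∀ t, HasDerivAt ψ' (ψ'' t) t)
    {t x : ℝ} (hx : x ≤ 1) (b1 : |ψ t| ≤ x) (b2 : |ψ' t| ≤ x) (b3 : |ψ'' t| ≤ x)
    (b4 : |φ' t - 1| ≤ x) (b5 : |φ'' t| ≤ x) :
    ‖cross (polarCurve p c φ ψ t) (deriv (polarCurve p c φ ψ) t) - p‖ ≤ 15 * x ∧
    ‖cross (polarCurve p c φ ψ t) (deriv (deriv (polarCurve p c φ ψ)) t)‖ ≤ 15 * x := by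
  have hx0 : 0 ≤ x := (abs_nonneg _).trans b1
  have s1 : |Real.sin (ψ t)| ≤ x := (Real.abs_sin_le_abs).trans b1
  have s2 : |Real.sin (ψ t)| ≤ 1 := Real.abs_sin_le_one _
  have c1 : |Real.cos (ψ t)| ≤ 1 := Real.abs_cos_le_one _
  have p2 : |φ' t| ≤ 2 := by
    have := abs_le.1 b4
    exact abs_le.2 ⟨by linarith, by linarith⟩
  have csq : |Real.cos (ψ t) ^ 2| ≤ 1 := by rw [abs_pow]; exact pow_le_one₀ (abs_nonneg _) c1
  have n1 := norm_frame_cos_le hp hc hpc (φ t)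
  have n2 := norm_frame_sin_le hp hc hpc (φ t)
  constructor
  · rw [cross_polarCurve hp hc hpc hφ hψ]
    have : (Real.cos (ψ t) ^ 2 * φ' t) • p -
        ψ' t • (-Real.sin (φ t) • c + Real.cos (φ t) • cross p c) -
        (Real.sin (ψ t) * Real.cos (ψ t) * φ' t) •
          (Real.cos (φ t) • c + Real.sin (φ t) • cross p c) - p =
        (Real.cos (ψ t) ^ 2 * φ' t - 1) • p +
        (-ψ' t) • (-Real.sin (φ t) • c + Real.cos (φ t) • cross p c) +
        (-(Real.sin (ψ t) * Real.cos (ψ t) * φ' t)) •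
          (Real.cos (φ t) • c + Real.sin (φ t) • cross p c) := by module
    rw [this]
    refine (norm_smul_add_three_le hp n2 n1 _ _ _).trans ?_
    rw [abs_neg, abs_neg]
    have e1 : |Real.cos (ψ t) ^ 2 * φ' t - 1| ≤ 1 * x + x * 1 := by
      have : Real.cos (ψ t) ^ 2 * φ' t - 1 =
          Real.cos (ψ t) ^ 2 * (φ' t - 1) - Real.sin (ψ t) * Real.sin (ψ t) := by
        have := Real.sin_sq_add_cos_sq (ψ t); linear_combination this
      rw [this]
      exact (abs_sub_le_add _ _).trans (add_le_add (abs_mul_le_of csq b4) (abs_mul_le_of s1 s2))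
    have e2 : |Real.sin (ψ t) * Real.cos (ψ t) * φ' t| ≤ x * 1 * 2 :=
      abs_mul_le_of (abs_mul_le_of s1 c1) p2
    linarith
  · rw [cross_polarCurve_second hp hc hpc hφc hψc hφ hψ hφ' hψ']
    refine (norm_smul_add_three_le hp n2 n1 _ _ _).trans ?_
    have e1 : |Real.cos (ψ t) ^ 2 * φ'' t - 2 * Real.sin (ψ t) * Real.cos (ψ t) * ψ' t * φ' t| ≤
        1 * x + 2 * 1 * 1 * x * 2 := by
      refine (abs_sub_le_add _ _).trans (add_le_add (abs_mul_le_of csq b5) ?_)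
      exact abs_mul_le_of (abs_mul_le_of (abs_mul_le_of (abs_mul_le_of (by norm_num) s2) c1) b2) p2
    have e2 : |-ψ'' t - Real.sin (ψ t) * Real.cos (ψ t) * φ' t ^ 2| ≤ x + x * 1 * 2 ^ 2 := by
      refine (abs_sub_le_add _ _).trans (add_le_add (by rwa [abs_neg]) ?_)
      refine abs_mul_le_of (abs_mul_le_of s1 c1) ?_
      rw [abs_pow]; exact pow_le_pow_left₀ (abs_nonneg _) p2 2
    have e3 : |ψ' t * φ' t - (Real.cos (ψ t) ^ 2 - Real.sin (ψ t) ^ 2) * ψ' t * φ' t -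
        Real.sin (ψ t) * Real.cos (ψ t) * φ'' t| ≤ x * 2 + 1 * x * 2 + 1 * 1 * x := by
      have cs : |Real.cos (ψ t) ^ 2 - Real.sin (ψ t) ^ 2| ≤ 1 := by
        rw [← Real.cos_two_mul']; exact Real.abs_cos_le_one _
      refine (abs_sub_le_add _ _).trans (add_le_add ((abs_sub_le_add _ _).trans (add_le_add ?_ ?_)) ?_)
      · exact abs_mul_le_of b2 p2
      · exact abs_mul_le_of (abs_mul_le_of cs b2) p2
      · exact abs_mul_le_of (abs_mul_le_of s2 c1) b5
    linarith

end Polar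

/-- The rotation about `p`. -/
lemma rotation_cross {p c : E3} (hp : ‖p‖ = 1) (hc : ‖c‖ = 1) (hpc : inner ℝ p c = (0 : ℝ))
    (κ t : ℝ) : cross (polarCurve p c (fun t => t + κ) (fun _ => 0) t)
      (deriv (polarCurve p c (fun t => t + κ) (fun _ => 0)) t) = p := by
  rw [cross_polarCurve (φ := fun t => t + κ) (φ' := fun _ => 1) (ψ := fun _ => 0)
    (ψ' := fun _ => 0) hp hc hpc
    (fun t => (hasDerivAt_id t).add_const κ) (fun t => hasDerivAt_const t 0)]
  simp

lemma rotation_cross_second {p c : E3} (hp : ‖p‖ = 1) (hc : ‖c‖ = 1)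
    (hpc : inner ℝ p c = (0 : ℝ)) (κ t : ℝ) :
    cross (polarCurve p c (fun t => t + κ) (fun _ => 0) t)
      (deriv (deriv (polarCurve p c (fun t => t + κ) (fun _ => 0))) t) = 0 := by
  apply cross_deriv_deriv (polarCurve_contDiff (by fun_prop) (by fun_prop))
  simp only [rotation_cross hp hc hpc]
  exact hasDerivAt_const _ _

/-- A state whose chirality is close to `p` can be bent into a rotation about `p`. -/
lemma exists_bend {p a v₀ : E3} (hp : ‖p‖ = 1) (ha : ‖a‖ = 1) (hav : inner ℝ a v₀ = (0 : ℝ))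
    {η : ℝ} (hη : η ≤ 1 / 100) (h : ‖cross a v₀ - p‖ ≤ η) :
    ∃ u v f, IsCurve u v f univ ∧ u 0 = a ∧ v 0 = v₀ ∧
      (∀ t, 1 ≤ t → cross (u t) (v t) = p) ∧ (∀ t, 1 < t → cross (u t) (f t) = 0) ∧
      ∀ t ∈ Icc (0 : ℝ) 1, ‖cross (u t) (v t) - p‖ ≤ 600 * η ∧ ‖cross (u t) (f t)‖ ≤ 600 * η := by
  have hη0 : 0 ≤ η := (norm_nonneg _).trans h
  set w := cross a v₀ with hw
  have hwa : inner ℝ w a = (0 : ℝ) := inner_cross_left a v₀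
  set s : ℝ := inner ℝ a p with hs
  have hsη : |s| ≤ η := by
    have : s = inner ℝ a (p - w) := by rw [inner_sub_right, real_inner_comm w a, hwa, hs]; ring
    rw [this]
    refine (abs_real_inner_le_norm _ _).trans ?_
    rw [ha, one_mul, norm_sub_rev]; exact h
  have hsle := abs_le.1 hsη
  set ψ₀ := Real.arcsin s with hψ₀
  have sin0 : Real.sin ψ₀ = s := Real.sin_arcsin (by linarith) (by linarith)
  have cos0 : Real.cos ψ₀ = √(1 - s ^ 2) := Real.cos_arcsin s
  have hcos : 1 / 2 ≤ Real.cos ψ₀ := by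
    rw [cos0]; apply Real.le_sqrt_of_sq_le; nlinarith
  have hcosne : Real.cos ψ₀ ≠ 0 := by linarith
  have hψabs : |ψ₀| ≤ 2 * η := by
    have h1 := Real.mul_abs_le_abs_sin (x := ψ₀) (abs_le.2 ⟨Real.neg_pi_div_two_le_arcsin s,
      Real.arcsin_le_pi_div_two s⟩)
    rw [sin0] at h1
    have h2 : (1 / 2 : ℝ) ≤ 2 / Real.pi := by
      rw [div_le_div_iff₀ (by norm_num) Real.pi_pos]; linarith [Real.pi_le_four]
    have h3 := mul_le_mul_of_nonneg_right h2 (abs_nonneg ψ₀)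
    linarith
  have hcs := Real.sin_sq_add_cos_sq ψ₀
  rw [sin0] at hcs
  -- `c` is the normalized projection of `a` to the equatorial plane, so that `a` has longitude `0`
  -- and latitude `ψ₀`.
  set c : E3 := (Real.cos ψ₀)⁻¹ • (a - s • p) with hcdef
  have hac : a = Real.cos ψ₀ • c + s • p := by
    rw [hcdef, smul_smul, mul_inv_cancel₀ hcosne]; module
  have hpp : inner ℝ p p = (1 : ℝ) := by rw [real_inner_self_eq_norm_sq, hp]; norm_num
  have hpc : inner ℝ p c = (0 : ℝ) := by
    rw [hcdef, inner_smul_right, inner_sub_right, inner_smul_right, real_inner_comm, hpp]; ring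
  have hc : ‖c‖ = 1 := by
    have h1 : ‖a - s • p‖ ^ 2 = Real.cos ψ₀ ^ 2 := by
      rw [norm_sub_sq_real, ha, norm_smul, hp, inner_smul_right, ← hs, Real.norm_eq_abs, mul_one,
        sq_abs]
      linarith
    have h2 : ‖a - s • p‖ = Real.cos ψ₀ :=
      (sq_eq_sq₀ (norm_nonneg _) (by linarith)).1 h1
    rw [hcdef, norm_smul, h2, norm_inv, Real.norm_eq_abs, abs_of_pos (by linarith),
      inv_mul_cancel₀ hcosne]
  clear_value c
  set d := cross p c with hd
  have hnd : ‖d‖ = 1 := by rw [hd, norm_cross_of_orth hp hpc, hc]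
  have hdp : inner ℝ p d = (0 : ℝ) := by rw [real_inner_comm]; exact inner_cross_left p c
  -- `r` and `k` are the initial speeds of latitude and longitude, obtained by solving the formula
  -- `cross_polarCurve` for chirality `w` at longitude `0`.
  set r : ℝ := -(inner ℝ w d : ℝ) with hr
  set k : ℝ := (Real.cos ψ₀ * inner ℝ w p - s * inner ℝ w c) / Real.cos ψ₀ with hk
  have hwc : Real.cos ψ₀ * inner ℝ w c + s * inner ℝ w p = 0 := by
    rw [hac, inner_add_right, inner_smul_right, inner_smul_right] at hwa; exact hwa
  have hrη : |r| ≤ η := by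
    have : (inner ℝ w d : ℝ) = inner ℝ (w - p) d := by rw [inner_sub_left, hdp, sub_zero]
    rw [hr, abs_neg, this]
    refine (abs_real_inner_le_norm _ _).trans ?_
    rw [hnd, mul_one]; exact h
  have hkη : |k - 1| ≤ 2 * η := by
    have h1 : k - 1 = inner ℝ (w - p) (Real.cos ψ₀ • p - s • c) / Real.cos ψ₀ := by
      rw [hk, inner_sub_left, inner_sub_right, inner_sub_right, inner_smul_right, inner_smul_right,
        inner_smul_right, inner_smul_right, hpp, hpc]
      field_simp; ring
    have h2 : ‖Real.cos ψ₀ • p - s • c‖ ^ 2 = 1 := by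
      rw [norm_sub_sq_real, norm_smul, norm_smul, inner_smul_left, inner_smul_right, hpc, hp, hc]
      simp only [Real.norm_eq_abs, mul_one, sq_abs, mul_zero]
      linarith
    have h3 : ‖Real.cos ψ₀ • p - s • c‖ = 1 :=
      (sq_eq_sq₀ (norm_nonneg _) zero_le_one).1 (by rw [h2]; norm_num)
    rw [h1, abs_div, abs_of_pos (by linarith : 0 < Real.cos ψ₀), div_le_iff₀ (by linarith)]
    refine (abs_real_inner_le_norm _ _).trans ?_
    rw [h3, mul_one]
    nlinarith
  -- the longitude and the latitude
  let κ := k - 1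
  let b := r + 2 * ψ₀
  -- The speed `φ'` goes linearly from `k` to `1`, and `ψ` is the cubic with value and slope `ψ₀`,
  -- `r` at time `0` and `0`, `0` at time `1`. At time `1` the curve meets the rotation `R` in
  -- position and velocity, `κ / 2` being the phase gained; the second derivatives need not match.
  let φ : ℝ → ℝ := fun t => t + κ * (t - t ^ 2 / 2)
  let φ' : ℝ → ℝ := fun t => 1 + κ * (1 - t)
  let φ'' : ℝ → ℝ := fun _ => -κ
  let ψ : ℝ → ℝ := fun t => (1 - t) ^ 2 * (ψ₀ + b * t)
  let ψ' : ℝ → ℝ := fun t => -2 * (1 - t) * (ψ₀ + b * t) + (1 - t) ^ 2 * b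
  let ψ'' : ℝ → ℝ := fun t => 2 * (ψ₀ + b * t) - 4 * (1 - t) * b
  have hφc : ContDiff ℝ 2 φ := by fun_prop
  have hψc : ContDiff ℝ 2 ψ := by fun_prop
  have dφ : ∀ t, HasDerivAt φ (φ' t) t := fun t => by
    have := (hasDerivAt_id t).add (((hasDerivAt_id t).sub
      (((hasDerivAt_id t).pow 2).div_const 2)).const_mul κ)
    refine this.congr_deriv ?_
    simp [φ']
  have dφ' : ∀ t, HasDerivAt φ' (φ'' t) t := fun t => by
    have := (((hasDerivAt_id t).const_sub 1).const_mul κ).const_add 1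
    refine this.congr_deriv ?_
    simp [φ'']
  have l1 : ∀ t : ℝ, HasDerivAt (fun t : ℝ => 1 - t) (-1) t := fun t =>
    (hasDerivAt_id t).const_sub 1
  have l2 : ∀ t : ℝ, HasDerivAt (fun t : ℝ => ψ₀ + b * t) b t := fun t => by
    have := ((hasDerivAt_id t).const_mul b).const_add ψ₀
    exact this.congr_deriv (by simp)
  have dψ : ∀ t, HasDerivAt ψ (ψ' t) t := fun t => by
    refine (((l1 t).pow 2).mul (l2 t)).congr_deriv ?_
    simp only [ψ', Pi.pow_apply]; ring
  have dψ' : ∀ t, HasDerivAt ψ' (ψ'' t) t := fun t => by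
    refine ((((l1 t).const_mul (-2)).mul (l2 t)).add (((l1 t).pow 2).mul_const b)).congr_deriv ?_
    simp only [ψ'']; ring
  let U := polarCurve p c φ ψ
  let R := polarCurve p c (fun t => t + κ / 2) (fun _ => 0)
  have hU := isCurve_polarCurve hp hc hpc hφc hψc
  have hR := isCurve_polarCurve (φ := fun t => t + κ / 2) (ψ := fun _ => 0) hp hc hpc
    (by fun_prop) (by fun_prop)
  have hU0 : U 0 = a := by
    change polarCurve p c φ ψ 0 = a
    have e1 : ψ 0 = ψ₀ := by simp [ψ]
    have e2 : φ 0 = 0 := by simp [φ]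
    rw [polarCurve, e1, e2, sin0, hac]; simp
  have hV0 : deriv U 0 = v₀ := by
    have h1 : cross (U 0) (deriv U 0) = w := by
      change cross (polarCurve p c φ ψ 0) (deriv (polarCurve p c φ ψ) 0) = w
      rw [cross_polarCurve hp hc hpc dφ dψ]
      have e1 : ψ 0 = ψ₀ := by simp [ψ]
      have e2 : φ 0 = 0 := by simp [φ]
      have e3 : ψ' 0 = r := by simp [ψ', b]
      have e4 : φ' 0 = k := by simp [φ', κ]
      rw [e1, e2, e3, e4, sin0, smul_frame (x := w) hp hc hpc, ← hd]
      have f1 : Real.cos ψ₀ ^ 2 * k = inner ℝ w p := by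
        rw [hk]; field_simp
        linear_combination (inner ℝ w p) * hcs - s * hwc
      have f2 : s * Real.cos ψ₀ * k = -inner ℝ w c := by
        rw [hk]; field_simp
        linear_combination -(inner ℝ w c) * hcs + Real.cos ψ₀ * hwc
      rw [f1, f2, hr]
      simp
      module
    have h2 := hU.orth 0 trivial
    have h3 := cross_cross_of_orth (hU.unit 0 trivial) h2
    change cross (cross (U 0) (deriv U 0)) (U 0) = deriv U 0 at h3
    rw [← h3, h1, hU0, hw, cross_cross_of_orth ha hav]
  have hU1 : U 1 = R 1 := by
    simp only [U, R, polarCurve, φ, ψ]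
    norm_num
    have : (1 : ℝ) + κ * (1 / 2) = 1 + κ / 2 := by ring
    rw [this]
  have hV1 : deriv U 1 = deriv R 1 := by
    simp only [U, R]
    rw [(hasDerivAt_polarCurve dφ dψ 1).deriv,
      (hasDerivAt_polarCurve (φ := fun t => t + κ / 2) (φ' := fun _ => 1) (ψ := fun _ => 0)
        (ψ' := fun _ => 0) (fun t => (hasDerivAt_id t).add_const _)
        (fun t => hasDerivAt_const t 0) 1).deriv]
    simp only [φ, ψ, φ', ψ']
    norm_num
    have : (1 : ℝ) + κ * (1 / 2) = 1 + κ / 2 := by ring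
    rw [this]
  refine ⟨glue 1 U R, glue 1 (deriv U) (deriv R), glue 1 (deriv (deriv U)) (deriv (deriv R)),
    IsCurve.glue (hU.mono (subset_univ _)) (hR.mono (subset_univ _)) isClosed_univ hU1 hV1,
    ?_, ?_, fun t ht => ?_, fun t ht => ?_, fun t ht => ?_⟩
  · rw [glue_of_le zero_le_one, hU0]
  · rw [glue_of_le zero_le_one, hV0]
  · rw [glue_of_ge hU1 ht, glue_of_ge hV1 ht]
    exact rotation_cross hp hc hpc _ _
  · rw [glue_of_lt ht, glue_of_lt ht]
    exact rotation_cross_second hp hc hpc _ _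
  · rw [glue_of_le ht.2, glue_of_le ht.2, glue_of_le ht.2]
    have hκ : |κ| ≤ 2 * η := hkη
    have hb : |b| ≤ 5 * η := by
      refine (abs_add_le _ _).trans ?_
      rw [abs_mul, abs_two]; linarith
    have ht1 : |1 - t| ≤ 1 := abs_le.2 ⟨by linarith [ht.2], by linarith [ht.1]⟩
    have htt : |t| ≤ 1 := abs_le.2 ⟨by linarith [ht.1], by linarith [ht.2]⟩
    have hlin : |ψ₀ + b * t| ≤ 7 * η := by
      refine (abs_add_le _ _).trans ?_
      have := abs_mul_le_of hb htt
      linarith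
    have hsq : |(1 - t) ^ 2| ≤ 1 := by rw [abs_pow]; exact pow_le_one₀ (abs_nonneg _) ht1
    -- The largest of the five quantities is `ψ''`, at most `2 · 7 η + 4 · 5 η = 34 η`, and `15 · 34
    -- ≤ 600`.
    have key := polarCurve_bounds (p := p) (c := c) hp hc hpc hφc hψc dφ dψ dφ' dψ' (t := t)
      (x := 34 * η) (by linarith) ?_ ?_ ?_ ?_ ?_
    · exact ⟨key.1.trans (by linarith), key.2.trans (by linarith)⟩
    · have := abs_mul_le_of hsq hlin
      exact this.trans (by linarith)
    · refine (abs_add_le _ _).trans ?_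
      have h1 := abs_mul_le_of (abs_mul_le_of (x := 2) (by norm_num : |(-2 : ℝ)| ≤ 2) ht1) hlin
      have h2 := abs_mul_le_of hsq hb
      linarith
    · refine (abs_sub_le_add _ _).trans ?_
      have h1 := abs_mul_le_of (x := 2) (by norm_num : |(2 : ℝ)| ≤ 2) hlin
      have h2 := abs_mul_le_of (abs_mul_le_of (x := 4) (by norm_num : |(4 : ℝ)| ≤ 4) ht1) hb
      linarith
    · have h1 := abs_mul_le_of hκ ht1
      simp only [φ', add_sub_cancel_left]
      linarith
    · simp only [φ'', abs_neg]; linarith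

end HelicalXY

end

section

namespace HelicalXY

/-! ### The cost of bending -/

variable {G : E3 → ℝ}

lemma dens_eq_zero {u v f : ℝ → E3} {t : ℝ} {p : E3} (hp : ‖p‖ = 1) (hGp : G p = 0)
    (hw : cross (u t) (v t) = p) (hf : cross (u t) (f t) = 0) : dens G u v f t = 0 := by
  simp [dens, hw, hf, hp, hGp]

lemma dens_reverse (u v f : ℝ → E3) (t : ℝ) :
    dens G (fun t => u (-t)) (fun t => -v (-t)) (fun t => f (-t)) t =
      dens (fun x => G (-x)) u v f (-t) := by
  simp [dens, cross_neg_right]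

/-- The bend lasts one unit of time, and the energy density is small during it: the potential is
continuous at `p ≠ 0` and vanishes there. After the bend the density is zero. -/
lemma exists_bend_right (hG : ContinuousOn G {0}ᶜ) {p : E3} (hp : ‖p‖ = 1) (hGp : G p = 0)
    {ε : ℝ} (hε : 0 < ε) :
    ∃ η > 0, ∀ a v₀ : E3, ‖a‖ = 1 → inner ℝ a v₀ = (0 : ℝ) → ‖cross a v₀ - p‖ ≤ η →
      ∃ u v f, IsCurve u v f univ ∧ u 0 = a ∧ v 0 = v₀ ∧
        (∀ t, 1 ≤ t → cross (u t) (v t) = p) ∧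
        ∫⁻ t in Ioi 0, dens G u v f t ≤ ENNReal.ofReal ε := by
  have hp0 : p ≠ 0 := by intro h; rw [h, norm_zero] at hp; norm_num at hp
  have hc : ContinuousAt (fun x : E3 => (‖x‖ ^ 2 - 1) ^ 2 + G x / 2) p :=
    (((continuous_norm.pow 2).sub continuous_const).pow 2).continuousAt.add
      ((hG.continuousAt (isOpen_compl_singleton.mem_nhds hp0)).div_const 2)
  have hlt : (‖p‖ ^ 2 - 1) ^ 2 + G p / 2 < ε / 2 := by rw [hp, hGp]; norm_num; exact hε
  obtain ⟨r, hr, hball⟩ := Metric.eventually_nhds_iff.1 (hc.eventually_lt_const hlt)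
  have hmin : 0 < min (min (r / 2) (ε / 2)) 1 := by positivity
  refine ⟨min (min (r / 2) (ε / 2)) 1 / 600, by positivity, fun a v₀ ha hav h => ?_⟩
  set η := min (min (r / 2) (ε / 2)) 1 / 600 with hη
  have h600 : 600 * η = min (min (r / 2) (ε / 2)) 1 := by rw [hη]; ring
  have k1 : 600 * η ≤ 1 := by rw [h600]; exact min_le_right _ _
  have k2 : 600 * η ≤ r / 2 := by rw [h600]; exact (min_le_left _ _).trans (min_le_left _ _)
  have k3 : 600 * η ≤ ε / 2 := by rw [h600]; exact (min_le_left _ _).trans (min_le_right _ _)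
  have k4 : 0 < 600 * η := by rw [h600]; exact hmin
  obtain ⟨u, v, f, hcurve, h0, h1, h2, h3, h4⟩ :=
    exists_bend hp ha hav (η := η) (by linarith) h
  refine ⟨u, v, f, hcurve, h0, h1, h2, ?_⟩
  have hunion : Ioi (0 : ℝ) = Ioc 0 1 ∪ Ioi 1 := (Ioc_union_Ioi_eq_Ioi zero_le_one).symm
  calc ∫⁻ t in Ioi 0, dens G u v f t
      ≤ (∫⁻ t in Ioc 0 1, dens G u v f t) + ∫⁻ t in Ioi 1, dens G u v f t := by
        rw [hunion]; exact lintegral_union_le _ _ _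
    _ ≤ (∫⁻ _ in Ioc (0 : ℝ) 1, ENNReal.ofReal ε) + ∫⁻ _ in Ioi (1 : ℝ), 0 := by
        refine add_le_add (setLIntegral_mono measurable_const fun t ht => ?_)
          (setLIntegral_mono measurable_const fun t ht => ?_)
        · obtain ⟨b1, b2⟩ := h4 t ⟨ht.1.le, ht.2⟩
          have hd : (‖cross (u t) (v t)‖ ^ 2 - 1) ^ 2 + G (cross (u t) (v t)) / 2 < ε / 2 :=
            hball (by rw [dist_eq_norm]; linarith)
          have hs : ‖cross (u t) (f t)‖ ^ 2 ≤ ε / 2 := by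
            have := norm_nonneg (cross (u t) (f t))
            nlinarith
          have hsplit : ENNReal.ofReal ε = ENNReal.ofReal (ε / 2) + ENNReal.ofReal (ε / 2) := by
            rw [← ENNReal.ofReal_add (by positivity) (by positivity), add_halves]
          rw [dens, hsplit]
          exact add_le_add (ENNReal.ofReal_le_ofReal hd.le) (ENNReal.ofReal_le_ofReal hs)
        · exact (dens_eq_zero hp hGp (h2 t ht.le) (h3 t ht)).le
    _ = ENNReal.ofReal ε := by simp

/-- Time reversal of `exists_bend_right`, applied to the well `-p` and the penalty `x ↦ G (-x)`. -/
lemma exists_bend_left (hG : ContinuousOn G {0}ᶜ) {p : E3} (hp : ‖p‖ = 1) (hGp : G p = 0)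
    {ε : ℝ} (hε : 0 < ε) :
    ∃ η > 0, ∀ a v₀ : E3, ‖a‖ = 1 → inner ℝ a v₀ = (0 : ℝ) → ‖cross a v₀ - p‖ ≤ η →
      ∃ u v f, IsCurve u v f univ ∧ u 0 = a ∧ v 0 = v₀ ∧
        (∀ t, t ≤ -1 → cross (u t) (v t) = p) ∧
        ∫⁻ t in Iio 0, dens G u v f t ≤ ENNReal.ofReal ε := by
  have hG' : ContinuousOn (fun x => G (-x)) {0}ᶜ :=
    hG.comp continuous_neg.continuousOn fun x hx => by simpa using hx
  obtain ⟨η, hη, H⟩ := exists_bend_right hG' (p := -p) (by rwa [norm_neg]) (by simpa using hGp) hε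
  refine ⟨η, hη, fun a v₀ ha hav h => ?_⟩
  obtain ⟨u, v, f, hcurve, h0, h1, h2, h3⟩ := H a (-v₀) ha (by rw [inner_neg_right, hav, neg_zero])
    (by rw [cross_neg_right, sub_neg_eq_add, neg_add_eq_sub, norm_sub_rev]; exact h)
  refine ⟨fun t => u (-t), fun t => -v (-t), fun t => f (-t), by simpa using hcurve.reverse,
    by simpa using h0, by simp [h1], fun t ht => ?_, ?_⟩
  · rw [cross_neg_right, h2 (-t) (by linarith), neg_neg]
  · simp only [dens_reverse]
    refine le_trans (le_of_eq ?_) h3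
    have := (Measure.measurePreserving_neg (volume : Measure ℝ)).setLIntegral_comp_preimage_emb
      (Homeomorph.neg ℝ).measurableEmbedding (dens (fun x => G (-x)) u v f) (Ioi 0)
    simpa using this

/-! ### Connecting curves -/

/-- `p` and `p'` are connected by a curve of energy at most `E` which is a rotation outside of a
compact interval. -/
def Connects (G : E3 → ℝ) (p p' : E3) (E : ℝ≥0∞) : Prop :=
  ∃ u v f S, 0 ≤ S ∧ IsCurve u v f univ ∧ (∀ t, t ≤ 0 → cross (u t) (v t) = p) ∧
    (∀ t, S ≤ t → cross (u t) (v t) = p') ∧ ∫⁻ t, dens G u v f t ≤ E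

lemma Connects.mono {p p' : E3} {E E' : ℝ≥0∞} (h : Connects G p p' E) (hE : E ≤ E') :
    Connects G p p' E' := by
  obtain ⟨u, v, f, S, h0, h1, h2, h3, h4⟩ := h
  exact ⟨u, v, f, S, h0, h1, h2, h3, h4.trans hE⟩

lemma Connects.transition_le {p p' : E3} {E : ℝ≥0∞} (h : Connects G p p' E)
    (hG : ContinuousOn G {0}ᶜ) : transition G p p' ≤ E := by
  obtain ⟨u, v, f, S, h0, h1, h2, h3, h4⟩ := h
  refine (h1.transition_le G hG ?_ ?_).trans h4
  · refine tendsto_const_nhds.congr' ?_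
    filter_upwards [eventually_le_atBot 0] with t ht
    exact (h2 t ht).symm
  · refine tendsto_const_nhds.congr' ?_
    filter_upwards [eventually_ge_atTop S] with t ht
    exact (h3 t ht).symm

lemma univ_shift {u v f : ℝ → E3} (h : IsCurve u v f univ) (τ : ℝ) :
    IsCurve (fun t => u (t - τ)) (fun t => v (t - τ)) (fun t => f (t - τ)) univ := by
  simpa using h.shift τ

lemma setLIntegral_shift (g : ℝ → ℝ≥0∞) (τ : ℝ) (s : Set ℝ) :
    ∫⁻ t in (fun t => t - τ) ⁻¹' s, g (t - τ) = ∫⁻ t in s, g t :=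
  (measurePreserving_sub_right volume τ).setLIntegral_comp_preimage_emb
    (Homeomorph.subRight τ).measurableEmbedding g s

/-- A curve on an interval with chirality close to `p` and `p'` at the end points can be
completed to a connecting curve. -/
lemma exists_connects (hG : ContinuousOn G {0}ᶜ) {p p' : E3} (hp : ‖p‖ = 1) (hGp : G p = 0)
    (hp' : ‖p'‖ = 1) (hGp' : G p' = 0) {ε : ℝ} (hε : 0 < ε) :
    ∃ η > 0, ∀ (u v f : ℝ → E3) (a b : ℝ), a ≤ b → IsCurve u v f (Icc a b) →
      ‖cross (u a) (v a) - p‖ ≤ η → ‖cross (u b) (v b) - p'‖ ≤ η →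
      Connects G p p' ((∫⁻ t in Icc a b, dens G u v f t) + ENNReal.ofReal ε) := by
  obtain ⟨η₁, hη₁, H₁⟩ := exists_bend_left hG hp hGp (half_pos hε)
  obtain ⟨η₂, hη₂, H₂⟩ := exists_bend_right hG hp' hGp' (half_pos hε)
  refine ⟨min η₁ η₂, lt_min hη₁ hη₂, fun u v f a b hab hc ha hb => ?_⟩
  obtain ⟨u₁, v₁, f₁, c₁, i₁, j₁, w₁, e₁⟩ := H₁ (u a) (v a) (hc.unit a (left_mem_Icc.2 hab))
    (hc.orth a (left_mem_Icc.2 hab)) (ha.trans (min_le_left _ _))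
  obtain ⟨u₂, v₂, f₂, c₂, i₂, j₂, w₂, e₂⟩ := H₂ (u b) (v b) (hc.unit b (right_mem_Icc.2 hab))
    (hc.orth b (right_mem_Icc.2 hab)) (hb.trans (min_le_right _ _))
  set U₁ := fun t => u₁ (t - a) with hU₁
  set V₁ := fun t => v₁ (t - a) with hV₁
  set F₁ := fun t => f₁ (t - a) with hF₁
  set U₂ := fun t => u₂ (t - b) with hU₂
  set V₂ := fun t => v₂ (t - b) with hV₂
  set F₂ := fun t => f₂ (t - b) with hF₂
  have C₁ : IsCurve U₁ V₁ F₁ univ := univ_shift c₁ a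
  have C₂ : IsCurve U₂ V₂ F₂ univ := univ_shift c₂ b
  have hUa : U₁ a = u a := by simp [hU₁, i₁]
  have hVa : V₁ a = v a := by simp [hV₁, j₁]
  have hUb : U₂ b = u b := by simp [hU₂, i₂]
  have hVb : V₂ b = v b := by simp [hV₂, j₂]
  have hm : IsCurve (glue a U₁ u) (glue a V₁ v) (glue a F₁ f) (Iic b) := by
    refine IsCurve.glue (C₁.mono (subset_univ _)) ?_ isClosed_Iic hUa hVa
    rwa [inter_comm, Ici_inter_Iic]
  have gu : glue a U₁ u b = U₂ b := by rw [glue_of_ge hUa hab, hUb]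
  have gv : glue a V₁ v b = V₂ b := by rw [glue_of_ge hVa hab, hVb]
  have hfull : IsCurve (glue b (glue a U₁ u) U₂) (glue b (glue a V₁ v) V₂)
      (glue b (glue a F₁ f) F₂) univ := by
    refine IsCurve.glue ?_ (C₂.mono (subset_univ _)) isClosed_univ gu gv
    rwa [univ_inter]
  set U := glue b (glue a U₁ u) U₂ with hU
  set V := glue b (glue a V₁ v) V₂ with hV
  set F := glue b (glue a F₁ f) F₂ with hF
  -- Each bend takes unit time, so the glued curve rotates before `a - 1` and after `b + 1`. The
  -- translation moves `a - 1` to the origin, and `b - a + 2` is the time that remains.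
  refine ⟨fun t => U (t - (-(a - 1))), fun t => V (t - (-(a - 1))), fun t => F (t - (-(a - 1))),
    b - a + 2, by linarith, univ_shift hfull _, fun t ht => ?_, fun t ht => ?_, ?_⟩
  · have h1 : t - (-(a - 1)) ≤ a := by linarith
    have h2 : t - (-(a - 1)) ≤ b := h1.trans hab
    simp only [hU, hV, glue_of_le h2, glue_of_le h1, hU₁, hV₁]
    exact w₁ _ (by linarith)
  · have h1 : b < t - (-(a - 1)) := by linarith
    simp only [hU, hV, glue_of_lt h1, hU₂, hV₂]
    exact w₂ _ (by linarith)
  · have hsh : ∫⁻ t, dens G (fun t => U (t - (-(a - 1)))) (fun t => V (t - (-(a - 1))))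
        (fun t => F (t - (-(a - 1)))) t = ∫⁻ t, dens G U V F t :=
      lintegral_sub_right_eq_self (fun t => dens G U V F t) (-(a - 1))
    rw [hsh]
    have hsplit : (univ : Set ℝ) = Iio a ∪ (Icc a b ∪ Ioi b) := by
      ext t; simp only [mem_univ, mem_union, mem_Iio, mem_Icc, mem_Ioi, true_iff]
      by_contra! h; exact absurd (h.2.1 h.1) (not_lt.2 h.2.2)
    calc ∫⁻ t, dens G U V F t ≤ (∫⁻ t in Iio a, dens G U V F t) +
          ((∫⁻ t in Icc a b, dens G U V F t) + ∫⁻ t in Ioi b, dens G U V F t) := by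
          rw [← setLIntegral_univ, hsplit]
          exact (lintegral_union_le _ _ _).trans (add_le_add le_rfl (lintegral_union_le _ _ _))
      _ ≤ ENNReal.ofReal (ε / 2) + ((∫⁻ t in Icc a b, dens G u v f t) +
          ENNReal.ofReal (ε / 2)) := by
          refine add_le_add ?_ (add_le_add ?_ ?_)
          · refine le_trans (le_of_eq ?_) e₁
            rw [← setLIntegral_shift (dens G u₁ v₁ f₁) a (Iio 0)]
            simp only [preimage_sub_const_Iio, zero_add]
            refine setLIntegral_congr_fun measurableSet_Iio fun t ht => ?_
            have h1 : t ≤ a := le_of_lt ht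
            simp only [dens, hU, hV, hF, glue_of_le (h1.trans hab), glue_of_le h1, hU₁, hV₁, hF₁]
          · refine le_of_eq ?_
            rw [Measure.restrict_congr_set (Ioc_ae_eq_Icc (a := a) (b := b)).symm]
            refine setLIntegral_congr_fun measurableSet_Ioc fun t ht => ?_
            simp only [dens, hU, hV, hF, glue_of_le ht.2, glue_of_lt ht.1]
          · refine le_trans (le_of_eq ?_) e₂
            rw [← setLIntegral_shift (dens G u₂ v₂ f₂) b (Ioi 0)]
            simp only [preimage_sub_const_Ioi, zero_add]
            refine setLIntegral_congr_fun measurableSet_Ioi fun t ht => ?_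
            have h1 : b < t := ht
            simp only [dens, hU, hV, hF, glue_of_lt h1, hU₂, hV₂, hF₂]
      _ = (∫⁻ t in Icc a b, dens G u v f t) + ENNReal.ofReal ε := by
          rw [show ε = ε / 2 + ε / 2 by ring, ENNReal.ofReal_add (by positivity) (by positivity)]
          simp only [show (ε / 2 + ε / 2) / 2 = ε / 2 by ring]
          ring

/-- The transition energy is approximated by connecting curves. -/
lemma connects_of_transition_lt (hG : ContinuousOn G {0}ᶜ) {p p' : E3} (hp : ‖p‖ = 1)
    (hGp : G p = 0) (hp' : ‖p'‖ = 1) (hGp' : G p' = 0) {E : ℝ≥0∞} (hE : transition G p p' < E) :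
    Connects G p p' E := by
  obtain ⟨u, v, f, hc, hbot, htop, hlt⟩ := exists_curve_of_transition_lt G hG hE
  obtain ⟨r, hr, hrE⟩ := ENNReal.lt_iff_exists_add_pos_lt.1 hlt
  obtain ⟨η, hη, H⟩ := exists_connects hG hp hGp hp' hGp' (ε := r) (by exact_mod_cast hr)
  have h1 : ∀ᶠ t in atBot, ‖cross (u t) (v t) - p‖ ≤ η := by
    filter_upwards [hbot (Metric.closedBall_mem_nhds p hη)] with t ht
    rwa [← dist_eq_norm]
  have h2 : ∀ᶠ t in atTop, ‖cross (u t) (v t) - p'‖ ≤ η := by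
    filter_upwards [htop (Metric.closedBall_mem_nhds p' hη)] with t ht
    rwa [← dist_eq_norm]
  obtain ⟨a, ha, ha0⟩ := (h1.and (eventually_le_atBot 0)).exists
  obtain ⟨b, hb, hb0⟩ := (h2.and (eventually_ge_atTop 0)).exists
  refine (H u v f a b (ha0.trans hb0) (hc.mono (subset_univ _)) ha hb).mono ?_
  refine le_trans ?_ hrE.le
  refine add_le_add (setLIntegral_le_lintegral _ _) ?_
  rw [ENNReal.ofReal_coe_nnreal]

/-! ### Phase matching and the triangle inequality -/

lemma IsCurve.v_eq {u v f : ℝ → E3} {s : Set ℝ} (h : IsCurve u v f s) {t : ℝ} (ht : t ∈ s) :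
    v t = cross (cross (u t) (v t)) (u t) :=
  (cross_cross_of_orth (h.unit t ht) (h.orth t ht)).symm

/-- A curve with constant unit chirality is a rotation. -/
lemma IsCurve.eq_rotation {u v f : ℝ → E3} (h : IsCurve u v f univ) {p : E3} (hp : ‖p‖ = 1)
    {a b : ℝ} (hab : a ≤ b) (hw : ∀ t ∈ Icc a b, cross (u t) (v t) = p) :
    u b = Real.cos (b - a) • u a + Real.sin (b - a) • cross p (u a) := by
  have hpu : inner ℝ p (u a) = (0 : ℝ) := by
    rw [← hw a (left_mem_Icc.2 hab)]; exact inner_cross_left _ _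
  have hua : ‖u a‖ = 1 := h.unit a trivial
  set R : ℝ → E3 := fun t => Real.cos (t - a) • u a + Real.sin (t - a) • cross p (u a) with hR
  have hRn : ∀ t, ‖R t‖ = 1 := fun t => norm_frame_cos_le hp hua hpu _
  have hppu : cross p (cross p (u a)) = -u a := by
    rw [cross_anticomm, cross_cross_of_orth hp hpu]
  have hRd : ∀ t, HasDerivAt R (cross p (R t)) t := fun t => by
    have h1 : HasDerivAt (fun t => t - a) 1 t := (hasDerivAt_id t).sub_const a
    refine ((h1.cos.smul_const (u a)).add (h1.sin.smul_const (cross p (u a)))).congr_deriv ?_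
    simp only [hR, cross_add_right, cross_smul_right, hppu]
    module
  -- Both `u` and `R` solve `x' = p × x`, whose generator is antisymmetric, so their scalar product
  -- is constant. It equals `1` at `a`, and unit vectors with scalar product `1` coincide.
  have hconst : ∀ t ∈ Icc a b, (inner ℝ (u t) (R t) : ℝ) = inner ℝ (u a) (R a) := by
    refine constant_of_has_deriv_right_zero (f := fun t => (inner ℝ (u t) (R t) : ℝ)) ?_ ?_
    · exact fun t _ =>
        ((h.hasDerivAt t).inner ℝ (hRd t)).continuousAt.continuousWithinAt
    · intro t ht
      have h1 := (h.hasDerivAt t).inner ℝ (hRd t)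
      have h2 : inner ℝ (u t) (cross p (R t)) + inner ℝ (v t) (R t) = (0 : ℝ) := by
        rw [h.v_eq (t := t) trivial, hw t ⟨ht.1, ht.2.le⟩]
        simp only [inner_eq, cross_apply_zero, cross_apply_one, cross_apply_two]; ring
      rw [h2] at h1
      exact h1.hasDerivWithinAt
  have h1 := hconst b (right_mem_Icc.2 hab)
  have hRa : R a = u a := by simp [hR]
  rw [hRa, real_inner_self_eq_norm_sq, hua] at h1
  have h2 : ‖u b - R b‖ ^ 2 = 0 := by
    rw [norm_sub_sq_real, h1, hRn, h.unit b trivial]; norm_num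
  have h3 : u b - R b = 0 := by simpa using h2
  exact sub_eq_zero.1 h3

/-- The orbit of a rotation is the whole circle. -/
lemma exists_phase {p a b : E3} (hp : ‖p‖ = 1) (ha : ‖a‖ = 1) (hb : ‖b‖ = 1)
    (hpa : inner ℝ p a = (0 : ℝ)) (hpb : inner ℝ p b = (0 : ℝ)) :
    ∃ τ, 0 ≤ τ ∧ τ ≤ 2 * Real.pi ∧ Real.cos τ • a + Real.sin τ • cross p a = b := by
  have hd := smul_frame (x := b) hp ha hpa
  rw [real_inner_comm p b, hpb, zero_smul, add_zero] at hd
  set x : ℝ := inner ℝ b a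
  set y : ℝ := inner ℝ b (cross p a)
  have hda : inner ℝ a (cross p a) = (0 : ℝ) := by
    rw [real_inner_comm]; exact inner_cross_right p a
  have hxy : x ^ 2 + y ^ 2 = 1 := by
    have h1 : ‖b‖ ^ 2 = x ^ 2 + y ^ 2 := by
      conv_lhs => rw [hd]
      rw [norm_add_sq_real, norm_smul, norm_smul, inner_smul_left, inner_smul_right, hda, ha,
        norm_cross_of_orth hp hpa, ha]
      simp
    rw [← h1, hb]; norm_num
  have hz : ‖(⟨x, y⟩ : ℂ)‖ = 1 := by
    rw [Complex.norm_def, Complex.normSq_mk, ← sq, ← sq, hxy, Real.sqrt_one]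
  have hz0 : (⟨x, y⟩ : ℂ) ≠ 0 := by
    intro h; rw [h, norm_zero] at hz; norm_num at hz
  set θ := Complex.arg ⟨x, y⟩ with hθ
  have hcos : Real.cos θ = x := by rw [hθ, Complex.cos_arg hz0, hz]; simp
  have hsin : Real.sin θ = y := by rw [hθ, Complex.sin_arg, hz]; simp
  have hpi := Real.pi_pos
  have r1 := Complex.neg_pi_lt_arg ⟨x, y⟩
  have r2 := Complex.arg_le_pi ⟨x, y⟩
  rcases le_or_gt 0 θ with h0 | h0
  · exact ⟨θ, h0, by linarith, by rw [hcos, hsin, ← hd]⟩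
  · refine ⟨θ + 2 * Real.pi, by linarith, by linarith, ?_⟩
    rw [Real.cos_add_two_pi, Real.sin_add_two_pi, hcos, hsin, ← hd]

/-- Two curves which rotate about `p`, the first one after time `S` and the second one before time
`0`, can be joined in any prescribed window of length `2π` after `S`. -/
lemma exists_joining_time {u v f u' v' f' : ℝ → E3} (h : IsCurve u v f univ)
    (h' : IsCurve u' v' f' univ) {p : E3} (hp : ‖p‖ = 1) {S L : ℝ} (hL : S ≤ L)
    (hw : ∀ t, S ≤ t → cross (u t) (v t) = p) (hw' : cross (u' 0) (v' 0) = p) :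
    ∃ τ, L ≤ τ ∧ τ ≤ L + 2 * Real.pi ∧ u τ = u' 0 ∧ v τ = v' 0 := by
  have hpu : inner ℝ p (u L) = (0 : ℝ) := by rw [← hw L hL]; exact inner_cross_left _ _
  have hpu' : inner ℝ p (u' 0) = (0 : ℝ) := by rw [← hw']; exact inner_cross_left _ _
  obtain ⟨τ, h0, h1, h2⟩ := exists_phase hp (h.unit L trivial) (h'.unit 0 trivial) hpu hpu'
  have h3 : u (L + τ) = u' 0 := by
    rw [h.eq_rotation hp (a := L) (b := L + τ) (by linarith) fun t ht => hw t (hL.trans ht.1),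
      add_sub_cancel_left, h2]
  refine ⟨L + τ, by linarith, by linarith, h3, ?_⟩
  rw [h.v_eq (t := L + τ) trivial, h'.v_eq (t := 0) trivial, hw', hw _ (by linarith), h3]

/-- The first curve keeps rotating about `p'`, at no cost, until its phase agrees with that of the
second one; there position and velocity match and the curves are glued. -/
lemma Connects.trans {p p' p'' : E3} (hp' : ‖p'‖ = 1) {E E' : ℝ≥0∞} (h : Connects G p p' E)
    (h' : Connects G p' p'' E') : Connects G p p'' (E + E') := by
  obtain ⟨u, v, f, S, hS, hc, h1, h2, h3⟩ := h
  obtain ⟨u', v', f', S', hS', hc', h1', h2', h3'⟩ := h'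
  obtain ⟨τ, hτ, -, hu, hv⟩ := exists_joining_time hc hc' hp' le_rfl h2 (h1' 0 le_rfl)
  have hcs := univ_shift hc' τ
  have hu' : u τ = (fun t => u' (t - τ)) τ := by simpa using hu
  have hv' : v τ = (fun t => v' (t - τ)) τ := by simpa using hv
  refine ⟨glue τ u (fun t => u' (t - τ)), glue τ v (fun t => v' (t - τ)),
    glue τ f (fun t => f' (t - τ)), S' + τ, by linarith,
    IsCurve.glue (hc.mono (subset_univ _)) (hcs.mono (subset_univ _)) isClosed_univ hu' hv',
    fun t ht => ?_, fun t ht => ?_, ?_⟩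
  · have : t ≤ τ := by linarith
    rw [glue_of_le this, glue_of_le this, h1 t ht]
  · have : τ ≤ t := by linarith
    rw [glue_of_ge hu' this, glue_of_ge hv' this, h2' _ (by linarith)]
  · rw [← setLIntegral_univ, ← Iic_union_Ioi (a := τ)]
    refine (lintegral_union_le _ _ _).trans (add_le_add ?_ ?_)
    · refine le_trans (le_of_eq ?_) ((setLIntegral_le_lintegral (Iic τ) _).trans h3)
      refine setLIntegral_congr_fun measurableSet_Iic fun t ht => ?_
      simp only [dens, glue_of_le (mem_Iic.1 ht)]
    · have hsh : ∫⁻ t, dens G u' v' f' (t - τ) = ∫⁻ t, dens G u' v' f' t :=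
        lintegral_sub_right_eq_self (fun t => dens G u' v' f' t) τ
      refine le_trans (le_of_eq ?_)
        ((setLIntegral_le_lintegral (Ioi τ) _).trans (hsh.le.trans h3'))
      refine setLIntegral_congr_fun measurableSet_Ioi fun t ht => ?_
      simp only [dens, glue_of_lt (mem_Ioi.1 ht)]

/-- Profiles reach their wells only asymptotically and cannot be concatenated directly, so they are
first replaced by connecting curves with an arbitrarily small loss. -/
lemma transition_triangle (hG : ContinuousOn G {0}ᶜ) {p p' p'' : E3} (hp : ‖p‖ = 1)
    (hGp : G p = 0) (hp' : ‖p'‖ = 1) (hGp' : G p' = 0) (hp'' : ‖p''‖ = 1) (hGp'' : G p'' = 0) :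
    transition G p p'' ≤ transition G p p' + transition G p' p'' := by
  by_cases h1 : transition G p p' = ⊤
  · simp [h1]
  by_cases h2 : transition G p' p'' = ⊤
  · simp [h2]
  refine ENNReal.le_of_forall_pos_le_add fun ε hε _ => ?_
  have hε2 : ((ε / 2 : NNReal) : ℝ≥0∞) ≠ 0 := by
    simpa using (half_pos hε).ne'
  have k1 := connects_of_transition_lt hG hp hGp hp' hGp' (ENNReal.lt_add_right h1 hε2)
  have k2 := connects_of_transition_lt hG hp' hGp' hp'' hGp'' (ENNReal.lt_add_right h2 hε2)
  refine ((k1.trans hp' k2).transition_le hG).trans (le_of_eq ?_)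
  have : ((ε / 2 : NNReal) : ℝ≥0∞) + (ε / 2 : NNReal) = ε := by
    rw [← ENNReal.coe_add, add_halves]
  rw [← this]; ring

/-- There is a rotation about any axis. -/
lemma exists_rotation {p : E3} (hp : ‖p‖ = 1) :
    ∃ u v f, IsCurve u v f univ ∧ ∀ t, cross (u t) (v t) = p ∧ cross (u t) (f t) = 0 := by
  obtain ⟨c, hc, hpc⟩ : ∃ c : E3, ‖c‖ = 1 ∧ inner ℝ p c = (0 : ℝ) := by
    have hfin : Fact (Module.finrank ℝ E3 = 2 + 1) := ⟨by simp⟩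
    have h1 : 0 < Module.finrank ℝ (Submodule.span ℝ {p})ᗮ := by
      rw [Submodule.finrank_orthogonal_span_singleton (n := 2)]
      · norm_num
      · intro h; rw [h, norm_zero] at hp; norm_num at hp
    have := Module.finrank_pos_iff.1 h1
    obtain ⟨x, hx⟩ := exists_ne (0 : (Submodule.span ℝ {p})ᗮ)
    have hx0 : ‖(x : E3)‖ ≠ 0 := by simpa using hx
    refine ⟨‖(x : E3)‖⁻¹ • (x : E3), by simp [norm_smul, hx0], ?_⟩
    rw [inner_smul_right, Submodule.mem_orthogonal_singleton_iff_inner_right.1 x.2, mul_zero]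
  exact ⟨_, _, _, isCurve_polarCurve (φ := fun t => t + 0) (ψ := fun _ => 0) hp hc hpc
    (by fun_prop) (by fun_prop), fun t => ⟨rotation_cross hp hc hpc 0 t,
    rotation_cross_second hp hc hpc 0 t⟩⟩

/-- Rotating about `p` forever costs nothing. -/
lemma connects_self {p : E3} (hp : ‖p‖ = 1) (hGp : G p = 0) : Connects G p p 0 := by
  obtain ⟨u, v, f, hc, h⟩ := exists_rotation hp
  refine ⟨u, v, f, 0, le_rfl, hc, fun t _ => (h t).1, fun t _ => (h t).1, ?_⟩
  simp only [fun t => dens_eq_zero (G := G) (f := f) hp hGp (h t).1 (h t).2, lintegral_zero, le_refl]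

lemma transition_self (hG : ContinuousOn G {0}ᶜ) {p : E3} (hp : ‖p‖ = 1) (hGp : G p = 0) :
    transition G p p = 0 :=
  le_antisymm ((connects_self hp hGp).transition_le hG) bot_le

end HelicalXY

end

section

namespace HelicalXY

/-! ### Weak compactness in `L²` -/

/-- Sequential Banach–Alaoglu in the dual of a separable space, transported by the Riesz isometry.
-/
lemma exists_weak_subseq {H : Type*} [NormedAddCommGroup H] [InnerProductSpace ℝ H]
    [CompleteSpace H] [TopologicalSpace.SeparableSpace H] (x : ℕ → H) (R : ℝ)
    (hx : ∀ n, ‖x n‖ ≤ R) :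
    ∃ (y : H) (φ : ℕ → ℕ), StrictMono φ ∧
      ∀ z, Tendsto (fun n => (inner ℝ (x (φ n)) z : ℝ)) atTop (𝓝 (inner ℝ y z)) := by
  have hc := WeakDual.isSeqCompact_closedBall (𝕜 := ℝ) (E := H) 0 R
  let X : ℕ → WeakDual ℝ H := fun n => StrongDual.toWeakDual (InnerProductSpace.toDual ℝ H (x n))
  have hX : ∀ n, X n ∈ WeakDual.toStrongDual (𝕜 := ℝ) (E := H) ⁻¹' Metric.closedBall 0 R := by
    intro n
    simp only [X, mem_preimage, Metric.mem_closedBall, dist_zero_right]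
    change ‖InnerProductSpace.toDual ℝ H (x n)‖ ≤ R
    rw [LinearIsometryEquiv.norm_map]; exact hx n
  obtain ⟨Y, -, φ, hφ, hY⟩ := hc hX
  refine ⟨(InnerProductSpace.toDual ℝ H).symm (WeakDual.toStrongDual Y), φ, hφ, fun z => ?_⟩
  have h1 := ((WeakDual.eval_continuous z).tendsto Y).comp hY
  have h2 : (inner ℝ ((InnerProductSpace.toDual ℝ H).symm (WeakDual.toStrongDual Y)) z : ℝ) = Y z := by
    rw [InnerProductSpace.toDual_symm_apply]; rfl
  rw [h2]
  exact h1

section L2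

variable {μ : Measure ℝ}

lemma L2_inner_eq {f g : ℝ → E3} (hf : MemLp f 2 μ) (hg : MemLp g 2 μ) :
    (inner ℝ (hf.toLp f) (hg.toLp g) : ℝ) = ∫ t, inner ℝ (f t) (g t) ∂μ := by
  rw [L2.inner_def]
  apply integral_congr_ae
  filter_upwards [hf.coeFn_toLp, hg.coeFn_toLp] with t h1 h2
  rw [h1, h2]

lemma integrable_inner {f g : ℝ → E3} (hf : MemLp f 2 μ) (hg : MemLp g 2 μ) :
    Integrable (fun t => (inner ℝ (f t) (g t) : ℝ)) μ := by
  have := L2.integrable_inner (𝕜 := ℝ) (hf.toLp f) (hg.toLp g)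
  refine this.congr ?_
  filter_upwards [hf.coeFn_toLp, hg.coeFn_toLp] with t h1 h2
  rw [h1, h2]

lemma integrable_norm_sq {f : ℝ → E3} (hf : MemLp f 2 μ) :
    Integrable (fun t => ‖f t‖ ^ 2) μ :=
  (memLp_two_iff_integrable_sq_norm hf.1).1 hf

lemma L2_norm_sq_eq {f : ℝ → E3} (hf : MemLp f 2 μ) :
    ‖hf.toLp f‖ ^ 2 = ∫ t, ‖f t‖ ^ 2 ∂μ := by
  rw [← real_inner_self_eq_norm_sq, L2_inner_eq]
  simp only [real_inner_self_eq_norm_sq]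

lemma abs_integral_inner_le {f g : ℝ → E3} (hf : MemLp f 2 μ) (hg : MemLp g 2 μ) :
    |∫ t, (inner ℝ (f t) (g t) : ℝ) ∂μ| ≤ √(∫ t, ‖f t‖ ^ 2 ∂μ) * √(∫ t, ‖g t‖ ^ 2 ∂μ) := by
  rw [← L2_inner_eq hf hg, ← L2_norm_sq_eq hf, ← L2_norm_sq_eq hg, Real.sqrt_sq (norm_nonneg _),
    Real.sqrt_sq (norm_nonneg _)]
  exact abs_real_inner_le_norm _ _

lemma exists_weak_subseq_fun [SFinite μ] {F : ℕ → ℝ → E3} (hF : ∀ n, MemLp (F n) 2 μ) {K : ℝ}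
    (hK : ∀ n, ∫ t, ‖F n t‖ ^ 2 ∂μ ≤ K) :
    ∃ (f : ℝ → E3) (φ : ℕ → ℕ), MemLp f 2 μ ∧ StrictMono φ ∧ ∀ g, MemLp g 2 μ →
      Tendsto (fun n => ∫ t, (inner ℝ (F (φ n) t) (g t) : ℝ) ∂μ) atTop
        (𝓝 (∫ t, inner ℝ (f t) (g t) ∂μ)) := by
  have hfact : Fact ((2 : ℝ≥0∞) ≠ ⊤) := ⟨by norm_num⟩
  obtain ⟨y, φ, hφ, hy⟩ := exists_weak_subseq (H := Lp E3 2 μ) (fun n => (hF n).toLp (F n)) (√K)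
    (fun n => Real.le_sqrt_of_sq_le (by rw [L2_norm_sq_eq]; exact hK n))
  refine ⟨y, φ, Lp.memLp y, hφ, fun g hg => ?_⟩
  have h1 := hy (hg.toLp g)
  have h2 : (inner ℝ y (hg.toLp g) : ℝ) = ∫ t, inner ℝ (y t) (g t) ∂μ := by
    rw [← L2_inner_eq (Lp.memLp y) hg, Lp.toLp_coeFn]
  rw [h2] at h1
  refine h1.congr fun n => ?_
  rw [L2_inner_eq]

lemma memLp_indicator_const [IsFiniteMeasure μ] {s : Set ℝ} (hs : MeasurableSet s) (c : E3) :
    MemLp (s.indicator fun _ => c) 2 μ :=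
  (memLp_const c).indicator hs

lemma inner_setIntegral [IsFiniteMeasure μ] {f : ℝ → E3} (hf : MemLp f 2 μ) {s : Set ℝ}
    (hs : MeasurableSet s) (c : E3) :
    ∫ t, (inner ℝ (f t) (s.indicator (fun _ => c) t) : ℝ) ∂μ = inner ℝ (∫ t in s, f t ∂μ) c := by
  have hi : IntegrableOn f s μ := (hf.integrable (by norm_num)).integrableOn
  rw [real_inner_comm, ← integral_inner hi, ← integral_indicator hs]
  congr 1; funext t
  by_cases ht : t ∈ s <;> simp [ht, real_inner_comm]

/-- Cauchy–Schwarz against the indicator of `s` times the vector `∫ f` itself. -/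
lemma norm_setIntegral_sq_le [IsFiniteMeasure μ] {f : ℝ → E3} (hf : MemLp f 2 μ) {s : Set ℝ}
    (hs : MeasurableSet s) {K : ℝ} (hK : ∫ t, ‖f t‖ ^ 2 ∂μ ≤ K) :
    ‖∫ t in s, f t ∂μ‖ ≤ √K * √(μ.real s) := by
  set c := ∫ t in s, f t ∂μ with hc
  by_cases hc0 : ‖c‖ = 0
  · rw [hc0]; positivity
  have h1 := abs_integral_inner_le hf (memLp_indicator_const (μ := μ) hs c)
  rw [inner_setIntegral hf hs, ← hc, real_inner_self_eq_norm_sq, abs_of_nonneg (by positivity)] at h1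
  have h2 : ∫ t, ‖s.indicator (fun _ => c) t‖ ^ 2 ∂μ = ‖c‖ ^ 2 * μ.real s := by
    have : (fun t => ‖s.indicator (fun _ => c) t‖ ^ 2) = s.indicator fun _ => ‖c‖ ^ 2 := by
      funext t; by_cases ht : t ∈ s <;> simp [ht]
    rw [this, integral_indicator hs]; simp [mul_comm]
  rw [h2, Real.sqrt_mul (by positivity), Real.sqrt_sq (norm_nonneg _)] at h1
  have h3 : √(∫ t, ‖f t‖ ^ 2 ∂μ) ≤ √K := Real.sqrt_le_sqrt hK
  have hcp : 0 < ‖c‖ := lt_of_le_of_ne (norm_nonneg _) (Ne.symm hc0)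
  have h4 : ‖c‖ * ‖c‖ ≤ ‖c‖ * (√K * √(μ.real s)) := by
    calc ‖c‖ * ‖c‖ = ‖c‖ ^ 2 := by ring
      _ ≤ _ := h1
      _ ≤ √K * (‖c‖ * √(μ.real s)) := by gcongr
      _ = _ := by ring
  exact le_of_mul_le_mul_left h4 hcp

/-- Indicators with constant vector values are admissible test functions, and convergence in `ℝ³`
may be tested on coordinates. -/
lemma tendsto_setIntegral_of_weak [IsFiniteMeasure μ] {F : ℕ → ℝ → E3} {f : ℝ → E3}
    (hF : ∀ n, MemLp (F n) 2 μ) (hf : MemLp f 2 μ)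
    (hw : ∀ g, MemLp g 2 μ → Tendsto (fun n => ∫ t, (inner ℝ (F n t) (g t) : ℝ) ∂μ) atTop
        (𝓝 (∫ t, inner ℝ (f t) (g t) ∂μ))) {s : Set ℝ} (hs : MeasurableSet s) :
    Tendsto (fun n => ∫ t in s, F n t ∂μ) atTop (𝓝 (∫ t in s, f t ∂μ)) := by
  have h1 : ∀ c : E3, Tendsto (fun n => (inner ℝ (∫ t in s, F n t ∂μ) c : ℝ)) atTop
      (𝓝 (inner ℝ (∫ t in s, f t ∂μ) c)) := fun c => by
    have := hw _ (memLp_indicator_const hs c)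
    simp only [inner_setIntegral (hF _) hs, inner_setIntegral hf hs] at this
    exact this
  have h2 : ∀ i : Fin 3, Tendsto (fun n => (∫ t in s, F n t ∂μ) i) atTop
      (𝓝 ((∫ t in s, f t ∂μ) i)) := fun i => by
    have := h1 (EuclideanSpace.single i 1)
    simpa [EuclideanSpace.inner_single_right] using this
  have h3 : Tendsto (fun n => (∫ t in s, F n t ∂μ).ofLp) atTop
      (𝓝 ((∫ t in s, f t ∂μ).ofLp)) := tendsto_pi_nhds.2 h2
  exact ((PiLp.continuous_toLp 2 (fun _ : Fin 3 => ℝ)).tendsto _).comp h3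

end L2

/-! ### Integrals of step functions -/

section Step

variable {h : ℝ}

lemma floor_of_mem_Ico (hh : 0 < h) {j : ℕ} {t : ℝ} (ht : t ∈ Ico (j * h) ((j + 1 : ℕ) * h)) :
    ⌊t / h⌋₊ = j := by
  rw [Nat.floor_eq_iff (div_nonneg ((by positivity : (0:ℝ) ≤ j * h).trans ht.1) hh.le)]
  constructor
  · rw [le_div_iff₀ hh]; exact ht.1
  · rw [div_lt_iff₀ hh]; have := ht.2; push_cast at this; exact this

lemma lintegral_step (hh : 0 < h) (F : ℕ → ℝ≥0∞) (N : ℕ) :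
    ∫⁻ t in Ico 0 (N * h), F ⌊t / h⌋₊ = ∑ j ∈ Finset.range N, ENNReal.ofReal h * F j := by
  induction N with
  | zero => simp
  | succ N ih =>
    have h1 : (0 : ℝ) ≤ N * h := by positivity
    have h2 : (N : ℝ) * h ≤ ((N + 1 : ℕ) : ℝ) * h := by push_cast; nlinarith
    rw [← Ico_union_Ico_eq_Ico h1 h2, lintegral_union measurableSet_Ico
      (by rw [Set.disjoint_left]; intro t ht ht'; exact absurd ht.2 (not_lt.2 ht'.1)), ih,
      Finset.sum_range_succ]
    congr 1
    rw [setLIntegral_congr_fun (g := fun _ => F N) measurableSet_Ico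
      (fun t ht => by simp only [floor_of_mem_Ico hh ht])]
    rw [setLIntegral_const, Real.volume_Ico, mul_comm]
    congr 2; push_cast; ring

lemma integral_step (hh : 0 < h) (F : ℕ → E3) (N : ℕ) :
    ∫ t in (0 : ℝ)..(N * h), F ⌊t / h⌋₊ = ∑ j ∈ Finset.range N, h • F j ∧
      IntervalIntegrable (fun t => F ⌊t / h⌋₊) volume 0 (N * h) := by
  induction N with
  | zero => simp
  | succ N ih =>
    have h2 : (N : ℝ) * h ≤ ((N + 1 : ℕ) : ℝ) * h := by push_cast; nlinarith
    have hae : ∀ᵐ t : ℝ, t ∈ uIoc ((N : ℝ) * h) (((N + 1 : ℕ) : ℝ) * h) → F N = F ⌊t / h⌋₊ := by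
      have : ∀ᵐ t : ℝ, t ≠ ((N + 1 : ℕ) : ℝ) * h := by simp [ae_iff, measure_singleton]
      filter_upwards [this] with t ht hts
      rw [uIoc_of_le h2] at hts
      rw [floor_of_mem_Ico hh ⟨hts.1.le, lt_of_le_of_ne hts.2 ht⟩]
    have hi : IntervalIntegrable (fun t => F ⌊t / h⌋₊) volume (N * h) ((N + 1 : ℕ) * h) := by
      refine (intervalIntegrable_const (c := F N)).congr_ae ?_
      rw [EventuallyEq, ae_restrict_iff' measurableSet_uIoc]
      exact hae
    refine ⟨?_, ih.2.trans hi⟩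
    rw [← intervalIntegral.integral_add_adjacent_intervals ih.2 hi, ih.1, Finset.sum_range_succ,
      ← intervalIntegral.integral_congr_ae hae, intervalIntegral.integral_const]
    congr 2; push_cast; ring

lemma measurable_step {α : Type*} [MeasurableSpace α] (F : ℕ → α) :
    Measurable fun t : ℝ => F ⌊t / h⌋₊ :=
  (measurable_from_nat (f := F)).comp (Nat.measurable_floor.comp (measurable_id.div_const h))

lemma floor_mul_le (hh : 0 < h) {t : ℝ} (ht : 0 ≤ t) : (⌊t / h⌋₊ : ℝ) * h ≤ t := by
  have := Nat.floor_le (div_nonneg ht hh.le)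
  rwa [le_div_iff₀ hh] at this

lemma lt_floor_mul (hh : 0 < h) (t : ℝ) : t < (⌊t / h⌋₊ : ℝ) * h + h := by
  have := Nat.lt_floor_add_one (t / h)
  rw [div_lt_iff₀ hh] at this
  linarith

end Step

end HelicalXY

end

section

namespace HelicalXY

/-! ### Compactness for chains with bounded energy -/

/-- The standing assumptions on the penalization. -/
structure IsPenalty (G : E3 → ℝ) : Prop where
  cont : ContinuousOn G {0}ᶜ
  nonneg : ∀ x, 0 ≤ G x
  hom : ∀ (t : ℝ) (x : E3), 0 < t → G (t • x) = G x
  zero : G 0 = 0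

/-- The second difference quotient of a chain, set to zero from the index `N` on. -/
def ddq (h : ℝ) (U : ℕ → E3) (N j : ℕ) : E3 :=
  -- The energy gives no control past `N`. The extension by zero places chains of different lengths
  -- on a common interval, where weak compactness applies.
  if j < N then h⁻¹ • (dq h (U (j + 1)) (U (j + 2)) - dq h (U j) (U (j + 1))) else 0

/-! ### Discrete derivatives of a single chain. -/

section Chain

variable {G : E3 → ℝ} {h : ℝ} {U : ℕ → E3} {N : ℕ}

/-- Discrete counterpart of `u ⟂ u'`: for unit vectors `⟨a, b - a⟩ = -‖b - a‖² / 2`, which leaves an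
error of order `h`. -/
lemma inner_dq_left (hh : 0 < h) {a b : E3} (ha : ‖a‖ = 1) (hb : ‖b‖ = 1) :
    inner ℝ a (dq h a b) = -(h / 2) * ‖dq h a b‖ ^ 2 := by
  rw [dq, norm_smul, mul_pow, normSq_sub_unit ha hb, inner_smul_right, inner_sub_right,
    real_inner_self_eq_norm_sq, ha]
  simp only [norm_inv, Real.norm_eq_abs, inv_pow, sq_abs]
  field_simp; ring

lemma inner_dq_right (hh : 0 < h) {a b : E3} (ha : ‖a‖ = 1) (hb : ‖b‖ = 1) :
    inner ℝ b (dq h a b) = (h / 2) * ‖dq h a b‖ ^ 2 := by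
  rw [dq, norm_smul, mul_pow, normSq_sub_unit ha hb, inner_smul_right, inner_sub_right,
    real_inner_self_eq_norm_sq, hb, real_inner_comm]
  simp only [norm_inv, Real.norm_eq_abs, inv_pow, sq_abs]
  field_simp

lemma siteE_nonneg (hh : 0 < h) (hG : ∀ x, 0 ≤ G x) (a b c : E3) : 0 ≤ siteE h G a b c := by
  have := hG (cross a b); unfold siteE; positivity

/-- The kinetic term sees only the part of the second difference quotient orthogonal to the middle
spin. The part along it is exactly `-x`, with `x` the mean of the two squared velocities, and is
controlled by the well term through `x² ≤ 2 (1 - x)² + 2`. -/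
lemma ddq_norm_sq_le (hh : 0 < h) (hG : ∀ x, 0 ≤ G x) (hU : ∀ j, ‖U j‖ = 1) (j : ℕ) :
    h * ‖ddq h U N j‖ ^ 2 ≤
      if j < N then 2 * siteE h G (U j) (U (j + 1)) (U (j + 2)) + 2 * h else 0 := by
  unfold ddq
  split_ifs with hj
  swap
  · simp
  rw [siteE_eq hh G (hU _) (hU _) (hU _)]
  set a := U j
  set b := U (j + 1)
  set c := U (j + 2)
  have h1 := norm_cross_sq b (h⁻¹ • (dq h b c - dq h a b))
  rw [hU, cross_smul_right, norm_smul, mul_pow, inner_smul_right, inner_sub_right,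
    inner_dq_left hh (hU _) (hU _), inner_dq_right hh (hU _) (hU _)] at h1
  have h2 : ‖h⁻¹‖ ^ 2 = 1 / h ^ 2 := by
    rw [norm_inv, Real.norm_eq_abs, inv_pow, sq_abs]; field_simp
  rw [h2] at h1
  set x := (‖dq h a b‖ ^ 2 + ‖dq h b c‖ ^ 2) / 2 with hx
  have h3 : (h⁻¹ * (-(h / 2) * ‖dq h b c‖ ^ 2 - h / 2 * ‖dq h a b‖ ^ 2)) = -x := by
    rw [hx]; field_simp; ring
  rw [h3] at h1
  have h4 : ‖h⁻¹ • (dq h b c - dq h a b)‖ ^ 2 =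
      ‖cross b (dq h b c - dq h a b)‖ ^ 2 / h ^ 2 + x ^ 2 := by
    rw [div_eq_mul_one_div]; linarith
  rw [h4]
  have h5 := hG (cross a b)
  have h6 : 0 ≤ ‖cross b (dq h b c - dq h a b)‖ ^ 2 / h ^ 2 := by positivity
  have h7 : ‖cross b (dq h b c - dq h a b)‖ ^ 2 / h ^ 2 + x ^ 2 ≤
      2 * (‖cross b (dq h b c - dq h a b)‖ ^ 2 / h ^ 2 + (1 - x) ^ 2 + G (cross a b) / 2) + 2 := by
    nlinarith [sq_nonneg (x - 2)]
  calc _ ≤ h * (2 * (‖cross b (dq h b c - dq h a b)‖ ^ 2 / h ^ 2 + (1 - x) ^ 2 +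
        G (cross a b) / 2) + 2) := mul_le_mul_of_nonneg_left h7 hh.le
    _ = _ := by ring

lemma sum_ddq_le (hh : 0 < h) (hG : ∀ x, 0 ≤ G x) (hU : ∀ j, ‖U j‖ = 1) {E T₀ : ℝ}
    (hN : N * h ≤ T₀)
    (hE : ∑ j ∈ Finset.range N, siteE h G (U j) (U (j + 1)) (U (j + 2)) ≤ E) (M : ℕ) :
    ∑ j ∈ Finset.range M, h * ‖ddq h U N j‖ ^ 2 ≤ 2 * E + 2 * T₀ := by
  calc ∑ j ∈ Finset.range M, h * ‖ddq h U N j‖ ^ 2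
      ≤ ∑ j ∈ Finset.range (max M N), h * ‖ddq h U N j‖ ^ 2 :=
        Finset.sum_le_sum_of_subset_of_nonneg
          (Finset.range_mono (le_max_left _ _)) fun _ _ _ => by positivity
    _ = ∑ j ∈ Finset.range N, h * ‖ddq h U N j‖ ^ 2 := by
        symm
        refine Finset.sum_subset (Finset.range_mono (le_max_right _ _)) fun j _ hj => ?_
        have : ¬ j < N := by simpa using hj
        simp [ddq, this]
    _ ≤ ∑ j ∈ Finset.range N, (2 * siteE h G (U j) (U (j + 1)) (U (j + 2)) + 2 * h) := by
        refine Finset.sum_le_sum fun j hj => ?_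
        have := ddq_norm_sq_le (N := N) hh hG hU j
        rwa [if_pos (Finset.mem_range.1 hj)] at this
    _ = 2 * (∑ j ∈ Finset.range N, siteE h G (U j) (U (j + 1)) (U (j + 2))) + 2 * (N * h) := by
        rw [Finset.sum_add_distrib, ← Finset.mul_sum]; simp; ring
    _ ≤ _ := by linarith

lemma dq_eq_integral (hh : 0 < h) {j : ℕ} (hj : j ≤ N) :
    dq h (U j) (U (j + 1)) =
      dq h (U 0) (U 1) + ∫ t in (0 : ℝ)..(j * h), ddq h U N ⌊t / h⌋₊ := by
  rw [(integral_step hh _ _).1]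
  have : ∀ k, k ≤ N → ∑ i ∈ Finset.range k, h • ddq h U N i =
      dq h (U k) (U (k + 1)) - dq h (U 0) (U 1) := by
    intro k
    induction k with
    | zero => simp
    | succ k ih =>
      intro hk
      rw [Finset.sum_range_succ, ih (by omega), ddq, if_pos (by omega), smul_smul,
        mul_inv_cancel₀ hh.ne', one_smul]
      abel
  rw [this j hj]; abel

lemma chain_eq_integral (hh : 0 < h) (j : ℕ) :
    U j = U 0 + ∫ t in (0 : ℝ)..(j * h), dq h (U ⌊t / h⌋₊) (U (⌊t / h⌋₊ + 1)) := by
  rw [(integral_step hh (fun j => dq h (U j) (U (j + 1))) _).1]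
  have : ∀ k, ∑ i ∈ Finset.range k, h • dq h (U i) (U (i + 1)) = U k - U 0 := by
    intro k
    induction k with
    | zero => simp
    | succ k ih =>
      rw [Finset.sum_range_succ, ih, dq, smul_smul, mul_inv_cancel₀ hh.ne', one_smul]
      abel
  rw [this j]; abel

lemma cross_ddq {j : ℕ} (hj : j < N) :
    ‖cross (U (j + 1)) (ddq h U N j)‖ ^ 2 =
      ‖cross (U (j + 1)) (dq h (U (j + 1)) (U (j + 2)) - dq h (U j) (U (j + 1)))‖ ^ 2 / h ^ 2 := by
  rw [ddq, if_pos hj, cross_smul_right, norm_smul, mul_pow, norm_inv, Real.norm_eq_abs, inv_pow,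
    sq_abs]
  ring

lemma memLp_step {T₀ : ℝ} :
    MemLp (fun t => ddq h U N ⌊t / h⌋₊) 2 (volume.restrict (Icc 0 T₀)) := by
  refine MemLp.of_bound (measurable_step _).aestronglyMeasurable
    (∑ j ∈ Finset.range N, ‖ddq h U N j‖) (ae_of_all _ fun t => ?_)
  by_cases hj : ⌊t / h⌋₊ < N
  · exact Finset.single_le_sum (f := fun j => ‖ddq h U N j‖) (fun _ _ => norm_nonneg _)
      (Finset.mem_range.2 hj)
  · rw [ddq, if_neg hj, norm_zero]
    exact Finset.sum_nonneg fun _ _ => norm_nonneg _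

lemma integral_sq_step_le {T₀ K : ℝ} (hh : 0 < h)
    (hK : ∀ M, ∑ j ∈ Finset.range M, h * ‖ddq h U N j‖ ^ 2 ≤ K) :
    ∫ t in Icc 0 T₀, ‖ddq h U N ⌊t / h⌋₊‖ ^ 2 ≤ K := by
  have hK0 : 0 ≤ K := by simpa using hK 0
  rw [integral_eq_lintegral_of_nonneg_ae (ae_of_all _ fun t => by positivity)
    ((measurable_step (h := h) (fun j => ‖ddq h U N j‖ ^ 2)).aestronglyMeasurable)]
  refine ENNReal.toReal_le_of_le_ofReal hK0 ?_
  have hsub : Icc 0 T₀ ⊆ Ico 0 (((⌊T₀ / h⌋₊ + 1 : ℕ) : ℝ) * h) := by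
    intro t ht
    refine ⟨ht.1, ht.2.trans_lt ?_⟩
    have := lt_floor_mul hh T₀
    push_cast; linarith
  refine (lintegral_mono_set hsub).trans ?_
  rw [lintegral_step hh (fun j => ENNReal.ofReal (‖ddq h U N j‖ ^ 2))]
  simp only [← ENNReal.ofReal_mul hh.le]
  rw [← ENNReal.ofReal_sum_of_nonneg fun _ _ => by positivity]
  exact ENNReal.ofReal_le_ofReal (hK _)

end Chain

/-- Sequences of chains which converge in the sense of the compactness theorem. -/
structure ChainConv (h : ℕ → ℝ) (U : ℕ → ℕ → E3) (N : ℕ → ℕ) (T₀ K T : ℝ) (u₀ v₀ : E3)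
    (f : ℝ → E3) : Prop where
  hpos : ∀ n, 0 < h n
  hlim : Tendsto h atTop (𝓝 0)
  unit : ∀ n j, ‖U n j‖ = 1
  len : ∀ n, N n * h n ≤ T₀
  bound : ∀ n M, ∑ j ∈ Finset.range M, h n * ‖ddq (h n) (U n) (N n) j‖ ^ 2 ≤ K
  hu₀ : Tendsto (fun n => U n 0) atTop (𝓝 u₀)
  hv₀ : Tendsto (fun n => dq (h n) (U n 0) (U n 1)) atTop (𝓝 v₀)
  hT : Tendsto (fun n => N n * h n) atTop (𝓝 T)
  memLp : MemLp f 2 (volume.restrict (Icc 0 T₀))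
  weak : ∀ g, MemLp g 2 (volume.restrict (Icc 0 T₀)) →
    Tendsto (fun n => ∫ t in Icc 0 T₀, (inner ℝ (ddq (h n) (U n) (N n) ⌊t / h n⌋₊) (g t) : ℝ)) atTop
      (𝓝 (∫ t in Icc 0 T₀, inner ℝ (f t) (g t)))

namespace ChainConv

variable {h : ℕ → ℝ} {U : ℕ → ℕ → E3} {N : ℕ → ℕ} {T₀ K T : ℝ} {u₀ v₀ : E3} {f : ℝ → E3}

lemma T_nonneg (H : ChainConv h U N T₀ K T u₀ v₀ f) : 0 ≤ T :=
  ge_of_tendsto' H.hT fun n => mul_nonneg (Nat.cast_nonneg _) (H.hpos n).le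

lemma T_le (H : ChainConv h U N T₀ K T u₀ v₀ f) : T ≤ T₀ := le_of_tendsto' H.hT H.len

lemma intervalIntegral_eq {F : ℝ → E3} {t : ℝ} (ht : t ∈ Icc 0 T₀) :
    ∫ s in (0 : ℝ)..t, F s = ∫ s in Ioc 0 t, F s ∂(volume.restrict (Icc 0 T₀)) := by
  rw [intervalIntegral.integral_of_le ht.1, Measure.restrict_restrict measurableSet_Ioc]
  congr 2
  rw [inter_eq_left.2]
  exact fun s hs => ⟨hs.1.le, hs.2.trans ht.2⟩

/-- The velocity is the initial velocity plus the integral of the second difference quotients. Weak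
convergence handles the integral up to `t`; moving the end point from `t` to `J n * h n` costs at
most the root of the displacement. -/
lemma tendsto_dq (H : ChainConv h U N T₀ K T u₀ v₀ f) {t : ℝ} (ht : t ∈ Icc 0 T₀) {J : ℕ → ℕ}
    (hJ : ∀ᶠ n in atTop, J n ≤ N n) (hJt : Tendsto (fun n => J n * h n) atTop (𝓝 t)) :
    Tendsto (fun n => dq (h n) (U n (J n)) (U n (J n + 1))) atTop
      (𝓝 (v₀ + ∫ s in (0 : ℝ)..t, f s)) := by
  set F : ℕ → ℝ → E3 := fun n t => ddq (h n) (U n) (N n) ⌊t / h n⌋₊ with hF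
  have hFm : ∀ n, MemLp (F n) 2 (volume.restrict (Icc 0 T₀)) := fun n => memLp_step
  have h1 : Tendsto (fun n => ∫ s in (0 : ℝ)..t, F n s) atTop (𝓝 (∫ s in (0 : ℝ)..t, f s)) := by
    simp only [intervalIntegral_eq ht]
    exact tendsto_setIntegral_of_weak hFm H.memLp H.weak measurableSet_Ioc
  have hFi : ∀ n a b, IntervalIntegrable (F n) volume a b := fun n a b => by
    have hl : LocallyIntegrable (F n) := by
      have hb : ∀ t, ‖F n t‖ ≤ ∑ j ∈ Finset.range (N n), ‖ddq (h n) (U n) (N n) j‖ := by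
        intro t
        by_cases hj : ⌊t / h n⌋₊ < N n
        · exact Finset.single_le_sum (f := fun j => ‖ddq (h n) (U n) (N n) j‖)
            (fun _ _ => norm_nonneg _) (Finset.mem_range.2 hj)
        · simp only [hF, ddq, if_neg hj, norm_zero]
          exact Finset.sum_nonneg fun _ _ => norm_nonneg _
      rw [locallyIntegrable_iff]
      intro k hk
      exact Measure.integrableOn_of_bounded hk.measure_lt_top.ne
        (measurable_step _).aestronglyMeasurable (ae_of_all _ hb)
    exact intervalIntegrable_of_locallyIntegrable hl a b
  have h2 : Tendsto (fun n => (∫ s in (0 : ℝ)..(J n * h n), F n s) - ∫ s in (0 : ℝ)..t, F n s)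
      atTop (𝓝 0) := by
    have hb : ∀ᶠ n in atTop, ‖(∫ s in (0 : ℝ)..(J n * h n), F n s) - ∫ s in (0 : ℝ)..t, F n s‖ ≤
        √K * √|J n * h n - t| := by
      filter_upwards [hJ] with n hn
      rw [intervalIntegral.integral_interval_sub_left (hFi _ _ _) (hFi _ _ _),
        intervalIntegral.norm_integral_eq_norm_integral_uIoc]
      have hJ0 : (J n : ℝ) * h n ∈ Icc 0 T₀ := ⟨mul_nonneg (Nat.cast_nonneg _) (H.hpos n).le,
        (mul_le_mul_of_nonneg_right (by exact_mod_cast hn) (H.hpos n).le).trans (H.len n)⟩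
      have hsub : uIoc t (J n * h n) ⊆ Icc 0 T₀ := by
        refine uIoc_subset_uIcc.trans ?_
        exact uIcc_subset_Icc ht hJ0
      have := norm_setIntegral_sq_le (hFm n) (s := uIoc t (J n * h n)) measurableSet_uIoc
        (integral_sq_step_le (H.hpos n) (H.bound n))
      rw [Measure.restrict_restrict measurableSet_uIoc, inter_eq_left.2 hsub, measureReal_def,
        Measure.restrict_apply measurableSet_uIoc, inter_eq_left.2 hsub, uIoc,
        Real.volume_Ioc, max_sub_min_eq_abs, ENNReal.toReal_ofReal (abs_nonneg _)] at this
      exact this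
    refine squeeze_zero_norm' hb ?_
    have h3 : Tendsto (fun n => √K * √|J n * h n - t|) atTop (𝓝 (√K * √|t - t|)) :=
      ((hJt.sub_const t).abs.sqrt).const_mul _
    simpa using h3
  have h3 := (H.hv₀.add (h2.add h1))
  rw [zero_add] at h3
  refine h3.congr' ?_
  filter_upwards [hJ] with n hn
  rw [sub_add_cancel, dq_eq_integral (H.hpos n) hn]

lemma exists_bound_dq (H : ChainConv h U N T₀ K T u₀ v₀ f) :
    ∃ M, ∀ n j, j ≤ N n → ‖dq (h n) (U n j) (U n (j + 1))‖ ≤ M := by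
  obtain ⟨M, hM⟩ := H.hv₀.norm.bddAbove_range
  refine ⟨M + √K * √T₀, fun n j hj => ?_⟩
  rw [dq_eq_integral (H.hpos n) hj]
  have hj0 : (j : ℝ) * h n ∈ Icc 0 T₀ := ⟨mul_nonneg (Nat.cast_nonneg _) (H.hpos n).le,
    (mul_le_mul_of_nonneg_right (by exact_mod_cast hj) (H.hpos n).le).trans (H.len n)⟩
  refine (norm_add_le _ _).trans (add_le_add (hM ⟨n, rfl⟩) ?_)
  rw [intervalIntegral_eq hj0]
  refine (norm_setIntegral_sq_le (memLp_step) measurableSet_Ioc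
    (integral_sq_step_le (H.hpos n) (H.bound n))).trans ?_
  gcongr
  rw [measureReal_def, Measure.restrict_apply measurableSet_Ioc, inter_eq_left.2, Real.volume_Ioc,
    sub_zero, ENNReal.toReal_ofReal hj0.1]
  · exact hj0.2
  · exact fun s hs => ⟨hs.1.le, hs.2.trans hj0.2⟩

lemma tendsto_floor_mul (H : ChainConv h U N T₀ K T u₀ v₀ f) {t : ℝ} (ht : 0 ≤ t) :
    Tendsto (fun n => (⌊t / h n⌋₊ : ℝ) * h n) atTop (𝓝 t) := by
  have h1 : Tendsto (fun n => t - h n) atTop (𝓝 (t - 0)) := H.hlim.const_sub t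
  rw [sub_zero] at h1
  refine tendsto_of_tendsto_of_tendsto_of_le_of_le h1 tendsto_const_nhds (fun n => ?_) fun n => ?_
  · have := lt_floor_mul (H.hpos n) t
    simp only; linarith
  · exact floor_mul_le (H.hpos n) ht

lemma intervalIntegrable_f (H : ChainConv h U N T₀ K T u₀ v₀ f) {a b : ℝ} (ha : a ∈ Icc 0 T₀)
    (hb : b ∈ Icc 0 T₀) : IntervalIntegrable f volume a b := by
  have : IntegrableOn f (Icc 0 T₀) := H.memLp.integrable (by norm_num)
  rw [intervalIntegrable_iff]
  exact this.mono_set (uIoc_subset_uIcc.trans (uIcc_subset_Icc ha hb))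

/-- The limit velocity. -/
def vel (v₀ : E3) (f : ℝ → E3) (t : ℝ) : E3 := v₀ + ∫ s in (0 : ℝ)..t, f s

/-- The limit curve. -/
def pos (u₀ v₀ : E3) (f : ℝ → E3) (t : ℝ) : E3 := u₀ + ∫ s in (0 : ℝ)..t, vel v₀ f s

lemma continuousOn_vel (H : ChainConv h U N T₀ K T u₀ v₀ f) :
    ContinuousOn (vel v₀ f) (Icc 0 T₀) := by
  by_cases h0 : 0 ≤ T₀
  · have := intervalIntegral.continuousOn_primitive_interval
      (f := f) (μ := volume) (a := 0) (b := T₀) (by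
        rw [uIcc_of_le h0]; exact H.memLp.integrable (by norm_num))
    rw [uIcc_of_le h0] at this
    exact continuousOn_const.add this
  · rw [Icc_eq_empty h0]; exact continuousOn_empty _

/-- The chain is the integral of its velocities, which are bounded and converge pointwise. The
indicator absorbs the moving end point, and dominated convergence applies. -/
lemma tendsto_chain (H : ChainConv h U N T₀ K T u₀ v₀ f) {t : ℝ} (ht : t ∈ Icc 0 T₀) {J : ℕ → ℕ}
    (hJ : ∀ n, J n ≤ N n) (hJt : Tendsto (fun n => J n * h n) atTop (𝓝 t)) :
    Tendsto (fun n => U n (J n)) atTop (𝓝 (pos u₀ v₀ f t)) := by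
  obtain ⟨M, hM⟩ := H.exists_bound_dq
  have hM0 : 0 ≤ M := (norm_nonneg _).trans (hM 0 0 (Nat.zero_le _))
  set μ := volume.restrict (Ioc 0 T₀) with hμ
  have key : Tendsto (fun n => ∫ s, (Iio ((J n : ℝ) * h n)).indicator
      (fun s => dq (h n) (U n ⌊s / h n⌋₊) (U n (⌊s / h n⌋₊ + 1))) s ∂μ) atTop
      (𝓝 (∫ s, (Iio t).indicator (vel v₀ f) s ∂μ)) := by
    refine tendsto_integral_of_dominated_convergence (fun _ => M) (fun n => ?_)
      (integrable_const M) (fun n => ?_) ?_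
    · exact ((measurable_step (h := h n) fun j => dq (h n) (U n j) (U n (j + 1))).indicator
        measurableSet_Iio).aestronglyMeasurable
    · rw [hμ, ae_restrict_iff' measurableSet_Ioc]
      refine ae_of_all _ fun s hs => ?_
      by_cases hsJ : s ∈ Iio ((J n : ℝ) * h n)
      · rw [indicator_of_mem hsJ]
        refine hM n _ (le_trans ?_ (hJ n))
        have h1 := floor_mul_le (H.hpos n) hs.1.le
        have h2 : (⌊s / h n⌋₊ : ℝ) * h n < J n * h n := h1.trans_lt hsJ
        have h3 := lt_of_mul_lt_mul_right h2 (H.hpos n).le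
        exact_mod_cast h3.le
      · rw [indicator_of_notMem hsJ, norm_zero]; exact hM0
    · have hne : ∀ᵐ s : ℝ, s ≠ t := by simp [ae_iff, measure_singleton]
      rw [hμ, ae_restrict_iff' measurableSet_Ioc]
      filter_upwards [hne] with s hst hs
      rcases lt_or_gt_of_ne hst with hlt | hgt
      · rw [indicator_of_mem (show s ∈ Iio t from hlt)]
        have ev : ∀ᶠ n in atTop, s < J n * h n := hJt.eventually_const_lt hlt
        have hfl : ∀ᶠ n in atTop, ⌊s / h n⌋₊ ≤ N n := by
          filter_upwards [ev] with n hn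
          have h1 := floor_mul_le (H.hpos n) hs.1.le
          have h3 := lt_of_mul_lt_mul_right (h1.trans_lt hn) (H.hpos n).le
          exact (by exact_mod_cast h3.le : ⌊s / h n⌋₊ ≤ J n).trans (hJ n)
        refine (H.tendsto_dq (t := s) ⟨hs.1.le, hs.2⟩ hfl (H.tendsto_floor_mul hs.1.le)).congr' ?_
        filter_upwards [ev] with n hn
        rw [indicator_of_mem (show s ∈ Iio _ from hn)]
      · rw [indicator_of_notMem (show s ∉ Iio t from not_lt.2 hgt.le)]
        have ev : ∀ᶠ n in atTop, J n * h n < s := hJt.eventually_lt_const hgt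
        refine tendsto_const_nhds.congr' ?_
        filter_upwards [ev] with n hn
        rw [indicator_of_notMem (show s ∉ Iio _ from not_lt.2 hn.le)]
  have conv : ∀ (F : ℝ → E3) (x : ℝ), x ∈ Icc 0 T₀ →
      ∫ s, (Iio x).indicator F s ∂μ = ∫ s in (0 : ℝ)..x, F s := by
    intro F x hx
    rw [integral_indicator measurableSet_Iio, hμ, Measure.restrict_restrict measurableSet_Iio,
      intervalIntegral.integral_of_le hx.1, ← integral_Ico_eq_integral_Ioc, integral_Ico_eq_integral_Ioo]
    congr 2
    ext s
    simp only [mem_inter_iff, mem_Iio, mem_Ioc, mem_Ioo]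
    exact ⟨fun h => ⟨h.2.1, h.1⟩, fun h => ⟨h.2, h.1, h.2.le.trans hx.2⟩⟩
  rw [conv _ _ ht] at key
  refine (H.hu₀.add key).congr fun n => ?_
  rw [conv _ _ ⟨mul_nonneg (Nat.cast_nonneg _) (H.hpos n).le,
    (mul_le_mul_of_nonneg_right (by exact_mod_cast hJ n) (H.hpos n).le).trans (H.len n)⟩,
    ← chain_eq_integral (H.hpos n)]

end ChainConv

end HelicalXY

end

section

namespace HelicalXY

/-! ### The limit of a sequence of chains and the lower semicontinuity of the energy. -/

lemma aestronglyMeasurable_cross {α : Type*} [MeasurableSpace α] {μ : Measure α} {f g : α → E3}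
    (hf : AEStronglyMeasurable f μ) (hg : AEStronglyMeasurable g μ) :
    AEStronglyMeasurable (fun t => cross (f t) (g t)) μ := by
  have := continuous_cross.comp_aestronglyMeasurable (hf.prodMk hg)
  exact this

lemma continuousOn_cross {α : Type*} [TopologicalSpace α] {f g : α → E3} {s : Set α}
    (hf : ContinuousOn f s) (hg : ContinuousOn g s) :
    ContinuousOn (fun t => cross (f t) (g t)) s := by
  have := continuous_cross.comp_continuousOn (hf.prodMk hg)
  exact this

namespace ChainConv

variable {h : ℕ → ℝ} {U : ℕ → ℕ → E3} {N : ℕ → ℕ} {T₀ K T : ℝ} {u₀ v₀ : E3} {f : ℝ → E3}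
  {G : E3 → ℝ}

lemma exists_index (H : ChainConv h U N T₀ K T u₀ v₀ f) {t : ℝ} (ht : t ∈ Icc 0 T) :
    ∃ J : ℕ → ℕ, (∀ n, J n ≤ N n) ∧ Tendsto (fun n => J n * h n) atTop (𝓝 t) := by
  refine ⟨fun n => min ⌊t / h n⌋₊ (N n), fun n => min_le_right _ _, ?_⟩
  have h1 := (H.tendsto_floor_mul ht.1).min H.hT
  rw [min_eq_left ht.2] at h1
  refine h1.congr fun n => ?_
  push_cast
  rw [min_mul_of_nonneg _ _ (H.hpos n).le]

lemma limit_unit (H : ChainConv h U N T₀ K T u₀ v₀ f) {t : ℝ} (ht : t ∈ Icc 0 T) :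
    ‖pos u₀ v₀ f t‖ = 1 := by
  obtain ⟨J, hJ, hJt⟩ := H.exists_index ht
  have := (H.tendsto_chain ⟨ht.1, ht.2.trans H.T_le⟩ hJ hJt).norm
  simp only [H.unit] at this
  exact tendsto_nhds_unique this tendsto_const_nhds |>.symm ▸ rfl

/-- By `inner_dq_left` the discrete scalar product is `-(h/2) ‖dq‖²`, and the velocities converge.
-/
lemma limit_orth (H : ChainConv h U N T₀ K T u₀ v₀ f) {t : ℝ} (ht : t ∈ Icc 0 T) :
    inner ℝ (pos u₀ v₀ f t) (vel v₀ f t) = (0 : ℝ) := by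
  obtain ⟨J, hJ, hJt⟩ := H.exists_index ht
  have ht' : t ∈ Icc 0 T₀ := ⟨ht.1, ht.2.trans H.T_le⟩
  have h1 := H.tendsto_chain ht' hJ hJt
  have h2 := H.tendsto_dq ht' (Eventually.of_forall hJ) hJt
  have h3 := h1.inner (𝕜 := ℝ) h2
  have h4 : Tendsto (fun n => -(h n / 2) * ‖dq (h n) (U n (J n)) (U n (J n + 1))‖ ^ 2) atTop
      (𝓝 (-(0 / 2) * ‖v₀ + ∫ s in (0 : ℝ)..t, f s‖ ^ 2)) :=
    ((H.hlim.div_const 2).neg).mul (h2.norm.pow 2)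
  have h5 := tendsto_nhds_unique (h3.congr fun n => inner_dq_left (H.hpos n) (H.unit n _)
    (H.unit n _)) h4
  simpa [vel] using h5

lemma isCurve (H : ChainConv h U N T₀ K T u₀ v₀ f) :
    IsCurve (pos u₀ v₀ f) (vel v₀ f) f (Icc 0 T) := by
  have hsub : Icc 0 T ⊆ Icc 0 T₀ := Icc_subset_Icc_right H.T_le
  have h0 : (0 : ℝ) ∈ Icc 0 T₀ := ⟨le_rfl, H.T_nonneg.trans H.T_le⟩
  have hv := H.continuousOn_vel
  refine ⟨fun a b hab => H.memLp.mono_measure (Measure.restrict_mono (hab.trans hsub) le_rfl),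
    hv.mono hsub, fun a b hab hs => ?_, fun a b hab hs => ?_, fun t ht => H.limit_unit ht,
    fun t ht => H.limit_orth ht⟩
  · have ha := hsub (hs (left_mem_Icc.2 hab))
    have hb := hsub (hs (right_mem_Icc.2 hab))
    simp only [vel, add_sub_add_left_eq_sub]
    exact intervalIntegral.integral_interval_sub_left (H.intervalIntegrable_f h0 hb)
      (H.intervalIntegrable_f h0 ha)
  · have ha := hsub (hs (left_mem_Icc.2 hab))
    have hb := hsub (hs (right_mem_Icc.2 hab))
    simp only [pos, add_sub_add_left_eq_sub]
    have hi : ∀ x ∈ Icc 0 T₀, IntervalIntegrable (vel v₀ f) volume 0 x := fun x hx =>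
      (hv.mono (uIcc_subset_Icc h0 hx)).intervalIntegrable
    exact intervalIntegral.integral_interval_sub_left (hi b hb) (hi a ha)

lemma tendsto_end (H : ChainConv h U N T₀ K T u₀ v₀ f) {t : ℝ} (ht : t ∈ Icc 0 T) {J : ℕ → ℕ}
    (hJ : ∀ n, J n ≤ N n) (hJt : Tendsto (fun n => J n * h n) atTop (𝓝 t)) :
    Tendsto (fun n => cross (U n (J n)) (dq (h n) (U n (J n)) (U n (J n + 1)))) atTop
      (𝓝 (cross (pos u₀ v₀ f t) (vel v₀ f t))) := by
  have ht' : t ∈ Icc 0 T₀ := ⟨ht.1, ht.2.trans H.T_le⟩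
  exact tendsto_cross (H.tendsto_chain ht' hJ hJt)
    (H.tendsto_dq ht' (Eventually.of_forall hJ) hJt)

/-- The test function in the lower semicontinuity argument. -/
def accel (u₀ v₀ : E3) (f : ℝ → E3) (T : ℝ) : ℝ → E3 :=
  (Ioo 0 T).indicator fun t => cross (pos u₀ v₀ f t) (f t)

lemma continuousOn_pos (H : ChainConv h U N T₀ K T u₀ v₀ f) :
    ContinuousOn (pos u₀ v₀ f) (Icc 0 T) := by
  have h1 : ContinuousOn (vel v₀ f) (uIcc 0 T) := by
    rw [uIcc_of_le H.T_nonneg]; exact H.continuousOn_vel.mono (Icc_subset_Icc_right H.T_le)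
  have := intervalIntegral.continuousOn_primitive_interval (μ := volume) h1.integrableOn_uIcc
  rw [uIcc_of_le H.T_nonneg] at this
  exact continuousOn_const.add this

lemma memLp_accel (H : ChainConv h U N T₀ K T u₀ v₀ f) :
    MemLp (accel u₀ v₀ f T) 2 (volume.restrict (Icc 0 T₀)) := by
  have hsub : Ioo 0 T ⊆ Icc 0 T₀ := fun t ht => ⟨ht.1.le, ht.2.le.trans H.T_le⟩
  rw [accel, memLp_indicator_iff_restrict measurableSet_Ioo,
    Measure.restrict_restrict measurableSet_Ioo, inter_eq_left.2 hsub]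
  have hf := H.memLp.mono_measure (Measure.restrict_mono hsub le_rfl)
  have hu : AEStronglyMeasurable (pos u₀ v₀ f) (volume.restrict (Ioo 0 T)) :=
    (H.continuousOn_pos.mono Ioo_subset_Icc_self).aestronglyMeasurable measurableSet_Ioo
  refine hf.mono (aestronglyMeasurable_cross hu hf.1) ?_
  rw [ae_restrict_iff' measurableSet_Ioo]
  refine ae_of_all _ fun t ht => (norm_cross_le _ _).trans ?_
  rw [H.limit_unit (Ioo_subset_Icc_self ht), one_mul]

lemma tendsto_chain_succ (H : ChainConv h U N T₀ K T u₀ v₀ f) {t : ℝ} (ht : t ∈ Ioo 0 T) :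
    Tendsto (fun n => U n (⌊t / h n⌋₊ + 1)) atTop (𝓝 (pos u₀ v₀ f t)) := by
  have ht' : t ∈ Icc 0 T₀ := ⟨ht.1.le, ht.2.le.trans H.T_le⟩
  have h1 : Tendsto (fun n => ((⌊t / h n⌋₊ + 1 : ℕ) : ℝ) * h n) atTop (𝓝 t) := by
    have := (H.tendsto_floor_mul ht.1.le).add H.hlim
    rw [add_zero] at this
    refine this.congr fun n => ?_
    push_cast; ring
  have h2 : Tendsto (fun n => ((min (⌊t / h n⌋₊ + 1) (N n) : ℕ) : ℝ) * h n) atTop (𝓝 t) := by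
    have := h1.min H.hT
    rw [min_eq_left ht.2.le] at this
    refine this.congr fun n => ?_
    rw [← min_mul_of_nonneg _ _ (H.hpos n).le]; push_cast; rfl
  have ev : ∀ᶠ n in atTop, ((⌊t / h n⌋₊ + 1 : ℕ) : ℝ) * h n < N n * h n := by
    have := (H.hT.sub h1).eventually_const_lt (show 0 < T - t by linarith [ht.2])
    filter_upwards [this] with n hn
    linarith
  refine (H.tendsto_chain ht' (J := fun n => min (⌊t / h n⌋₊ + 1) (N n))
    (fun n => min_le_right _ _) h2).congr' ?_
  filter_upwards [ev] with n hn
  have h3 := lt_of_mul_lt_mul_right hn (H.hpos n).le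
  have h4 : ⌊t / h n⌋₊ + 1 ≤ N n := by exact_mod_cast h3.le
  rw [min_eq_left h4]

lemma inner_cross_cycle (a b c : E3) : inner ℝ (cross a b) c = (inner ℝ b (cross c a) : ℝ) := by
  simp only [inner_eq, cross_apply_zero, cross_apply_one, cross_apply_two]; ring

/-- In `U × ddq` the first factor converges strongly and the second one weakly. The cyclic identity
`⟨U × F, ψ⟩ = ⟨F, ψ × U⟩` moves the strong factor to the test function. -/
lemma tendsto_integral_accel (H : ChainConv h U N T₀ K T u₀ v₀ f) :
    Tendsto (fun n => ∫ t in Icc 0 T₀, (inner ℝ (cross (U n (⌊t / h n⌋₊ + 1))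
      (ddq (h n) (U n) (N n) ⌊t / h n⌋₊)) (accel u₀ v₀ f T t) : ℝ)) atTop
      (𝓝 (∫ t in Icc 0 T₀, ‖accel u₀ v₀ f T t‖ ^ 2)) := by
  set μ := volume.restrict (Icc 0 T₀) with hμ
  set ψ := accel u₀ v₀ f T with hψ
  set F : ℕ → ℝ → E3 := fun n t => ddq (h n) (U n) (N n) ⌊t / h n⌋₊ with hF
  set W : ℕ → ℝ → E3 := fun n t => U n (⌊t / h n⌋₊ + 1) with hW
  have hsub : Ioo 0 T ⊆ Icc 0 T₀ := fun t ht => ⟨ht.1.le, ht.2.le.trans H.T_le⟩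
  have hψm := H.memLp_accel
  have hFm : ∀ n, MemLp (F n) 2 μ := fun n => memLp_step
  have hψ0 : ∀ t, t ∉ Ioo 0 T → ψ t = 0 := fun t ht => indicator_of_notMem ht _
  -- the limit test function
  set g : ℝ → E3 := fun t => cross (ψ t) ((Ioo 0 T).indicator (pos u₀ v₀ f) t) with hg
  have hum : AEStronglyMeasurable ((Ioo 0 T).indicator (pos u₀ v₀ f)) μ := by
    rw [aestronglyMeasurable_indicator_iff measurableSet_Ioo, hμ,
      Measure.restrict_restrict measurableSet_Ioo, inter_eq_left.2 hsub]
    exact (H.continuousOn_pos.mono Ioo_subset_Icc_self).aestronglyMeasurable measurableSet_Ioo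
  have hun : ∀ t, ‖(Ioo 0 T).indicator (pos u₀ v₀ f) t‖ ≤ 1 := fun t => by
    by_cases ht : t ∈ Ioo 0 T
    · rw [indicator_of_mem ht, H.limit_unit (Ioo_subset_Icc_self ht)]
    · rw [indicator_of_notMem ht, norm_zero]; norm_num
  have hgm : MemLp g 2 μ := by
    refine hψm.mono (aestronglyMeasurable_cross hψm.1 hum)
      (ae_of_all _ fun t => (norm_cross_le _ _).trans ?_)
    exact mul_le_of_le_one_right (norm_nonneg _) (hun t)
  have hlim : ∫ t, (inner ℝ (f t) (g t) : ℝ) ∂μ = ∫ t, ‖ψ t‖ ^ 2 ∂μ := by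
    congr 1; funext t
    by_cases ht : t ∈ Ioo 0 T
    · have : ψ t = cross (pos u₀ v₀ f t) (f t) := indicator_of_mem ht _
      rw [hg]
      simp only [indicator_of_mem ht]
      rw [← inner_cross_cycle, ← this, real_inner_self_eq_norm_sq]
    · simp [hg, hψ0 t ht, cross]
  have hWm : ∀ n, AEStronglyMeasurable (W n) μ := fun n =>
    (measurable_step (h := h n) fun j => U n (j + 1)).aestronglyMeasurable
  -- The error of replacing the discrete spin by its limit. It tends to zero in `L²` by dominated
  -- convergence, so its pairing with the bounded sequence `F` vanishes.
  set r : ℕ → ℝ → E3 := fun n t => cross (ψ t) (W n t - (Ioo 0 T).indicator (pos u₀ v₀ f) t) with hr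
  have hrb : ∀ n t, ‖r n t‖ ≤ 2 * ‖ψ t‖ := fun n t => by
    refine (norm_cross_le _ _).trans ?_
    have : ‖W n t - (Ioo 0 T).indicator (pos u₀ v₀ f) t‖ ≤ 1 + 1 :=
      (norm_sub_le _ _).trans (add_le_add (H.unit n _).le (hun t))
    nlinarith [norm_nonneg (ψ t)]
  have hrm : ∀ n, MemLp (r n) 2 μ := fun n =>
    (hψm.const_smul (2 : ℝ)).mono
      (aestronglyMeasurable_cross hψm.1 ((hWm n).sub hum))
      (ae_of_all _ fun t => by
        rw [Pi.smul_apply, norm_smul, Real.norm_two]; exact hrb n t)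
  have hr0 : Tendsto (fun n => ∫ t, ‖r n t‖ ^ 2 ∂μ) atTop (𝓝 0) := by
    have : Tendsto (fun n => ∫ t, ‖r n t‖ ^ 2 ∂μ) atTop (𝓝 (∫ _, (0 : ℝ) ∂μ)) := by
      refine tendsto_integral_of_dominated_convergence (fun t => 4 * ‖ψ t‖ ^ 2)
        (fun n => (hrm n).1.norm.pow 2) ((integrable_norm_sq hψm).const_mul 4)
        (fun n => ae_of_all _ fun t => ?_) (ae_of_all _ fun t => ?_)
      · rw [Real.norm_eq_abs, abs_of_nonneg (by positivity)]
        have := pow_le_pow_left₀ (norm_nonneg _) (hrb n t) 2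
        nlinarith
      · by_cases ht : t ∈ Ioo 0 T
        · have h1 := (H.tendsto_chain_succ ht).sub_const (pos u₀ v₀ f t)
          rw [sub_self] at h1
          have h2 := ((tendsto_cross (tendsto_const_nhds (x := ψ t)) h1).norm.pow 2)
          simp only [hr, hW, indicator_of_mem ht]
          convert h2 using 2
          simp [cross]
        · simp [hr, hψ0 t ht, cross]
    simpa using this
  have hsplit : ∀ n, ∫ t, (inner ℝ (cross (W n t) (F n t)) (ψ t) : ℝ) ∂μ =
      (∫ t, (inner ℝ (F n t) (g t) : ℝ) ∂μ) + ∫ t, (inner ℝ (F n t) (r n t) : ℝ) ∂μ := fun n => by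
    rw [← integral_add (integrable_inner (hFm n) hgm) (integrable_inner (hFm n) (hrm n))]
    congr 1; funext t
    rw [inner_cross_cycle, ← inner_add_right]
    simp only [hg, hr, cross_sub_right]
    congr 1; abel
  have herr : Tendsto (fun n => ∫ t, (inner ℝ (F n t) (r n t) : ℝ) ∂μ) atTop (𝓝 0) := by
    have hb : ∀ n, ‖∫ t, (inner ℝ (F n t) (r n t) : ℝ) ∂μ‖ ≤ √K * √(∫ t, ‖r n t‖ ^ 2 ∂μ) := fun n =>
      (abs_integral_inner_le (hFm n) (hrm n)).trans (mul_le_mul_of_nonneg_right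
        (Real.sqrt_le_sqrt (integral_sq_step_le (H.hpos n) (H.bound n))) (Real.sqrt_nonneg _))
    refine squeeze_zero_norm hb ?_
    simpa using (hr0.sqrt).const_mul (√K)
  have := (H.weak g hgm).add herr
  rw [add_zero, hlim] at this
  exact this.congr fun n => (hsplit n).symm

/-- The density of the potential part of the energy of a chain. -/
def sitePot (h : ℝ) (G : E3 → ℝ) (a b c : E3) : ℝ :=
  (1 - (‖dq h a b‖ ^ 2 + ‖dq h b c‖ ^ 2) / 2) ^ 2 + G (cross a b) / 2

lemma cross_eq_smul_dq {h : ℝ} (hh : 0 < h) (a b : E3) : cross a b = h • cross a (dq h a b) := by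
  rw [dq, cross_smul_right, smul_smul, mul_inv_cancel₀ hh.ne', one_smul, cross_sub_right, cross_self,
    sub_zero]

/-- By homogeneity `G (a × b)` is `G` at the rescaled chirality, which converges to `w`. If `w ≠ 0`
then `G` is continuous at `w`; if `w = 0` then the limit density has no penalty, and `G ≥ 0` can be
discarded in the chain. -/
lemma liminf_sitePot (H : ChainConv h U N T₀ K T u₀ v₀ f) (hG : IsPenalty G) {t : ℝ}
    (ht : t ∈ Ioo 0 T) :
    ENNReal.ofReal ((‖cross (pos u₀ v₀ f t) (vel v₀ f t)‖ ^ 2 - 1) ^ 2 +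
      G (cross (pos u₀ v₀ f t) (vel v₀ f t)) / 2) ≤
      liminf (fun n => (Ico 0 (N n * h n)).indicator (fun t => ENNReal.ofReal (sitePot (h n) G
        (U n ⌊t / h n⌋₊) (U n (⌊t / h n⌋₊ + 1)) (U n (⌊t / h n⌋₊ + 2)))) t) atTop := by
  have ht' : t ∈ Icc 0 T₀ := ⟨ht.1.le, ht.2.le.trans H.T_le⟩
  have hfl := H.tendsto_floor_mul ht.1.le
  have h1 : Tendsto (fun n => ((⌊t / h n⌋₊ + 1 : ℕ) : ℝ) * h n) atTop (𝓝 t) := by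
    have := hfl.add H.hlim
    rw [add_zero] at this
    refine this.congr fun n => ?_
    push_cast; ring
  have ev : ∀ᶠ n in atTop, ⌊t / h n⌋₊ + 1 ≤ N n := by
    have := (H.hT.sub h1).eventually_const_lt (show 0 < T - t by linarith [ht.2])
    filter_upwards [this] with n hn
    have h3 := lt_of_mul_lt_mul_right (sub_pos.1 hn) (H.hpos n).le
    exact_mod_cast h3.le
  have hd0 := H.tendsto_dq ht' (J := fun n => ⌊t / h n⌋₊) (ev.mono fun n hn => by omega) hfl
  have hd1 := H.tendsto_dq ht' (J := fun n => ⌊t / h n⌋₊ + 1) ev h1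
  have hvel : v₀ + ∫ s in (0 : ℝ)..t, f s = vel v₀ f t := rfl
  rw [hvel] at hd0 hd1
  have hu : Tendsto (fun n => U n ⌊t / h n⌋₊) atTop (𝓝 (pos u₀ v₀ f t)) := by
    have := (H.tendsto_chain_succ ht).sub (H.hlim.smul hd0)
    rw [zero_smul, sub_zero] at this
    refine this.congr fun n => ?_
    rw [dq, smul_smul, mul_inv_cancel₀ (H.hpos n).ne', one_smul]; abel
  have hw := tendsto_cross hu hd0
  set w := cross (pos u₀ v₀ f t) (vel v₀ f t) with hwdef
  have hwn : ‖w‖ = ‖vel v₀ f t‖ := norm_cross_of_orth (H.limit_unit (Ioo_subset_Icc_self ht))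
    (H.limit_orth (Ioo_subset_Icc_self ht))
  have hpot : Tendsto (fun n => (1 - (‖dq (h n) (U n ⌊t / h n⌋₊) (U n (⌊t / h n⌋₊ + 1))‖ ^ 2 +
      ‖dq (h n) (U n (⌊t / h n⌋₊ + 1)) (U n (⌊t / h n⌋₊ + 2))‖ ^ 2) / 2) ^ 2) atTop
      (𝓝 ((‖w‖ ^ 2 - 1) ^ 2)) := by
    have := ((((hd0.norm.pow 2).add (hd1.norm.pow 2)).div_const 2).const_sub 1).pow 2
    rw [← hwn] at this
    convert this using 2
    ring
  have hin : ∀ᶠ n in atTop, t ∈ Ico 0 (N n * h n) := by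
    filter_upwards [H.hT.eventually_const_lt ht.2] with n hn using ⟨ht.1.le, hn⟩
  by_cases hw0 : w = 0
  · have hpot' : Tendsto (fun n => ENNReal.ofReal ((1 - (‖dq (h n) (U n ⌊t / h n⌋₊)
        (U n (⌊t / h n⌋₊ + 1))‖ ^ 2 + ‖dq (h n) (U n (⌊t / h n⌋₊ + 1))
        (U n (⌊t / h n⌋₊ + 2))‖ ^ 2) / 2) ^ 2)) atTop (𝓝 (ENNReal.ofReal ((‖w‖ ^ 2 - 1) ^ 2))) :=
      (ENNReal.continuous_ofReal.tendsto _).comp hpot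
    have e : (‖w‖ ^ 2 - 1) ^ 2 + G w / 2 = (‖w‖ ^ 2 - 1) ^ 2 := by rw [hw0, hG.zero]; ring
    rw [e, ← hpot'.liminf_eq]
    refine liminf_le_liminf ?_
    filter_upwards [hin] with n hn
    rw [indicator_of_mem hn]
    apply ENNReal.ofReal_le_ofReal
    rw [sitePot]
    have := hG.nonneg (cross (U n ⌊t / h n⌋₊) (U n (⌊t / h n⌋₊ + 1)))
    linarith
  · have hGt := ((hG.cont.continuousAt (isOpen_compl_singleton.mem_nhds hw0)).tendsto.comp hw)
    have hsum := (ENNReal.continuous_ofReal.tendsto _).comp (hpot.add (hGt.div_const 2))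
    have : Tendsto (fun n => (Ico 0 (N n * h n)).indicator (fun t => ENNReal.ofReal (sitePot (h n) G
        (U n ⌊t / h n⌋₊) (U n (⌊t / h n⌋₊ + 1)) (U n (⌊t / h n⌋₊ + 2)))) t) atTop
        (𝓝 (ENNReal.ofReal ((‖w‖ ^ 2 - 1) ^ 2 + G w / 2))) := by
      refine hsum.congr' ?_
      filter_upwards [hin] with n hn
      rw [indicator_of_mem hn]
      simp only [Function.comp_apply, sitePot]
      have e := cross_eq_smul_dq (H.hpos n) (U n ⌊t / h n⌋₊) (U n (⌊t / h n⌋₊ + 1))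
      rw [e, hG.hom _ _ (H.hpos n)]
    rw [this.liminf_eq]

/-- Lower semicontinuity of the energy. -/
lemma lintegral_dens_le (H : ChainConv h U N T₀ K T u₀ v₀ f) (hG : IsPenalty G) {E : ℝ}
    (hE : ∀ n, ∑ j ∈ Finset.range (N n),
      siteE (h n) G (U n j) (U n (j + 1)) (U n (j + 2)) ≤ E) :
    ∫⁻ t in Icc 0 T, dens G (pos u₀ v₀ f) (vel v₀ f) f t ≤ ENNReal.ofReal E := by
  set μ := volume.restrict (Icc 0 T₀) with hμ
  set ψ := accel u₀ v₀ f T with hψ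
  set A := ∫ t, ‖ψ t‖ ^ 2 ∂μ with hA
  -- Lower bound for the kinetic energy from `‖X‖² ≥ 2 ⟨X, ψ⟩ - ‖ψ‖²`. It is linear in `X` and
  -- passes to the weak limit, where the choice of `ψ` makes it equal to the kinetic energy `A`.
  set α : ℕ → ℝ := fun n => 2 * (∫ t, (inner ℝ (cross (U n (⌊t / h n⌋₊ + 1))
      (ddq (h n) (U n) (N n) ⌊t / h n⌋₊)) (ψ t) : ℝ) ∂μ) - A with hα
  have hαlim : Tendsto α atTop (𝓝 A) := by
    have := (H.tendsto_integral_accel.const_mul 2).sub_const A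
    convert this using 2
    rw [← hψ, ← hμ, ← hA]; ring
  have hψm := H.memLp_accel
  set b : ℕ → ℝ := fun n => ∑ j ∈ Finset.range (N n),
    h n * sitePot (h n) G (U n j) (U n (j + 1)) (U n (j + 2)) with hb
  -- the quadratic part
  have hquad : ∀ n, α n + b n ≤ E := by
    intro n
    refine le_trans ?_ (hE n)
    set a : ℕ → ℝ := fun j => ‖cross (U n (j + 1)) (ddq (h n) (U n) (N n) j)‖ ^ 2 with ha
    have hsum : ∑ j ∈ Finset.range (N n), siteE (h n) G (U n j) (U n (j + 1)) (U n (j + 2)) =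
        ∑ j ∈ Finset.range (N n), h n * a j + b n := by
      rw [hb, ← Finset.sum_add_distrib]
      refine Finset.sum_congr rfl fun j hj => ?_
      rw [siteE_eq (H.hpos n) G (H.unit n _) (H.unit n _) (H.unit n _), ha]
      simp only
      rw [cross_ddq (Finset.mem_range.1 hj), sitePot]
      ring
    rw [hsum]
    have hgm : MemLp (fun t => cross (U n (⌊t / h n⌋₊ + 1))
        (ddq (h n) (U n) (N n) ⌊t / h n⌋₊)) 2 μ := by
      refine (memLp_step (h := h n) (U := U n) (N := N n)).mono
        (measurable_step (h := h n) fun j =>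
          cross (U n (j + 1)) (ddq (h n) (U n) (N n) j)).aestronglyMeasurable
        (ae_of_all _ fun t => (norm_cross_le _ _).trans ?_)
      rw [H.unit, one_mul]
    have h1 : α n ≤ ∫ t, a ⌊t / h n⌋₊ ∂μ := by
      have i1 := integrable_inner hgm hψm
      have i2 := integrable_norm_sq hψm
      have i3 := integrable_norm_sq hgm
      have : α n = ∫ t, (2 * (inner ℝ (cross (U n (⌊t / h n⌋₊ + 1))
          (ddq (h n) (U n) (N n) ⌊t / h n⌋₊)) (ψ t) : ℝ) - ‖ψ t‖ ^ 2) ∂μ := by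
        rw [integral_sub (i1.const_mul 2) i2, integral_const_mul]
      rw [this]
      refine integral_mono ((i1.const_mul 2).sub i2) i3 fun t => ?_
      have := norm_sub_sq_real (cross (U n (⌊t / h n⌋₊ + 1))
          (ddq (h n) (U n) (N n) ⌊t / h n⌋₊)) (ψ t)
      have h0 := sq_nonneg ‖cross (U n (⌊t / h n⌋₊ + 1))
          (ddq (h n) (U n) (N n) ⌊t / h n⌋₊) - ψ t‖
      simp only
      linarith
    have h2 : ∫ t, a ⌊t / h n⌋₊ ∂μ ≤ ∑ j ∈ Finset.range (N n), h n * a j := by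
      rw [integral_eq_lintegral_of_nonneg_ae (ae_of_all _ fun t => by positivity)
        (measurable_step (h := h n) a).aestronglyMeasurable]
      have hs0 : ∀ j, 0 ≤ h n * a j := fun j => mul_nonneg (H.hpos n).le (by positivity)
      refine ENNReal.toReal_le_of_le_ofReal (Finset.sum_nonneg fun j _ => hs0 j) ?_
      have hsub : Icc 0 T₀ ⊆ Ico 0 ((max (N n) (⌊T₀ / h n⌋₊ + 1) : ℕ) * h n) := by
        intro t ht
        refine ⟨ht.1, ht.2.trans_lt ?_⟩
        have h3 := lt_floor_mul (H.hpos n) T₀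
        have h4 : ((⌊T₀ / h n⌋₊ + 1 : ℕ) : ℝ) ≤ (max (N n) (⌊T₀ / h n⌋₊ + 1) : ℕ) := by
          exact_mod_cast le_max_right _ _
        have h5 := mul_le_mul_of_nonneg_right h4 (H.hpos n).le
        push_cast at h5 ⊢
        linarith
      refine (lintegral_mono_set hsub).trans ?_
      rw [lintegral_step (H.hpos n) (fun j => ENNReal.ofReal (a j))]
      simp only [← ENNReal.ofReal_mul (H.hpos n).le]
      rw [← ENNReal.ofReal_sum_of_nonneg fun j _ => hs0 j]
      refine ENNReal.ofReal_le_ofReal (le_of_eq ?_)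
      symm
      refine Finset.sum_subset (Finset.range_mono (le_max_left _ _)) fun j _ hj => ?_
      have : ¬ j < N n := by simpa using hj
      simp [ha, ddq, this, cross]
    linarith
  have hb0 : ∀ n, 0 ≤ b n := fun n => Finset.sum_nonneg fun j _ => by
    have := hG.nonneg (cross (U n j) (U n (j + 1)))
    have := (H.hpos n).le
    unfold sitePot; positivity
  have hAE : A ≤ E := le_of_tendsto' hαlim fun n => by linarith [hquad n, hb0 n]
  -- the potential part
  have hpot : ∫⁻ t in Ioo 0 T, ENNReal.ofReal ((‖cross (pos u₀ v₀ f t) (vel v₀ f t)‖ ^ 2 - 1) ^ 2 +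
      G (cross (pos u₀ v₀ f t) (vel v₀ f t)) / 2) ≤ ENNReal.ofReal (E - A) := by
    have hmeas : ∀ n, Measurable ((Ico 0 (N n * h n)).indicator (fun t => ENNReal.ofReal
        (sitePot (h n) G (U n ⌊t / h n⌋₊) (U n (⌊t / h n⌋₊ + 1)) (U n (⌊t / h n⌋₊ + 2))))) :=
      fun n => (measurable_step (h := h n) fun j => ENNReal.ofReal
        (sitePot (h n) G (U n j) (U n (j + 1)) (U n (j + 2)))).indicator measurableSet_Ico
    calc _ ≤ ∫⁻ t in Ioo 0 T, liminf (fun n => (Ico 0 (N n * h n)).indicator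
          (fun t => ENNReal.ofReal (sitePot (h n) G (U n ⌊t / h n⌋₊) (U n (⌊t / h n⌋₊ + 1))
            (U n (⌊t / h n⌋₊ + 2)))) t) atTop :=
          setLIntegral_mono' measurableSet_Ioo fun t ht => H.liminf_sitePot hG ht
      _ ≤ liminf (fun n => ∫⁻ t in Ioo 0 T, (Ico 0 (N n * h n)).indicator
          (fun t => ENNReal.ofReal (sitePot (h n) G (U n ⌊t / h n⌋₊) (U n (⌊t / h n⌋₊ + 1))
            (U n (⌊t / h n⌋₊ + 2)))) t) atTop := lintegral_liminf_le hmeas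
      -- The chain has potential energy at most `E - α n`, so Fatou leaves at most `E - A` for the
      -- potential part of the limit.
      _ ≤ liminf (fun n => ENNReal.ofReal (E - α n)) atTop := by
          refine liminf_le_liminf (Eventually.of_forall fun n => ?_)
          refine (setLIntegral_le_lintegral _ _).trans ?_
          rw [lintegral_indicator measurableSet_Ico, lintegral_step (H.hpos n)
            (fun j => ENNReal.ofReal (sitePot (h n) G (U n j) (U n (j + 1)) (U n (j + 2))))]
          simp only [← ENNReal.ofReal_mul (H.hpos n).le]
          rw [← ENNReal.ofReal_sum_of_nonneg fun j _ => by
            have := hG.nonneg (cross (U n j) (U n (j + 1)))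
            have := (H.hpos n).le
            unfold sitePot; positivity]
          exact ENNReal.ofReal_le_ofReal (by linarith [hquad n])
      _ = ENNReal.ofReal (E - A) :=
          ((ENNReal.continuous_ofReal.tendsto _).comp (hαlim.const_sub E)).liminf_eq
  have hkin : ∫⁻ t in Ioo 0 T, ENNReal.ofReal (‖cross (pos u₀ v₀ f t) (f t)‖ ^ 2) =
      ENNReal.ofReal A := by
    rw [hA, ofReal_integral_eq_lintegral_ofReal (integrable_norm_sq hψm)
      (ae_of_all _ fun t => by positivity)]
    have hsub : Ioo 0 T ⊆ Icc 0 T₀ := fun t ht => ⟨ht.1.le, ht.2.le.trans H.T_le⟩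
    have e : (fun t => ENNReal.ofReal (‖ψ t‖ ^ 2)) = (Ioo 0 T).indicator
        fun t => ENNReal.ofReal (‖cross (pos u₀ v₀ f t) (f t)‖ ^ 2) := by
      funext t
      by_cases ht : t ∈ Ioo 0 T
      · rw [indicator_of_mem ht, hψ, accel, indicator_of_mem ht]
      · rw [indicator_of_notMem ht, hψ, accel, indicator_of_notMem ht]; simp
    rw [e, lintegral_indicator measurableSet_Ioo, Measure.restrict_restrict measurableSet_Ioo,
      inter_eq_left.2 hsub]
  have hcw : ContinuousOn (fun t => cross (pos u₀ v₀ f t) (vel v₀ f t)) (Ioo 0 T) :=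
    continuousOn_cross (H.continuousOn_pos.mono Ioo_subset_Icc_self)
      (H.continuousOn_vel.mono fun t ht => ⟨ht.1.le, ht.2.le.trans H.T_le⟩)
  have haem : AEMeasurable (fun t => cross (pos u₀ v₀ f t) (vel v₀ f t))
      (volume.restrict (Ioo 0 T)) := hcw.aemeasurable measurableSet_Ioo
  rw [Measure.restrict_congr_set (Ioo_ae_eq_Icc (a := (0 : ℝ)) (b := T)).symm]
  calc ∫⁻ t in Ioo 0 T, dens G (pos u₀ v₀ f) (vel v₀ f) f t
      = (∫⁻ t in Ioo 0 T, ENNReal.ofReal ((‖cross (pos u₀ v₀ f t) (vel v₀ f t)‖ ^ 2 - 1) ^ 2 +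
          G (cross (pos u₀ v₀ f t) (vel v₀ f t)) / 2)) +
        ∫⁻ t in Ioo 0 T, ENNReal.ofReal (‖cross (pos u₀ v₀ f t) (f t)‖ ^ 2) := by
        refine lintegral_add_left' ?_ _
        exact (((haem.norm.pow_const 2).sub_const 1).pow_const 2 |>.add
          (((measurable_of_continuousOn hG.cont).comp_aemeasurable haem).div_const 2)).ennreal_ofReal
    _ ≤ ENNReal.ofReal (E - A) + ENNReal.ofReal A := add_le_add hpot hkin.le
    _ = ENNReal.ofReal E := by
        have hA0 : 0 ≤ A := integral_nonneg fun t => by positivity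
        rw [← ENNReal.ofReal_add (by linarith) hA0, sub_add_cancel]

end ChainConv

/-- Compactness and lower semicontinuity for chains of bounded length and energy. -/
theorem exists_limit_curve {G : E3 → ℝ} (hG : IsPenalty G) {T₀ E M : ℝ} {h : ℕ → ℝ}
    (hh : ∀ n, 0 < h n) (hh0 : Tendsto h atTop (𝓝 0)) {N : ℕ → ℕ} (hN : ∀ n, N n * h n ≤ T₀)
    {U : ℕ → ℕ → E3} (hU : ∀ n j, ‖U n j‖ = 1) (hM : ∀ n, ‖dq (h n) (U n 0) (U n 1)‖ ≤ M)
    (hE : ∀ n, ∑ j ∈ Finset.range (N n),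
      siteE (h n) G (U n j) (U n (j + 1)) (U n (j + 2)) ≤ E) :
    ∃ (u v f : ℝ → E3) (T : ℝ) (φ : ℕ → ℕ), 0 ≤ T ∧ StrictMono φ ∧ IsCurve u v f (Icc 0 T) ∧
      Tendsto (fun n => cross (U (φ n) 0) (dq (h (φ n)) (U (φ n) 0) (U (φ n) 1))) atTop
        (𝓝 (cross (u 0) (v 0))) ∧
      Tendsto (fun n => cross (U (φ n) (N (φ n)))
        (dq (h (φ n)) (U (φ n) (N (φ n))) (U (φ n) (N (φ n) + 1)))) atTop
        (𝓝 (cross (u T) (v T))) ∧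
      ∫⁻ t in Icc 0 T, dens G u v f t ≤ ENNReal.ofReal E := by
  have hcomp : IsCompact ((Metric.closedBall (0 : E3) 1 ×ˢ Metric.closedBall (0 : E3) M) ×ˢ
      Icc (0 : ℝ) T₀) :=
    ((isCompact_closedBall _ _).prod (isCompact_closedBall _ _)).prod isCompact_Icc
  obtain ⟨⟨⟨u₀, v₀⟩, T⟩, -, φ, hφ, hlim⟩ := hcomp.tendsto_subseq
    (x := fun n => ((U n 0, dq (h n) (U n 0) (U n 1)), N n * h n)) (fun n => by
      refine ⟨⟨?_, ?_⟩, mul_nonneg (Nat.cast_nonneg _) (hh n).le, hN n⟩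
      · simp [hU]
      · simpa using hM n)
  have hK := fun n => sum_ddq_le (hh n) hG.nonneg (hU n) (hN n) (hE n)
  obtain ⟨f, ψ, hf, hψ, hw⟩ := exists_weak_subseq_fun (μ := volume.restrict (Icc 0 T₀))
    (F := fun n t => ddq (h (φ n)) (U (φ n)) (N (φ n)) ⌊t / h (φ n)⌋₊)
    (fun n => memLp_step) (fun n => integral_sq_step_le (hh _) (hK (φ n)))
  have hφψ := hφ.comp hψ
  have hlim' := hlim.comp hψ.tendsto_atTop
  have l1 := (continuous_fst.comp continuous_fst).tendsto _ |>.comp hlim'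
  have l2 := (continuous_snd.comp continuous_fst).tendsto _ |>.comp hlim'
  have l3 := continuous_snd.tendsto _ |>.comp hlim'
  have H : ChainConv (fun n => h (φ (ψ n))) (fun n => U (φ (ψ n))) (fun n => N (φ (ψ n)))
      T₀ (2 * E + 2 * T₀) T u₀ v₀ f :=
    ⟨fun n => hh _, hh0.comp hφψ.tendsto_atTop, fun n => hU _, fun n => hN _, fun n => hK _,
      l1, l2, l3, hf, hw⟩
  refine ⟨ChainConv.pos u₀ v₀ f, ChainConv.vel v₀ f, f, T, φ ∘ ψ, H.T_nonneg, hφψ, H.isCurve,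
    ?_, ?_, H.lintegral_dens_le hG fun n => hE _⟩
  · exact H.tendsto_end (left_mem_Icc.2 H.T_nonneg) (J := fun _ => 0) (fun _ => Nat.zero_le _)
      (by simp)
  · exact H.tendsto_end (right_mem_Icc.2 H.T_nonneg) (J := fun n => N (φ (ψ n)))
      (fun _ => le_rfl) l3

end HelicalXY

end

section

namespace HelicalXY

/-! ### Lower bound for the energy of chains between wells. -/

variable {G : E3 → ℝ} {W : Finset E3} {h : ℝ}

/-- `W` is the set of zeros of `G` on the unit sphere. -/
structure IsWells (G : E3 → ℝ) (W : Finset E3) : Prop where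
  norm : ∀ p ∈ W, ‖p‖ = 1
  zero : ∀ p ∈ W, G p = 0
  mem : ∀ x, ‖x‖ = 1 → G x = 0 → x ∈ W

/-- The rescaled chirality of a pair of spins. -/
def chir (h : ℝ) (a b : E3) : E3 := cross a (dq h a b)

lemma norm_chir_sq (hh : 0 < h) {a b : E3} (ha : ‖a‖ = 1) (hb : ‖b‖ = 1) :
    ‖chir h a b‖ ^ 2 = ‖dq h a b‖ ^ 2 * (1 - h ^ 2 * ‖dq h a b‖ ^ 2 / 4) := by
  rw [chir, norm_cross_sq, inner_dq_left hh ha hb, ha]; ring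

lemma chir_eq (hh : 0 < h) (a b : E3) : cross a b = h • chir h a b := ChainConv.cross_eq_smul_dq hh a b

/-- The chirality of a pair is the same seen from either spin, since `a × (b - a) = b × (b - a)`.
Thus the kinetic term of a site is the squared increment of the chirality. -/
lemma chir_sub (h : ℝ) (a b c : E3) :
    cross b (dq h b c - dq h a b) = chir h b c - chir h a b := by
  rw [cross_sub_right]
  congr 1
  rw [chir, dq, cross_smul_right, cross_smul_right, cross_sub_right, cross_sub_right, cross_self,
    cross_self, zero_sub, sub_zero, ← cross_anticomm]

/-- On a compact annulus deprived of the `η`-balls about the wells, the function `|‖w‖² - 1| + G w`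
is continuous, because the annulus avoids the origin, and positive; hence it has a positive minimum.
-/
lemma exists_well_near (hG : IsPenalty G) (hW : IsWells G W) {η : ℝ} (hη : 0 < η) :
    ∃ ρ > 0, ∀ w : E3, |‖w‖ ^ 2 - 1| ≤ ρ → G w ≤ ρ → ∃ p ∈ W, ‖w - p‖ < η := by
  set K : Set E3 := (Metric.closedBall 0 2 ∩ {w | 1 / 2 ≤ ‖w‖}) ∩ ⋂ p ∈ W, {w | η ≤ ‖w - p‖}
    with hK
  have hKc : IsCompact K := by
    refine ((isCompact_closedBall (0 : E3) 2).inter_right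
      (isClosed_le continuous_const continuous_norm)).inter_right ?_
    exact isClosed_biInter fun p _ => isClosed_le continuous_const (by fun_prop)
  have hne : ∀ w ∈ K, w ≠ 0 := fun w hw h0 => by
    have : (1 / 2 : ℝ) ≤ ‖w‖ := hw.1.2
    rw [h0, norm_zero] at this; norm_num at this
  have hcont : ContinuousOn (fun w : E3 => |‖w‖ ^ 2 - 1| + G w) K := by
    refine ContinuousOn.add (by fun_prop) (hG.cont.mono hne)
  have key : ∃ ρ > 0, ∀ w ∈ K, ρ ≤ |‖w‖ ^ 2 - 1| + G w := by
    by_cases hKe : K.Nonempty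
    · obtain ⟨x, hx, hmin⟩ := hKc.exists_isMinOn hKe hcont
      refine ⟨|‖x‖ ^ 2 - 1| + G x, ?_, fun w hw => hmin hw⟩
      have h1 := abs_nonneg (‖x‖ ^ 2 - 1)
      have h2 := hG.nonneg x
      refine lt_of_le_of_ne (by positivity) fun h0 => ?_
      have h3 : ‖x‖ ^ 2 = 1 := by
        have : |‖x‖ ^ 2 - 1| = 0 := by linarith
        linarith [abs_eq_zero.1 this]
      have h4 : ‖x‖ = 1 := by nlinarith [norm_nonneg x]
      have hxW := hW.mem x h4 (by linarith)
      have := mem_iInter₂.1 hx.2 x hxW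
      rw [mem_ofPred_eq, sub_self, norm_zero] at this
      linarith
    · exact ⟨1, one_pos, fun w hw => (hKe ⟨w, hw⟩).elim⟩
  obtain ⟨ρ, hρ, H⟩ := key
  refine ⟨min (ρ / 4) (1 / 2), by positivity, fun w h1 h2 => ?_⟩
  by_contra! hcon
  have h3 := h1.trans (min_le_right _ _)
  have h4 := abs_le.1 h3
  have hwK : w ∈ K := by
    refine ⟨⟨?_, ?_⟩, mem_iInter₂.2 fun p hp => hcon p hp⟩
    · rw [mem_closedBall_zero_iff]; nlinarith [norm_nonneg w]
    · rw [mem_ofPred_eq]; nlinarith [norm_nonneg w]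
  linarith [H w hwK, h1.trans (min_le_left _ _), h2.trans (min_le_left _ _)]

lemma sq_mul_sq_le {h s : ℝ} (h0 : 0 ≤ h) (h1 : h ≤ 1) (hs0 : 0 ≤ s) (hs : s ≤ 4) :
    h ^ 2 * s ^ 2 / 4 ≤ 4 * h := by
  have h2 : s ^ 2 ≤ 4 ^ 2 := pow_le_pow_left₀ hs0 hs 2
  have h3 : h ^ 2 ≤ h := by nlinarith
  have := mul_le_mul h3 h2 (by positivity) h0
  linarith

/-- A site of low energy has its chirality near a well. -/
lemma exists_site_bound (hG : IsPenalty G) (hW : IsWells G W) {η : ℝ} (hη : 0 < η) :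
    ∃ m > 0, ∃ h₀ > 0, ∀ h, 0 < h → h < h₀ → ∀ a b c : E3, ‖a‖ = 1 → ‖b‖ = 1 → ‖c‖ = 1 →
      siteE h G a b c ≤ h * m → ∃ p ∈ W, ‖chir h a b - p‖ < η := by
  obtain ⟨ρ, hρ, H⟩ := exists_well_near hG hW hη
  refine ⟨min 1 (min (ρ / 2) ((ρ / 2) ^ 2)), by positivity, min 1 (ρ / 32), by positivity,
    fun h hh hh0 a b c ha hb hc hE => ?_⟩
  set m := min 1 (min (ρ / 2) ((ρ / 2) ^ 2)) with hm
  have hm1 : m ≤ 1 := min_le_left _ _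
  have hm2 : m ≤ ρ / 2 := (min_le_right _ _).trans (min_le_left _ _)
  have hm3 : m ≤ (ρ / 2) ^ 2 := (min_le_right _ _).trans (min_le_right _ _)
  have hh1 : h < 1 := hh0.trans_le (min_le_left _ _)
  have hh2 : h < ρ / 32 := hh0.trans_le (min_le_right _ _)
  rw [siteE_eq hh G ha hb hc, chir_sub h] at hE
  have hE := le_of_mul_le_mul_left hE hh
  set s := ‖dq h a b‖ ^ 2 with hs
  set s' := ‖dq h b c‖ ^ 2 with hs'
  set w := chir h a b with hw
  set w' := chir h b c with hw'
  have hG0 := hG.nonneg (cross a b)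
  have hx0 : 0 ≤ ‖w' - w‖ ^ 2 / h ^ 2 := by positivity
  have hy0 := sq_nonneg (1 - (s + s') / 2)
  have hGw : G w = G (cross a b) := by rw [chir_eq hh, hG.hom _ _ hh]
  have hs0 : 0 ≤ s := by positivity
  have hs'0 : 0 ≤ s' := by positivity
  have hy1 : |1 - (s + s') / 2| ≤ 1 := abs_le_one_iff_mul_self_le_one.2 (by rw [← pow_two]; linarith)
  have hy2 : |1 - (s + s') / 2| ≤ ρ / 2 := by
    refine abs_le_of_sq_le_sq ?_ (by positivity)
    linarith
  have hy1' := abs_le.1 hy1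
  have hy2' := abs_le.1 hy2
  have hws : ‖w‖ ^ 2 = s * (1 - h ^ 2 * s / 4) := norm_chir_sq hh ha hb
  have hws' : ‖w'‖ ^ 2 = s' * (1 - h ^ 2 * s' / 4) := norm_chir_sq hh hb hc
  have hs4 : s ≤ 4 := by linarith
  have hs'4 : s' ≤ 4 := by linarith
  have hws2 : ‖w‖ ^ 2 = s - h ^ 2 * s ^ 2 / 4 := by rw [hws]; ring
  have hws2' : ‖w'‖ ^ 2 = s' - h ^ 2 * s' ^ 2 / 4 := by rw [hws']; ring
  have e1 := sq_mul_sq_le hh.le hh1.le hs0 hs4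
  have e2 := sq_mul_sq_le hh.le hh1.le hs'0 hs'4
  have e1' : 0 ≤ h ^ 2 * s ^ 2 / 4 := by positivity
  have e2' : 0 ≤ h ^ 2 * s' ^ 2 / 4 := by positivity
  have hdw : ‖w' - w‖ ≤ h := by
    have : ‖w' - w‖ ^ 2 / h ^ 2 ≤ 1 := by linarith
    rw [div_le_one (by positivity)] at this
    exact (sq_le_sq₀ (norm_nonneg _) hh.le).1 this
  have hwn : ‖w‖ ≤ 2 := by
    have : ‖w‖ ^ 2 ≤ 2 ^ 2 := by linarith
    exact (sq_le_sq₀ (norm_nonneg _) (by norm_num)).1 this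
  have hwn' : ‖w'‖ ≤ 2 := by
    have : ‖w'‖ ^ 2 ≤ 2 ^ 2 := by linarith
    exact (sq_le_sq₀ (norm_nonneg _) (by norm_num)).1 this
  -- The well term controls only the mean of the two squared velocities. The kinetic term brings the
  -- two chiralities within distance `h`, so that each squared norm is close to `1`.
  have hdiff : |‖w'‖ ^ 2 - ‖w‖ ^ 2| ≤ 4 * h := by
    have : ‖w'‖ ^ 2 - ‖w‖ ^ 2 = (‖w'‖ + ‖w‖) * (‖w'‖ - ‖w‖) := by ring
    rw [this, abs_mul, abs_of_nonneg (by positivity)]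
    have := (abs_norm_sub_norm_le w' w).trans hdw
    exact mul_le_mul (by linarith) this (abs_nonneg _) (by norm_num)
  have hd := abs_le.1 hdiff
  refine H w ?_ (by rw [hGw]; linarith)
  rw [abs_le]
  constructor <;> linarith

/-- Because `‖w‖² = s (1 - h² s / 4)`, a bounded chirality does not exclude almost antipodal spins,
with `s` near `4 / h²`. The energy bound does, since it makes `s` at most of order `h^(-1/2)`; here
the crude bound `h² s ≤ 2` is enough. -/
lemma sq_mul_le_two {h s s' C : ℝ} (hh : 0 < h) (hh1 : h < 1) (hh2 : h * (16 * (|C| + 1)) ≤ 1)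
    (hs'0 : 0 ≤ s') (h3 : h * (1 - (s + s') / 2) ^ 2 ≤ |C|) : h ^ 2 * s ≤ 2 := by
  by_contra! hcon
  have hC := abs_nonneg C
  generalize |C| = D at *
  have hh4 : h ≤ 1 / 16 := by nlinarith
  have hsq : h ^ 2 ≤ 1 / 16 := by nlinarith
  have h5 : 2 < s := by nlinarith
  have h6 : (s / 2 - 1) ^ 2 ≤ (1 - (s + s') / 2) ^ 2 := by
    rw [show (1 - (s + s') / 2) ^ 2 = (s / 2 - 1 + s' / 2) ^ 2 by ring]
    exact pow_le_pow_left₀ (by linarith) (by linarith) 2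
  have hb2 : 1 / 2 ≤ h ^ 2 * s / 2 - h ^ 2 := by linarith
  have hb3 : (1 / 2) ^ 2 ≤ (h ^ 2 * s / 2 - h ^ 2) ^ 2 := pow_le_pow_left₀ (by norm_num) hb2 2
  have h7 : h * (h ^ 2 * s / 2 - h ^ 2) ^ 2 ≤ D * h ^ 4 := by
    have : h * (h ^ 2 * s / 2 - h ^ 2) ^ 2 = (h * (s / 2 - 1) ^ 2) * h ^ 4 := by ring
    rw [this]
    exact mul_le_mul_of_nonneg_right ((mul_le_mul_of_nonneg_left h6 hh.le).trans h3) (by positivity)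
  have hb4 : h * (1 / 2) ^ 2 ≤ h * (D * h * h ^ 2) := by
    refine (mul_le_mul_of_nonneg_left hb3 hh.le).trans (h7.trans_eq (by ring))
  have hb6 := le_of_mul_le_mul_left hb4 hh
  have hb7 : D * h ≤ 1 / 16 := by nlinarith
  have : D * h * h ^ 2 ≤ 1 / 16 * 1 :=
    mul_le_mul hb7 (by linarith) (by positivity) (by norm_num)
  linarith

/-- The initial velocity is bounded as soon as the chirality is. -/
lemma exists_norm_dq_le (hG : IsPenalty G) (C : ℝ) :
    ∃ h₀ > 0, ∀ h, 0 < h → h < h₀ → ∀ a b c : E3, ‖a‖ = 1 → ‖b‖ = 1 → ‖c‖ = 1 →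
      siteE h G a b c ≤ C → ‖chir h a b‖ ≤ 2 → ‖dq h a b‖ ≤ 3 := by
  refine ⟨min 1 (1 / (16 * (|C| + 1))), by positivity, fun h hh hh0 a b c ha hb hc hE hw => ?_⟩
  have hh1 : h < 1 := hh0.trans_le (min_le_left _ _)
  have hh2 := (lt_div_iff₀ (by positivity)).1 (hh0.trans_le (min_le_right _ _))
  rw [siteE_eq hh G ha hb hc] at hE
  have hws := norm_chir_sq hh ha hb
  set s := ‖dq h a b‖ ^ 2 with hs
  set s' := ‖dq h b c‖ ^ 2 with hs'
  have hG0 := hG.nonneg (cross a b)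
  have hx0 : 0 ≤ ‖cross b (dq h b c - dq h a b)‖ ^ 2 / h ^ 2 := by positivity
  have hs0 : 0 ≤ s := by positivity
  have hs'0 : 0 ≤ s' := by positivity
  have h3 : h * (1 - (s + s') / 2) ^ 2 ≤ |C| := by
    refine le_trans ?_ (hE.trans (le_abs_self C))
    exact mul_le_mul_of_nonneg_left (by linarith) hh.le
  have h4 := sq_mul_le_two hh hh1 (by linarith) hs'0 h3
  have h8 : ‖chir h a b‖ ^ 2 ≤ 2 ^ 2 := pow_le_pow_left₀ (norm_nonneg _) hw 2
  have h9 : s * (1 / 2) ≤ s * (1 - h ^ 2 * s / 4) := mul_le_mul_of_nonneg_left (by linarith) hs0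
  exact (sq_le_sq₀ (norm_nonneg _) (by norm_num)).1 (by linarith)

/-- A chain between two wells that visits no well in between. -/
lemma exists_single_transit (hG : IsPenalty G) (hW : IsWells G W) {p p' : E3} (hp : p ∈ W)
    (hp' : p' ∈ W) {ε : ℝ} (hε : 0 < ε) (C : ℝ) :
    ∃ η₀ > 0, ∀ η, 0 < η → η ≤ η₀ → ∃ h₀ > 0, ∀ h, 0 < h → h < h₀ → ∀ (U : ℕ → E3) (N : ℕ),
      (∀ j, ‖U j‖ = 1) → 0 < N →
      ∑ j ∈ Finset.range N, siteE h G (U j) (U (j + 1)) (U (j + 2)) ≤ C →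
      ‖chir h (U 0) (U 1) - p‖ < η → ‖chir h (U N) (U (N + 1)) - p'‖ < η →
      (∀ j, 0 < j → j < N → ∀ r ∈ W, η ≤ ‖chir h (U j) (U (j + 1)) - r‖) →
      transition G p p' ≤ ENNReal.ofReal
        (∑ j ∈ Finset.range N, siteE h G (U j) (U (j + 1)) (U (j + 2))) + ENNReal.ofReal ε := by
  obtain ⟨η₁, hη₁, Hc⟩ := exists_connects hG.cont (hW.norm p hp) (hW.zero p hp) (hW.norm p' hp')
    (hW.zero p' hp') (half_pos hε)
  refine ⟨min η₁ 1, by positivity, fun η hη hη' => ?_⟩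
  obtain ⟨m, hm, hm₀, hmpos, Hm⟩ := exists_site_bound hG hW hη
  obtain ⟨hd₀, hdpos, Hd⟩ := exists_norm_dq_le hG C
  -- If the estimate failed for arbitrarily small `h`, the counterexamples would form a sequence of
  -- chains to which the compactness theorem applies.
  by_contra! hcon
  have hpos : ∀ n : ℕ, 0 < min (min hm₀ hd₀) (1 / ((n : ℝ) + 1)) := fun n => by positivity
  choose h hh hlt U N hU hN hE h0 h1 hbet hfail using fun n => hcon _ (hpos n)
  have hh0 : Tendsto h atTop (𝓝 0) :=
    squeeze_zero (fun n => (hh n).le) (fun n => (hlt n).le.trans (min_le_right _ _))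
      tendsto_one_div_add_atTop_nhds_zero_nat
  set E : ℕ → ℝ := fun n => ∑ j ∈ Finset.range (N n), siteE (h n) G (U n j) (U n (j + 1))
    (U n (j + 2)) with hEdef
  have hs0 : ∀ n j, 0 ≤ siteE (h n) G (U n j) (U n (j + 1)) (U n (j + 2)) := fun n j =>
    siteE_nonneg (hh n) hG.nonneg _ _ _
  have hE0 : ∀ n, 0 ≤ E n := fun n => Finset.sum_nonneg fun j _ => hs0 n j
  have hsite : ∀ n, ∀ j < N n, siteE (h n) G (U n j) (U n (j + 1)) (U n (j + 2)) ≤ C :=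
    fun n j hj => (Finset.single_le_sum (f := fun j => siteE (h n) G (U n j) (U n (j + 1))
      (U n (j + 2))) (fun j _ => hs0 n j) (Finset.mem_range.2 hj)).trans (hE n)
  -- bounded length
  have hlen : ∀ n, N n * h n ≤ C / m + hm₀ := fun n => by
    -- Sites `1, …, N - 1` are away from all wells and each costs at least `h m`; the site `0`,
    -- which may be near a well, accounts for the summand `hm₀`.
    have h2 : ∀ j ∈ Finset.Ico 1 (N n), h n * m ≤
        siteE (h n) G (U n j) (U n (j + 1)) (U n (j + 2)) := fun j hj => by
      have hj' := Finset.mem_Ico.1 hj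
      by_contra! hc
      obtain ⟨r, hr, hr'⟩ := Hm (h n) (hh n) ((hlt n).trans_le ((min_le_left _ _).trans
        (min_le_left _ _))) _ _ _ (hU n j) (hU n (j + 1)) (hU n (j + 2)) hc.le
      linarith [hbet n j (by omega) hj'.2 r hr]
    have h3 := Finset.card_nsmul_le_sum _ _ _ h2
    rw [Nat.card_Ico, nsmul_eq_mul, Nat.cast_sub (hN n)] at h3
    have h4 : ∑ j ∈ Finset.Ico 1 (N n), siteE (h n) G (U n j) (U n (j + 1)) (U n (j + 2)) ≤ C := by
      refine le_trans (Finset.sum_le_sum_of_subset_of_nonneg ?_ fun j _ _ => hs0 n j) (hE n)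
      intro j hj
      exact Finset.mem_range.2 (Finset.mem_Ico.1 hj).2
    have h5 : ((N n : ℝ) - (1 : ℕ)) * h n ≤ C / m := by
      rw [le_div_iff₀ hm]; linarith
    have h6 := (hlt n).trans_le ((min_le_left _ _).trans (min_le_left _ _))
    push_cast at h5
    linarith
  have hpn := hW.norm p hp
  have hη1 : η ≤ 1 := hη'.trans (min_le_right _ _)
  have hM : ∀ n, ‖dq (h n) (U n 0) (U n 1)‖ ≤ 3 := fun n => by
    refine Hd (h n) (hh n) ((hlt n).trans_le ((min_le_left _ _).trans (min_le_right _ _))) _ _ _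
      (hU n 0) (hU n 1) (hU n 2) (hsite n 0 (hN n)) ?_
    have := norm_add_le (chir (h n) (U n 0) (U n 1) - p) p
    rw [sub_add_cancel] at this
    linarith [h0 n]
  -- a subsequence along which the energies converge
  obtain ⟨Es, -, φ, hφ, hEs⟩ := isCompact_Icc.tendsto_subseq (x := E) (s := Icc 0 C)
    fun n => ⟨hE0 n, hE n⟩
  obtain ⟨n₀, hn₀⟩ := eventually_atTop.1 ((Metric.tendsto_nhds.1 hEs (ε / 4) (by positivity)))
  have hφ' : Tendsto (fun n => φ (n + n₀)) atTop atTop :=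
    hφ.tendsto_atTop.comp (tendsto_add_atTop_nat n₀)
  obtain ⟨u, v, f, T, ψ, hT, hψ, hc, l0, l1, hle⟩ := exists_limit_curve hG (T₀ := C / m + hm₀)
    (E := Es + ε / 4) (M := 3) (h := fun n => h (φ (n + n₀))) (fun n => hh _) (hh0.comp hφ')
    (N := fun n => N (φ (n + n₀))) (fun n => hlen _) (U := fun n => U (φ (n + n₀)))
    (fun n => hU _) (fun n => hM _) (fun n => by
      have := hn₀ (n + n₀) (by omega)
      rw [Real.dist_eq] at this
      have := (abs_lt.1 this).2
      simp only [Function.comp_apply] at this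
      change E (φ (n + n₀)) ≤ _
      linarith)
  have hη1' : η ≤ η₁ := hη'.trans (min_le_left _ _)
  have b0 : ‖cross (u 0) (v 0) - p‖ ≤ η₁ :=
    le_of_tendsto' (l0.sub_const p).norm fun n => ((h0 _).le.trans hη1')
  have b1 : ‖cross (u T) (v T) - p'‖ ≤ η₁ :=
    le_of_tendsto' (l1.sub_const p').norm fun n => ((h1 _).le.trans hη1')
  have hcon2 := (Hc u v f 0 T hT hc b0 b1).transition_le hG.cont
  have h7 := hfail (φ (0 + n₀))
  have h8 := hn₀ (0 + n₀) (by omega)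
  rw [Real.dist_eq] at h8
  have h8 := (abs_lt.1 h8).1
  simp only [Function.comp_apply] at h8
  -- Completing the limit curve costs `ε / 2`, and passing from a chain to the limit energy `Es` and
  -- back costs `ε / 4` twice.
  refine absurd (hcon2.trans (add_le_add_left hle _)) (not_le.2 ?_)
  refine lt_of_le_of_lt ?_ h7
  rw [← ENNReal.ofReal_add (hE0 _) hε.le]
  have hEs0 : 0 ≤ Es := ge_of_tendsto' hEs fun n => hE0 _
  rw [← ENNReal.ofReal_add (by positivity) (by positivity)]
  apply ENNReal.ofReal_le_ofReal
  linarith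

/-! ### From single transits to arbitrary chains. -/

lemma exists_pos_le (W : Finset E3) {f : E3 → E3 → ℝ} (hf : ∀ p ∈ W, ∀ p' ∈ W, 0 < f p p') :
    ∃ η > 0, ∀ p ∈ W, ∀ p' ∈ W, η ≤ f p p' := by
  by_cases hne : (W ×ˢ W).Nonempty
  · refine ⟨(W ×ˢ W).inf' hne fun x => f x.1 x.2, ?_, fun p hp p' hp' =>
      Finset.inf'_le (f := fun x : E3 × E3 => f x.1 x.2) (b := (p, p'))
        (Finset.mk_mem_product hp hp')⟩
    rw [gt_iff_lt, Finset.lt_inf'_iff]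
    exact fun x hx => hf _ (Finset.mem_product.1 hx).1 _ (Finset.mem_product.1 hx).2
  · exact ⟨1, one_pos, fun p hp p' hp' => (hne ⟨(p, p'), Finset.mk_mem_product hp hp'⟩).elim⟩

/-- The energy of the first `N` sites of a chain. -/
def chainE (h : ℝ) (G : E3 → ℝ) (U : ℕ → E3) (N : ℕ) : ℝ :=
  ∑ j ∈ Finset.range N, siteE h G (U j) (U (j + 1)) (U (j + 2))

lemma chainE_nonneg (hh : 0 < h) (hG : IsPenalty G) (U : ℕ → E3) (N : ℕ) : 0 ≤ chainE h G U N :=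
  Finset.sum_nonneg fun _ _ => siteE_nonneg hh hG.nonneg _ _ _

lemma chainE_add (U : ℕ → E3) (M N : ℕ) :
    chainE h G U (M + N) = chainE h G U M + chainE h G (fun j => U (M + j)) N := by
  rw [chainE, Finset.sum_range_add]; rfl

/-- A chain between wells is a succession of single transits. -/
lemma transition_le_chainE (hG : IsPenalty G) (hW : IsWells G W) {ε η C : ℝ} (hε : 0 ≤ ε)
    (hh : 0 < h)
    (huniq : ∀ w : E3, ∀ p ∈ W, ∀ p' ∈ W, ‖w - p‖ < η → ‖w - p'‖ < η → p = p')
    (H : ∀ p ∈ W, ∀ p' ∈ W, ∀ (U : ℕ → E3) (N : ℕ), (∀ j, ‖U j‖ = 1) → 0 < N →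
      chainE h G U N ≤ C → ‖chir h (U 0) (U 1) - p‖ < η → ‖chir h (U N) (U (N + 1)) - p'‖ < η →
      (∀ j, 0 < j → j < N → ∀ r ∈ W, η ≤ ‖chir h (U j) (U (j + 1)) - r‖) →
      transition G p p' ≤ ENNReal.ofReal (chainE h G U N) + ENNReal.ofReal ε)
    (A : Finset E3) : ∀ (U : ℕ → E3) (N : ℕ), (∀ j, ‖U j‖ = 1) →
      chainE h G U N ≤ C → ∀ p ∈ W, ∀ p' ∈ W,
      ‖chir h (U 0) (U 1) - p‖ < η → ‖chir h (U N) (U (N + 1)) - p'‖ < η →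
      (∀ j ≤ N, ∀ r ∈ W, ‖chir h (U j) (U (j + 1)) - r‖ < η → r ∈ A) →
      transition G p p' ≤ ENNReal.ofReal (chainE h G U N) + ENNReal.ofReal (A.card * ε) := by
  -- `A` contains the wells the chain may still visit. Cutting at the last visit to `p`, and then at
  -- the next visit to some well `r`, leaves a remainder that never returns to `p`. Thus the number
  -- of transits is bounded by the number of wells, however long the chain is.
  induction A using Finset.strongInduction with
  | H A ih =>
  intro U N hU hE p hp p' hp' h0 h1 hvis
  by_cases hpp : p = p'
  · subst hpp
    rw [transition_self hG.cont (hW.norm p hp) (hW.zero p hp)]; exact bot_le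
  classical
  have hpA : p ∈ A := hvis 0 (Nat.zero_le _) p hp h0
  set P : ℕ → Prop := fun j => ‖chir h (U j) (U (j + 1)) - p‖ < η with hP
  -- the last visit to `p`
  obtain ⟨j₀, hj₀P, hj₀N, hlast⟩ : ∃ j₀, P j₀ ∧ j₀ < N ∧ ∀ j, j₀ < j → j ≤ N → ¬ P j := by
    have hj₀P : P (Nat.findGreatest P N) := Nat.findGreatest_spec (P := P) (Nat.zero_le N) h0
    refine ⟨Nat.findGreatest P N, hj₀P, ?_, fun j h2 h3 => Nat.findGreatest_is_greatest h2 h3⟩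
    refine lt_of_le_of_ne (Nat.findGreatest_le N) fun he => hpp ?_
    rw [he] at hj₀P
    exact huniq _ p hp p' hp' hj₀P h1
  -- the next visit to a well
  obtain ⟨j₁, r, hr, hj₁, hj₁N, hr', hmin⟩ : ∃ j₁, ∃ r ∈ W, j₀ < j₁ ∧ j₁ ≤ N ∧
      ‖chir h (U j₁) (U (j₁ + 1)) - r‖ < η ∧ ∀ j, j₀ < j → j < j₁ →
        ∀ r ∈ W, η ≤ ‖chir h (U j) (U (j + 1)) - r‖ := by
    have hex : ∃ j, j₀ < j ∧ ∃ r ∈ W, ‖chir h (U j) (U (j + 1)) - r‖ < η := ⟨N, hj₀N, p', hp', h1⟩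
    obtain ⟨hj₁, r, hr, hr'⟩ := Nat.find_spec hex
    refine ⟨_, r, hr, hj₁, Nat.find_le ⟨hj₀N, p', hp', h1⟩, hr', fun j hj hj' s hs => ?_⟩
    by_contra! hc
    exact Nat.find_min hex hj' ⟨hj, s, hs, hc⟩
  have hrp : r ≠ p := fun he => hlast j₁ hj₁ hj₁N (by rw [hP]; rwa [he] at hr')
  obtain ⟨d, rfl⟩ : ∃ d, j₁ = j₀ + d := ⟨j₁ - j₀, by omega⟩
  obtain ⟨e, rfl⟩ : ∃ e, N = j₀ + d + e := ⟨N - (j₀ + d), by omega⟩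
  have hsum := (chainE_add (h := h) (G := G) U (j₀ + d) e).trans
    (congrArg (· + chainE h G (fun j => U (j₀ + d + j)) e) (chainE_add U j₀ d))
  have n0 := chainE_nonneg hh hG U j₀
  have n1 := chainE_nonneg hh hG (fun j => U (j₀ + j)) d
  have n2 := chainE_nonneg hh hG (fun j => U (j₀ + d + j)) e
  have t1 := H p hp r hr (fun j => U (j₀ + j)) d (fun j => hU _) (by omega) (by linarith) hj₀P hr'
    (fun j hj hj' => hmin (j₀ + j) (by omega) (by omega))
  have t2 := ih (A.erase p) (Finset.erase_ssubset hpA) (fun j => U (j₀ + d + j)) e (fun j => hU _)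
    (by linarith) r hr p' hp' hr' h1 (fun j hj s hs hs' => by
      refine Finset.mem_erase.2 ⟨fun he => ?_, hvis (j₀ + d + j) (by omega) s hs hs'⟩
      rw [he] at hs'
      exact hlast (j₀ + d + j) (by omega) (by omega) hs')
  refine (transition_triangle hG.cont (hW.norm p hp) (hW.zero p hp) (hW.norm r hr) (hW.zero r hr)
    (hW.norm p' hp') (hW.zero p' hp')).trans ((add_le_add t1 t2).trans ?_)
  have n3 : 0 ≤ ((A.erase p).card : ℝ) * ε := by positivity
  rw [← ENNReal.ofReal_add n1 hε, ← ENNReal.ofReal_add n2 n3,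
    ← ENNReal.ofReal_add (by positivity) (by positivity),
    ← ENNReal.ofReal_add (by rw [hsum]; positivity) (by positivity)]
  apply ENNReal.ofReal_le_ofReal
  have hcard : (A.card : ℝ) = (A.erase p).card + 1 := by
    rw [← Finset.card_erase_add_one hpA]; push_cast; rfl
  rw [hsum, hcard]
  linarith

/-- Lower bound for the energy of a chain between two wells. -/
theorem exists_chain_bound (hG : IsPenalty G) (hW : IsWells G W) {ε : ℝ} (hε : 0 < ε) (C : ℝ) :
    ∃ η > 0, ∃ h₀ > 0, ∀ h, 0 < h → h < h₀ → ∀ (U : ℕ → E3) (N : ℕ), (∀ j, ‖U j‖ = 1) →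
      chainE h G U N ≤ C → ∀ p ∈ W, ∀ p' ∈ W,
      ‖chir h (U 0) (U 1) - p‖ < η → ‖chir h (U N) (U (N + 1)) - p'‖ < η →
      transition G p p' ≤ ENNReal.ofReal (chainE h G U N) + ENNReal.ofReal ε := by
  -- There are at most `W.card` transits, each with error `ε'`.
  set ε' := ε / (W.card + 1) with hε'
  have hε'0 : 0 < ε' := by positivity
  choose! η₀ hη₀ H using fun (p p' : E3) (hp : p ∈ W) (hp' : p' ∈ W) =>
    exists_single_transit hG hW hp hp' hε'0 C
  obtain ⟨η₁, hη₁, Hη⟩ := exists_pos_le W (f := η₀) fun p hp p' hp' => hη₀ p p' hp hp'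
  classical
  -- Half the distance between wells, so that a point is `η`-close to at most one well.
  obtain ⟨η₂, hη₂, Hsep⟩ := exists_pos_le W (f := fun p p' => if p = p' then 1 else ‖p - p'‖ / 2)
    fun p hp p' hp' => by
      split_ifs with hpp
      · exact one_pos
      · exact half_pos (norm_pos_iff.2 (sub_ne_zero.2 hpp))
  set η := min η₁ η₂ with hη
  have hηpos : 0 < η := lt_min hη₁ hη₂
  choose! h₀ hh₀ H using fun p p' hp hp' =>
    H p p' hp hp' η hηpos ((min_le_left _ _).trans (Hη p hp p' hp'))
  obtain ⟨hs, hspos, Hs⟩ := exists_pos_le W (f := h₀) fun p hp p' hp' => hh₀ p p' hp hp'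
  refine ⟨η, hηpos, hs, hspos, fun h hh hhs U N hU hE p hp p' hp' h0 h1 => ?_⟩
  have huniq : ∀ w : E3, ∀ p ∈ W, ∀ p' ∈ W, ‖w - p‖ < η → ‖w - p'‖ < η → p = p' := by
    intro w p hp p' hp' h1 h2
    by_contra hne
    have h3 := Hsep p hp p' hp'
    rw [if_neg hne] at h3
    have h4 := norm_sub_le_norm_sub_add_norm_sub p w p'
    rw [norm_sub_rev p w] at h4
    have := min_le_right η₁ η₂
    linarith
  refine (transition_le_chainE hG hW hε'0.le hh huniq (fun p hp p' hp' =>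
    H p p' hp hp' h hh (hhs.trans_le (Hs p hp p' hp'))) W U N hU hE p hp p' hp' h0 h1
    fun j _ r hr _ => hr).trans ?_
  refine add_le_add_right (ENNReal.ofReal_le_ofReal ?_) _
  rw [hε', mul_div_assoc', div_le_iff₀ (by positivity)]
  nlinarith

end HelicalXY

end

section

namespace HelicalXY

variable {G : E3 → ℝ}

/-! ### Removing the rest times of a curve -/

/-- The acceleration vanishes almost everywhere on the set of rest times. -/
lemma IsCurve.ae_eq_zero {u v f : ℝ → E3} (h : IsCurve u v f univ) :
    ∀ᵐ t, v t = 0 → f t = 0 := by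
  -- Only countably many rest times are isolated from the right in the set of rest times. At any
  -- other rest time where `v` is differentiable, the derivative `f t` must vanish.
  have hc : ∀ᵐ t, t ∉ {x ∈ {t | v t = 0} | 𝓝[{t | v t = 0} ∩ Ioi x] x = ⊥} :=
    countable_setOfPred_isolated_right_within.ae_notMem volume
  filter_upwards [_root_.LocallyIntegrable.ae_hasDerivAt_integral h.locallyIntegrable, hc] with t ht hi hv
  have hd : HasDerivAt v (f t) t := by
    have h1 : v = fun y => v 0 + ∫ s in (0 : ℝ)..y, f s := by
      funext y
      rw [← integral_all (fun a b hab => h.int_v a b hab (subset_univ _)) 0 y]; abel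
    rw [h1]
    exact (ht 0).const_add _
  have hne : (𝓝[{t | v t = 0} ∩ Ioi t] t).NeBot := neBot_iff.2 fun h0 => hi ⟨hv, h0⟩
  rw [← hd.deriv]
  refine deriv_zero_of_frequently_const (c := 0) ?_
  have h2 : ∃ᶠ y in 𝓝[{t | v t = 0} ∩ Ioi t] t, v y = 0 :=
    (eventually_nhdsWithin_of_forall fun y hy => hy.1).frequently
  exact h2.filter_mono (nhdsWithin_mono _ fun y hy => ne_of_gt hy.2)

/-- The time spent in motion. -/
def clock (v : ℝ → E3) (t : ℝ) : ℝ := ∫ s in (0 : ℝ)..t, {t | v t ≠ 0}.indicator (fun _ => (1 : ℝ)) s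

section Clock

variable {u v f : ℝ → E3} {S : ℝ}

lemma measurableSet_moving (hv : Continuous v) : MeasurableSet {t | v t ≠ 0} :=
  (isOpen_ne_fun hv continuous_const).measurableSet

lemma locallyIntegrable_clock (hv : Continuous v) :
    LocallyIntegrable ({t | v t ≠ 0}.indicator fun _ => (1 : ℝ)) :=
  (locallyIntegrable_const 1).indicator (measurableSet_moving hv)

lemma clock_sub (hv : Continuous v) (a b : ℝ) :
    clock v b - clock v a = ∫ s in a..b, {t | v t ≠ 0}.indicator (fun _ => (1 : ℝ)) s := by
  have hi := intervalIntegrable_of_locallyIntegrable (locallyIntegrable_clock hv)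
  exact intervalIntegral.integral_interval_sub_left (hi _ _) (hi _ _)

lemma clock_sub_eq (hv : Continuous v) {a b : ℝ} (hab : a ≤ b) :
    ENNReal.ofReal (clock v b - clock v a) = volume (Ioo a b ∩ {t | v t ≠ 0}) := by
  rw [clock_sub hv, intervalIntegral.integral_of_le hab, ← integral_Icc_eq_integral_Ioc,
    integral_Icc_eq_integral_Ioo, setIntegral_indicator (measurableSet_moving hv), integral_const,
    smul_eq_mul, mul_one, measureReal_restrict_apply MeasurableSet.univ, univ_inter,
    ofReal_measureReal (h := ((measure_mono inter_subset_left).trans_lt measure_Ioo_lt_top).ne)]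

lemma clock_mono (hv : Continuous v) : Monotone (clock v) := fun a b hab => by
  rw [← sub_nonneg, clock_sub hv]
  exact intervalIntegral.integral_nonneg hab fun t _ => indicator_nonneg (fun _ _ => zero_le_one) t

lemma continuous_clock (hv : Continuous v) : Continuous (clock v) :=
  continuous_of_integral (locallyIntegrable_clock hv) (clock_sub hv)

lemma clock_sub_of_moving (hv : Continuous v) {a b : ℝ} (hab : a ≤ b)
    (h : ∀ t ∈ Icc a b, v t ≠ 0) : clock v b - clock v a = b - a := by
  rw [clock_sub hv, ← mul_one (b - a), ← smul_eq_mul, ← intervalIntegral.integral_const]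
  refine intervalIntegral.integral_congr fun t ht => ?_
  rw [uIcc_of_le hab] at ht
  exact indicator_of_mem (h t ht) _

lemma clock_of_nonpos (hv : Continuous v) (h0 : ∀ t, t ≤ 0 → v t ≠ 0) {t : ℝ} (ht : t ≤ 0) :
    clock v t = t := by
  have := clock_sub_of_moving hv ht fun s hs => h0 s hs.2
  have h1 : clock v 0 = 0 := intervalIntegral.integral_same
  linarith

lemma clock_of_ge (hv : Continuous v) (h1 : ∀ t, S ≤ t → v t ≠ 0) {t : ℝ} (ht : S ≤ t) :
    clock v t = clock v S + (t - S) := by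
  have := clock_sub_of_moving hv ht fun s hs => h1 s hs.1
  linarith

lemma clock_surjective (hv : Continuous v) (h0 : ∀ t, t ≤ 0 → v t ≠ 0)
    (h1 : ∀ t, S ≤ t → v t ≠ 0) : Function.Surjective (clock v) := by
  refine (continuous_clock hv).surjective ?_ ?_
  · have : Tendsto (fun t : ℝ => clock v S + (t - S)) atTop atTop :=
      tendsto_atTop_add_const_left _ _ (tendsto_atTop_add_const_right _ _ tendsto_id)
    refine this.congr' ?_
    filter_upwards [eventually_ge_atTop S] with t ht using (clock_of_ge hv h1 ht).symm
  · refine tendsto_id.congr' ?_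
    filter_upwards [eventually_le_atBot 0] with t ht using (clock_of_nonpos hv h0 ht).symm

/-- The moving times in `(a, b)` form an open set of measure zero, hence an empty one: the clock
stands still only while the curve rests. -/
lemma eq_zero_of_clock_eq (hv : Continuous v) {a b : ℝ} (hab : a < b) (h : clock v a = clock v b) :
    ∀ t ∈ Icc a b, v t = 0 := by
  have h1 := clock_sub_eq hv hab.le
  rw [h, sub_self, ENNReal.ofReal_zero] at h1
  have hopen : IsOpen (Ioo a b ∩ {t | v t ≠ 0}) := isOpen_Ioo.inter (isOpen_ne_fun hv continuous_const)
  have h2 := (hopen.measure_eq_zero_iff volume).1 h1.symm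
  have h3 : ∀ t ∈ Ioo a b, v t = 0 := fun t ht => by
    by_contra hc
    exact (h2 ▸ (⟨ht, hc⟩ : t ∈ Ioo a b ∩ {t | v t ≠ 0}) : t ∈ (∅ : Set ℝ))
  have h4 : closure (Ioo a b) ⊆ {t | v t = 0} :=
    closure_minimal h3 (isClosed_eq hv continuous_const)
  rwa [closure_Ioo hab.ne] at h4

end Clock

/-- The inverse of the clock. -/
lemma exists_clock_inverse {v : ℝ → E3} {S : ℝ} (hv : Continuous v) (h0 : ∀ t, t ≤ 0 → v t ≠ 0)
    (h1 : ∀ t, S ≤ t → v t ≠ 0) :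
    ∃ σ : ℝ → ℝ, StrictMono σ ∧ (∀ s, clock v (σ s) = s) ∧ (∀ t, v t ≠ 0 → σ (clock v t) = t) ∧
      MeasurableEmbedding σ ∧ MeasurePreserving σ volume (volume.restrict {t | v t ≠ 0}) := by
  obtain ⟨σ, hσ⟩ := (clock_surjective hv h0 h1).hasRightInverse
  have hmono : StrictMono σ := fun s s' hs => by
    by_contra! hc
    have := clock_mono hv hc
    rw [hσ, hσ] at this
    linarith
  have hleft : ∀ t, v t ≠ 0 → σ (clock v t) = t := fun t ht => by
    have he := hσ (clock v t)
    rcases lt_trichotomy (σ (clock v t)) t with hlt | heq | hgt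
    · exact (ht (eq_zero_of_clock_eq hv hlt he t (right_mem_Icc.2 hlt.le))).elim
    · exact heq
    · exact (ht (eq_zero_of_clock_eq hv hgt he.symm t (left_mem_Icc.2 hgt.le))).elim
  have hemb : MeasurableEmbedding σ := hmono.monotone.measurable.measurableEmbedding hmono.injective
  -- It suffices to compare intervals: the moving times in the preimage of `(a, b)` are those in `(σ
  -- a, σ b)`, and their measure is the elapsed clock time `b - a`.
  have hmap : Measure.map (clock v) (volume.restrict {t | v t ≠ 0}) = volume := by
    symm
    refine Real.measure_ext_Ioo_rat fun a b => ?_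
    rw [Measure.map_apply (clock_mono hv).measurable measurableSet_Ioo,
      Measure.restrict_apply ((clock_mono hv).measurable measurableSet_Ioo)]
    have e : clock v ⁻¹' Ioo (a : ℝ) b ∩ {t | v t ≠ 0} = Ioo (σ a) (σ b) ∩ {t | v t ≠ 0} := by
      ext t
      refine and_congr_left fun ht => ?_
      conv_rhs => rw [← hleft t ht]
      exact ⟨fun h => ⟨hmono h.1, hmono h.2⟩, fun h => ⟨hmono.lt_iff_lt.1 h.1, hmono.lt_iff_lt.1 h.2⟩⟩
    rw [e, Real.volume_Ioo]
    rcases le_total (a : ℝ) b with hab | hab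
    · rw [← clock_sub_eq hv (hmono.monotone hab), hσ, hσ]
    · rw [ENNReal.ofReal_of_nonpos (by linarith), Ioo_eq_empty (not_lt.2 (hmono.monotone hab)),
        empty_inter, measure_empty]
  refine ⟨σ, hmono, hσ, hleft, hemb, hemb.measurable, ?_⟩
  conv_lhs => rw [← hmap]
  rw [Measure.map_map hemb.measurable (clock_mono hv).measurable]
  conv_rhs => rw [← Measure.map_id (μ := volume.restrict {t | v t ≠ 0})]
  refine Measure.map_congr ?_
  exact (ae_restrict_iff' (measurableSet_moving hv)).2 (ae_of_all _ hleft)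

/-- A connecting curve can be reparametrized so that it is almost never at rest. -/
lemma Connects.exists_moving {p p' : E3} (hp : ‖p‖ = 1) (hp' : ‖p'‖ = 1) {E : ℝ≥0∞}
    (h : Connects G p p' E) :
    ∃ u v f S, 0 ≤ S ∧ IsCurve u v f univ ∧ (∀ t, t ≤ 0 → cross (u t) (v t) = p) ∧
      (∀ t, S ≤ t → cross (u t) (v t) = p') ∧ ∫⁻ t, dens G u v f t ≤ E ∧
      volume {t | v t = 0} = 0 := by
  obtain ⟨u, v, f, S, hS, hc, hw0, hw1, hE⟩ := h
  have hne : ∀ t q, ‖q‖ = 1 → cross (u t) (v t) = q → v t ≠ 0 := fun t q hq hw hv => by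
    rw [hv] at hw
    rw [← hw] at hq
    simp [cross] at hq
  have hm0 := fun t ht => hne t p hp (hw0 t ht)
  have hm1 := fun t ht => hne t p' hp' (hw1 t ht)
  have hv := hc.continuous_v
  obtain ⟨σ, hmono, hσ, hleft, hemb, hpres⟩ := exists_clock_inverse hv hm0 hm1
  have hpre : ∀ a b, σ ⁻¹' Ioc (σ a) (σ b) = Ioc a b := fun a b => by
    ext s; simp [hmono.lt_iff_lt, hmono.le_iff_le]
  have hpre' : ∀ a b, σ ⁻¹' Icc (σ a) (σ b) = Icc a b := fun a b => by
    ext s; simp [hmono.le_iff_le]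
  -- Change of variables by `σ`: for a function that vanishes almost everywhere at rest times,
  -- cutting out these times does not change the integral.
  have hint : ∀ g : ℝ → E3, (∀ᵐ t, v t = 0 → g t = 0) → ∀ a b, a ≤ b →
      ∫ s in a..b, g (σ s) = ∫ t in (σ a)..(σ b), g t := fun g hg a b hab => by
    rw [intervalIntegral.integral_of_le hab, intervalIntegral.integral_of_le (hmono.monotone hab),
      ← hpre, hpres.setIntegral_preimage_emb hemb, Measure.restrict_restrict measurableSet_Ioc]
    symm
    refine setIntegral_eq_of_subset_of_ae_sdiff_eq_zero measurableSet_Ioc.nullMeasurableSet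
      inter_subset_left ?_
    filter_upwards [hg] with t ht ht'
    exact ht (by_contra fun hcon => ht'.2 ⟨ht'.1, hcon⟩)
  have hMem : ∀ a b, MemLp (f ∘ σ) 2 (volume.restrict (Icc a b)) := fun a b => by
    have h1 := hpres.restrict_preimage_emb hemb (Icc (σ a) (σ b))
    rw [hpre'] at h1
    refine MemLp.comp_measurePreserving ?_ h1
    exact (hc.memLp _ _ (subset_univ _)).mono_measure (Measure.restrict_mono_measure
      Measure.restrict_le_self _)
  have hloc : LocallyIntegrable (f ∘ σ) := by
    refine MemL2Loc.locallyIntegrable fun K hK => ?_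
    obtain ⟨R, hR⟩ := hK.isBounded.subset_closedBall 0
    rw [Real.closedBall_eq_Icc] at hR
    exact (hMem _ _).mono_measure (Measure.restrict_mono hR le_rfl)
  have hv1 : ∀ a b, a ≤ b → v (σ b) - v (σ a) = ∫ t in a..b, f (σ t) := fun a b hab => by
    rw [hint f hc.ae_eq_zero a b hab]
    exact hc.int_v _ _ (hmono.monotone hab) (subset_univ _)
  -- Across a jump of `σ` the original curve is at rest, so position and velocity agree on both
  -- sides.
  have hsame : ∀ t, u (σ (clock v t)) = u t ∧ v (σ (clock v t)) = v t := by
    have key : ∀ a b, a ≤ b → clock v a = clock v b → u a = u b ∧ v a = v b := by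
      intro a b hab he
      rcases hab.eq_or_lt with rfl | hlt
      · exact ⟨rfl, rfl⟩
      have hz := eq_zero_of_clock_eq hv hlt he
      refine ⟨?_, by rw [hz a (left_mem_Icc.2 hab), hz b (right_mem_Icc.2 hab)]⟩
      have := hc.int_u a b hab (subset_univ _)
      rw [intervalIntegral.integral_congr (g := fun _ => (0 : E3)) (fun t ht => by
        rw [uIcc_of_le hab] at ht; exact hz t ht), intervalIntegral.integral_zero] at this
      exact (sub_eq_zero.1 this).symm
    intro t
    rcases le_total (σ (clock v t)) t with hle | hle
    · exact key _ _ hle (hσ _)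
    · obtain ⟨h1, h2⟩ := key _ _ hle (hσ _).symm
      exact ⟨h1.symm, h2.symm⟩
  refine ⟨u ∘ σ, v ∘ σ, f ∘ σ, clock v S, ?_, ⟨fun a b _ => hMem a b, ?_, fun a b hab _ => hv1 a b hab,
    fun a b hab _ => ?_, fun t _ => hc.unit _ trivial, fun t _ => hc.orth _ trivial⟩,
    fun s hs => ?_, fun s hs => ?_, ?_, ?_⟩
  · have := clock_mono hv hS
    rwa [show clock v 0 = 0 from intervalIntegral.integral_same] at this
  · exact (continuous_of_integral hloc (integral_all hv1)).continuousOn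
  · have := hint v (ae_of_all _ fun t ht => ht) a b hab
    simp only [Function.comp_apply]
    rw [this]
    exact hc.int_u _ _ (hmono.monotone hab) (subset_univ _)
  · have h1 := hsame s
    rw [clock_of_nonpos hv hm0 hs] at h1
    simp only [Function.comp_apply]
    rw [h1.1, h1.2, hw0 s hs]
  · have h2 := clock_of_ge hv hm1 (t := s - clock v S + S) (by linarith)
    have h1 := hsame (s - clock v S + S)
    rw [h2, show clock v S + (s - clock v S + S - S) = s by ring] at h1
    simp only [Function.comp_apply]
    rw [h1.1, h1.2, hw1 _ (by linarith)]
  · have h1 := hpres.lintegral_comp_emb hemb (dens G u v f)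
    exact (h1.le.trans (lintegral_mono' Measure.restrict_le_self le_rfl)).trans hE
  · have h1 := hpres.measure_preimage (s := {t | v t = 0})
      (isClosed_eq hv continuous_const).measurableSet.nullMeasurableSet
    rw [Measure.restrict_apply (isClosed_eq hv continuous_const).measurableSet] at h1
    have h2 : {t | v t = 0} ∩ {t | v t ≠ 0} = ∅ := by ext t; simp
    rw [h2, measure_empty] at h1
    exact h1

end HelicalXY

end

section

namespace HelicalXY

variable {G : E3 → ℝ} {u v f : ℝ → E3} {θ M : ℝ}

/-! ### Sampling a curve: the kinetic part -/

lemma sq_norm_integral_le {F : ℝ → E3} {a b : ℝ} (hab : a ≤ b)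
    (hF : MemLp F 2 (volume.restrict (Icc a b))) :
    ‖∫ t in a..b, F t‖ ^ 2 ≤ (b - a) * ∫ t in a..b, ‖F t‖ ^ 2 := by
  have h1 := norm_setIntegral_sq_le hF MeasurableSet.univ le_rfl
  rw [Measure.restrict_univ, measureReal_restrict_apply MeasurableSet.univ, univ_inter,
    Real.volume_real_Icc_of_le hab] at h1
  rw [intervalIntegral.integral_of_le hab, intervalIntegral.integral_of_le hab,
    ← integral_Icc_eq_integral_Ioc, ← integral_Icc_eq_integral_Ioc]
  refine (pow_le_pow_left₀ (norm_nonneg _) h1 2).trans (le_of_eq ?_)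
  rw [mul_pow, Real.sq_sqrt (integral_nonneg fun t => by positivity), Real.sq_sqrt (by linarith),
    mul_comm]

/-- The majorant of the acceleration seen from a nearby point. -/
def nearAccel (u f : ℝ → E3) (r : ℝ) (t : ℝ) : ℝ := (‖cross (u t) (f t)‖ + r * ‖f t‖) ^ 2

lemma IsCurve.memLp_cross (hc : IsCurve u v f univ) (a b : ℝ) :
    MemLp (fun t => cross (u t) (f t)) 2 (volume.restrict (Icc a b)) := by
  have hf := hc.memLp a b (subset_univ _)
  refine hf.mono (aestronglyMeasurable_cross hc.continuous_u.aestronglyMeasurable hf.1)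
    (ae_of_all _ fun t => (norm_cross_le _ _).trans ?_)
  rw [hc.unit t trivial, one_mul]

lemma IsCurve.integrable_nearAccel (hc : IsCurve u v f univ) (r a b : ℝ) :
    IntervalIntegrable (nearAccel u f r) volume a b := by
  wlog hab : a ≤ b
  · exact (this hc r b a (by linarith)).symm
  rw [intervalIntegrable_iff_integrableOn_Icc_of_le hab]
  have hf := (hc.memLp a b (subset_univ _)).norm.const_mul r
  exact ((hc.memLp_cross a b).norm.add hf).integrable_sq

/-- The second difference is a double integral of `f`, and Cauchy–Schwarz is applied to each
integration. The frozen factor `u (t + θ)` differs from `u τ` by at most `θ M`, whence the majorant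
`nearAccel`. -/
lemma IsCurve.norm_cross_second_difference_le (hc : IsCurve u v f univ) (hθ : 0 < θ)
    (hM : ∀ t, ‖v t‖ ≤ M) (t : ℝ) :
    ‖cross (u (t + θ)) (u t - (2 : ℝ) • u (t + θ) + u (t + 2 * θ))‖ ^ 2 ≤
      θ ^ 2 * ∫ x in t..(t + θ), ∫ τ in x..(x + θ), nearAccel u f (θ * M) τ := by
  have hv := hc.continuous_v
  set b := u (t + θ) with hb
  have hbn : ‖b‖ = 1 := hc.unit _ trivial
  have hM0 : 0 ≤ M := (norm_nonneg _).trans (hM 0)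
  have hvi : ∀ x y, u y - u x = ∫ s in x..y, v s :=
    integral_all fun a b hab => hc.int_u a b hab (subset_univ _)
  have hfi : ∀ x y, v y - v x = ∫ s in x..y, f s :=
    integral_all fun a b hab => hc.int_v a b hab (subset_univ _)
  have e1 : cross b (u t - (2 : ℝ) • b + u (t + 2 * θ)) =
      ∫ x in t..(t + θ), cross b (v (x + θ) - v x) := by
    have : u t - (2 : ℝ) • b + u (t + 2 * θ) = ∫ x in t..(t + θ), (v (x + θ) - v x) := by
      rw [intervalIntegral.integral_sub ((by fun_prop : Continuous fun x => v (x + θ)).intervalIntegrable _ _)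
        (hv.intervalIntegrable _ _), intervalIntegral.integral_comp_add_right, ← hvi, ← hvi]
      rw [show t + θ + θ = t + 2 * θ by ring, ← hb]
      module
    rw [this]
    have h1 := (crossL b).intervalIntegral_comp_comm (μ := volume) (a := t) (b := t + θ)
      (f := fun x => v (x + θ) - v x)
      ((by fun_prop : Continuous fun x => v (x + θ) - v x).intervalIntegrable _ _)
    simp only [crossL_apply] at h1
    exact h1.symm
  have hDc : Continuous fun x => cross b (v (x + θ) - v x) := by
    have : Continuous fun x => crossL b (v (x + θ) - v x) := by fun_prop
    simpa only [crossL_apply] using this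
  have hgi := hc.integrable_nearAccel (θ * M)
  have hgc : Continuous fun x => ∫ τ in x..(x + θ), nearAccel u f (θ * M) τ := by
    have h1 : Continuous fun x => ∫ τ in (0 : ℝ)..x, nearAccel u f (θ * M) τ :=
      intervalIntegral.continuous_primitive hgi 0
    have h2 : (fun x => ∫ τ in x..(x + θ), nearAccel u f (θ * M) τ) = fun x =>
        (∫ τ in (0 : ℝ)..(x + θ), nearAccel u f (θ * M) τ) -
          ∫ τ in (0 : ℝ)..x, nearAccel u f (θ * M) τ := by
      funext x
      rw [intervalIntegral.integral_interval_sub_left (hgi _ _) (hgi _ _)]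
    rw [h2]
    exact (h1.comp (continuous_add_const θ)).sub h1
  have hD : ∀ x ∈ Icc t (t + θ), ‖cross b (v (x + θ) - v x)‖ ^ 2 ≤
      θ * ∫ τ in x..(x + θ), nearAccel u f (θ * M) τ := by
    intro x hx
    have e2 : cross b (v (x + θ) - v x) = ∫ τ in x..(x + θ), cross b (f τ) := by
      rw [hfi]
      have h1 := (crossL b).intervalIntegral_comp_comm (μ := volume) (a := x) (b := x + θ) (f := f)
        (intervalIntegrable_of_locallyIntegrable hc.locallyIntegrable _ _)
      simp only [crossL_apply] at h1
      exact h1.symm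
    have hf := hc.memLp x (x + θ) (subset_univ _)
    have hm : MemLp (fun τ => cross b (f τ)) 2 (volume.restrict (Icc x (x + θ))) := by
      refine hf.mono (aestronglyMeasurable_cross aestronglyMeasurable_const hf.1)
        (ae_of_all _ fun t => (norm_cross_le _ _).trans ?_)
      rw [hbn, one_mul]
    have h2 := sq_norm_integral_le (by linarith : x ≤ x + θ) hm
    rw [e2]
    refine h2.trans ?_
    rw [add_sub_cancel_left]
    refine mul_le_mul_of_nonneg_left ?_ hθ.le
    refine intervalIntegral.integral_mono_on (by linarith) ?_ (hgi _ _) fun τ hτ => ?_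
    · rw [intervalIntegrable_iff_integrableOn_Icc_of_le (by linarith)]
      exact integrable_norm_sq hm
    · refine pow_le_pow_left₀ (norm_nonneg _) ?_ 2
      have h3 : cross b (f τ) = cross (u τ) (f τ) + cross (b - u τ) (f τ) := by
        rw [← cross_add_left]; congr 1; abel
      rw [h3]
      refine (norm_add_le _ _).trans (add_le_add le_rfl ((norm_cross_le _ _).trans ?_))
      refine mul_le_mul_of_nonneg_right ?_ (norm_nonneg _)
      have h4 : ‖b - u τ‖ ≤ M * |t + θ - τ| := by
        rw [hb, hvi]
        exact intervalIntegral.norm_integral_le_of_norm_le_const fun s _ => hM s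
      refine h4.trans ?_
      rw [mul_comm]
      refine mul_le_mul_of_nonneg_right (abs_le.2 ⟨?_, ?_⟩) hM0
      · linarith [hx.2, hτ.2]
      · linarith [hx.1, hτ.1]
  rw [e1]
  have hm : MemLp (fun x => cross b (v (x + θ) - v x)) 2 (volume.restrict (Icc t (t + θ))) :=
    memL2Loc_of_continuous hDc _ isCompact_Icc
  refine (sq_norm_integral_le (by linarith : t ≤ t + θ) hm).trans ?_
  rw [add_sub_cancel_left, sq, mul_assoc]
  refine mul_le_mul_of_nonneg_left ?_ hθ.le
  rw [← intervalIntegral.integral_const_mul]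
  exact intervalIntegral.integral_mono_on (by linarith) ((hDc.norm.pow 2).intervalIntegrable _ _)
    ((hgc.const_mul θ).intervalIntegrable _ _) hD

/-- Summation of the kinetic parts along a sampled curve. -/
lemma IsCurve.sum_second_difference_le (hc : IsCurve u v f univ) (hθ : 0 < θ)
    (hM : ∀ t, ‖v t‖ ≤ M) {A B s : ℝ} (hs : A ≤ s) (N : ℕ) (hN : s + (N + 2) * θ ≤ B) :
    ∑ j ∈ Finset.range N, ‖cross (u (s + (j + 1 : ℕ) * θ)) (u (s + j * θ) -
      (2 : ℝ) • u (s + (j + 1 : ℕ) * θ) + u (s + (j + 2 : ℕ) * θ))‖ ^ 2 ≤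
      θ ^ 3 * ∫ τ in A..B, nearAccel u f (θ * M) τ := by
  have hgi := hc.integrable_nearAccel (θ * M)
  set γ := nearAccel u f (θ * M) with hγ
  have hγ0 : ∀ t, 0 ≤ γ t := fun t => sq_nonneg _
  set Γ : ℝ → ℝ := fun x => ∫ τ in (0 : ℝ)..x, γ τ with hΓ
  have hΓc : Continuous Γ := intervalIntegral.continuous_primitive hgi 0
  have hΓs : ∀ x y, ∫ τ in x..y, γ τ = Γ y - Γ x := fun x y =>
    (intervalIntegral.integral_interval_sub_left (hgi _ _) (hgi _ _)).symm
  have hΓm : Monotone Γ := fun x y hxy => by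
    rw [← sub_nonneg, ← hΓs]
    exact intervalIntegral.integral_nonneg hxy fun t _ => hγ0 t
  have hi : ∀ x y, IntervalIntegrable (fun x => Γ (x + θ) - Γ x) volume x y := fun x y =>
    ((hΓc.comp (continuous_add_const θ)).sub hΓc).intervalIntegrable _ _
  have h1 : ∀ j ∈ Finset.range N, ‖cross (u (s + (j + 1 : ℕ) * θ)) (u (s + j * θ) -
      (2 : ℝ) • u (s + (j + 1 : ℕ) * θ) + u (s + (j + 2 : ℕ) * θ))‖ ^ 2 ≤
      θ ^ 2 * ∫ x in (s + (j : ℕ) * θ)..(s + (j + 1 : ℕ) * θ), (Γ (x + θ) - Γ x) := by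
    intro j _
    have h := hc.norm_cross_second_difference_le hθ hM (s + j * θ)
    have e1 : s + j * θ + θ = s + (j + 1 : ℕ) * θ := by push_cast; ring
    have e2 : s + j * θ + 2 * θ = s + (j + 2 : ℕ) * θ := by push_cast; ring
    rw [e1, e2, ← hγ] at h
    simpa only [hΓs] using h
  refine (Finset.sum_le_sum h1).trans ?_
  rw [← Finset.mul_sum, intervalIntegral.sum_integral_adjacent_intervals (fun j _ => hi _ _)]
  have h2 : ∫ x in (s + (0 : ℕ) * θ)..(s + N * θ), (Γ (x + θ) - Γ x) ≤ θ * ∫ τ in A..B, γ τ := by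
    have hg := hΓc.intervalIntegrable (μ := volume)
    -- The integral of `Γ (x + θ) - Γ x` telescopes to two windows of length `θ` at the ends, where
    -- the monotone `Γ` lies between `Γ A` and `Γ B`.
    have e3 : ∫ x in (s + (0 : ℕ) * θ)..(s + N * θ), (Γ (x + θ) - Γ x) =
        (∫ x in (s + N * θ)..(s + N * θ + θ), Γ x) - ∫ x in s..(s + θ), Γ x := by
      have hsh : Continuous fun x => Γ (x + θ) := hΓc.comp (continuous_add_const θ)
      rw [intervalIntegral.integral_sub (hsh.intervalIntegrable _ _) (hg _ _),
        intervalIntegral.integral_comp_add_right (f := Γ)]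
      have a1 := intervalIntegral.integral_add_adjacent_intervals (hg s (s + θ))
        (hg (s + θ) (s + N * θ + θ))
      have a2 := intervalIntegral.integral_add_adjacent_intervals (hg s (s + N * θ))
        (hg (s + N * θ) (s + N * θ + θ))
      simp only [Nat.cast_zero, zero_mul, add_zero]
      linarith
    have u1 : ∫ x in (s + N * θ)..(s + N * θ + θ), Γ x ≤ θ * Γ B := by
      have := intervalIntegral.integral_mono_on (by linarith : s + N * θ ≤ s + N * θ + θ) (hg _ _)
        (intervalIntegrable_const (c := Γ B)) fun x hx => hΓm (by linarith [hx.2] : x ≤ B)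
      rwa [intervalIntegral.integral_const, add_sub_cancel_left, smul_eq_mul] at this
    have u2 : θ * Γ A ≤ ∫ x in s..(s + θ), Γ x := by
      have := intervalIntegral.integral_mono_on (by linarith : s ≤ s + θ)
        (intervalIntegrable_const (c := Γ A)) (hg _ _) fun x hx => hΓm (hs.trans hx.1)
      rwa [intervalIntegral.integral_const, add_sub_cancel_left, smul_eq_mul] at this
    rw [e3, hΓs]
    linarith
  calc _ ≤ θ ^ 2 * (θ * ∫ τ in A..B, γ τ) := mul_le_mul_of_nonneg_left h2 (by positivity)
    _ = _ := by ring

/-- The kinetic majorant converges as the spacing tends to zero. -/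
lemma IsCurve.tendsto_nearAccel (hc : IsCurve u v f univ) {A B : ℝ} (hAB : A ≤ B) {r : ℕ → ℝ}
    (hr : Tendsto r atTop (𝓝 0)) :
    Tendsto (fun n => ∫ τ in A..B, nearAccel u f (r n) τ) atTop
      (𝓝 (∫ τ in A..B, ‖cross (u τ) (f τ)‖ ^ 2)) := by
  have hf := hc.memLp A B (subset_univ _)
  have hx := hc.memLp_cross A B
  have i1 : IntervalIntegrable (fun τ => ‖cross (u τ) (f τ)‖ ^ 2) volume A B := by
    rw [intervalIntegrable_iff_integrableOn_Icc_of_le hAB]; exact integrable_norm_sq hx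
  have i2 : IntervalIntegrable (fun τ => ‖f τ‖ ^ 2) volume A B := by
    rw [intervalIntegrable_iff_integrableOn_Icc_of_le hAB]; exact integrable_norm_sq hf
  have i3 : IntervalIntegrable (fun τ => ‖cross (u τ) (f τ)‖ * ‖f τ‖) volume A B := by
    rw [intervalIntegrable_iff_integrableOn_Icc_of_le hAB]
    exact hx.norm.integrable_mul hf.norm
  have e : ∀ n, ∫ τ in A..B, nearAccel u f (r n) τ = (∫ τ in A..B, ‖cross (u τ) (f τ)‖ ^ 2) +
      2 * r n * (∫ τ in A..B, ‖cross (u τ) (f τ)‖ * ‖f τ‖) + r n ^ 2 * ∫ τ in A..B, ‖f τ‖ ^ 2 := by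
    intro n
    rw [← intervalIntegral.integral_const_mul, ← intervalIntegral.integral_const_mul,
      ← intervalIntegral.integral_add i1 (i3.const_mul _),
      ← intervalIntegral.integral_add (i1.add (i3.const_mul _)) (i2.const_mul _)]
    refine intervalIntegral.integral_congr fun τ _ => ?_
    simp only [nearAccel]; ring
  simp only [e]
  have := ((tendsto_const_nhds (x := ∫ τ in A..B, ‖cross (u τ) (f τ)‖ ^ 2)).add
    ((hr.const_mul 2).mul_const (∫ τ in A..B, ‖cross (u τ) (f τ)‖ * ‖f τ‖))).add
    ((hr.pow 2).mul_const (∫ τ in A..B, ‖f τ‖ ^ 2))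
  simpa using this

end HelicalXY

end

section

namespace HelicalXY

open ChainConv

variable {G : E3 → ℝ} {u v f : ℝ → E3} {M : ℝ}

/-! ### Sampling a curve: the potential part -/

/-- The chord of an arc of length `θ`. -/
def chord (θ : ℝ) : ℝ := 2 * Real.sin (θ / 2)

lemma chord_bounds {θ : ℝ} (h0 : 0 < θ) (h1 : θ ≤ 1) :
    0 < chord θ ∧ chord θ ≤ θ ∧ θ ≤ 2 * chord θ := by
  have a1 := Real.sin_gt_sub_cube (x := θ / 2) (by positivity)
  have a2 := Real.sin_le (x := θ / 2) (by positivity)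
  have a3 : (θ / 2) ^ 3 / 4 ≤ θ / 4 := by nlinarith [sq_nonneg θ]
  unfold chord
  refine ⟨by linarith, by linarith, by linarith⟩

lemma tendsto_div_chord {θ : ℕ → ℝ} (h0 : ∀ n, 0 < θ n) (hθ : Tendsto θ atTop (𝓝 0)) :
    Tendsto (fun n => θ n / chord (θ n)) atTop (𝓝 1) := by
  have h1 : Tendsto (fun n => Real.sinc (θ n / 2)) atTop (𝓝 1) := by
    have := (Real.continuous_sinc.tendsto 0).comp (by simpa using hθ.div_const 2)
    rwa [Real.sinc_zero] at this
  have := h1.inv₀ one_ne_zero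
  rw [inv_one] at this
  refine this.congr fun n => ?_
  have := (h0 n).ne'
  rw [Real.sinc_of_ne_zero (by positivity), chord]
  field_simp

/-- The base points move with `n`, so strict differentiability is needed; it follows from `C¹`. The
quotient is normalized by the chord and not by `θ`, which is harmless since `θ / chord θ → 1`. -/
lemma IsCurve.tendsto_dq_sample (hc : IsCurve u v f univ) {t θ : ℕ → ℝ} {x : ℝ}
    (ht : Tendsto t atTop (𝓝 x)) (h0 : ∀ n, 0 < θ n) (hθ : Tendsto θ atTop (𝓝 0)) :
    Tendsto (fun n => dq (chord (θ n)) (u (t n)) (u (t n + θ n))) atTop (𝓝 (v x)) := by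
  have hs : HasStrictDerivAt u (v x) x := by
    have := (hc.contDiff.contDiffAt (x := x)).hasStrictDerivAt one_ne_zero
    rwa [hc.deriv_u] at this
  have h1 := hs.hasStrictFDerivAt.isLittleO.tendsto_inv_smul_nhds_zero
  have hp : Tendsto (fun n => (t n + θ n, t n)) atTop (𝓝 (x, x)) := by
    have := (ht.add hθ).prodMk_nhds ht
    rwa [add_zero] at this
  have h2 := h1.comp hp
  have h3 : Tendsto (fun n => (θ n)⁻¹ • (u (t n + θ n) - u (t n))) atTop (𝓝 (v x)) := by
    have := h2.add_const (v x)
    rw [zero_add] at this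
    refine this.congr fun n => ?_
    have hn := (h0 n).ne'
    simp [smul_sub, smul_smul, hn]
  have h4 := (tendsto_div_chord h0 hθ).smul h3
  rw [one_smul] at h4
  refine h4.congr fun n => ?_
  have hn := (h0 n).ne'
  rw [dq, smul_smul]
  congr 1
  field_simp

lemma IsPenalty.exists_bound (hG : IsPenalty G) : ∃ K, 0 ≤ K ∧ ∀ x, G x ≤ K := by
  have hne : ∀ x ∈ Metric.sphere (0 : E3) 1, x ∈ ({0}ᶜ : Set E3) := fun x hx h0 => by
    rw [mem_singleton_iff.1 h0] at hx; simp at hx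
  obtain ⟨K, hK⟩ := (isCompact_sphere (0 : E3) 1).bddAbove_image (hG.cont.mono hne)
  refine ⟨max K 0, le_max_right _ _, fun x => ?_⟩
  by_cases hx : x = 0
  · rw [hx, hG.zero]; exact le_max_right _ _
  · have hx' := norm_pos_iff.2 hx
    rw [← hG.hom ‖x‖⁻¹ x (inv_pos.2 hx')]
    refine (hK ⟨‖x‖⁻¹ • x, ?_, rfl⟩).trans (le_max_left _ _)
    simp [norm_smul, hx'.ne']

/-- The potential part of the energy density. -/
def pot (G : E3 → ℝ) (w : E3) : ℝ := (‖w‖ ^ 2 - 1) ^ 2 + G w / 2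

/-- As `‖u × v‖ = ‖v‖`, the condition `v x ≠ 0` keeps the limit chirality away from the only
possible discontinuity of `G`. This is why rest times are removed from the curves. -/
lemma IsCurve.tendsto_sitePot (hG : IsPenalty G) (hc : IsCurve u v f univ) {t θ : ℕ → ℝ} {x : ℝ}
    (ht : Tendsto t atTop (𝓝 x)) (h0 : ∀ n, 0 < θ n) (h1 : ∀ n, θ n ≤ 1)
    (hθ : Tendsto θ atTop (𝓝 0)) (hx : v x ≠ 0) :
    Tendsto (fun n => sitePot (chord (θ n)) G (u (t n)) (u (t n + θ n)) (u (t n + 2 * θ n))) atTop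
      (𝓝 (pot G (cross (u x) (v x)))) := by
  have d0 := hc.tendsto_dq_sample ht h0 hθ
  have ht1 : Tendsto (fun n => t n + θ n) atTop (𝓝 x) := by simpa using ht.add hθ
  have d1 := hc.tendsto_dq_sample ht1 h0 hθ
  have e : ∀ n, t n + θ n + θ n = t n + 2 * θ n := fun n => by ring
  simp only [e] at d1
  have hu := (hc.continuous_u.tendsto x).comp ht
  have hwn : ‖cross (u x) (v x)‖ = ‖v x‖ := norm_cross_of_orth (hc.unit x trivial) (hc.orth x trivial)
  have hw0 : cross (u x) (v x) ≠ 0 := fun h => hx (by rwa [h, norm_zero, eq_comm, norm_eq_zero] at hwn)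
  have hGt := (hG.cont.continuousAt (isOpen_compl_singleton.mem_nhds hw0)).tendsto.comp
    (tendsto_cross hu d0)
  have a1 := ((((d0.norm.pow 2).add (d1.norm.pow 2)).div_const 2).const_sub 1).pow 2
  have := a1.add (hGt.div_const 2)
  rw [← hwn] at this
  have e2 : (1 - (‖cross (u x) (v x)‖ ^ 2 + ‖cross (u x) (v x)‖ ^ 2) / 2) ^ 2 +
      G (cross (u x) (v x)) / 2 = pot G (cross (u x) (v x)) := by unfold pot; ring
  rw [e2] at this
  refine this.congr fun n => ?_
  have hh := (chord_bounds (h0 n) (h1 n)).1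
  have e3 := cross_eq_smul_dq hh (u (t n)) (u (t n + θ n))
  simp only [sitePot, Function.comp_apply]
  rw [e3, hG.hom _ _ hh]

lemma IsCurve.norm_dq_sample_le (hc : IsCurve u v f univ) (hM : ∀ t, ‖v t‖ ≤ M) {θ : ℝ}
    (h0 : 0 < θ) (h1 : θ ≤ 1) (t : ℝ) : ‖dq (chord θ) (u t) (u (t + θ))‖ ≤ 2 * M := by
  obtain ⟨b0, -, b2⟩ := chord_bounds h0 h1
  have hM0 : 0 ≤ M := (norm_nonneg _).trans (hM 0)
  have : ‖u (t + θ) - u t‖ ≤ M * |t + θ - t| := by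
    rw [hc.int_u t (t + θ) (by linarith) (subset_univ _)]
    exact intervalIntegral.norm_integral_le_of_norm_le_const fun s _ => hM s
  rw [add_sub_cancel_left, abs_of_pos h0] at this
  rw [dq, norm_smul, norm_inv, Real.norm_of_nonneg b0.le, inv_mul_le_iff₀ b0]
  nlinarith

lemma lintegral_step_shift {h : ℝ} (hh : 0 < h) (F : ℕ → ℝ≥0∞) (N : ℕ) (s : ℝ) :
    ∫⁻ x in Ico s (s + N * h), F ⌊(x - s) / h⌋₊ = ∑ j ∈ Finset.range N, ENNReal.ofReal h * F j := by
  have hI := lintegral_step hh F N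
  rw [← lintegral_indicator measurableSet_Ico] at hI ⊢
  rw [← hI, ← lintegral_sub_right_eq_self (μ := volume)
    ((Ico 0 (N * h)).indicator fun t => F ⌊t / h⌋₊) s]
  congr 1
  funext x
  by_cases hx : x ∈ Ico s (s + N * h)
  · rw [indicator_of_mem hx, indicator_of_mem (by constructor <;> linarith [hx.1, hx.2])]
  · rw [indicator_of_notMem hx, indicator_of_notMem]
    exact fun h => hx (by constructor <;> linarith [h.1, h.2])

lemma measurable_pot (hG : IsPenalty G) (hc : IsCurve u v f univ) :
    Measurable fun x => pot G (cross (u x) (v x)) := by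
  have hcc : Continuous fun t => cross (u t) (v t) := by
    rw [← continuousOn_univ]
    exact continuousOn_cross hc.continuous_u.continuousOn hc.continuous_v.continuousOn
  exact ((hcc.norm.pow 2).sub continuous_const |>.pow 2).measurable.add
    (((measurable_of_continuousOn hG.cont).comp hcc.measurable).div_const 2)

/-- The potential part of the sampled energy. -/
lemma IsCurve.exists_potential_error (hG : IsPenalty G) (hc : IsCurve u v f univ)
    (hM : ∀ t, ‖v t‖ ≤ M) (hz : volume {t | v t = 0} = 0) {A B : ℝ} {θ s : ℕ → ℝ} {N : ℕ → ℕ}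
    (h0 : ∀ n, 0 < θ n) (h1 : ∀ n, θ n ≤ 1) (hθ : Tendsto θ atTop (𝓝 0)) (hs : ∀ n, A ≤ s n)
    (hN : ∀ n, s n + (N n + 2) * θ n ≤ B) :
    ∃ δ : ℕ → ℝ≥0∞, Tendsto δ atTop (𝓝 0) ∧ ∀ n,
      ∑ j ∈ Finset.range (N n), ENNReal.ofReal (θ n) * ENNReal.ofReal (sitePot (chord (θ n)) G
        (u (s n + j * θ n)) (u (s n + (j + 1 : ℕ) * θ n)) (u (s n + (j + 2 : ℕ) * θ n))) ≤
      (∫⁻ x in Icc A B, ENNReal.ofReal (pot G (cross (u x) (v x)))) + δ n := by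
  obtain ⟨K, hK0, hK⟩ := hG.exists_bound
  have hM0 : 0 ≤ M := (norm_nonneg _).trans (hM 0)
  set a : ℕ → ℝ → ℝ := fun n t => sitePot (chord (θ n)) G (u t) (u (t + θ n)) (u (t + 2 * θ n))
    with ha
  set I : ℕ → Set ℝ := fun n => Ico (s n) (s n + N n * θ n) with hI
  set node : ℕ → ℝ → ℝ := fun n x => s n + ⌊(x - s n) / θ n⌋₊ * θ n with hnode
  set F : ℕ → ℝ → ℝ≥0∞ := fun n => (I n).indicator fun x =>
    ENNReal.ofReal |a n (node n x) - pot G (cross (u x) (v x))| with hF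
  have hsub : ∀ n, I n ⊆ Icc A B := fun n x hx =>
    ⟨(hs n).trans hx.1, by nlinarith [hx.2, hN n, h0 n]⟩
  have hpm := measurable_pot hG hc
  have hnm : ∀ n, Measurable fun x => a n (node n x) := fun n =>
    (measurable_step (h := θ n) (fun j : ℕ => a n (s n + j * θ n))).comp (measurable_sub_const (s n))
  have ha0 : ∀ n t, 0 ≤ a n t ∧ a n t ≤ (1 + 4 * M ^ 2) ^ 2 + K := fun n t => by
    have b1 := hc.norm_dq_sample_le hM (h0 n) (h1 n) t
    have b2 := hc.norm_dq_sample_le hM (h0 n) (h1 n) (t + θ n)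
    rw [show t + θ n + θ n = t + 2 * θ n by ring] at b2
    have c1 := pow_le_pow_left₀ (norm_nonneg _) b1 2
    have c2 := pow_le_pow_left₀ (norm_nonneg _) b2 2
    have g0 := hG.nonneg (cross (u t) (u (t + θ n)))
    have g1 := hK (cross (u t) (u (t + θ n)))
    simp only [ha, sitePot]
    refine ⟨by positivity, add_le_add (sq_le_sq' ?_ ?_) (by linarith)⟩
    · nlinarith
    · have e1 := sq_nonneg ‖dq (chord (θ n)) (u t) (u (t + θ n))‖
      have e2 := sq_nonneg ‖dq (chord (θ n)) (u (t + θ n)) (u (t + 2 * θ n))‖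
      nlinarith
  have hp0 : ∀ x, 0 ≤ pot G (cross (u x) (v x)) ∧
      pot G (cross (u x) (v x)) ≤ (1 + 4 * M ^ 2) ^ 2 + K := fun x => by
    have g0 := hG.nonneg (cross (u x) (v x))
    have g1 := hK (cross (u x) (v x))
    have e1 : ‖cross (u x) (v x)‖ ≤ M := by
      rw [norm_cross_of_orth (hc.unit x trivial) (hc.orth x trivial)]; exact hM x
    have c1 := pow_le_pow_left₀ (norm_nonneg _) e1 2
    unfold pot
    refine ⟨by positivity, add_le_add (sq_le_sq' ?_ ?_) (by linarith)⟩
    · nlinarith [sq_nonneg ‖cross (u x) (v x)‖, sq_nonneg M]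
    · nlinarith [sq_nonneg ‖cross (u x) (v x)‖, sq_nonneg M]
  refine ⟨fun n => ∫⁻ x in Icc A B, F n x, ?_, fun n => ?_⟩
  · have hlim : Tendsto (fun n => ∫⁻ x in Icc A B, F n x) atTop (𝓝 (∫⁻ _ in Icc A B, 0)) := by
      refine tendsto_lintegral_of_dominated_convergence
        (fun _ => ENNReal.ofReal ((1 + 4 * M ^ 2) ^ 2 + K)) (fun n => ?_) (fun n => ?_) ?_ ?_
      · refine Measurable.indicator ?_ measurableSet_Ico
        exact ((hnm n).sub hpm).abs.ennreal_ofReal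
      · refine ae_of_all _ fun x => ?_
        simp only [hF]
        by_cases hx : x ∈ I n
        · rw [indicator_of_mem hx]
          refine ENNReal.ofReal_le_ofReal (abs_sub_le_iff.2 ⟨?_, ?_⟩)
          · linarith [(ha0 n (node n x)).2, (hp0 x).1]
          · linarith [(ha0 n (node n x)).1, (hp0 x).2]
        · rw [indicator_of_notMem hx]; exact bot_le
      · rw [setLIntegral_const]
        exact ENNReal.mul_ne_top ENNReal.ofReal_ne_top measure_Icc_lt_top.ne
      · have hae : ∀ᵐ x, v x ≠ 0 := by
          rw [ae_iff]; simpa using hz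
        filter_upwards [ae_restrict_of_ae hae] with x hx
        classical
        -- Outside the sampling window the node is replaced by `x`, so that one sequence converging
        -- to `x` covers all `n`.
        set t : ℕ → ℝ := fun n => if x ∈ I n then node n x else x with ht
        have htx : Tendsto t atTop (𝓝 x) := by
          rw [tendsto_iff_dist_tendsto_zero]
          refine squeeze_zero (fun n => dist_nonneg) (fun n => ?_) hθ
          simp only [ht]
          split_ifs with hxI
          · have e1 := floor_mul_le (h0 n) (sub_nonneg.2 hxI.1)
            have e2 := lt_floor_mul (h0 n) (x - s n)
            rw [Real.dist_eq, abs_le]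
            simp only [hnode]
            constructor <;> linarith
          · rw [dist_self]; exact (h0 n).le
        have h2 := hc.tendsto_sitePot hG htx h0 h1 hθ hx
        have h3 : Tendsto (fun n => ENNReal.ofReal |a n (t n) - pot G (cross (u x) (v x))|) atTop
            (𝓝 0) := by
          have := ((h2.sub_const (pot G (cross (u x) (v x)))).abs)
          rw [sub_self, abs_zero] at this
          have := (ENNReal.continuous_ofReal.tendsto 0).comp this
          rwa [ENNReal.ofReal_zero] at this
        refine tendsto_of_tendsto_of_tendsto_of_le_of_le tendsto_const_nhds h3 (fun n => bot_le)
          fun n => ?_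
        simp only [hF]
        by_cases hxI : x ∈ I n
        · rw [indicator_of_mem hxI]
          simp only [ht, if_pos hxI, le_refl]
        · rw [indicator_of_notMem hxI]; exact bot_le
    simpa using hlim
  · have hstep := lintegral_step_shift (h0 n) (fun j => ENNReal.ofReal (a n (s n + j * θ n))) (N n)
      (s n)
    have e : ∀ j : ℕ, a n (s n + j * θ n) = sitePot (chord (θ n)) G
        (u (s n + j * θ n)) (u (s n + (j + 1 : ℕ) * θ n)) (u (s n + (j + 2 : ℕ) * θ n)) := fun j => by
      simp only [ha]
      rw [show s n + j * θ n + θ n = s n + (j + 1 : ℕ) * θ n by push_cast; ring,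
        show s n + j * θ n + 2 * θ n = s n + (j + 2 : ℕ) * θ n by push_cast; ring]
    simp only [← e]
    rw [← hstep]
    calc ∫⁻ x in I n, ENNReal.ofReal (a n (node n x))
        ≤ ∫⁻ x in I n, (ENNReal.ofReal (pot G (cross (u x) (v x))) + F n x) := by
          refine setLIntegral_mono' measurableSet_Ico fun x hx => ?_
          simp only [hF]
          rw [indicator_of_mem hx, ← ENNReal.ofReal_add (hp0 x).1 (abs_nonneg _)]
          refine ENNReal.ofReal_le_ofReal ?_
          linarith [le_abs_self (a n (node n x) - pot G (cross (u x) (v x)))]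
      _ ≤ ∫⁻ x in Icc A B, (ENNReal.ofReal (pot G (cross (u x) (v x))) + F n x) :=
          lintegral_mono_set (hsub n)
      _ = _ := lintegral_add_left hpm.ennreal_ofReal _

/-- The energy of a sampled curve is asymptotically bounded by the energy of the curve. -/
lemma IsCurve.eventually_chainE_sample_le (hG : IsPenalty G) (hc : IsCurve u v f univ)
    (hM : ∀ t, ‖v t‖ ≤ M) (hz : volume {t | v t = 0} = 0) {E ε : ℝ} (hE0 : 0 ≤ E) (hε : 0 < ε)
    (hE : ∫⁻ t, dens G u v f t ≤ ENNReal.ofReal E) {A B : ℝ} (hAB : A ≤ B)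
    {θ s : ℕ → ℝ} {N : ℕ → ℕ}
    (h0 : ∀ n, 0 < θ n) (h1 : ∀ n, θ n ≤ 1) (hθ : Tendsto θ atTop (𝓝 0)) (hs : ∀ n, A ≤ s n)
    (hN : ∀ n, s n + (N n + 2) * θ n ≤ B) :
    ∀ᶠ n in atTop, chainE (chord (θ n)) G (fun j => u (s n + j * θ n)) (N n) ≤ E + ε := by
  obtain ⟨δ, hδ, Hδ⟩ := hc.exists_potential_error hG hM hz h0 h1 hθ hs hN
  set P : ℝ≥0∞ := ∫⁻ x in Icc A B, ENNReal.ofReal (pot G (cross (u x) (v x))) with hP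
  set κ : ℕ → ℝ := fun n => (θ n / chord (θ n)) ^ 3 * ∫ τ in A..B, nearAccel u f (θ n * M) τ with hκ
  set a : ℝ := ∫ τ in A..B, ‖cross (u τ) (f τ)‖ ^ 2 with ha
  have hκlim : Tendsto κ atTop (𝓝 a) := by
    have hr : Tendsto (fun n => θ n * M) atTop (𝓝 0) := by simpa using hθ.mul_const M
    have := ((tendsto_div_chord h0 hθ).pow 3).mul (hc.tendsto_nearAccel hAB hr)
    simpa using this
  have hlim : Tendsto (fun n => ENNReal.ofReal (κ n) + (P + δ n)) atTop
      (𝓝 (ENNReal.ofReal a + (P + 0))) :=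
    ((ENNReal.continuous_ofReal.tendsto a).comp hκlim).add (hδ.const_add P)
  have hle : ENNReal.ofReal a + (P + 0) ≤ ENNReal.ofReal E := by
    refine le_trans (le_of_eq ?_) ((setLIntegral_le_lintegral (Icc A B) _).trans hE)
    rw [add_zero, add_comm, hP, ha, intervalIntegral.integral_of_le hAB, ← integral_Icc_eq_integral_Ioc,
      ofReal_integral_eq_lintegral_ofReal (integrable_norm_sq (hc.memLp_cross A B))
        (ae_of_all _ fun t => by positivity)]
    exact (lintegral_add_left (measurable_pot hG hc).ennreal_ofReal _).symm
  have hlt : ENNReal.ofReal E < ENNReal.ofReal (E + ε) :=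
    (ENNReal.ofReal_lt_ofReal_iff (by linarith)).2 (by linarith)
  filter_upwards [hlim.eventually_lt_const (hle.trans_lt hlt)] with n hn
  obtain ⟨b0, b1, b2⟩ := chord_bounds (h0 n) (h1 n)
  set h := chord (θ n) with hh
  have hsum : chainE h G (fun j => u (s n + j * θ n)) (N n) ≤ κ n +
      ∑ j ∈ Finset.range (N n), θ n * sitePot h G
        (u (s n + j * θ n)) (u (s n + (j + 1 : ℕ) * θ n)) (u (s n + (j + 2 : ℕ) * θ n)) := by
    have hk := hc.sum_second_difference_le (h0 n) hM (hs n) (N n) (hN n)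
    have hk2 := mul_le_mul_of_nonneg_left hk (by positivity : (0 : ℝ) ≤ (h ^ 3)⁻¹)
    have ek : (h ^ 3)⁻¹ * (θ n ^ 3 * ∫ τ in A..B, nearAccel u f (θ n * M) τ) = κ n := by
      rw [show κ n = (θ n / h) ^ 3 * ∫ τ in A..B, nearAccel u f (θ n * M) τ from rfl, div_pow]
      field_simp
    rw [ek, Finset.mul_sum] at hk2
    refine le_trans ?_ (add_le_add hk2 le_rfl)
    rw [← Finset.sum_add_distrib, chainE]
    refine Finset.sum_le_sum fun j _ => ?_
    rw [siteE_eq b0 G (hc.unit _ trivial) (hc.unit _ trivial) (hc.unit _ trivial), mul_add, mul_add,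
      add_assoc, ← mul_add]
    refine add_le_add (le_of_eq ?_) (mul_le_mul_of_nonneg_right b1 ?_)
    · have e1 : dq h (u (s n + (j + 1 : ℕ) * θ n)) (u (s n + (j + 2 : ℕ) * θ n)) -
          dq h (u (s n + j * θ n)) (u (s n + (j + 1 : ℕ) * θ n)) =
          h⁻¹ • (u (s n + j * θ n) - (2 : ℝ) • u (s n + (j + 1 : ℕ) * θ n) +
            u (s n + (j + 2 : ℕ) * θ n)) := by
        rw [dq, dq]; module
      rw [e1, cross_smul_right, norm_smul, norm_inv, Real.norm_of_nonneg b0.le]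
      field_simp
    · have := hG.nonneg (cross (u (s n + j * θ n)) (u (s n + (j + 1 : ℕ) * θ n)))
      positivity
  have hsp : ∀ j : ℕ, 0 ≤ sitePot h G (u (s n + j * θ n)) (u (s n + (j + 1 : ℕ) * θ n))
      (u (s n + (j + 2 : ℕ) * θ n)) := fun j => by
    have := hG.nonneg (cross (u (s n + j * θ n)) (u (s n + (j + 1 : ℕ) * θ n)))
    unfold sitePot; positivity
  have hfin : ENNReal.ofReal (chainE h G (fun j => u (s n + j * θ n)) (N n)) ≤
      ENNReal.ofReal (κ n) + (P + δ n) := by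
    refine (ENNReal.ofReal_le_ofReal hsum).trans (ENNReal.ofReal_add_le.trans ?_)
    refine add_le_add le_rfl (le_trans (le_of_eq ?_) (Hδ n))
    rw [ENNReal.ofReal_sum_of_nonneg fun j _ => mul_nonneg (h0 n).le (hsp j)]
    simp only [ENNReal.ofReal_mul (h0 n).le]
    rfl
  exact ((ENNReal.ofReal_lt_ofReal_iff (by linarith)).1 (hfin.trans_lt hn)).le

/-- Uniformity in the starting point and in the number of samples: a counterexample for every bound
`1 / (n + 1)` on the spacing would contradict `eventually_chainE_sample_le`. -/
lemma IsCurve.exists_sample_bound (hG : IsPenalty G) (hc : IsCurve u v f univ)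
    (hM : ∀ t, ‖v t‖ ≤ M) (hz : volume {t | v t = 0} = 0) {E ε : ℝ} (hE0 : 0 ≤ E) (hε : 0 < ε)
    (hE : ∫⁻ t, dens G u v f t ≤ ENNReal.ofReal E) {A B : ℝ} (hAB : A ≤ B) :
    ∃ θ₀ > 0, θ₀ ≤ 1 ∧ ∀ θ, 0 < θ → θ < θ₀ → ∀ (s : ℝ) (N : ℕ), A ≤ s → s + (N + 2) * θ ≤ B →
      chainE (chord θ) G (fun j => u (s + j * θ)) N ≤ E + ε := by
  by_contra! hcon
  choose θ h0 hlt s N hs hN hfail using fun n : ℕ => hcon (1 / ((n : ℝ) + 1)) (by positivity) (by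
    rw [div_le_one (by positivity)]; linarith [n.cast_nonneg (α := ℝ)])
  have h1 : ∀ n, θ n ≤ 1 := fun n => (hlt n).le.trans (by
    rw [div_le_one (by positivity)]; linarith [n.cast_nonneg (α := ℝ)])
  have hθ : Tendsto θ atTop (𝓝 0) :=
    squeeze_zero (fun n => (h0 n).le) (fun n => (hlt n).le) tendsto_one_div_add_atTop_nhds_zero_nat
  obtain ⟨n, hn⟩ := (hc.eventually_chainE_sample_le hG hM hz hE0 hε hE hAB h0 h1 hθ hs hN).exists
  linarith [hfail n]

end HelicalXY

end

section

namespace HelicalXY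

variable {G : E3 → ℝ} {u v f : ℝ → E3} {p : E3}

/-! ### Concatenating transitions -/

lemma IsCurve.eq_rotation_back (h : IsCurve u v f univ) (hp : ‖p‖ = 1) {a b : ℝ} (hab : a ≤ b)
    (hw : ∀ t ∈ Icc a b, cross (u t) (v t) = p) :
    u a = Real.cos (b - a) • u b - Real.sin (b - a) • cross p (u b) := by
  have hpu : inner ℝ p (u a) = (0 : ℝ) := by
    rw [← hw a (left_mem_Icc.2 hab)]; exact inner_cross_left _ _
  have hppu : cross p (cross p (u a)) = -u a := by
    rw [cross_anticomm, cross_cross_of_orth hp hpu]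
  rw [h.eq_rotation hp hab hw, cross_add_right, cross_smul_right, cross_smul_right, hppu]
  have e : Real.cos (b - a) • (Real.cos (b - a) • u a + Real.sin (b - a) • cross p (u a)) -
      Real.sin (b - a) • (Real.cos (b - a) • cross p (u a) + Real.sin (b - a) • -u a) =
      (Real.cos (b - a) ^ 2 + Real.sin (b - a) ^ 2) • u a := by module
  rw [e, Real.cos_sq_add_sin_sq, one_smul]

lemma chord_sq (θ : ℝ) : chord θ ^ 2 = 2 - 2 * Real.cos θ := by
  have h := Real.cos_two_mul (θ / 2)
  rw [mul_div_cancel₀ θ two_ne_zero] at h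
  have h2 := Real.sin_sq_add_cos_sq (θ / 2)
  unfold chord
  nlinarith

lemma IsCurve.cross_sample (h : IsCurve u v f univ) (hp : ‖p‖ = 1) {t θ : ℝ} (h0 : 0 ≤ θ)
    (hw : ∀ τ ∈ Icc t (t + θ), cross (u τ) (v τ) = p) :
    cross (u t) (u (t + θ)) = Real.sin θ • p := by
  have hpu : inner ℝ p (u t) = (0 : ℝ) := by
    rw [← hw t (left_mem_Icc.2 (by linarith))]; exact inner_cross_left _ _
  have hx : cross (u t) (cross p (u t)) = p := by
    rw [cross_anticomm, cross_cross_right, h.unit t trivial, hpu]; simp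
  have hr := h.eq_rotation hp (by linarith : t ≤ t + θ) hw
  rw [add_sub_cancel_left] at hr
  rw [hr, cross_add_right, cross_smul_right, cross_smul_right, cross_self, smul_zero, zero_add, hx]

lemma IsCurve.inner_sample (h : IsCurve u v f univ) (hp : ‖p‖ = 1) {t θ : ℝ} (h0 : 0 ≤ θ)
    (hw : ∀ τ ∈ Icc t (t + θ), cross (u τ) (v τ) = p) :
    inner ℝ (u (t + θ)) (u t) = Real.cos θ := by
  have hr := h.eq_rotation hp (by linarith : t ≤ t + θ) hw
  rw [add_sub_cancel_left] at hr
  rw [hr, inner_add_left, inner_smul_left, inner_smul_left, inner_cross_right,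
    real_inner_self_eq_norm_sq, h.unit t trivial]
  simp

/-- Sampling a rotation costs nothing. -/
lemma IsCurve.siteE_eq_zero (hG : IsPenalty G) (h : IsCurve u v f univ) (hp : ‖p‖ = 1)
    (hGp : G p = 0) {t θ : ℝ} (h0 : 0 < θ) (h1 : θ ≤ 1)
    (hw : ∀ τ ∈ Icc t (t + 2 * θ), cross (u τ) (v τ) = p) :
    siteE (chord θ) G (u t) (u (t + θ)) (u (t + 2 * θ)) = 0 := by
  have hs : 0 < Real.sin θ := Real.sin_pos_of_pos_of_le_one h0 h1
  have e1 := h.cross_sample hp h0.le fun τ hτ => hw τ ⟨hτ.1, by linarith [hτ.2]⟩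
  have hw1 : ∀ τ ∈ Icc t (t + θ), cross (u τ) (v τ) = p := fun τ hτ =>
    hw τ ⟨hτ.1, by linarith [hτ.2]⟩
  have hw2 : ∀ τ ∈ Icc (t + θ) (t + 2 * θ), cross (u τ) (v τ) = p := fun τ hτ =>
    hw τ ⟨by linarith [hτ.1], hτ.2⟩
  have r1 := h.eq_rotation_back hp (by linarith : t ≤ t + θ) hw1
  have r2 := h.eq_rotation hp (by linarith : t + θ ≤ t + 2 * θ) hw2
  rw [add_sub_cancel_left] at r1
  rw [show t + 2 * θ - (t + θ) = θ by ring] at r2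
  -- A rotation satisfies `u t + u (t + 2θ) = 2 cos θ • u (t + θ)`, and the chord is the value of
  -- `h` with `2 (1 - h² / 2) = 2 cos θ`.
  have e2 : u t - (2 * (1 - chord θ ^ 2 / 2)) • u (t + θ) + u (t + 2 * θ) = 0 := by
    rw [chord_sq, r2]
    conv_lhs => enter [1, 1]; rw [r1]
    module
  rw [siteE, e2, e1, hG.hom _ _ hs, hGp]
  simp

/-- The energy of all samples of `u` of spacing less than `θ₀` is at most `E`. -/
def SampleBound (G : E3 → ℝ) (u : ℝ → E3) (θ₀ E : ℝ) : Prop :=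
  ∀ θ, 0 < θ → θ < θ₀ → ∀ (s : ℝ) (N : ℕ), chainE (chord θ) G (fun j => u (s + j * θ)) N ≤ E

variable {h : ℝ}

lemma chainE_congr {U U' : ℕ → E3} {N : ℕ} (hU : ∀ j < N, U j = U' j ∧ U (j + 1) = U' (j + 1) ∧
    U (j + 2) = U' (j + 2)) : chainE h G U N = chainE h G U' N :=
  Finset.sum_congr rfl fun j hj => by
    obtain ⟨h0, h1, h2⟩ := hU j (Finset.mem_range.1 hj)
    rw [h0, h1, h2]

/-- A sampled chain can be cut at any time. -/
lemma exists_cut (U : ℝ → E3) {θ : ℝ} (hθ : 0 < θ) (s T : ℝ) (N : ℕ) :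
    ∃ a b : ℕ, a + b = N ∧ (∀ j < a, s + j * θ < T) ∧ (0 < b → T ≤ s + a * θ) ∧
      (0 < a → s + a * θ < T + θ) ∧
      chainE h G (fun j => U (s + j * θ)) N = chainE h G (fun j => U (s + j * θ)) a +
        chainE h G (fun j => U (s + a * θ + j * θ)) b := by
  refine ⟨min N ⌈(T - s) / θ⌉₊, N - min N ⌈(T - s) / θ⌉₊, by omega, fun j hj => ?_, fun hb => ?_,
    fun ha => ?_, ?_⟩
  · have := Nat.lt_ceil.1 (hj.trans_le (min_le_right _ _))
    rw [lt_div_iff₀ hθ] at this; linarith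
  · have : min N ⌈(T - s) / θ⌉₊ = ⌈(T - s) / θ⌉₊ := by omega
    rw [this]
    have := Nat.le_ceil ((T - s) / θ)
    rw [div_le_iff₀ hθ] at this; linarith
  · have h1 : min N ⌈(T - s) / θ⌉₊ - 1 < ⌈(T - s) / θ⌉₊ := by omega
    have h2 := Nat.lt_ceil.1 h1
    rw [lt_div_iff₀ hθ, Nat.cast_sub (by omega)] at h2
    push_cast at h2 ⊢
    linarith
  · have := chainE_add (h := h) (G := G) (fun j => U (s + j * θ)) (min N ⌈(T - s) / θ⌉₊)
      (N - min N ⌈(T - s) / θ⌉₊)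
    rw [show min N ⌈(T - s) / θ⌉₊ + (N - min N ⌈(T - s) / θ⌉₊) = N by omega] at this
    rw [this]
    congr 2
    funext j
    congr 1
    push_cast; ring

lemma IsCurve.chainE_eq_zero (hG : IsPenalty G) (h : IsCurve u v f univ) (hp : ‖p‖ = 1)
    (hGp : G p = 0) {θ : ℝ} (h0 : 0 < θ) (h1 : θ ≤ 1) {s : ℝ} {N : ℕ}
    (hw : ∀ j < N, ∀ t ∈ Icc (s + j * θ) (s + j * θ + 2 * θ), cross (u t) (v t) = p) :
    chainE (chord θ) G (fun j => u (s + j * θ)) N = 0 := by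
  refine Finset.sum_eq_zero fun j hj => ?_
  have := h.siteE_eq_zero hG hp hGp h0 h1 (hw j (Finset.mem_range.1 hj))
  rw [show s + j * θ + θ = s + (j + 1 : ℕ) * θ by push_cast; ring,
    show s + j * θ + 2 * θ = s + (j + 2 : ℕ) * θ by push_cast; ring] at this
  exact this

/-- Since `2θ < 1`, a site starting before `-1` or not before `S` sees only a rotation and costs
nothing. The other sites lie in the fixed window `[-1, S + 2]`, so the bound holds for samples of
any length. -/
lemma Connects.exists_sampleBound (hG : IsPenalty G) {p p' : E3} (hp : ‖p‖ = 1) (hGp : G p = 0)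
    (hp' : ‖p'‖ = 1) (hGp' : G p' = 0) {E ε : ℝ} (hE : 0 ≤ E) (hε : 0 < ε)
    (hc : Connects G p p' (ENNReal.ofReal E)) :
    ∃ u v f S θ₀ M, 0 ≤ S ∧ 0 < θ₀ ∧ θ₀ ≤ 1 / 2 ∧ IsCurve u v f univ ∧
      (∀ t, t ≤ 0 → cross (u t) (v t) = p) ∧ (∀ t, S ≤ t → cross (u t) (v t) = p') ∧
      (∀ t, ‖v t‖ ≤ M) ∧ SampleBound G u θ₀ (E + ε) := by
  obtain ⟨u, v, f, S, hS, hc, hw0, hw1, hE', hz⟩ := hc.exists_moving hp hp'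
  obtain ⟨M, hM⟩ : ∃ M, ∀ t, ‖v t‖ ≤ M := by
    obtain ⟨C, hC⟩ := isCompact_Icc.bddAbove_image (hc.continuous_v.norm.continuousOn (s := Icc 0 S))
    refine ⟨max C 1, fun t => ?_⟩
    have hn := norm_cross_of_orth (hc.unit t trivial) (hc.orth t trivial)
    rcases le_total t 0 with h0 | h0
    · rw [← hn, hw0 t h0, hp]; exact le_max_right _ _
    rcases le_total S t with h1 | h1
    · rw [← hn, hw1 t h1, hp']; exact le_max_right _ _
    · exact (hC ⟨t, ⟨h0, h1⟩, rfl⟩).trans (le_max_left _ _)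
  obtain ⟨θ₀, hθ₀, -, H⟩ := hc.exists_sample_bound hG hM hz hE hε hE' (A := -1) (B := S + 2)
    (by linarith)
  refine ⟨u, v, f, S, min θ₀ (1 / 2), M, hS, by positivity, min_le_right _ _, hc, hw0, hw1, hM,
    fun θ h0 hlt s N => ?_⟩
  have hlt1 : θ < 1 / 2 := hlt.trans_le (min_le_right _ _)
  have hlt0 : θ < θ₀ := hlt.trans_le (min_le_left _ _)
  obtain ⟨a, b, hab, ha1, ha2, -, e1⟩ := exists_cut (h := chord θ) (G := G) u h0 s (-1) N
  have z1 := hc.chainE_eq_zero hG hp hGp h0 (by linarith) (s := s) (N := a) fun j hj t ht =>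
    hw0 t (by linarith [ha1 j hj, ht.2])
  rw [e1, z1, zero_add]
  rcases Nat.eq_zero_or_pos b with rfl | hb
  · simp only [chainE, Finset.range_zero, Finset.sum_empty]; linarith
  have hs' := ha2 hb
  generalize s + a * θ = s' at hs'
  obtain ⟨a', b', -, hc1, hc2, hc3, e2⟩ := exists_cut (h := chord θ) (G := G) u h0 s' S b
  have z2 : chainE (chord θ) G (fun j => u (s' + a' * θ + j * θ)) b' = 0 := by
    rcases Nat.eq_zero_or_pos b' with rfl | hb'
    · simp [chainE]
    refine hc.chainE_eq_zero hG hp' hGp' h0 (by linarith) fun j _ t ht => hw1 t ?_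
    have : 0 ≤ (j : ℝ) * θ := by positivity
    linarith [ht.1, hc2 hb']
  rw [e2, z2, add_zero]
  rcases Nat.eq_zero_or_pos a' with rfl | ha'
  · simp only [chainE, Finset.range_zero, Finset.sum_empty]; linarith
  exact H θ h0 hlt0 s' a' hs' (by linarith [hc3 ha'])

lemma SampleBound.shift {θ₀ E : ℝ} (h : SampleBound G u θ₀ E) (τ : ℝ) :
    SampleBound G (fun t => u (t - τ)) θ₀ E := fun θ h0 h1 s N => by
  have := h θ h0 h1 (s - τ) N
  refine le_trans (le_of_eq ?_) this
  congr 1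
  funext j
  change u (s + j * θ - τ) = _
  rw [show s + j * θ - τ = s - τ + j * θ by ring]

lemma SampleBound.mono {θ₀ θ₁ E : ℝ} (h : SampleBound G u θ₀ E) (h1 : θ₁ ≤ θ₀) :
    SampleBound G u θ₁ E := fun θ h0 hlt => h θ h0 (hlt.trans_le h1)

/-- Two curves that rotate about the same axis before the junction can be glued. -/
lemma SampleBound.glue {u' v' f' : ℝ → E3} (hc : IsCurve u v f univ) (hc' : IsCurve u' v' f' univ)
    (hp : ‖p‖ = 1) {τ θ₀ E E' : ℝ} (hθ₀ : θ₀ ≤ 1 / 2) (h : SampleBound G u θ₀ E)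
    (h' : SampleBound G u' θ₀ E') (hτ : u τ = u' τ)
    (hw : ∀ t ∈ Icc (τ - 1) τ, cross (u t) (v t) = p)
    (hw' : ∀ t ∈ Icc (τ - 1) τ, cross (u' t) (v' t) = p) :
    SampleBound G (HelicalXY.glue τ u u') θ₀ (E + E') := fun θ h0 hlt s N => by
  -- On `[τ - 1, τ]` both curves are the same rotation. Hence the glued curve equals `u` before `τ`
  -- and `u'` after `τ - 1`, and since `2θ < 1` no site sees more than one of the two.
  have heq : ∀ t, τ - 1 ≤ t → HelicalXY.glue τ u u' t = u' t := fun t ht => by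
    rcases le_or_gt t τ with h1 | h1
    · rw [glue_of_le h1, hc.eq_rotation_back hp h1 fun x hx => hw x ⟨ht.trans hx.1, hx.2⟩,
        hc'.eq_rotation_back hp h1 fun x hx => hw' x ⟨ht.trans hx.1, hx.2⟩, hτ]
    · exact glue_of_lt h1
  obtain ⟨a, b, hab, ha1, ha2, -, e1⟩ := exists_cut (h := chord θ) (G := G) (HelicalXY.glue τ u u') h0 s
    (τ - 1) N
  rw [e1]
  refine add_le_add ?_ ?_
  · refine le_trans (le_of_eq (chainE_congr fun j hj => ?_)) (h θ h0 hlt s a)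
    have := ha1 j hj
    refine ⟨glue_of_le (by linarith), glue_of_le ?_, glue_of_le ?_⟩
    · push_cast; linarith
    · push_cast; linarith
  · refine le_trans (le_of_eq (chainE_congr fun j hj => ?_)) (h' θ h0 hlt (s + a * θ) b)
    have h1 := ha2 (by omega)
    have h2 : ∀ i : ℕ, 0 ≤ (i : ℝ) * θ := fun i => by positivity
    exact ⟨heq _ (by linarith [h2 j]), heq _ (by linarith [h2 (j + 1)]),
      heq _ (by linarith [h2 (j + 2)])⟩

/-- A curve passing successively through the wells `p 0, …, p r`, the transition from `p i` to
`p (i + 1)` taking place in `[y i, y i + L]`. -/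
structure IsPulse (G : E3 → ℝ) (p : ℕ → E3) (r : ℕ) (y : ℕ → ℝ) (L M θ₀ E : ℝ) (u v f : ℝ → E3) :
    Prop where
  curve : IsCurve u v f univ
  bound : ∀ t, ‖v t‖ ≤ M
  sample : SampleBound G u θ₀ E
  well : ∀ i ≤ r, ∀ t, (0 < i → y (i - 1) + L ≤ t) → (i < r → t ≤ y i) → cross (u t) (v t) = p i

/-- Transitions are appended one at a time; while waiting for `y r` the curve rotates about `p r`
for free. The constants `θ₀`, `L`, `M` are chosen before `y`, because the jump times will move apart
while the sampling bounds must stay uniform. -/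
theorem exists_pulse (hG : IsPenalty G) {p : ℕ → E3} (hp : ∀ i, ‖p i‖ = 1) (hGp : ∀ i, G (p i) = 0)
    {E : ℕ → ℝ} {ε : ℝ} (hE : ∀ i, 0 ≤ E i) (hε : 0 < ε) (r : ℕ)
    (hc : ∀ i < r, Connects G (p i) (p (i + 1)) (ENNReal.ofReal (E i))) :
    ∃ θ₀ L M, 0 < θ₀ ∧ θ₀ ≤ 1 / 2 ∧ 0 ≤ L ∧ ∀ y : ℕ → ℝ, (∀ i, y i + L ≤ y (i + 1)) →
      ∃ u v f, IsPulse G p r y L M θ₀ ((∑ i ∈ Finset.range r, E i) + r * ε) u v f := by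
  induction r with
  | zero =>
    refine ⟨1 / 2, 0, 1, by norm_num, le_rfl, le_rfl, fun y _ => ?_⟩
    obtain ⟨u, v, f, hc, hw⟩ := exists_rotation (hp 0)
    refine ⟨u, v, f, hc, fun t => ?_, fun θ h0 h1 s N => ?_, fun i hi t _ _ => ?_⟩
    · rw [← norm_cross_of_orth (hc.unit t trivial) (hc.orth t trivial), (hw t).1, hp]
    · rw [hc.chainE_eq_zero hG (hp 0) (hGp 0) h0 (by linarith) fun j _ t _ => (hw t).1]; simp
    · rw [Nat.le_zero.1 hi]; exact (hw t).1
  | succ r ih =>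
    obtain ⟨θ₁, L, M, hθ₁, hθ₁', hL, H⟩ := ih fun i hi => hc i (by omega)
    obtain ⟨u', v', f', S, θ₂, M', hS, hθ₂, -, hc', hw0, hw1, hM', hb'⟩ :=
      (hc r (by omega)).exists_sampleBound hG (hp _) (hGp _) (hp _) (hGp _) (hE r) hε
    have hpi := Real.pi_pos
    -- Phase matching takes at most `2π` after `y r` and the transition takes `S`. The extra `1`
    -- makes the earlier transitions end before `y r - 1`, as `SampleBound.glue` requires.
    refine ⟨min θ₁ θ₂, L + 1 + 2 * Real.pi + S, max M M', lt_min hθ₁ hθ₂,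
      (min_le_left _ _).trans hθ₁', by positivity, fun y hy => ?_⟩
    obtain ⟨u, v, f, hP⟩ := H y fun i => by linarith [hy i]
    have hymono : Monotone y := monotone_nat_of_le_succ fun i => by linarith [hy i]
    have hwr : ∀ t, y r - 1 ≤ t → cross (u t) (v t) = p r := fun t ht =>
      hP.well r le_rfl t (fun h0 => by
        have := hy (r - 1)
        rw [Nat.sub_add_cancel h0] at this
        linarith) (fun h => (lt_irrefl _ h).elim)
    obtain ⟨τ, hτ0, hτ1, hu, hv⟩ := exists_joining_time hP.curve hc' (hp r) (S := y r) (L := y r)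
      le_rfl (fun t ht => hwr t (by linarith)) (hw0 0 le_rfl)
    have hcs := univ_shift hc' τ
    have hu' : u τ = (fun t => u' (t - τ)) τ := by simpa using hu
    have hv' : v τ = (fun t => v' (t - τ)) τ := by simpa using hv
    refine ⟨glue τ u (fun t => u' (t - τ)), glue τ v (fun t => v' (t - τ)),
      glue τ f (fun t => f' (t - τ)), IsCurve.glue (hP.curve.mono (subset_univ _))
        (hcs.mono (subset_univ _)) isClosed_univ hu' hv', fun t => ?_, ?_, fun i hi t h0 h1 => ?_⟩
    · rcases le_or_gt t τ with h | h
      · rw [glue_of_le h]; exact (hP.bound t).trans (le_max_left _ _)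
      · rw [glue_of_lt h]; exact (hM' _).trans (le_max_right _ _)
    · have := SampleBound.glue hP.curve hcs (hp r) ((min_le_left _ _).trans hθ₁')
        (hP.sample.mono (min_le_left θ₁ θ₂)) ((hb'.shift τ).mono (min_le_right θ₁ θ₂)) hu'
        (fun t ht => hwr t (by linarith [ht.1])) (fun t ht => hw0 _ (by linarith [ht.2]))
      rw [Finset.sum_range_succ]
      push_cast
      convert this using 1
      ring
    · rcases Nat.lt_or_ge i (r + 1) with hir | hir
      · have htr : t ≤ y r := (h1 hir).trans (hymono (by omega))
        rw [glue_of_le (by linarith), glue_of_le (by linarith)]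
        exact hP.well i (by omega) t (fun h => by linarith [h0 h]) (fun h => h1 (by omega))
      · have : i = r + 1 := by omega
        subst this
        have := h0 (by omega)
        rw [Nat.add_sub_cancel] at this
        rw [glue_of_ge hu' (by linarith), glue_of_ge hv' (by linarith)]
        exact hw1 _ (by linarith)

end HelicalXY

end

section

namespace HelicalXY

/-! ### Slicing the square -/

/-- Lebesgue measure on the unit interval. -/
abbrev volI : Measure ℝ := volume.restrict (Ioo 0 1)

/-- The point with coordinates `x` and `y`. -/
def pt (x y : ℝ) : E2 := WithLp.toLp 2 ![x, y]

@[simp] lemma pt_zero (x y : ℝ) : pt x y 0 = x := rfl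

@[simp] lemma pt_one (x y : ℝ) : pt x y 1 = y := rfl

lemma pt_eta (p : E2) : pt (p 0) (p 1) = p := by
  ext i; fin_cases i <;> rfl

/-- The coordinates of a point. -/
def planeEquiv : E2 ≃ᵐ ℝ × ℝ :=
  (MeasurableEquiv.toLp 2 (Fin 2 → ℝ)).symm.trans MeasurableEquiv.finTwoArrow

lemma planeEquiv_apply (p : E2) : planeEquiv p = (p 0, p 1) := rfl

lemma planeEquiv_symm_apply (q : ℝ × ℝ) : planeEquiv.symm q = pt q.1 q.2 := by
  rw [MeasurableEquiv.symm_apply_eq]; rfl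

lemma measurableSet_Omega : MeasurableSet Omega := by
  have : Omega = planeEquiv ⁻¹' (Ioo 0 1 ×ˢ Ioo 0 1) := by
    ext p; simp [Omega, planeEquiv_apply, Fin.forall_fin_two]
  rw [this]
  exact planeEquiv.measurable (measurableSet_Ioo.prod measurableSet_Ioo)

lemma mem_Omega {p : E2} : p ∈ Omega ↔ p 0 ∈ Ioo (0 : ℝ) 1 ∧ p 1 ∈ Ioo (0 : ℝ) 1 := by
  simp [Omega, Fin.forall_fin_two]

lemma measurePreserving_plane : MeasurePreserving planeEquiv volOmega (volI.prod volI) := by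
  have h1 : MeasurePreserving planeEquiv volume volume :=
    (PiLp.volume_preserving_ofLp (Fin 2)).trans (volume_preserving_finTwoArrow ℝ)
  have h2 := h1.restrict_preimage_emb planeEquiv.measurableEmbedding (Ioo 0 1 ×ˢ Ioo 0 1)
  rw [Measure.volume_eq_prod, ← Measure.prod_restrict] at h2
  have : planeEquiv ⁻¹' (Ioo 0 1 ×ˢ Ioo 0 1) = Omega := by
    ext p; simp [Omega, planeEquiv_apply, Fin.forall_fin_two]
  rwa [this] at h2

instance : IsFiniteMeasure volOmega := by
  refine ⟨?_⟩
  have := measurePreserving_plane.measure_preimage MeasurableSet.univ.nullMeasurableSet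
  rw [preimage_univ] at this
  rw [this]
  exact measure_lt_top _ _

instance : (ae volI).NeBot := by
  rw [ae_neBot]
  intro h0
  have : volI univ = 0 := by rw [h0]; rfl
  simp at this

lemma ae_volOmega {P : E2 → Prop} :
    (∀ᵐ p ∂volOmega, P p) ↔ ∀ᵐ q ∂(volI.prod volI), P (pt q.1 q.2) := by
  rw [← measurePreserving_plane.map_eq, planeEquiv.measurableEmbedding.ae_map_iff]
  simp only [planeEquiv_apply, pt_eta]

lemma ae_of_fst {P : ℝ → Prop} (h : ∀ᵐ x ∂volI, P x) : ∀ᵐ p ∂volOmega, P (p 0) := by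
  rw [ae_volOmega]
  exact Measure.quasiMeasurePreserving_fst.ae h

lemma ae_ae_fst {P : E2 → Prop} (h : ∀ᵐ p ∂volOmega, P p) : ∀ᵐ x ∂volI, ∀ᵐ y ∂volI, P (pt x y) := by
  rw [ae_volOmega] at h
  exact Measure.ae_ae_of_ae_prod h

lemma ae_ae_snd {P : E2 → Prop} (h : ∀ᵐ p ∂volOmega, P p) : ∀ᵐ y ∂volI, ∀ᵐ x ∂volI, P (pt x y) := by
  rw [ae_volOmega] at h
  have := (Measure.measurePreserving_swap (μ := volI) (ν := volI)).quasiMeasurePreserving.ae h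
  exact Measure.ae_ae_of_ae_prod this

lemma ae_of_ae_ae_fst {P : ℝ → Prop} (h : ∀ᵐ p ∂volOmega, P (p 0)) : ∀ᵐ x ∂volI, P x := by
  obtain ⟨y, hy⟩ := (ae_ae_snd h).exists
  exact hy

lemma lintegral_volOmega {F : E2 → ℝ≥0∞} (hF : AEMeasurable F volOmega) :
    ∫⁻ p, F p ∂volOmega = ∫⁻ y, ∫⁻ x, F (pt x y) ∂volI ∂volI := by
  have h1 := measurePreserving_plane.symm.lintegral_comp_emb planeEquiv.symm.measurableEmbedding F
  rw [← h1]
  have hF' : AEMeasurable (fun q => F (planeEquiv.symm q)) (volI.prod volI) :=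
    AEMeasurable.comp_quasiMeasurePreserving hF measurePreserving_plane.symm.quasiMeasurePreserving
  rw [lintegral_prod_symm _ hF']
  simp only [planeEquiv_symm_apply]

lemma integral_volOmega {F : E2 → ℝ} (hF : Integrable F volOmega) :
    ∫ p, F p ∂volOmega = ∫ y, ∫ x, F (pt x y) ∂volI ∂volI := by
  have h1 := measurePreserving_plane.symm.integral_comp planeEquiv.symm.measurableEmbedding F
  rw [← h1]
  have hF' : Integrable (fun q => F (planeEquiv.symm q)) (volI.prod volI) :=
    (measurePreserving_plane.symm.integrable_comp_emb planeEquiv.symm.measurableEmbedding).2 hF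
  rw [integral_prod_symm _ hF']
  simp only [planeEquiv_symm_apply]

lemma integral_volOmega' {F : E2 → ℝ} (hF : Integrable F volOmega) :
    ∫ p, F p ∂volOmega = ∫ x, ∫ y, F (pt x y) ∂volI ∂volI := by
  have h1 := measurePreserving_plane.symm.integral_comp planeEquiv.symm.measurableEmbedding F
  rw [← h1]
  have hF' : Integrable (fun q => F (planeEquiv.symm q)) (volI.prod volI) :=
    (measurePreserving_plane.symm.integrable_comp_emb planeEquiv.symm.measurableEmbedding).2 hF
  rw [integral_prod _ hF']
  simp only [planeEquiv_symm_apply]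

end HelicalXY

end

section

namespace HelicalXY

/-! ### Functions with finitely many jumps -/

variable {X : Type*} {f : ℝ → X} {L : Set ℝ}

/-- `t 0 < … < t m` are points of `L` with `f (t i) ≠ f (t (i + 1))`. -/
def IsJumpChain (f : ℝ → X) (L : Set ℝ) (m : ℕ) (t : ℕ → ℝ) : Prop :=
  (∀ i ≤ m, t i ∈ L) ∧ ∀ i < m, t i < t (i + 1) ∧ f (t i) ≠ f (t (i + 1))

lemma IsJumpChain.prefix {m i : ℕ} {t : ℕ → ℝ} (h : IsJumpChain f L m t) (hi : i ≤ m) :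
    IsJumpChain f L i t :=
  ⟨fun j hj => h.1 j (hj.trans hi), fun j hj => h.2 j (hj.trans_le hi)⟩

lemma IsJumpChain.suffix {m i : ℕ} {t : ℕ → ℝ} (h : IsJumpChain f L m t) (hi : i ≤ m) :
    IsJumpChain f L (m - i) (fun j => t (i + j)) :=
  ⟨fun j hj => h.1 _ (by omega), fun j hj => h.2 (i + j) (by omega)⟩

lemma isJumpChain_singleton {s : ℝ} (hs : s ∈ L) : IsJumpChain f L 0 (fun _ => s) :=
  ⟨fun _ _ => hs, fun _ h => (Nat.not_lt_zero _ h).elim⟩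

lemma IsJumpChain.concat {m m' : ℕ} {t t' : ℕ → ℝ} (h : IsJumpChain f L m t)
    (h' : IsJumpChain f L m' t') (hlt : t m < t' 0) (hne : f (t m) ≠ f (t' 0)) :
    ∃ t'', IsJumpChain f L (m + m' + 1) t'' ∧ t'' 0 = t 0 ∧ t'' (m + m' + 1) = t' m' := by
  refine ⟨fun j => if j ≤ m then t j else t' (j - (m + 1)), ⟨fun j hj => ?_, fun j hj => ?_⟩, ?_, ?_⟩
  · beta_reduce
    split_ifs with hjm
    · exact h.1 j hjm
    · exact h'.1 _ (by omega)
  · beta_reduce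
    rcases lt_trichotomy j m with hjm | rfl | hjm
    · rw [if_pos hjm.le, if_pos (by omega)]; exact h.2 j hjm
    · rw [if_pos le_rfl, if_neg (by omega), Nat.sub_self]; exact ⟨hlt, hne⟩
    · rw [if_neg (by omega), if_neg (by omega), show j + 1 - (m + 1) = j - (m + 1) + 1 by omega]
      exact h'.2 _ (by omega)
  · beta_reduce
    rw [if_pos (Nat.zero_le _)]
  · beta_reduce
    rw [if_neg (by omega)]; congr 1; omega

/-- A step function on the unit interval, with values `p 0, …, p m` between the jump points
`0 = x 0 < x 1 < … < x (m + 1) = 1`. -/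
structure IsStep (f : ℝ → X) (m : ℕ) (x : ℕ → ℝ) (p : ℕ → X) : Prop where
  zero : x 0 = 0
  one : x (m + 1) = 1
  lt : ∀ i ≤ m, x i < x (i + 1)
  ne : ∀ i < m, p i ≠ p (i + 1)
  ae : ∀ i ≤ m, ∀ᵐ s, s ∈ Ioo (x i) (x (i + 1)) → f s = p i

/-- Almost every point is a point at which `f` recurs. -/
lemma exists_recurrent {W : Set X} (hW : W.Countable) (hLW : ∀ s ∈ L, f s ∈ W)
    (hL : ∀ᵐ t ∂volI, t ∈ L) :
    ∃ L' ⊆ L, (∀ᵐ t ∂volI, t ∈ L') ∧ ∀ t ∈ L', ∀ a b, a < t → t < b →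
      ∃ s ∈ L', s ≠ t ∧ a < s ∧ s < b ∧ f s = f t := by
  set A : X → ℝ → ℝ → Set ℝ := fun p a b => {s | s ∈ L ∧ f s = p ∧ a < s ∧ s < b} with hA
  -- With rational end points and countably many values, only countably many null sets are
  -- discarded.
  have hnull : ∀ᵐ t, ∀ p ∈ W, ∀ a b : ℚ, volume (A p a b) = 0 → t ∉ A p a b := by
    refine (ae_ball_iff hW).2 fun p _ => ae_all_iff.2 fun a => ae_all_iff.2 fun b => ?_
    by_cases h : volume (A p a b) = 0
    · filter_upwards [measure_eq_zero_iff_ae_notMem.1 h] with t ht _ using ht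
    · exact ae_of_all _ fun t ht => (h ht).elim
  set L' : Set ℝ := {t | t ∈ L ∧ ∀ p ∈ W, ∀ a b : ℚ, volume (A p a b) = 0 → t ∉ A p a b} with hL'
  refine ⟨L', fun t ht => ht.1, ?_, fun t ht a b ha hb => ?_⟩
  · filter_upwards [hL, ae_restrict_of_ae hnull] with t h1 h2 using ⟨h1, h2⟩
  · obtain ⟨a', ha1, ha2⟩ := exists_rat_btwn ha
    obtain ⟨b', hb1, hb2⟩ := exists_rat_btwn hb
    have h1 : volume (A (f t) a' b') ≠ 0 := fun h =>
      ht.2 _ (hLW t ht.1) a' b' h ⟨ht.1, rfl, ha2, hb1⟩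
    by_contra! hc
    refine h1 (measure_eq_zero_iff_ae_notMem.2 ?_)
    have hne : ∀ᵐ s : ℝ, s ≠ t := by simp [ae_iff]
    filter_upwards [hnull, hne] with s hs hst hsA
    exact hc s ⟨hsA.1, hs⟩ hst (ha1.trans hsA.2.2.1) (hsA.2.2.2.trans hb2) hsA.2.1

/-- A function without long chains of jumps is a step function. -/
theorem exists_isStep (hL : ∀ᵐ t ∂volI, t ∈ L) (hL0 : L ⊆ Ioo 0 1)
    (hrec : ∀ t ∈ L, ∀ a b, a < t → t < b → ∃ s ∈ L, s ≠ t ∧ a < s ∧ s < b ∧ f s = f t)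
    {K : ℕ} (hK : ∀ m t, IsJumpChain f L m t → m ≤ K) :
    ∃ m x t, IsStep f m x (fun i => f (t i)) ∧ IsJumpChain f L m t := by
  classical
  obtain ⟨s₀, hs₀⟩ := hL.exists
  set P : ℕ → Prop := fun m => ∃ t, IsJumpChain f L m t with hP
  have hP0 : P 0 := ⟨_, isJumpChain_singleton hs₀⟩
  obtain ⟨m, ⟨t, ht⟩, hmax⟩ : ∃ m, P m ∧ ∀ n, P n → n ≤ m :=
    ⟨Nat.findGreatest P K, Nat.findGreatest_spec (Nat.zero_le K) hP0, fun n hn =>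
      Nat.le_findGreatest (hK n hn.choose hn.choose_spec) hn⟩
  -- The chain `t` has maximal length. Each of the following facts holds because otherwise one or
  -- two more points could be inserted.
  have hmax' : ∀ n t', IsJumpChain f L n t' → n ≤ m := fun n t' h => hmax n ⟨t', h⟩
  have hfirst : ∀ s ∈ L, s < t 0 → f s = f (t 0) := fun s hs hlt => by
    by_contra hc
    obtain ⟨t', h', -⟩ := (isJumpChain_singleton hs).concat ht hlt hc
    have := hmax' _ _ h'
    omega
  have hlast : ∀ s ∈ L, t m < s → f s = f (t m) := fun s hs hlt => by
    by_contra hc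
    obtain ⟨t', h', -⟩ := ht.concat (isJumpChain_singleton hs) hlt (Ne.symm hc)
    have := hmax' _ _ h'
    omega
  have hmid : ∀ i < m, ∀ s ∈ L, t i < s → s < t (i + 1) → f s = f (t i) ∨ f s = f (t (i + 1)) := by
    intro i hi s hs h1 h2
    by_contra! hc
    obtain ⟨t', h', -, e'⟩ := (ht.prefix hi.le).concat (isJumpChain_singleton hs) h1 hc.1.symm
    obtain ⟨t'', h'', -⟩ := h'.concat (ht.suffix (i := i + 1) hi) (by rw [e']; exact h2)
      (by rw [e']; exact hc.2)
    have := hmax' _ _ h''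
    omega
  have hswitch : ∀ i < m, ∀ s ∈ L, ∀ s' ∈ L, t i < s → s < s' → s' < t (i + 1) →
      f s = f (t (i + 1)) → f s' = f (t (i + 1)) := by
    intro i hi s hs s' hs' h1 h2 h3 he
    rcases hmid i hi s' hs' (h1.trans h2) h3 with he' | he'
    swap
    · exact he'
    exfalso
    have hneq := (ht.2 i hi).2
    obtain ⟨t', h', -, e'⟩ := (ht.prefix hi.le).concat (isJumpChain_singleton hs) h1 (by rwa [he])
    obtain ⟨t'', h'', -, e''⟩ := h'.concat (isJumpChain_singleton hs') (by rw [e']; exact h2)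
      (by rw [e', he, he']; exact hneq.symm)
    obtain ⟨t''', h''', -⟩ := h''.concat (ht.suffix (i := i + 1) hi) (by rw [e'']; exact h3)
      (by rw [e'', he']; exact hneq)
    have := hmax' _ _ h'''
    omega
  -- the jump points
  set A : ℕ → Set ℝ := fun i => {s | s ∈ L ∧ t i ≤ s ∧ s ≤ t (i + 1) ∧ f s = f (t i)} with hA
  have hAt : ∀ i < m, t i ∈ A i := fun i hi => ⟨ht.1 i hi.le, le_rfl, (ht.2 i hi).1.le, rfl⟩
  have hAb : ∀ i, BddAbove (A i) := fun i => ⟨t (i + 1), fun s hs => hs.2.2.1⟩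
  -- The `i`-th jump is put at the supremum of the points up to `t i` that still carry the value of
  -- `t (i - 1)`. By `hswitch` the function does not switch back.
  set x : ℕ → ℝ := fun i => if i = 0 then 0 else if i ≤ m then sSup (A (i - 1)) else 1 with hx
  have hx0 : x 0 = 0 := if_pos rfl
  have hx1 : x (m + 1) = 1 := by simp [hx]
  have hxi : ∀ i < m, x (i + 1) = sSup (A i) := fun i hi => by
    simp only [hx]; rw [if_neg (by omega), if_pos (by omega), Nat.add_sub_cancel]
  have hxl : ∀ i < m, t i ≤ x (i + 1) := fun i hi => by
    rw [hxi i hi]; exact le_csSup (hAb i) (hAt i hi)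
  have hxu : ∀ i < m, x (i + 1) ≤ t (i + 1) := fun i hi => by
    rw [hxi i hi]; exact csSup_le ⟨_, hAt i hi⟩ fun s hs => hs.2.2.1
  have hleft : ∀ i ≤ m, ∀ s ∈ L, x i < s → s ≤ t i → f s = f (t i) := by
    intro i hi s hs h1 h2
    rcases h2.eq_or_lt with rfl | h2
    · rfl
    rcases Nat.eq_zero_or_pos i with rfl | hi0
    · exact hfirst s hs h2
    obtain ⟨j, rfl⟩ : ∃ j, i = j + 1 := ⟨i - 1, by omega⟩
    have h3 := (hxl j (by omega)).trans_lt h1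
    refine (hmid j (by omega) s hs h3 h2).resolve_left fun he => ?_
    rw [hxi j (by omega)] at h1
    exact absurd (le_csSup (hAb j) (⟨hs, h3.le, h2.le, he⟩ : s ∈ A j)) (not_le.2 h1)
  have hright : ∀ i ≤ m, ∀ s ∈ L, t i ≤ s → s < x (i + 1) → f s = f (t i) := by
    intro i hi s hs h1 h2
    rcases h1.eq_or_lt with rfl | h1
    · rfl
    rcases hi.eq_or_lt with rfl | hi
    · exact hlast s hs h1
    rw [hxi i hi] at h2
    obtain ⟨s', hs', hss⟩ := exists_lt_of_lt_csSup ⟨_, hAt i hi⟩ h2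
    have hneq := (ht.2 i hi).2
    have h3 : s' < t (i + 1) := lt_of_le_of_ne hs'.2.2.1 fun he => hneq (by
      rw [← hs'.2.2.2, he])
    refine (hmid i hi s hs h1 (hss.trans h3)).resolve_right fun he => ?_
    have := hswitch i hi s hs s' hs'.1 h1 hss h3 he
    exact hneq (hs'.2.2.2.symm.trans this)
  have htm : ∀ i ≤ m, x i ≤ t i ∧ t i ≤ x (i + 1) := fun i hi => by
    constructor
    · rcases Nat.eq_zero_or_pos i with rfl | hi0
      · rw [hx0]; exact (hL0 (ht.1 0 (Nat.zero_le _))).1.le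
      · obtain ⟨j, rfl⟩ : ∃ j, i = j + 1 := ⟨i - 1, by omega⟩
        exact hxu j (by omega)
    · rcases hi.eq_or_lt with rfl | hi
      · rw [hx1]; exact (hL0 (ht.1 _ le_rfl)).2.le
      · exact hxl i hi
  refine ⟨m, x, t, ⟨hx0, hx1, fun i hi => ?_, fun i hi => (ht.2 i hi).2, fun i hi => ?_⟩, ht⟩
  · obtain ⟨h1, h2⟩ := htm i hi
    refine lt_of_le_of_ne (h1.trans h2) fun he => ?_
    have e1 : x i = t i := le_antisymm h1 (by rw [he]; exact h2)
    have e2 : x (i + 1) = t i := by rw [← he, e1]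
    have i0 : i ≠ 0 := by
      rintro rfl
      rw [hx0] at e1
      exact absurd (hL0 (ht.1 0 hi)).1 (by rw [← e1]; exact lt_irrefl _)
    have im : i ≠ m := by
      rintro rfl
      rw [hx1] at e2
      exact absurd (hL0 (ht.1 _ hi)).2 (by rw [← e2]; exact lt_irrefl _)
    obtain ⟨j, rfl⟩ : ∃ j, i = j + 1 := ⟨i - 1, by omega⟩
    have him : j + 1 < m := by omega
    -- If two jump points coincided, the value at `t (j + 1)` would be taken only at that point
    -- between its neighbours; recurrence supplies a second one.
    obtain ⟨s, hs, hst, ha, hb, hfs⟩ := hrec (t (j + 1)) (ht.1 _ hi) (t j) (t (j + 1 + 1))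
      (ht.2 j (by omega)).1 (ht.2 (j + 1) him).1
    rcases lt_or_gt_of_ne hst with hlt | hgt
    · -- values at `s` and beyond agree with the one at `t (j + 1)`
      have : x (j + 1) ≤ s := by
        rw [hxi j (by omega)]
        refine csSup_le ⟨_, hAt j (by omega)⟩ fun r hr => ?_
        by_contra! hc
        have hneq := (ht.2 j (by omega)).2
        rcases hr.2.2.1.eq_or_lt with he' | hlt'
        · exact hneq (by rw [← hr.2.2.2, he'])
        · exact hneq (hr.2.2.2.symm.trans (hswitch j (by omega) s hs r hr.1 ha hc hlt' hfs))
      linarith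
    · have : s ≤ x (j + 1 + 1) := by
        rw [hxi (j + 1) him]
        exact le_csSup (hAb _) ⟨hs, hgt.le, hb.le, hfs⟩
      linarith
  · have hbd : Ioo (x i) (x (i + 1)) ⊆ Ioo 0 1 := by
      have h0 : 0 ≤ x i := by
        rcases Nat.eq_zero_or_pos i with rfl | hi0
        · exact hx0.ge
        · obtain ⟨j, rfl⟩ : ∃ j, i = j + 1 := ⟨i - 1, by omega⟩
          exact (hL0 (ht.1 j (by omega))).1.le.trans (hxl j (by omega))
      have h1 : x (i + 1) ≤ 1 := by
        rcases hi.eq_or_lt with rfl | hi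
        · exact hx1.le
        · exact (hxu i hi).trans (hL0 (ht.1 _ hi)).2.le
      exact Ioo_subset_Ioo h0 h1
    filter_upwards [(ae_restrict_iff' measurableSet_Ioo).1 hL] with s hs hsx
    have hsL := hs (hbd hsx)
    rcases le_total s (t i) with h | h
    · exact hleft i hi s hsL hsx.1 h
    · exact hright i hi s hsL h hsx.2

end HelicalXY

end

section

namespace HelicalXY

/-! ### The limit energy of a step function -/

lemma isApproxLim_of_ae {z : E2 → E3} {A : E2 → Set E2} {p : E2} {a : E3} {r₀ : ℝ} (hr₀ : 0 < r₀)
    (h : ∀ᵐ x, x ∈ Metric.ball p r₀ ∩ A p → z x = a) (hA : MeasurableSet (A p)) :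
    IsApproxLim z A p a := by
  refine tendsto_const_nhds.congr' ?_
  filter_upwards [Ioo_mem_nhdsGT hr₀] with r hr
  have : (fun x => ‖z x - a‖) =ᵐ[volume.restrict (Metric.ball p r ∩ A p)] fun _ => (0 : ℝ) := by
    rw [EventuallyEq, ae_restrict_iff' (Metric.isOpen_ball.measurableSet.inter hA)]
    filter_upwards [h] with x hx hxr
    rw [hx ⟨Metric.ball_subset_ball hr.2.le hxr.1, hxr.2⟩, sub_self, norm_zero]
  rw [average_congr this]
  simp

/-- The ball of radius `r / 2` centred at `p + (r / 2) σ` lies in `H`, where `z = b`, and fills a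
quarter of the disc of radius `r`. So the averages of `‖z - a‖` are at least `‖b - a‖ / 4`. -/
lemma isApproxLim_unique {z : E2 → E3} {A : E2 → Set E2} {p σ : E2} {a b : E3} {r₀ : ℝ}
    {H : Set E2} (hr₀ : 0 < r₀) (hz : IntegrableOn z (Metric.ball p r₀)) (hσ : ‖σ‖ ≤ 1)
    (hH : ∀ r, 0 < r → Metric.ball (p + (r / 2) • σ) (r / 2) ⊆ H) (hHA : H ⊆ A p)
    (hb : ∀ᵐ x, x ∈ Metric.ball p r₀ ∩ H → z x = b) (ha : IsApproxLim z A p a) : a = b := by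
  have key : ∀ᶠ r in 𝓝[>] (0 : ℝ),
      (1 / 4) * ‖b - a‖ ≤ ⨍ x in Metric.ball p r ∩ A p, ‖z x - a‖ := by
    filter_upwards [Ioo_mem_nhdsGT hr₀] with r hr
    set S := Metric.ball (p + (r / 2) • σ) (r / 2) with hS
    have hSb : S ⊆ Metric.ball p r := by
      refine Metric.ball_subset_ball' ?_
      rw [dist_eq_norm, add_sub_cancel_left, norm_smul, Real.norm_of_nonneg (by linarith [hr.1])]
      nlinarith [hr.1]
    have hSA : S ⊆ Metric.ball p r ∩ A p := subset_inter hSb ((hH r hr.1).trans hHA)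
    have hint : IntegrableOn (fun x => ‖z x - a‖) (Metric.ball p r ∩ A p) := by
      have h1 : IntegrableOn z (Metric.ball p r ∩ A p) :=
        hz.mono_set (inter_subset_left.trans (Metric.ball_subset_ball hr.2.le))
      have h2 : IntegrableOn (fun _ => a) (Metric.ball p r ∩ A p) :=
        integrableOn_const (((measure_mono inter_subset_left).trans_lt measure_ball_lt_top).ne)
      exact (h1.sub h2).norm
    have h1 : ∫ x in S, ‖z x - a‖ = volume.real S * ‖b - a‖ := by
      have : (fun x => ‖z x - a‖) =ᵐ[volume.restrict S] fun _ => ‖b - a‖ := by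
        rw [EventuallyEq, ae_restrict_iff' Metric.isOpen_ball.measurableSet]
        filter_upwards [hb] with x hx hxS
        rw [hx ⟨Metric.ball_subset_ball hr.2.le (hSb hxS), hH r hr.1 hxS⟩]
      rw [integral_congr_ae this, setIntegral_const, smul_eq_mul]
    have h2 : ∫ x in S, ‖z x - a‖ ≤ ∫ x in Metric.ball p r ∩ A p, ‖z x - a‖ :=
      setIntegral_mono_set hint (ae_of_all _ fun _ => norm_nonneg _) hSA.eventuallyLE
    have h3 : volume.real S = (1 / 4) * volume.real (Metric.ball p r) := by
      rw [hS, measureReal_def, measureReal_def,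
        Measure.addHaar_ball _ _ (by linarith [hr.1] : (0 : ℝ) ≤ r / 2),
        Measure.addHaar_ball _ _ hr.1.le, ENNReal.toReal_mul, ENNReal.toReal_mul,
        ENNReal.toReal_ofReal (by have := hr.1; positivity), ENNReal.toReal_ofReal (by have := hr.1; positivity)]
      simp only [finrank_euclideanSpace, Fintype.card_fin]
      ring
    have h4 : volume.real (Metric.ball p r ∩ A p) ≤ volume.real (Metric.ball p r) :=
      measureReal_mono inter_subset_left measure_ball_lt_top.ne
    have h5 : 0 < volume.real (Metric.ball p r) :=
      ENNReal.toReal_pos (Metric.measure_ball_pos _ _ hr.1).ne' measure_ball_lt_top.ne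
    have h6 : 0 < volume.real (Metric.ball p r ∩ A p) := by
      refine lt_of_lt_of_le ?_ (measureReal_mono hSA
        ((measure_mono inter_subset_left).trans_lt measure_ball_lt_top).ne)
      rw [h3]; positivity
    rw [setAverage_eq, smul_eq_mul, ← div_eq_inv_mul, le_div_iff₀ h6]
    calc 1 / 4 * ‖b - a‖ * volume.real (Metric.ball p r ∩ A p)
        ≤ 1 / 4 * ‖b - a‖ * volume.real (Metric.ball p r) := by gcongr
      _ = volume.real S * ‖b - a‖ := by rw [h3]; ring
      _ ≤ _ := by rw [← h1]; exact h2
  have := ge_of_tendsto ha key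
  have h0 : ‖b - a‖ = 0 := le_antisymm (by linarith) (norm_nonneg _)
  exact (sub_eq_zero.1 (norm_eq_zero.1 h0)).symm

lemma approxLim_eq {z : E2 → E3} {A : E2 → Set E2} {p : E2} {a : E3}
    (h : IsApproxLim z A p a) (hu : ∀ b, IsApproxLim z A p b → b = a) : approxLim z A p = a := by
  have h' : ∃ a, IsApproxLim z A p a := ⟨a, h⟩
  rw [approxLim, dif_pos h']
  exact hu _ h'.choose_spec

/-- The first unit vector of the plane. -/
def e₀ : E2 := EuclideanSpace.single 0 1

lemma norm_e₀ : ‖e₀‖ = 1 := by simp [e₀]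

lemma e₀_zero : e₀ 0 = 1 := by simp [e₀]

lemma abs_coord_sub_lt {p x : E2} {r : ℝ} (h : x ∈ Metric.ball p r) (i : Fin 2) :
    |x i - p i| < r := by
  rw [Metric.mem_ball, dist_eq_norm] at h
  have := PiLp.norm_apply_le (x - p) i
  rw [PiLp.sub_apply, Real.norm_eq_abs] at this
  exact this.trans_lt h

lemma ball_right_subset (p : E2) (r : ℝ) :
    Metric.ball (p + (r / 2) • e₀) (r / 2) ⊆ {x | p 0 < x 0} := fun x hx => by
  have := abs_coord_sub_lt hx 0
  simp only [PiLp.add_apply, PiLp.smul_apply, e₀_zero, smul_eq_mul, mul_one] at this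
  rw [abs_lt] at this
  show p 0 < x 0
  linarith

lemma ball_left_subset (p : E2) (r : ℝ) :
    Metric.ball (p + (r / 2) • -e₀) (r / 2) ⊆ {x | x 0 < p 0} := fun x hx => by
  have := abs_coord_sub_lt hx 0
  simp only [PiLp.add_apply, PiLp.smul_apply, PiLp.neg_apply, e₀_zero, smul_eq_mul, mul_one,
    mul_neg] at this
  rw [abs_lt] at this
  show x 0 < p 0
  linarith

lemma isOpen_Omega : IsOpen Omega := by
  have : Omega = (fun p : E2 => p 0) ⁻¹' Ioo 0 1 ∩ (fun p : E2 => p 1) ⁻¹' Ioo 0 1 := by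
    ext p; simp [mem_Omega]
  rw [this]
  exact (isOpen_Ioo.preimage (by fun_prop)).inter (isOpen_Ioo.preimage (by fun_prop))

/-! ### The discontinuity set of a step function. -/

variable {z₀ : ℝ → E3} {m : ℕ} {x : ℕ → ℝ} {P : ℕ → E3}

lemma IsStep.lt_of_lt (h : IsStep z₀ m x P) {i j : ℕ} (hij : i < j) (hj : j ≤ m + 1) : x i < x j := by
  induction j, hij using Nat.le_induction with
  | base => exact h.lt _ (by omega)
  | succ k hk ih => exact (ih (by omega)).trans (h.lt k (by omega))

lemma IsStep.mem_Ioo (h : IsStep z₀ m x P) {i : ℕ} (h0 : 0 < i) (hi : i ≤ m) :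
    x i ∈ Ioo (0 : ℝ) 1 :=
  ⟨by rw [← h.zero]; exact h.lt_of_lt h0 (by omega), by rw [← h.one]; exact h.lt_of_lt (by omega) le_rfl⟩

lemma IsStep.exists_mem (h : IsStep z₀ m x P) {s : ℝ} (hs : s ∈ Ioo (0 : ℝ) 1) :
    (∃ i ≤ m, s ∈ Ioo (x i) (x (i + 1))) ∨ ∃ i < m, s = x (i + 1) := by
  classical
  have h0 : x 0 ≤ s := by rw [h.zero]; exact hs.1.le
  have h1 := Nat.findGreatest_spec (P := fun i => x i ≤ s) (Nat.zero_le (m + 1)) h0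
  set i := Nat.findGreatest (fun i => x i ≤ s) (m + 1) with hi
  have him : i ≤ m + 1 := Nat.findGreatest_le _
  have him' : i ≠ m + 1 := fun he => by
    rw [he, h.one] at h1; exact absurd hs.2 (not_lt.2 h1)
  have h2 : s < x (i + 1) := by
    by_contra! hc
    have := Nat.le_findGreatest (P := fun i => x i ≤ s) (by omega : i + 1 ≤ m + 1) hc
    omega
  rcases h1.eq_or_lt with he | hlt
  · right
    have : i ≠ 0 := fun h0' => by rw [h0', h.zero] at he; exact absurd hs.1 (by rw [← he]; exact lt_irrefl _)
    exact ⟨i - 1, by omega, by rw [Nat.sub_add_cancel (by omega)]; exact he.symm⟩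
  · exact Or.inl ⟨i, by omega, hlt, h2⟩

variable {z : E2 → E3}

lemma IsStep.ae_plane (h : IsStep z₀ m x P) (hz : ∀ᵐ p ∂volOmega, z p = z₀ (p 0)) {i : ℕ}
    (hi : i ≤ m) : ∀ᵐ p, p ∈ Omega → p 0 ∈ Ioo (x i) (x (i + 1)) → z p = P i := by
  have h1 := ae_of_fst (ae_restrict_of_ae (s := Ioo 0 1) (h.ae i hi))
  have h2 : ∀ᵐ p ∂volOmega, p 0 ∈ Ioo (x i) (x (i + 1)) → z p = P i := by
    filter_upwards [hz, h1] with p hp hp' hpx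
    rw [hp, hp' hpx]
  exact (ae_restrict_iff' measurableSet_Omega).1 h2

lemma exists_ball_subset {p : E2} (hp : p ∈ Omega) {a b : ℝ} (hab : p 0 ∈ Ioo a b) :
    ∃ r₀ > 0, Metric.ball p r₀ ⊆ {q | q ∈ Omega ∧ q 0 ∈ Ioo a b} := by
  have : IsOpen {q : E2 | q ∈ Omega ∧ q 0 ∈ Ioo a b} :=
    isOpen_Omega.inter (isOpen_Ioo.preimage (by fun_prop : Continuous fun q : E2 => q 0))
  exact Metric.isOpen_iff.1 this p ⟨hp, hab⟩

lemma measurableSet_lt_fst (s : ℝ) : MeasurableSet {q : E2 | s < q 0} :=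
  (isOpen_Ioi.preimage (by fun_prop : Continuous fun q : E2 => q 0)).measurableSet

lemma measurableSet_fst_lt (s : ℝ) : MeasurableSet {q : E2 | q 0 < s} :=
  (isOpen_Iio.preimage (by fun_prop : Continuous fun q : E2 => q 0)).measurableSet

lemma IsStep.exists_isApproxLim (h : IsStep z₀ m x P) (hz : ∀ᵐ p ∂volOmega, z p = z₀ (p 0))
    {p : E2} (hp : p ∈ Omega) {i : ℕ} (hi : i ≤ m) (hpi : p 0 ∈ Ioo (x i) (x (i + 1))) :
    IsApproxLim z (fun _ => univ) p (P i) := by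
  obtain ⟨r₀, hr₀, hsub⟩ := exists_ball_subset hp hpi
  refine isApproxLim_of_ae hr₀ ?_ MeasurableSet.univ
  filter_upwards [h.ae_plane hz hi] with q hq hqr
  exact hq (hsub hqr.1).1 (hsub hqr.1).2

/-- Near the point `z` is constant on each half-disc. A full approximate limit would have to equal
both of these distinct values. -/
lemma IsStep.jump (h : IsStep z₀ m x P) (hz : ∀ᵐ p ∂volOmega, z p = z₀ (p 0))
    (hint : Integrable z volOmega) {p : E2} (hp : p ∈ Omega) {i : ℕ} (hi : i < m)
    (hpi : p 0 = x (i + 1)) :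
    leftLim z p = P i ∧ rightLim z p = P (i + 1) ∧ ¬ ∃ a, IsApproxLim z (fun _ => univ) p a := by
  obtain ⟨r₀, hr₀, hsub⟩ := exists_ball_subset hp (a := x i) (b := x (i + 1 + 1))
    ⟨by rw [hpi]; exact h.lt i hi.le, by rw [hpi]; exact h.lt (i + 1) hi⟩
  have hint' : IntegrableOn z (Metric.ball p r₀) :=
    IntegrableOn.mono_set hint fun q hq => (hsub hq).1
  have hl : ∀ᵐ q, q ∈ Metric.ball p r₀ ∩ {q | q 0 < p 0} → z q = P i := by
    filter_upwards [h.ae_plane hz hi.le] with q hq hqr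
    exact hq (hsub hqr.1).1 ⟨(hsub hqr.1).2.1, by rw [← hpi]; exact hqr.2⟩
  have hr : ∀ᵐ q, q ∈ Metric.ball p r₀ ∩ {q | p 0 < q 0} → z q = P (i + 1) := by
    filter_upwards [h.ae_plane hz (i := i + 1) hi] with q hq hqr
    exact hq (hsub hqr.1).1 ⟨by rw [← hpi]; exact hqr.2, (hsub hqr.1).2.2⟩
  have hul : ∀ (A : E2 → Set E2), {q | q 0 < p 0} ⊆ A p → ∀ b, IsApproxLim z A p b → b = P i :=
    fun A hA b hb => isApproxLim_unique hr₀ hint' (by rw [norm_neg, norm_e₀])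
      (fun r _ => ball_left_subset p r) hA hl hb
  have hur : ∀ (A : E2 → Set E2), {q | p 0 < q 0} ⊆ A p → ∀ b, IsApproxLim z A p b → b = P (i + 1) :=
    fun A hA b hb => isApproxLim_unique hr₀ hint' norm_e₀.le
      (fun r _ => ball_right_subset p r) hA hr hb
  refine ⟨approxLim_eq ?_ (hul _ subset_rfl), approxLim_eq ?_ (hur _ subset_rfl), ?_⟩
  · exact isApproxLim_of_ae hr₀ hl (measurableSet_fst_lt _)
  · exact isApproxLim_of_ae hr₀ hr (measurableSet_lt_fst _)
  · rintro ⟨a, ha⟩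
    exact h.ne i hi ((hul _ (subset_univ _) a ha).symm.trans (hur _ (subset_univ _) a ha))

lemma vertical_eq_image (s : ℝ) (hs : s ∈ Ioo (0 : ℝ) 1) :
    {p | p ∈ Omega ∧ p 0 = s} = pt s '' Ioo 0 1 := by
  ext p
  constructor
  · rintro ⟨hp, rfl⟩
    exact ⟨p 1, (mem_Omega.1 hp).2, pt_eta p⟩
  · rintro ⟨t, ht, rfl⟩
    exact ⟨mem_Omega.2 ⟨hs, ht⟩, rfl⟩

lemma isometry_pt (s : ℝ) : Isometry (pt s) := by
  refine Isometry.of_dist_eq fun a b => ?_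
  rw [EuclideanSpace.dist_eq, Fin.sum_univ_two]
  simp [dist_nonneg]

lemma hausdorffMeasure_vertical {s : ℝ} (hs : s ∈ Ioo (0 : ℝ) 1) :
    Measure.hausdorffMeasure 1 {p | p ∈ Omega ∧ p 0 = s} = 1 := by
  rw [vertical_eq_image s hs, (isometry_pt s).hausdorffMeasure_image (Or.inl zero_le_one),
    hausdorffMeasure_real]
  simp

/-- The discontinuity set consists of `m` disjoint vertical segments of length one, and the
integrand is constant on each. -/
theorem IsStep.lintegral_transition (h : IsStep z₀ m x P)
    (hz : ∀ᵐ p ∂volOmega, z p = z₀ (p 0)) (hint : Integrable z volOmega) (G : E3 → ℝ) :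
    ∫⁻ p in discontinuitySet z, transition G (leftLim z p) (rightLim z p)
      ∂(Measure.hausdorffMeasure 1) = ∑ i ∈ Finset.range m, transition G (P i) (P (i + 1)) := by
  have hset : discontinuitySet z = ⋃ i ∈ Finset.range m, {p | p ∈ Omega ∧ p 0 = x (i + 1)} := by
    ext p
    simp only [mem_iUnion, Finset.mem_range, exists_prop]
    constructor
    · rintro ⟨hp, hn⟩
      rcases h.exists_mem (mem_Omega.1 hp).1 with ⟨i, hi, hpi⟩ | ⟨i, hi, hpi⟩
      · exact (hn ⟨_, h.exists_isApproxLim hz hp hi hpi⟩).elim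
      · exact ⟨i, hi, hp, hpi⟩
    · rintro ⟨i, hi, hp, hpi⟩
      exact ⟨hp, (h.jump hz hint hp hi hpi).2.2⟩
  have hmeas : ∀ s : ℝ, MeasurableSet {p | p ∈ Omega ∧ p 0 = s} := fun s =>
    measurableSet_Omega.inter
      (isClosed_singleton.preimage (by fun_prop : Continuous fun q : E2 => q 0)).measurableSet
  rw [hset, lintegral_biUnion_finset _ fun i _ => hmeas _]
  · refine Finset.sum_congr rfl fun i hi => ?_
    have hi' := Finset.mem_range.1 hi
    rw [setLIntegral_congr_fun (g := fun _ => transition G (P i) (P (i + 1))) (hmeas _),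
      setLIntegral_const, hausdorffMeasure_vertical (h.mem_Ioo (Nat.succ_pos i) hi'), mul_one]
    intro p hp
    obtain ⟨h1, h2, -⟩ := h.jump hz hint hp.1 hi' hp.2
    show transition G (leftLim z p) (rightLim z p) = _
    rw [h1, h2]
  · intro i hi j hj hij
    have hi' := Finset.mem_range.1 hi
    have hj' := Finset.mem_range.1 hj
    refine Set.disjoint_left.2 fun p hp hp' => ?_
    have he : x (i + 1) = x (j + 1) := hp.2.symm.trans hp'.2
    rcases lt_or_gt_of_ne hij with hlt | hlt
    · exact (h.lt_of_lt (Nat.succ_lt_succ hlt) (by omega)).ne he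
    · exact (h.lt_of_lt (Nat.succ_lt_succ hlt) (by omega)).ne' he

end HelicalXY

end

section

namespace HelicalXY

/-! ### A lower bound for transitions -/

variable {G : E3 → ℝ} {W : Finset E3}

lemma exists_separation (W : Finset E3) : ∃ d > 0, ∀ p ∈ W, ∀ p' ∈ W, p ≠ p' → d ≤ ‖p - p'‖ := by
  classical
  obtain ⟨d, hd, H⟩ := exists_pos_le W (f := fun p p' => if p = p' then 1 else ‖p - p'‖)
    fun p _ p' _ => by
      split_ifs with h
      · exact one_pos
      · exact norm_pos_iff.2 (sub_ne_zero.2 h)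
  refine ⟨d, hd, fun p hp p' hp' hne => ?_⟩
  have := H p hp p' hp'
  rwa [if_neg hne] at this

/-- The increment is the integral of `u × f` over a time at most one; Young's inequality `x ≤ η/2 +
x²/(2η)` bounds it by the energy. -/
lemma IsCurve.norm_cross_sub_le {u v f : ℝ → E3} (hc : IsCurve u v f univ) {η : ℝ} (hη : 0 < η)
    {a b : ℝ} (hab : a ≤ b) (hb : b ≤ a + 1)
    (hE : ∫⁻ t, dens G u v f t ≤ ENNReal.ofReal (η ^ 2)) :
    ‖cross (u b) (v b) - cross (u a) (v a)‖ ≤ η := by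
  have hw : Continuous fun t => cross (u t) (v t) :=
    continuous_cross.comp (hc.continuous_u.prodMk hc.continuous_v)
  have h1 := hc.isWeakDeriv_cross.integral_eq hw a b
  have hm : AEMeasurable (fun t => ENNReal.ofReal (‖cross (u t) (f t)‖ ^ 2)) := by
    have := hc.isWeakDeriv_cross.2.1.aestronglyMeasurable
    exact (this.norm.aemeasurable.pow_const 2).ennreal_ofReal
  rw [← ENNReal.ofReal_le_ofReal_iff hη.le, ofReal_norm, h1, intervalIntegral.integral_of_le hab]
  calc ‖∫ t in Ioc a b, cross (u t) (f t)‖ₑ ≤ ∫⁻ t in Ioc a b, ‖cross (u t) (f t)‖ₑ :=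
        enorm_integral_le_lintegral_enorm _
    _ ≤ ∫⁻ t in Ioc a b, (ENNReal.ofReal (η / 2) +
          ENNReal.ofReal (1 / (2 * η)) * ENNReal.ofReal (‖cross (u t) (f t)‖ ^ 2)) := by
        refine lintegral_mono fun t => ?_
        rw [← ofReal_norm, ← ENNReal.ofReal_mul (by positivity), ← ENNReal.ofReal_add (by positivity)
          (by positivity)]
        refine ENNReal.ofReal_le_ofReal ?_
        have : η / 2 + 1 / (2 * η) * ‖cross (u t) (f t)‖ ^ 2 - ‖cross (u t) (f t)‖ =
          (‖cross (u t) (f t)‖ - η) ^ 2 / (2 * η) := by field_simp; ring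
        have h0 : 0 ≤ (‖cross (u t) (f t)‖ - η) ^ 2 / (2 * η) := by positivity
        linarith
    _ = ENNReal.ofReal (η / 2) * volume (Ioc a b) + ENNReal.ofReal (1 / (2 * η)) *
          ∫⁻ t in Ioc a b, ENNReal.ofReal (‖cross (u t) (f t)‖ ^ 2) := by
        rw [lintegral_add_left measurable_const, lintegral_const, lintegral_const_mul'' _ hm.restrict,
          Measure.restrict_apply_univ]
    _ ≤ ENNReal.ofReal (η / 2) * 1 + ENNReal.ofReal (1 / (2 * η)) * ENNReal.ofReal (η ^ 2) := by
        gcongr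
        · rw [Real.volume_Ioc, ← ENNReal.ofReal_one]
          exact ENNReal.ofReal_le_ofReal (by linarith)
        · exact ((lintegral_mono' Measure.restrict_le_self fun t => le_add_self).trans hE)
    _ = ENNReal.ofReal η := by
        rw [mul_one, ← ENNReal.ofReal_mul (by positivity), ← ENNReal.ofReal_add (by positivity)
          (by positivity)]
        congr 1
        field_simp; ring

/-- A cheap profile is at distance `d / 2` from `p` at some time, and by `norm_cross_sub_le` moves
by at most `d / 8` during the next unit of time. So it stays away from all wells for that long and
pays a fixed potential energy. -/
lemma IsWells.exists_le_transition (hG : IsPenalty G) (hW : IsWells G W) :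
    ∃ τ > 0, ∀ p ∈ W, ∀ p' ∈ W, p ≠ p' → ENNReal.ofReal τ ≤ transition G p p' := by
  obtain ⟨d, hd, hsep⟩ := exists_separation W
  obtain ⟨ρ, hρ, hnear⟩ := exists_well_near hG hW (η := d / 8) (by positivity)
  set μ := min (ρ ^ 2) (ρ / 2) with hμ
  have hμ0 : 0 < μ := by positivity
  refine ⟨min μ ((d / 8) ^ 2), by positivity, fun p hp p' hp' hne => ?_⟩
  by_contra! hlt
  obtain ⟨u, v, f, hc, hbot, htop, hE⟩ := exists_curve_of_transition_lt G hG.cont hlt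
  have hw : Continuous fun t => cross (u t) (v t) :=
    continuous_cross.comp (hc.continuous_u.prodMk hc.continuous_v)
  have hdist : Continuous fun t => ‖cross (u t) (v t) - p‖ := (hw.sub continuous_const).norm
  obtain ⟨t₀, ht₀⟩ : ∃ t₀, ‖cross (u t₀) (v t₀) - p‖ = d / 2 := by
    have h1 : ∀ᶠ t in atBot, ‖cross (u t) (v t) - p‖ < d / 2 := by
      have := (hbot.sub_const p).norm
      rw [sub_self, norm_zero] at this
      exact this.eventually (gt_mem_nhds (by positivity))
    have h2 : ∀ᶠ t in atTop, d / 2 < ‖cross (u t) (v t) - p‖ := by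
      have := (htop.sub_const p).norm
      refine this.eventually (lt_mem_nhds ?_)
      have := hsep p' hp' p hp hne.symm
      linarith
    obtain ⟨a, ha⟩ := h1.exists
    obtain ⟨b, hb⟩ := h2.exists
    exact mem_range_of_exists_le_of_exists_ge hdist ⟨a, ha.le⟩ ⟨b, hb.le⟩
  have hbad : ∀ t ∈ Icc t₀ (t₀ + 1), ENNReal.ofReal μ ≤ dens G u v f t := by
    intro t ht
    have h1 := hc.norm_cross_sub_le (G := G) (η := d / 8) (by positivity) ht.1 ht.2
      (hE.le.trans (ENNReal.ofReal_le_ofReal (min_le_right _ _)))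
    refine le_trans (ENNReal.ofReal_le_ofReal ?_) le_self_add
    by_contra! hc'
    have hGn := hG.nonneg (cross (u t) (v t))
    obtain ⟨p'', hp'', hn⟩ := hnear (cross (u t) (v t))
      (abs_le_of_sq_le_sq (by
        have := min_le_left (ρ ^ 2) (ρ / 2)
        rw [← hμ] at this
        linarith) hρ.le) (by
        have := min_le_right (ρ ^ 2) (ρ / 2)
        rw [← hμ] at this
        have := sq_nonneg (‖cross (u t) (v t)‖ ^ 2 - 1)
        linarith)
    have h2 : ‖cross (u t₀) (v t₀) - p''‖ ≤ d / 4 := by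
      have : cross (u t₀) (v t₀) - p'' = (cross (u t) (v t) - p'') -
        (cross (u t) (v t) - cross (u t₀) (v t₀)) := by abel
      rw [this]
      exact (norm_sub_le _ _).trans (by linarith)
    by_cases he : p'' = p
    · rw [he, ht₀] at h2; linarith
    · have h3 := hsep p'' hp'' p hp he
      have : p'' - p = (cross (u t₀) (v t₀) - p) - (cross (u t₀) (v t₀) - p'') := by abel
      rw [this] at h3
      have := norm_sub_le (cross (u t₀) (v t₀) - p) (cross (u t₀) (v t₀) - p'')
      linarith
  have h1 : ENNReal.ofReal μ ≤ ∫⁻ t, dens G u v f t := by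
    calc ENNReal.ofReal μ = ∫⁻ _ in Icc t₀ (t₀ + 1), ENNReal.ofReal μ := by
          rw [setLIntegral_const, Real.volume_Icc]; simp
      _ ≤ ∫⁻ t in Icc t₀ (t₀ + 1), dens G u v f t := setLIntegral_mono' measurableSet_Icc hbad
      _ ≤ _ := setLIntegral_le_lintegral _ _
  exact absurd (h1.trans_lt hE) (not_lt.2 (ENNReal.ofReal_le_ofReal (min_le_left _ _)))

/-! ### Test fields -/

lemma integral_volOmega_mul (f g : ℝ → ℝ) :
    ∫ p, f (p 0) * g (p 1) ∂volOmega = (∫ x, f x ∂volI) * ∫ y, g y ∂volI := by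
  rw [← integral_prod_mul,
    ← measurePreserving_plane.integral_comp planeEquiv.measurableEmbedding]
  rfl

lemma hasFDerivAt_mul_coord {f g f' g' : ℝ → ℝ} (hf : ∀ x, HasDerivAt f (f' x) x)
    (hg : ∀ x, HasDerivAt g (g' x) x) (p : E2) :
    HasFDerivAt (fun p : E2 => (f (p 0) * g (p 1)) • e₀)
      ((f (p 0) • g' (p 1) • (EuclideanSpace.proj 1 : E2 →L[ℝ] ℝ) +
        g (p 1) • f' (p 0) • (EuclideanSpace.proj 0 : E2 →L[ℝ] ℝ)).smulRight e₀) p := by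
  have h0 : HasFDerivAt (fun p : E2 => p 0) (EuclideanSpace.proj 0 : E2 →L[ℝ] ℝ) p :=
    (EuclideanSpace.proj 0 : E2 →L[ℝ] ℝ).hasFDerivAt
  have h1 : HasFDerivAt (fun p : E2 => p 1) (EuclideanSpace.proj 1 : E2 →L[ℝ] ℝ) p :=
    (EuclideanSpace.proj 1 : E2 →L[ℝ] ℝ).hasFDerivAt
  exact (((hf (p 0)).comp_hasFDerivAt p h0).mul ((hg (p 1)).comp_hasFDerivAt p h1)).smul_const e₀

lemma divergence_mul_coord {f g f' g' : ℝ → ℝ} (hf : ∀ x, HasDerivAt f (f' x) x)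
    (hg : ∀ x, HasDerivAt g (g' x) x) (p : E2) :
    divergence (fun p : E2 => (f (p 0) * g (p 1)) • e₀) p = f' (p 0) * g (p 1) := by
  rw [divergence, (hasFDerivAt_mul_coord hf hg p).fderiv, Fin.sum_univ_two]
  simp [e₀]
  ring

/-- Test fields of the form `Ψ(x) χ(y) e₀` with a fixed cutoff `χ` reduce the planar total variation
to a one-dimensional one; `c` is the integral of `χ`. -/
lemma tv_test {z : E2 → E3} {z₀ : ℝ → E3} (hz : ∀ᵐ p ∂volOmega, z p = z₀ (p 0))
    (hz₀ : Integrable z₀ volI) :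
    ∃ c > 0, ∀ (Ψ Ψ' : ℝ → E3) (a b : ℝ), (∀ x, HasDerivAt Ψ (Ψ' x) x) → Continuous Ψ' → 0 < a →
      b < 1 → (∀ x, x ∉ Icc a b → Ψ x = 0) → (∀ x, ‖Ψ x‖ ≤ 1) →
      ENNReal.ofReal (c * ∫ x, inner ℝ (z₀ x) (Ψ' x) ∂volI) ≤ totalVariation z := by
  let χ : ContDiffBump (1 / 2 : ℝ) := ⟨1 / 8, 1 / 4, by norm_num, by norm_num⟩
  have hχ0 : ∀ y, y ∉ Icc (1 / 4 : ℝ) (3 / 4) → χ y = 0 := fun y hy => by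
    refine χ.zero_of_le_dist ?_
    show (1 / 4 : ℝ) ≤ _
    by_contra! h
    rw [Real.dist_eq, abs_lt] at h
    exact hy ⟨by linarith, by linarith⟩
  have hχi : ∫ y, χ y ∂volI = ∫ y, χ y := by
    refine setIntegral_eq_integral_of_forall_compl_eq_zero fun y hy => hχ0 y fun h => hy ?_
    exact ⟨by linarith [h.1], by linarith [h.2]⟩
  refine ⟨∫ y, χ y ∂volI, by rw [hχi]; exact χ.integral_pos, fun Ψ Ψ' a b hd hc ha hb hs h1 => ?_⟩
  have hcd : ContDiff ℝ 1 χ := χ.contDiff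
  have hχd : ∀ y, HasDerivAt χ (deriv χ y) y := fun y =>
    (hcd.differentiable (by norm_num) y).hasDerivAt
  have hΨd : ∀ α x, HasDerivAt (fun x => Ψ x α) (Ψ' x α) x := fun α x =>
    ((EuclideanSpace.proj α : E3 →L[ℝ] ℝ).hasFDerivAt.comp_hasDerivAt x (hd x))
  have hΨ1 : ContDiff ℝ 1 Ψ := by
    rw [contDiff_one_iff_deriv]
    refine ⟨fun x => (hd x).differentiableAt, ?_⟩
    rwa [show deriv Ψ = Ψ' from funext fun x => (hd x).deriv]
  set φ : Fin 3 → E2 → E2 := fun α p => (Ψ (p 0) α * χ (p 1)) • e₀ with hφ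
  have hK : IsCompact (planeEquiv ⁻¹' (Icc a b ×ˢ Icc (1 / 4) (3 / 4))) := by
    have : planeEquiv ⁻¹' (Icc a b ×ˢ Icc (1 / 4) (3 / 4)) =
        (EuclideanSpace.equiv (Fin 2) ℝ).toHomeomorph ⁻¹' (univ.pi ![Icc a b, Icc (1 / 4) (3 / 4)]) := by
      ext p
      rw [mem_preimage, planeEquiv_apply, mem_prod, mem_preimage, mem_univ_pi, Fin.forall_fin_two]
      rfl
    rw [this, Homeomorph.isCompact_preimage]
    refine isCompact_univ_pi fun i => ?_
    fin_cases i <;> exact isCompact_Icc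
  have hsupp : ∀ α, Function.support (φ α) ⊆ planeEquiv ⁻¹' (Icc a b ×ˢ Icc (1 / 4) (3 / 4)) := by
    intro α p hp
    rw [mem_preimage, planeEquiv_apply]
    by_contra hcon
    refine hp ?_
    simp only [hφ]
    rw [mem_prod, not_and_or] at hcon
    rcases hcon with h | h
    · rw [hs _ h]; simp
    · rw [hχ0 _ h]; simp
  have hadm : ∀ α, ContDiff ℝ 1 (φ α) ∧ HasCompactSupport (φ α) ∧ tsupport (φ α) ⊆ Omega := by
    intro α
    refine ⟨?_, HasCompactSupport.of_support_subset_isCompact hK (hsupp α), ?_⟩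
    · have h0 : ContDiff ℝ 1 fun p : E2 => p 0 := (EuclideanSpace.proj 0 : E2 →L[ℝ] ℝ).contDiff
      have h1 : ContDiff ℝ 1 fun p : E2 => p 1 := (EuclideanSpace.proj 1 : E2 →L[ℝ] ℝ).contDiff
      exact (((contDiff_apply hΨ1 α).comp h0).mul (hcd.comp h1)).smul contDiff_const
    · refine (closure_minimal (hsupp α) hK.isClosed).trans fun p hp => ?_
      rw [mem_preimage, planeEquiv_apply, mem_prod] at hp
      exact mem_Omega.2 ⟨⟨by linarith [hp.1.1], by linarith [hp.1.2]⟩,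
        ⟨by linarith [hp.2.1], by linarith [hp.2.2]⟩⟩
  have hle : ∀ p, ∑ α, ‖φ α p‖ ^ 2 ≤ 1 := by
    intro p
    have e : ∀ α, ‖φ α p‖ ^ 2 = ‖Ψ (p 0) α‖ ^ 2 * χ (p 1) ^ 2 := fun α => by
      simp only [hφ]
      rw [norm_smul, norm_e₀, mul_one, norm_mul, mul_pow, Real.norm_eq_abs (χ _), sq_abs]
    simp only [e]
    rw [← Finset.sum_mul, ← EuclideanSpace.norm_sq_eq]
    have h2 : χ (p 1) ^ 2 ≤ 1 := pow_le_one₀ χ.nonneg χ.le_one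
    have h3 : ‖Ψ (p 0)‖ ^ 2 ≤ 1 := pow_le_one₀ (norm_nonneg _) (h1 _)
    nlinarith [sq_nonneg (χ (p 1)), sq_nonneg ‖Ψ (p 0)‖]
  refine le_trans (ENNReal.ofReal_le_ofReal (le_of_eq ?_)) (le_iSup₂_of_le φ hadm
    (le_iSup_of_le hle le_rfl))
  have hα : ∀ α, ∫ p, z p α * divergence (φ α) p ∂volOmega =
      (∫ x, z₀ x α * Ψ' x α ∂volI) * ∫ y, χ y ∂volI := by
    intro α
    rw [← integral_volOmega_mul]
    refine integral_congr_ae ?_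
    filter_upwards [hz] with p hp
    rw [divergence_mul_coord (hΨd α) hχd, hp]; ring
  simp only [hα]
  rw [← Finset.sum_mul, mul_comm, ← integral_finsetSum]
  · congr 1
    refine integral_congr_ae (ae_of_all _ fun x => ?_)
    simp only [PiLp.inner_apply]
    refine Finset.sum_congr rfl fun i _ => ?_
    simp [mul_comm]
  · intro α _
    obtain ⟨C, hC⟩ := isCompact_Icc.exists_bound_of_continuousOn (s := Icc (0 : ℝ) 1)
      (continuous_apply' hc α).continuousOn
    have hzα : Integrable (fun x => z₀ x α) volI :=
      (EuclideanSpace.proj α : E3 →L[ℝ] ℝ).integrable_comp hz₀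
    refine hzα.mul_bdd (c := C) (continuous_apply' hc α).aestronglyMeasurable ?_
    filter_upwards [ae_restrict_mem measurableSet_Ioo] with x hx
    exact hC x ⟨hx.1.le, hx.2.le⟩

end HelicalXY

end

section

namespace HelicalXY

/-! ### Functions of bounded variation of one variable -/

lemma ContDiffBump.exists_primitive (φ : ContDiffBump (0 : ℝ)) (hφ : φ.rOut < 1) :
    ∃ Φ : ℝ → ℝ, (∀ x, HasDerivAt Φ (φ.normed volume x) x) ∧ Monotone Φ ∧
      (∀ x ≤ -φ.rOut, Φ x = 0) ∧ ∀ x ≥ φ.rOut, Φ x = 1 := by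
  have hc : Continuous (φ.normed (volume : Measure ℝ)) := φ.continuous_normed
  have hsupp : Function.support (φ.normed (volume : Measure ℝ)) = Ioo (-φ.rOut) φ.rOut := by
    rw [φ.support_normed_eq, Real.ball_eq_Ioo]; simp
  have hd : ∀ x, HasDerivAt (fun x => ∫ s in (-1)..x, φ.normed volume s) (φ.normed volume x) x :=
    fun x => intervalIntegral.integral_hasDerivAt_right (hc.intervalIntegrable _ _)
      (hc.stronglyMeasurableAtFilter _ _) hc.continuousAt
  refine ⟨_, hd, ?_, fun x hx => ?_, fun x hx => ?_⟩
  · refine monotone_of_deriv_nonneg (fun x => (hd x).differentiableAt) fun x => ?_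
    rw [(hd x).deriv]
    exact φ.nonneg_normed x
  · refine (intervalIntegral.integral_congr (g := fun _ => (0 : ℝ)) fun s hs => ?_).trans
      intervalIntegral.integral_zero
    have hs' : s ≤ -φ.rOut := hs.2.trans (sup_le (by linarith) hx)
    have : s ∉ Function.support (φ.normed (volume : Measure ℝ)) := by
      rw [hsupp]; exact fun h => absurd h.1 (not_lt.2 hs')
    exact Function.notMem_support.1 this
  · rw [intervalIntegral.integral_eq_integral_of_support_subset, φ.integral_normed]
    rw [hsupp]
    exact fun s hs => ⟨by linarith [hs.1], hs.2.le.trans hx⟩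

/-- A shrinking sequence of mollifiers. -/
def mollifier (k : ℕ) : ContDiffBump (0 : ℝ) :=
  ⟨1 / (2 * ((k : ℝ) + 2)), 1 / ((k : ℝ) + 2), by positivity, by
    rw [div_lt_div_iff₀ (by positivity) (by positivity)]
    have : (0 : ℝ) ≤ k := k.cast_nonneg
    linarith⟩

lemma mollifier_rOut_lt (k : ℕ) : (mollifier k).rOut < 1 := by
  show 1 / ((k : ℝ) + 2) < 1
  rw [div_lt_one (by positivity)]
  have : (0 : ℝ) ≤ k := k.cast_nonneg
  linarith

lemma tendsto_mollifier : Tendsto (fun k => (mollifier k).rOut) atTop (𝓝 0) := by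
  have h := (tendsto_add_atTop_iff_nat 1).2 
    (tendsto_one_div_add_atTop_nhds_zero_nat (𝕜 := ℝ))
  refine h.congr fun k => ?_
  show _ = 1 / ((k : ℝ) + 2)
  push_cast
  ring

lemma ae_tendsto_mollify {g : ℝ → E3} (hg : Integrable g volI) :
    ∀ᵐ t ∂volI, Tendsto (fun k => ∫ s, (mollifier k).normed volume (s - t) • g s ∂volI) atTop
      (𝓝 (g t)) := by
  have hi : Integrable ((Ioo (0 : ℝ) 1).indicator g) :=
    (integrable_indicator_iff measurableSet_Ioo).2 hg
  have h := ContDiffBump.ae_convolution_tendsto_right_of_locallyIntegrable (μ := volume)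
    (φ := mollifier) (K := 2) tendsto_mollifier
    (Eventually.of_forall fun k => le_of_eq (by
      show 1 / ((k : ℝ) + 2) = 2 * (1 / (2 * ((k : ℝ) + 2)))
      field_simp)) hi.locallyIntegrable
  filter_upwards [ae_restrict_of_ae h, ae_restrict_mem measurableSet_Ioo] with t ht ht1
  rw [indicator_of_mem ht1] at ht
  refine ht.congr fun k => ?_
  rw [convolution_lsmul_swap, ← integral_indicator measurableSet_Ioo]
  refine integral_congr_ae (ae_of_all _ fun s => ?_)
  by_cases hs : s ∈ Ioo (0 : ℝ) 1
  · simp only [indicator_of_mem hs]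
    rw [← (mollifier k).normed_neg, neg_sub]
  · simp only [indicator_of_notMem hs, smul_zero]

/-- `L` consists of points with values in `W` where the mollifications converge. A chain of `m`
jumps yields a test field whose pairing with `z₀` tends to the sum of the jump sizes, at least `m
d`, while it is bounded by the total variation. -/
theorem exists_chain_length_bound {z : E2 → E3} {z₀ : ℝ → E3}
    (hz : ∀ᵐ p ∂volOmega, z p = z₀ (p 0)) (hz₀ : Integrable z₀ volI) (hTV : totalVariation z < ⊤)
    {W : Finset E3} (hW : ∀ᵐ x ∂volI, z₀ x ∈ W) :
    ∃ L ⊆ Ioo (0 : ℝ) 1, (∀ᵐ t ∂volI, t ∈ L) ∧ (∀ t ∈ L, z₀ t ∈ W) ∧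
      ∃ K : ℕ, ∀ m t, IsJumpChain z₀ L m t → m ≤ K := by
  obtain ⟨d, hd, hsep⟩ := exists_separation W
  obtain ⟨c, hc, htest⟩ := tv_test hz hz₀
  refine ⟨{t | t ∈ Ioo (0 : ℝ) 1 ∧ z₀ t ∈ W ∧ Tendsto
    (fun k => ∫ s, (mollifier k).normed volume (s - t) • z₀ s ∂volI) atTop (𝓝 (z₀ t))},
    fun t ht => ht.1, ?_, fun t ht => ht.2.1, ⌊(totalVariation z).toReal / (c * d)⌋₊,
    fun m t ht => ?_⟩
  · filter_upwards [ae_tendsto_mollify hz₀, hW, ae_restrict_mem measurableSet_Ioo] with t h1 h2 h3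
    using ⟨h3, h2, h1⟩
  set s : ℕ → E3 := fun i => ‖z₀ (t i) - z₀ (t (i + 1))‖⁻¹ • (z₀ (t i) - z₀ (t (i + 1))) with hs
  have hs1 : ∀ i, ‖s i‖ ≤ 1 := fun i => by
    simp only [hs]
    rw [norm_smul, norm_inv, norm_norm]
    exact inv_mul_le_one
  have hmono : ∀ i j, i ≤ j → j ≤ m → t i ≤ t j := fun i j hij => by
    induction j, hij using Nat.le_induction with
    | base => exact fun _ => le_rfl
    | succ n hn ih => exact fun h => (ih (by omega)).trans (ht.2 n (by omega)).1.le
  have hlim : Tendsto (fun k => c * ∑ i ∈ Finset.range m, inner ℝ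
      ((∫ x, (mollifier k).normed volume (x - t i) • z₀ x ∂volI) -
        ∫ x, (mollifier k).normed volume (x - t (i + 1)) • z₀ x ∂volI) (s i)) atTop
      (𝓝 (c * ∑ i ∈ Finset.range m, inner ℝ (z₀ (t i) - z₀ (t (i + 1))) (s i))) := by
    refine (tendsto_finsetSum _ fun i hi => ?_).const_mul c
    have hi' := Finset.mem_range.1 hi
    exact (((ht.1 i hi'.le).2.2).sub ((ht.1 (i + 1) hi').2.2)).inner tendsto_const_nhds
  have hev : ∀ᶠ k in atTop, c * ∑ i ∈ Finset.range m, inner ℝ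
      ((∫ x, (mollifier k).normed volume (x - t i) • z₀ x ∂volI) -
        ∫ x, (mollifier k).normed volume (x - t (i + 1)) • z₀ x ∂volI) (s i) ≤
      (totalVariation z).toReal := by
    have h0 := (ht.1 0 (Nat.zero_le _)).1
    have h1 := (ht.1 m le_rfl).1
    filter_upwards [tendsto_mollifier.eventually (gt_mem_nhds h0.1),
      tendsto_mollifier.eventually (gt_mem_nhds (sub_pos.2 h1.2))] with k hk0 hk1
    obtain ⟨Φ, hΦ, hΦm, hΦ0, hΦ1⟩ := ContDiffBump.exists_primitive _ (mollifier_rOut_lt k)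
    have hρc : Continuous ((mollifier k).normed (volume : Measure ℝ)) :=
      (mollifier k).continuous_normed
    have hΦle : ∀ x, Φ x ≤ 1 := fun x =>
      (hΦm (le_max_left x (mollifier k).rOut)).trans (hΦ1 _ (le_max_right _ _)).le
    have hΦge : ∀ x, 0 ≤ Φ x := fun x =>
      (hΦ0 _ (min_le_right x (-(mollifier k).rOut))).ge.trans (hΦm (min_le_left _ _))
    -- Mollified indicators of the intervals between consecutive `t i`, multiplied by the unit
    -- directions of the jumps. The weights are nonnegative and their sum telescopes to at most `1`;
    -- their derivatives produce differences of mollifications at the `t i`.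
    have hΨ := htest (fun x => ∑ i ∈ Finset.range m, (Φ (x - t i) - Φ (x - t (i + 1))) • s i)
      (fun x => ∑ i ∈ Finset.range m, ((mollifier k).normed volume (x - t i) -
        (mollifier k).normed volume (x - t (i + 1))) • s i)
      (t 0 - (mollifier k).rOut) (t m + (mollifier k).rOut) ?_ ?_ (by linarith) (by linarith) ?_ ?_
    · rw [ENNReal.ofReal_le_iff_le_toReal hTV.ne] at hΨ
      convert hΨ using 2
      have hint : ∀ a, Integrable (fun x => (mollifier k).normed volume (x - a) • z₀ x) volI :=
        fun a => by
          obtain ⟨C, hC⟩ := isCompact_Icc.exists_bound_of_continuousOn (s := Icc (0 : ℝ) 1)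
            (hρc.comp (continuous_id.sub continuous_const) :
              Continuous fun x => (mollifier k).normed volume (x - a)).continuousOn
          refine hz₀.bdd_smul C
            (hρc.comp (continuous_id.sub continuous_const)).aestronglyMeasurable ?_
          filter_upwards [ae_restrict_mem measurableSet_Ioo] with x hx
          exact hC x ⟨hx.1.le, hx.2.le⟩
      simp only [inner_sum, inner_smul_right]
      rw [integral_finsetSum]
      · refine Finset.sum_congr rfl fun i _ => ?_
        rw [← integral_sub (hint _) (hint _), real_inner_comm,
          ← integral_inner (μ := volI) (f := fun x => (mollifier k).normed volume (x - t i) • z₀ x -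
            (mollifier k).normed volume (x - t (i + 1)) • z₀ x) ((hint _).sub (hint _))]
        refine integral_congr_ae (ae_of_all _ fun x => ?_)
        simp only
        rw [← sub_smul, inner_smul_right, real_inner_comm]
      · intro i _
        have := ((hint (t i)).sub (hint (t (i + 1)))).inner_const (𝕜 := ℝ) (s i)
        refine this.congr (ae_of_all _ fun x => ?_)
        simp only [Pi.sub_apply]
        rw [← sub_smul, real_inner_smul_left]
    · intro x
      refine HasDerivAt.fun_sum fun i _ => HasDerivAt.smul_const ?_ _
      exact ((hΦ _).comp_sub_const x (t i)).sub ((hΦ _).comp_sub_const x (t (i + 1)))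
    · refine continuous_finsetSum _ fun i _ => ?_
      exact ((hρc.comp (continuous_id.sub continuous_const)).sub
        (hρc.comp (continuous_id.sub continuous_const))).smul continuous_const
    · intro x hx
      refine Finset.sum_eq_zero fun i hi => ?_
      have hi' := Finset.mem_range.1 hi
      have e1 := hmono 0 i (Nat.zero_le _) hi'.le
      have e2 := hmono i (i + 1) (Nat.le_succ _) hi'
      have e3 := hmono (i + 1) m hi' le_rfl
      rw [mem_Icc, not_and_or, not_le, not_le] at hx
      rcases hx with hx | hx
      · rw [hΦ0 _ (by linarith), hΦ0 _ (by linarith), sub_zero, zero_smul]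
      · rw [hΦ1 (x - t i) (by show _ ≤ _; linarith), hΦ1 (x - t (i + 1)) (by show _ ≤ _; linarith),
          sub_self, zero_smul]
    · intro x
      calc ‖∑ i ∈ Finset.range m, (Φ (x - t i) - Φ (x - t (i + 1))) • s i‖
          ≤ ∑ i ∈ Finset.range m, (Φ (x - t i) - Φ (x - t (i + 1))) := by
            refine norm_sum_le_of_le _ fun i hi => ?_
            have hi' := Finset.mem_range.1 hi
            have : 0 ≤ Φ (x - t i) - Φ (x - t (i + 1)) :=
              sub_nonneg.2 (hΦm (by linarith [hmono i (i + 1) (Nat.le_succ _) hi']))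
            rw [norm_smul, Real.norm_of_nonneg this]
            exact mul_le_of_le_one_right this (hs1 i)
        _ = Φ (x - t 0) - Φ (x - t m) := Finset.sum_range_sub' (fun i => Φ (x - t i)) m
        _ ≤ 1 := by linarith [hΦle (x - t 0), hΦge (x - t m)]
  have hfin := le_of_tendsto hlim hev
  have hlow : (m : ℝ) * d ≤ ∑ i ∈ Finset.range m, inner ℝ (z₀ (t i) - z₀ (t (i + 1))) (s i) := by
    rw [← nsmul_eq_mul, ← Finset.card_range m, ← Finset.sum_const, Finset.card_range]
    refine Finset.sum_le_sum fun i hi => ?_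
    have hi' := Finset.mem_range.1 hi
    have hdi := hsep _ (ht.1 i hi'.le).2.1 _ (ht.1 (i + 1) hi').2.1 (ht.2 i hi').2
    simp only [hs]
    rw [inner_smul_right, real_inner_self_eq_norm_sq, sq, ← mul_assoc,
      inv_mul_cancel₀ (hd.trans_le hdi).ne', one_mul]
    exact hdi
  refine Nat.le_floor ?_
  rw [le_div_iff₀ (by positivity)]
  nlinarith

/-! ### Step functions have bounded variation -/

lemma hasDerivAt_pt_left (x y : ℝ) : HasDerivAt (fun x => pt x y) e₀ x := by
  have : (fun x => pt x y) = fun x : ℝ => pt 0 y + x • e₀ := by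
    funext x; ext i; fin_cases i <;> simp [pt, e₀]
  rw [this]
  simpa using ((hasDerivAt_id x).smul_const e₀).const_add (pt 0 y)

lemma hasDerivAt_pt_right (x y : ℝ) :
    HasDerivAt (fun y => pt x y) (EuclideanSpace.single 1 1) y := by
  have : (fun y => pt x y) = fun y : ℝ => pt x 0 + y • (EuclideanSpace.single 1 1 : E2) := by
    funext y; ext i; fin_cases i <;> simp [pt]
  rw [this]
  simpa using ((hasDerivAt_id y).smul_const (EuclideanSpace.single 1 1 : E2)).const_add (pt x 0)

/-- The derivative of the `j`-th component in the direction `j`. -/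
def diag (φ : E2 → E2) (j : Fin 2) (p : E2) : ℝ := (fderiv ℝ φ p (EuclideanSpace.single j 1)) j

lemma divergence_eq (φ : E2 → E2) (p : E2) : divergence φ p = diag φ 0 p + diag φ 1 p := by
  rw [divergence, Fin.sum_univ_two]; rfl

lemma continuous_diag {φ : E2 → E2} (hφ : ContDiff ℝ 1 φ) (j : Fin 2) : Continuous (diag φ j) := by
  have := (hφ.continuous_fderiv one_ne_zero).clm_apply
    (continuous_const (y := (EuclideanSpace.single j 1 : E2)))
  exact (EuclideanSpace.proj j : E2 →L[ℝ] ℝ).continuous.comp this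

lemma hasDerivAt_diag_left {φ : E2 → E2} (hφ : ContDiff ℝ 1 φ) (x y : ℝ) :
    HasDerivAt (fun x => φ (pt x y) 0) (diag φ 0 (pt x y)) x := by
  have h1 := (hφ.differentiable one_ne_zero (pt x y)).hasFDerivAt
  exact (EuclideanSpace.proj 0 : E2 →L[ℝ] ℝ).hasFDerivAt.comp_hasDerivAt x
    (h1.comp_hasDerivAt x (hasDerivAt_pt_left x y))

lemma hasDerivAt_diag_right {φ : E2 → E2} (hφ : ContDiff ℝ 1 φ) (x y : ℝ) :
    HasDerivAt (fun y => φ (pt x y) 1) (diag φ 1 (pt x y)) y := by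
  have h1 := (hφ.differentiable one_ne_zero (pt x y)).hasFDerivAt
  exact (EuclideanSpace.proj 1 : E2 →L[ℝ] ℝ).hasFDerivAt.comp_hasDerivAt y
    (h1.comp_hasDerivAt y (hasDerivAt_pt_right x y))

lemma integral_diag_left {φ : E2 → E2} (hφ : ContDiff ℝ 1 φ) (a b y : ℝ) :
    ∫ x in a..b, diag φ 0 (pt x y) = φ (pt b y) 0 - φ (pt a y) 0 := by
  refine intervalIntegral.integral_eq_sub_of_hasDerivAt (fun x _ => hasDerivAt_diag_left hφ x y) ?_
  refine Continuous.intervalIntegrable ((continuous_diag hφ 0).comp ?_) _ _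
  exact continuous_iff_continuousAt.2 fun x => (hasDerivAt_pt_left x y).continuousAt

lemma integral_diag_right {φ : E2 → E2} (hφ : ContDiff ℝ 1 φ) (hsupp : tsupport φ ⊆ Omega)
    (x : ℝ) : ∫ y, diag φ 1 (pt x y) ∂volI = 0 := by
  have h0 : ∀ p, p ∉ Omega → φ p = 0 := fun p hp => image_eq_zero_of_notMem_tsupport fun h => hp (hsupp h)
  rw [← integral_Ioc_eq_integral_Ioo, ← intervalIntegral.integral_of_le zero_le_one,
    intervalIntegral.integral_eq_sub_of_hasDerivAt (fun y _ => hasDerivAt_diag_right hφ x y),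
    h0 (pt x 1), h0 (pt x 0)]
  · simp
  · intro h; simpa using (mem_Omega.1 h).2
  · intro h; simpa using (mem_Omega.1 h).2
  refine Continuous.intervalIntegrable ((continuous_diag hφ 1).comp ?_) _ _
  exact continuous_iff_continuousAt.2 fun x => (hasDerivAt_pt_right _ x).continuousAt

lemma integrable_mul_continuous {z g : E2 → ℝ} (hz : Integrable z volOmega) (hg : Continuous g) :
    Integrable (fun p => z p * g p) volOmega := by
  obtain ⟨C, hC⟩ := (isCompact_closedBall (0 : E2) 2).exists_bound_of_continuousOn hg.continuousOn
  refine hz.mul_bdd (c := C) hg.aestronglyMeasurable ?_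
  filter_upwards [ae_restrict_mem measurableSet_Omega] with p hp
  refine hC p ?_
  obtain ⟨h0, h1⟩ := mem_Omega.1 hp
  rw [mem_closedBall_zero_iff, EuclideanSpace.norm_eq, Fin.sum_univ_two,
    Real.norm_of_nonneg h0.1.le, Real.norm_of_nonneg h1.1.le]
  exact Real.sqrt_le_iff.2 ⟨by norm_num, by nlinarith [h0.1, h0.2, h1.1, h1.2]⟩

/-- The `y`-derivative integrates to zero on every vertical line, where `z` is constant and the
field vanishes at the ends. The `x`-derivative is integrated exactly on each of the `m + 1` pieces,
each contributing at most `2` per component. -/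
theorem IsStep.totalVariation_lt_top {z₀ : ℝ → E3} {m : ℕ} {x : ℕ → ℝ} {P : ℕ → E3} {z : E2 → E3}
    (h : IsStep z₀ m x P) (hP : ∀ i ≤ m, ‖P i‖ ≤ 1) (hz : ∀ᵐ p ∂volOmega, z p = z₀ (p 0))
    (hint : Integrable z volOmega) : totalVariation z < ⊤ := by
  refine lt_of_le_of_lt (iSup_le fun φ => iSup₂_le fun hφ hφ1 => ENNReal.ofReal_le_ofReal
    (?_ : _ ≤ ∑ α : Fin 3, (2 * ((m : ℝ) + 1)))) ENNReal.ofReal_lt_top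
  refine Finset.sum_le_sum fun α _ => ?_
  obtain ⟨hc, -, hsupp⟩ := hφ α
  have hzα : Integrable (fun p => z p α) volOmega :=
    (EuclideanSpace.proj α : E3 →L[ℝ] ℝ).integrable_comp hint
  have hi : ∀ j, Integrable (fun p => z p α * diag (φ α) j p) volOmega := fun j =>
    integrable_mul_continuous hzα (continuous_diag hc j)
  have hφα : ∀ p, |φ α p 0| ≤ 1 := fun p => by
    refine (PiLp.norm_apply_le (φ α p) 0).trans ?_
    rw [← sq_le_one_iff₀ (norm_nonneg _)]
    exact (Finset.single_le_sum (f := fun α => ‖φ α p‖ ^ 2) (fun _ _ => sq_nonneg _)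
      (Finset.mem_univ α)).trans (hφ1 p)
  simp only [divergence_eq, mul_add]
  rw [integral_add (hi 0) (hi 1), integral_volOmega (hi 0), integral_volOmega' (hi 1)]
  have hz2 : ∫ s, ∫ y, z (pt s y) α * diag (φ α) 1 (pt s y) ∂volI ∂volI = 0 := by
    rw [← integral_zero ℝ ℝ (μ := volI)]
    refine integral_congr_ae ?_
    filter_upwards [ae_ae_fst hz] with s hs
    have : (fun y => z (pt s y) α * diag (φ α) 1 (pt s y)) =ᵐ[volI]
        fun y => z₀ s α * diag (φ α) 1 (pt s y) := by
      filter_upwards [hs] with y hy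
      rw [hy]; rfl
    rw [integral_congr_ae this, integral_const_mul, integral_diag_right hc hsupp, mul_zero]
  rw [hz2, add_zero]
  refine (le_abs_self _).trans ?_
  have : ∀ᵐ y ∂volI, ‖∫ s, z (pt s y) α * diag (φ α) 0 (pt s y) ∂volI‖ ≤ 2 * ((m : ℝ) + 1) := by
    filter_upwards [ae_ae_snd hz] with y hy
    have e1 : (fun s => z (pt s y) α * diag (φ α) 0 (pt s y)) =ᵐ[volI]
        fun s => z₀ s α * diag (φ α) 0 (pt s y) := by
      filter_upwards [hy] with s hs
      rw [hs]; rfl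
    have hdc : Continuous fun s => diag (φ α) 0 (pt s y) := (continuous_diag hc 0).comp
      (continuous_iff_continuousAt.2 fun x => (hasDerivAt_pt_left x y).continuousAt)
    have e2 : ∀ i ≤ m, ∀ᵐ s, s ∈ Ioc (x i) (x (i + 1)) →
        P i α * diag (φ α) 0 (pt s y) = z₀ s α * diag (φ α) 0 (pt s y) := by
      intro i hi
      have hne : ∀ᵐ s : ℝ, s ≠ x (i + 1) := by simp [ae_iff]
      filter_upwards [h.ae i hi, hne] with s hs hs' hsx
      rw [hs ⟨hsx.1, lt_of_le_of_ne hsx.2 hs'⟩]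
    have e3 : ∀ i ≤ m, IntervalIntegrable (fun s => z₀ s α * diag (φ α) 0 (pt s y)) volume
        (x i) (x (i + 1)) ∧ ∫ s in x i..x (i + 1), z₀ s α * diag (φ α) 0 (pt s y) =
          P i α * (φ α (pt (x (i + 1)) y) 0 - φ α (pt (x i) y) 0) := by
      intro i hi
      have hu : uIoc (x i) (x (i + 1)) = Ioc (x i) (x (i + 1)) := uIoc_of_le (h.lt i hi).le
      constructor
      · refine ((hdc.const_mul _).intervalIntegrable _ _ : IntervalIntegrable
          (fun s => P i α * diag (φ α) 0 (pt s y)) volume _ _).congr_ae ?_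
        rw [hu, EventuallyEq, ae_restrict_iff' measurableSet_Ioc]
        exact e2 i hi
      · rw [← integral_diag_left hc, ← intervalIntegral.integral_const_mul]
        refine intervalIntegral.integral_congr_ae ?_
        rw [hu]
        filter_upwards [e2 i hi] with s hs hsx using (hs hsx).symm
    have e4 : ∫ s in (0 : ℝ)..1, z₀ s α * diag (φ α) 0 (pt s y) =
        ∫ s in x 0..x (m + 1), z₀ s α * diag (φ α) 0 (pt s y) := by rw [h.zero, h.one]
    rw [integral_congr_ae e1, ← integral_Ioc_eq_integral_Ioo,
      ← intervalIntegral.integral_of_le zero_le_one, e4,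
      ← intervalIntegral.sum_integral_adjacent_intervals (fun i hi => (e3 i (by omega)).1)]
    refine (norm_sum_le_of_le (f := fun i => ∫ s in x i..x (i + 1), z₀ s α * diag (φ α) 0 (pt s y))
      (n := fun _ => (2 : ℝ)) _ fun i hi => ?_).trans ?_
    · have hi' : i ≤ m := Nat.lt_succ_iff.1 (Finset.mem_range.1 hi)
      rw [(e3 i hi').2, norm_mul]
      have h1 : ‖P i α‖ ≤ 1 := (PiLp.norm_apply_le (P i) α).trans (hP i hi')
      have h2 : ‖φ α (pt (x (i + 1)) y) 0 - φ α (pt (x i) y) 0‖ ≤ 2 := by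
        refine (norm_sub_le _ _).trans ?_
        have a1 := hφα (pt (x (i + 1)) y)
        have a2 := hφα (pt (x i) y)
        rw [Real.norm_eq_abs, Real.norm_eq_abs]
        linarith
      nlinarith [norm_nonneg (P i α), norm_nonneg (φ α (pt (x (i + 1)) y) 0 - φ α (pt (x i) y) 0)]
    · rw [Finset.sum_const, Finset.card_range, nsmul_eq_mul]
      push_cast
      linarith
  refine (norm_integral_le_of_norm_le_const this).trans (le_of_eq ?_)
  simp
  ring

end HelicalXY

end

section

namespace HelicalXY

/-! ### The limit energy of a function of bounded variation -/

/-! ### The zeros of the penalty on the unit sphere. -/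

section Wells

variable {k : ℕ} {q : Fin k → E3} {G : E3 → ℝ}

open Classical in
/-- The wells, as a finite set. -/
def wellSet (q : Fin k → E3) : Finset E3 :=
  Finset.univ.image q ∪ Finset.univ.image fun l => -q l

lemma mem_wellSet {x : E3} : x ∈ wellSet q ↔ x ∈ wells q := by
  simp only [wellSet, Finset.mem_union, Finset.mem_image, Finset.mem_univ, true_and, wells]
  constructor
  · rintro (⟨l, rfl⟩ | ⟨l, rfl⟩)
    · exact ⟨l, Or.inl rfl⟩
    · exact ⟨l, Or.inr rfl⟩
  · rintro ⟨l, rfl | rfl⟩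
    · exact Or.inl ⟨l, rfl⟩
    · exact Or.inr ⟨l, rfl⟩

lemma isWells_wellSet (hq : ∀ l, ‖q l‖ = 1) (hGzero : {x | G x = 0} = lines q) :
    IsWells G (wellSet q) := by
  have hz : ∀ x, G x = 0 ↔ ∃ l, ∃ a : ℝ, a • q l = x := fun x => by
    have : x ∈ {x | G x = 0} ↔ x ∈ lines q := by rw [hGzero]
    rw [mem_ofPred_eq, lines, mem_iUnion] at this
    simpa only [SetLike.mem_coe, Submodule.mem_span_singleton] using this
  refine ⟨fun p hp => ?_, fun p hp => ?_, fun x hx h0 => ?_⟩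
  · obtain ⟨l, rfl | rfl⟩ := mem_wellSet.1 hp
    · exact hq l
    · rw [norm_neg, hq l]
  · obtain ⟨l, rfl | rfl⟩ := mem_wellSet.1 hp
    · exact (hz _).2 ⟨l, 1, one_smul _ _⟩
    · exact (hz _).2 ⟨l, -1, by rw [neg_one_smul]⟩
  · obtain ⟨l, a, rfl⟩ := (hz x).1 h0
    rw [norm_smul, hq l, mul_one, Real.norm_eq_abs] at hx
    rw [mem_wellSet]
    rcases eq_or_eq_neg_of_abs_eq hx with rfl | rfl
    · exact ⟨l, Or.inl (one_smul _ _)⟩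
    · exact ⟨l, Or.inr (neg_one_smul _ _)⟩

end Wells

/-! ### From bounded variation to step functions. -/

variable {G : E3 → ℝ} {W : Finset E3} {z₀ : ℝ → E3} {z : L1Omega}

lemma measurable_pt : Measurable fun q : ℝ × ℝ => pt q.1 q.2 :=
  (funext planeEquiv_symm_apply : (fun q => planeEquiv.symm q) = _) ▸ planeEquiv.symm.measurable

lemma ae_mem_of_indep (hz : ∀ᵐ p ∂volOmega, z p = z₀ (p 0)) (hW : ∀ᵐ p ∂volOmega, z p ∈ W) :
    ∀ᵐ x ∂volI, z₀ x ∈ W := by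
  refine ae_of_ae_ae_fst ?_
  filter_upwards [hz, hW] with p h1 h2
  rwa [← h1]

lemma integrable_of_indep (hW1 : ∀ p ∈ W, ‖p‖ = 1) (hz : ∀ᵐ p ∂volOmega, z p = z₀ (p 0))
    (hW : ∀ᵐ p ∂volOmega, z p ∈ W) : Integrable z₀ volI := by
  obtain ⟨y, hy⟩ := (ae_ae_snd hz).exists
  have hm : AEStronglyMeasurable z₀ volI := by
    refine AEStronglyMeasurable.congr (f := fun x => z (pt x y)) ?_ hy
    exact ((Lp.stronglyMeasurable z).comp_measurable
      (measurable_pt.comp (measurable_id.prodMk measurable_const))).aestronglyMeasurable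
  refine Integrable.of_bound hm 1 ?_
  filter_upwards [ae_mem_of_indep hz hW] with x hx using (hW1 _ hx).le

lemma integrable_L1 (z : L1Omega) : Integrable z volOmega := L1.integrable_coeFn z

/-- Bounded variation limits the length of jump chains in `L`. Passing to the recurrent points `L'`
keeps this bound and gives the recurrence that `exists_isStep` needs. -/
theorem exists_isStep_of_totalVariation (hW1 : ∀ p ∈ W, ‖p‖ = 1)
    (hz : ∀ᵐ p ∂volOmega, z p = z₀ (p 0)) (hW : ∀ᵐ p ∂volOmega, z p ∈ W)
    (hTV : totalVariation z < ⊤) :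
    ∃ m x P, IsStep z₀ m x P ∧ ∀ i ≤ m, P i ∈ W := by
  obtain ⟨L, hL0, hL, hLW, K, hK⟩ := exists_chain_length_bound hz (integrable_of_indep hW1 hz hW) hTV
    (ae_mem_of_indep hz hW)
  obtain ⟨L', hLL, hL', hrec⟩ := exists_recurrent (W := (W : Set E3)) W.countable_toSet hLW hL
  obtain ⟨m, x, t, hs, ht⟩ := exists_isStep hL' (hLL.trans hL0) hrec (K := K) fun m t ht =>
    hK m t ⟨fun i hi => hLL (ht.1 i hi), ht.2⟩
  exact ⟨m, x, _, hs, fun i hi => hLW _ (hLL (ht.1 i hi))⟩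

theorem IsStep.limitEnergy_eq {k : ℕ} {q : Fin k → E3} (hq : ∀ l, ‖q l‖ = 1) {m : ℕ} {x : ℕ → ℝ}
    {P : ℕ → E3} (h : IsStep z₀ m x P) (hP : ∀ i ≤ m, P i ∈ wells q)
    (hz : ∀ᵐ p ∂volOmega, z p = z₀ (p 0)) (G : E3 → ℝ) :
    limitEnergy q G z = ∑ i ∈ Finset.range m, transition G (P i) (P (i + 1)) := by
  have hP1 : ∀ i ≤ m, ‖P i‖ ≤ 1 := fun i hi => by
    obtain ⟨l, hl | hl⟩ := hP i hi
    · rw [hl, hq]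
    · rw [hl, norm_neg, hq]
  have hz₀ : ∀ᵐ s ∂volI, z₀ s ∈ wells q := by
    have hall : ∀ᵐ s, ∀ i ≤ m, s ∈ Ioo (x i) (x (i + 1)) → z₀ s = P i := by
      rw [ae_all_iff]; intro i
      rw [eventually_imp_distrib_left]
      exact h.ae i
    have hne : ∀ᵐ s : ℝ, ∀ i, s ≠ x (i + 1) := ae_all_iff.2 fun i => by simp [ae_iff]
    filter_upwards [ae_restrict_of_ae hall, ae_restrict_of_ae hne, ae_restrict_mem measurableSet_Ioo]
      with s h1 h2 h3
    rcases h.exists_mem h3 with ⟨i, hi, hs⟩ | ⟨i, -, hs⟩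
    · rw [h1 i hi hs]; exact hP i hi
    · exact (h2 i hs).elim
  have hmem : ∀ᵐ p ∂volOmega, z p ∈ wells q := by
    filter_upwards [hz, ae_of_fst hz₀] with p h1 h2
    rwa [h1]
  rw [limitEnergy, if_pos ⟨⟨h.totalVariation_lt_top hP1 hz (integrable_L1 z), hmem⟩, z₀, hz⟩]
  exact h.lintegral_transition hz (integrable_L1 z) G

end HelicalXY

end

section

namespace HelicalXY

/-! ### The lattice -/

/-- The largest index of a lattice point. -/
def side (lam : ℝ) : ℤ := ⌈1 / lam⌉ - 1

lemma mem_unit_iff {lam : ℝ} (hl : 0 < lam) (j : ℤ) :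
    lam * j ∈ Ioo (0 : ℝ) 1 ↔ 1 ≤ j ∧ j ≤ side lam := by
  have h1 : lam * j < 1 ↔ j ≤ side lam := by
    rw [side, Int.le_sub_one_iff, Int.lt_ceil, lt_div_iff₀ hl, mul_comm]
  have h2 : 0 < lam * j ↔ 1 ≤ j := by
    rw [mul_pos_iff_of_pos_left hl]
    norm_cast
  rw [mem_Ioo, h1, h2]

lemma mem_lattice_iff {lam : ℝ} (hl : 0 < lam) (i : ℤ × ℤ) :
    i ∈ lattice lam ↔ (1 ≤ i.1 ∧ i.1 ≤ side lam) ∧ (1 ≤ i.2 ∧ i.2 ≤ side lam) := by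
  rw [← mem_unit_iff hl, ← mem_unit_iff hl]; rfl

/-- The columns of the bulk. -/
def cols (lam : ℝ) : Finset ℤ := Finset.Icc 1 (side lam - 2)

/-- The rows of the bulk. -/
def rows (lam : ℝ) : Finset ℤ := Finset.Icc 1 (side lam - 1)

lemma bulk_eq {lam : ℝ} (hl : 0 < lam) : bulk lam = ↑(cols lam ×ˢ rows lam) := by
  ext ⟨j, m⟩
  simp only [bulk, mem_lattice_iff hl, cols, rows, Finset.coe_product, Finset.coe_Icc, mem_prod,
    mem_Icc, mem_ofPred_eq]
  constructor
  · rintro ⟨⟨⟨h1, h2⟩, h3, h4⟩, ⟨⟨h5, h6⟩, -⟩, -, h9, h10⟩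
    exact ⟨⟨h1, by omega⟩, h3, by omega⟩
  · rintro ⟨⟨h1, h2⟩, h3, h4⟩
    exact ⟨⟨⟨h1, by omega⟩, h3, by omega⟩, ⟨⟨by omega, by omega⟩, h3, by omega⟩,
      ⟨h1, by omega⟩, by omega, by omega⟩

lemma side_mul_le {lam : ℝ} (hl : 0 < lam) : lam * side lam ≤ 1 := by
  have h1 : (side lam : ℝ) < 1 / lam := by
    rw [← Int.lt_ceil, side]; omega
  rw [lt_div_iff₀ hl] at h1
  linarith

lemma eventually_floor {lam : ℕ → ℝ} (hl : ∀ n, 0 < lam n) (hl0 : Tendsto lam atTop (𝓝 0)) {x : ℝ}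
    (hx : x ∈ Ioo (0 : ℝ) 1) (K : ℕ) :
    ∀ᶠ n in atTop, 1 ≤ ⌊x / lam n⌋ ∧ ⌊x / lam n⌋ + K ≤ side (lam n) := by
  have h1 : Tendsto (fun n => x + K * lam n) atTop (𝓝 (x + K * 0)) :=
    tendsto_const_nhds.add (hl0.const_mul _)
  rw [mul_zero, add_zero] at h1
  filter_upwards [hl0.eventually (gt_mem_nhds hx.1), h1.eventually (gt_mem_nhds hx.2)] with n hn hn'
  have hp := hl n
  have h2 : (1 : ℤ) ≤ ⌊x / lam n⌋ := by
    rw [Int.le_floor, le_div_iff₀ hp]; push_cast; linarith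
  refine ⟨h2, ((mem_unit_iff hp _).1 ⟨?_, ?_⟩).2⟩
  · have : (1 : ℝ) ≤ ⌊x / lam n⌋ := by exact_mod_cast h2
    push_cast
    positivity
  · have := Int.floor_le (x / lam n)
    rw [le_div_iff₀ hp] at this
    push_cast
    linarith

lemma measurable_floor_div (lam : ℝ) : Measurable fun x : ℝ => ⌊x / lam⌋ :=
  Int.measurable_floor.comp (measurable_id.div_const _)

lemma lintegral_floor {lam : ℝ} (hl : 0 < lam) (F : ℤ → ℝ≥0∞) :
    ∫⁻ x : ℝ, F ⌊x / lam⌋ = ENNReal.ofReal lam * ∑' j, F j := by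
  have hm : Measurable fun x : ℝ => ⌊x / lam⌋ := measurable_floor_div lam
  rw [← lintegral_map (f := F) (Measurable.of_discrete) hm, lintegral_countable', mul_comm,
    ← ENNReal.tsum_mul_right]
  refine tsum_congr fun j => ?_
  congr 1
  rw [Measure.map_apply hm (measurableSet_singleton _)]
  have : (fun x : ℝ => ⌊x / lam⌋) ⁻¹' {j} = Ico (j * lam) ((j + 1) * lam) := by
    ext x
    rw [mem_preimage, mem_singleton_iff, Int.floor_eq_iff, le_div_iff₀ hl, div_lt_iff₀ hl, mem_Ico]
  rw [this, Real.volume_Ico]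
  congr 1; ring

lemma lintegral_floor_le {lam : ℝ} (hl : 0 < lam) (F : ℤ → ℝ≥0∞) :
    ∫⁻ x, F ⌊x / lam⌋ ∂volI ≤ ENNReal.ofReal lam * ∑' j, F j :=
  (setLIntegral_le_lintegral _ _).trans (lintegral_floor hl F).le

/-! ### Rewriting the energy -/

lemma scale_eq {lam del h : ℝ} (hd : 0 < del) (hh : h = Real.sqrt (2 * del)) :
    Real.sqrt 2 * lam * del ^ (3 / 2 : ℝ) = lam * h ^ 3 / 2 := by
  have h1 : del ^ (3 / 2 : ℝ) = Real.sqrt del ^ 3 := by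
    rw [Real.sqrt_eq_rpow, ← Real.rpow_natCast, ← Real.rpow_mul hd.le]; norm_num
  rw [h1, hh, Real.sqrt_mul zero_le_two, mul_pow]
  have : Real.sqrt 2 ^ 3 = 2 * Real.sqrt 2 := by
    rw [pow_succ, Real.sq_sqrt zero_le_two]
  rw [this]; ring

/-- The horizontal part of the energy of the grid. -/
def horE (lam h : ℝ) (G : E3 → ℝ) (u : ℤ × ℤ → E3) : ℝ :=
  lam * ∑ i ∈ cols lam ×ˢ rows lam, siteE h G (u i) (u (i.1 + 1, i.2)) (u (i.1 + 2, i.2))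

/-- The sum of the squared vertical differences. -/
def verE (lam : ℝ) (u : ℤ × ℤ → E3) : ℝ :=
  ∑ i ∈ cols lam ×ˢ rows lam, ‖u (i.1, i.2 + 1) - u i‖ ^ 2

/-- The normalization is `λ h³ / 2` with `h = √(2δ)`. The factor `λ` left in `horE` is the height of
a row. The lower bound on `J₂` will make the vertical coefficient `J λ / h³` at least of order
`h⁻²`. -/
lemma energy_eq {lam del h J : ℝ} (hl : 0 < lam) (hd : 0 < del) (hh : h = Real.sqrt (2 * del))
    (G : E3 → ℝ) (u : ℤ × ℤ → E3) :
    energyH lam del J u + penalty lam del G u =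
      (Real.sqrt 2 * lam * del ^ (3 / 2 : ℝ)) * (horE lam h G u + J * lam / h ^ 3 * verE lam u) := by
  have hh0 : 0 < h := by rw [hh]; positivity
  have hd2 : del = h ^ 2 / 2 := by rw [hh, Real.sq_sqrt (by positivity)]; ring
  rw [energyH, penalty, bulk_eq hl, finsum_mem_coe_finset, finsum_mem_coe_finset,
    finsum_mem_coe_finset, scale_eq hd hh, horE, verE, hd2]
  rw [mul_add (1 / 2 : ℝ), add_right_comm, mul_add (lam * h ^ 3 / 2)]
  congr 1
  · rw [Finset.mul_sum, Finset.mul_sum, Finset.mul_sum, Finset.mul_sum, ← Finset.sum_add_distrib]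
    refine Finset.sum_congr rfl fun i _ => ?_
    rw [siteE]
    field_simp
  · rw [← Finset.mul_sum]
    field_simp

lemma horE_nonneg {lam h : ℝ} (hl : 0 < lam) (hh : 0 < h) {G : E3 → ℝ} (hG : ∀ x, 0 ≤ G x)
    (u : ℤ × ℤ → E3) : 0 ≤ horE lam h G u :=
  mul_nonneg hl.le (Finset.sum_nonneg fun _ _ => siteE_nonneg hh hG _ _ _)

lemma verE_nonneg (lam : ℝ) (u : ℤ × ℤ → E3) : 0 ≤ verE lam u :=
  Finset.sum_nonneg fun _ _ => sq_nonneg _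

/-- The energies read only lattice values, so a spin field may be extended by unit vectors off the
lattice. -/
lemma energy_congr {lam h : ℝ} {G : E3 → ℝ} {u u' : ℤ × ℤ → E3} (hl : 0 < lam)
    (h' : ∀ i ∈ lattice lam, u i = u' i) :
    horE lam h G u = horE lam h G u' ∧ verE lam u = verE lam u' := by
  have hi : ∀ i ∈ cols lam ×ˢ rows lam, ∀ a b : ℤ, 0 ≤ a → a ≤ 2 → 0 ≤ b → b ≤ 1 →
      u (i.1 + a, i.2 + b) = u' (i.1 + a, i.2 + b) := by
    intro i hi a b ha ha' hb hb'
    simp only [cols, rows, Finset.mem_product, Finset.mem_Icc] at hi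
    refine h' _ ((mem_lattice_iff hl _).2 ?_)
    simp only
    omega
  constructor
  · rw [horE, horE]
    congr 1
    refine Finset.sum_congr rfl fun i hi' => ?_
    have e0 := hi i hi' 0 0 (by norm_num) (by norm_num) (by norm_num) (by norm_num)
    have e1 := hi i hi' 1 0 (by norm_num) (by norm_num) (by norm_num) (by norm_num)
    have e2 := hi i hi' 2 0 (by norm_num) (by norm_num) (by norm_num) (by norm_num)
    simp only [add_zero, Prod.mk.eta] at e0 e1 e2
    rw [e0, e1, e2]
  · rw [verE, verE]
    refine Finset.sum_congr rfl fun i hi' => ?_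
    have e0 := hi i hi' 0 0 (by norm_num) (by norm_num) (by norm_num) (by norm_num)
    have e1 := hi i hi' 0 1 (by norm_num) (by norm_num) (by norm_num) (by norm_num)
    simp only [add_zero, Prod.mk.eta] at e0 e1
    rw [e0, e1]

end HelicalXY

end

section

namespace HelicalXY

variable {G : E3 → ℝ} {W : Finset E3} {lam h : ℕ → ℝ} {u : ℕ → ℤ × ℤ → E3} {κ C : ℝ} {z : L1Omega}

/-! ### Sequences of low energy -/

/-- A sequence of unit spin fields on refining grids, with bounded energies. -/
structure LowEnergy (G : E3 → ℝ) (lam h : ℕ → ℝ) (u : ℕ → ℤ × ℤ → E3) (κ C : ℝ) : Prop where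
  lam_pos : ∀ n, 0 < lam n
  lam_lim : Tendsto lam atTop (𝓝 0)
  h_pos : ∀ n, 0 < h n
  h_lim : Tendsto h atTop (𝓝 0)
  ratio : Tendsto (fun n => lam n / h n) atTop (𝓝 0)
  unit : ∀ n i, ‖u n i‖ = 1
  κ_pos : 0 < κ
  hor : ∀ n, horE (lam n) (h n) G (u n) ≤ C
  ver : ∀ n, κ / h n ^ 2 * verE (lam n) (u n) ≤ C

/-- The rescaled chirality on the cells of the grid. -/
def gridChir (lam h : ℝ) (u : ℤ × ℤ → E3) (p : E2) : E3 :=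
  chir h (u (⌊p 0 / lam⌋, ⌊p 1 / lam⌋)) (u (⌊p 0 / lam⌋ + 1, ⌊p 1 / lam⌋))

lemma LowEnergy.nonneg (H : LowEnergy G lam h u κ C) (hG : IsPenalty G) : 0 ≤ C :=
  (horE_nonneg (H.lam_pos 0) (H.h_pos 0) hG.nonneg _).trans (H.hor 0)

/-- The integral of `siteE / h` over the cells is `(λ / h) horE → 0`. By Fatou almost every point
has a site energy below `h m` infinitely often, for every `m > 0`; then `exists_site_bound` puts the
limit in the closed set `W`. -/
lemma LowEnergy.ae_mem (H : LowEnergy G lam h u κ C) (hG : IsPenalty G) (hW : IsWells G W)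
    (hlim : ∀ᵐ p ∂volOmega, Tendsto (fun n => gridChir (lam n) (h n) (u n) p) atTop (𝓝 (z p))) :
    ∀ᵐ p ∂volOmega, z p ∈ W := by
  classical
  set F : ℕ → ℤ × ℤ → ℝ≥0∞ := fun n i => if i ∈ cols (lam n) ×ˢ rows (lam n) then
    ENNReal.ofReal (siteE (h n) G (u n i) (u n (i.1 + 1, i.2)) (u n (i.1 + 2, i.2)) / h n) else 0
    with hF
  have hm : ∀ n, Measurable fun p : E2 => (⌊p 0 / lam n⌋, ⌊p 1 / lam n⌋) := fun n =>
    ((measurable_floor_div _).comp (by fun_prop)).prodMk ((measurable_floor_div _).comp (by fun_prop))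
  have hFm : ∀ n, Measurable fun p : E2 => F n (⌊p 0 / lam n⌋, ⌊p 1 / lam n⌋) := fun n =>
    (Measurable.of_discrete (f := F n)).comp (hm n)
  have hle : ∀ n, ∫⁻ p, F n (⌊p 0 / lam n⌋, ⌊p 1 / lam n⌋) ∂volOmega ≤
      ENNReal.ofReal (lam n / h n * C) := by
    intro n
    have hl := H.lam_pos n
    have hh := H.h_pos n
    rw [lintegral_volOmega (hFm n).aemeasurable]
    simp only [pt_zero, pt_one]
    calc ∫⁻ y, ∫⁻ x, F n (⌊x / lam n⌋, ⌊y / lam n⌋) ∂volI ∂volI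
        ≤ ∫⁻ y, ENNReal.ofReal (lam n) * ∑' j, F n (j, ⌊y / lam n⌋) ∂volI :=
          lintegral_mono fun y => lintegral_floor_le hl fun j => F n (j, ⌊y / lam n⌋)
      _ ≤ ENNReal.ofReal (lam n) * ∑' m, (ENNReal.ofReal (lam n) * ∑' j, F n (j, m)) :=
          lintegral_floor_le hl fun m => ENNReal.ofReal (lam n) * ∑' j, F n (j, m)
      _ = ENNReal.ofReal (lam n) * (ENNReal.ofReal (lam n) * ∑' i, F n i) := by
          rw [ENNReal.tsum_mul_left, ENNReal.tsum_comm, ENNReal.tsum_prod']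
      _ = ENNReal.ofReal (lam n / h n * horE (lam n) (h n) G (u n)) := by
          rw [tsum_eq_sum (s := cols (lam n) ×ˢ rows (lam n)) (f := F n) fun i hi => if_neg hi,
            Finset.sum_congr rfl fun i hi => (if_pos hi : F n i = ENNReal.ofReal (siteE (h n) G (u n i)
              (u n (i.1 + 1, i.2)) (u n (i.1 + 2, i.2)) / h n)),
            ← ENNReal.ofReal_sum_of_nonneg fun i _ =>
              div_nonneg (siteE_nonneg hh hG.nonneg _ _ _) hh.le,
            ← ENNReal.ofReal_mul hl.le, ← ENNReal.ofReal_mul hl.le, horE, ← Finset.sum_div]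
          congr 1
          field_simp
      _ ≤ _ := ENNReal.ofReal_le_ofReal (by have := H.hor n; gcongr)
  have hzero : ∫⁻ p, liminf (fun n => F n (⌊p 0 / lam n⌋, ⌊p 1 / lam n⌋)) atTop ∂volOmega = 0 := by
    refine le_antisymm ((lintegral_liminf_le hFm).trans ?_) zero_le
    have ht : Tendsto (fun n => ENNReal.ofReal (lam n / h n * C)) atTop (𝓝 0) := by
      have := ENNReal.tendsto_ofReal (H.ratio.mul_const C)
      simpa using this
    rw [← ht.liminf_eq]
    exact liminf_le_liminf (Eventually.of_forall hle)
  rw [lintegral_eq_zero_iff (Measurable.liminf hFm)] at hzero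
  filter_upwards [hzero, hlim, ae_restrict_mem measurableSet_Omega] with p hp0 hpl hpΩ
  obtain ⟨hx, hy⟩ := mem_Omega.1 hpΩ
  have hcl : z p ∈ closure (W : Set E3) := by
    rw [Metric.mem_closure_iff]
    intro ε hε
    obtain ⟨m, hm, h₀, hh₀, hsite⟩ := exists_site_bound hG hW (half_pos hε)
    have hfr : ∃ᶠ n in atTop, F n (⌊p 0 / lam n⌋, ⌊p 1 / lam n⌋) < ENNReal.ofReal m := by
      refine frequently_lt_of_liminf_lt (by isBoundedDefault) ?_
      rw [hp0]; exact ENNReal.ofReal_pos.2 hm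
    have hev : ∀ᶠ n in atTop, dist (z p) (gridChir (lam n) (h n) (u n) p) < ε / 2 := by
      have := (tendsto_const_nhds (x := z p)).dist hpl
      rw [dist_self] at this
      exact this.eventually (gt_mem_nhds (half_pos hε))
    obtain ⟨n, hn, hn1, hn2, hn3, hn4⟩ := (hfr.and_eventually (hev.and
      ((H.h_lim.eventually (gt_mem_nhds hh₀)).and ((eventually_floor H.lam_pos H.lam_lim hx 2).and
        (eventually_floor H.lam_pos H.lam_lim hy 2))))).exists
    have hh := H.h_pos n
    have hmem : (⌊p 0 / lam n⌋, ⌊p 1 / lam n⌋) ∈ cols (lam n) ×ˢ rows (lam n) := by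
      simp only [cols, rows, Finset.mem_product, Finset.mem_Icc]
      push_cast at hn3 hn4
      omega
    have hs : siteE (h n) G (u n (⌊p 0 / lam n⌋, ⌊p 1 / lam n⌋))
        (u n (⌊p 0 / lam n⌋ + 1, ⌊p 1 / lam n⌋)) (u n (⌊p 0 / lam n⌋ + 2, ⌊p 1 / lam n⌋)) ≤
        h n * m := by
      simp only [hF] at hn
      rw [if_pos hmem, ENNReal.ofReal_lt_ofReal_iff hm, div_lt_iff₀ hh] at hn
      linarith
    obtain ⟨w, hw, hwd⟩ := hsite (h n) hh hn2 _ _ _ (H.unit n _) (H.unit n _) (H.unit n _) hs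
    refine ⟨w, hw, ?_⟩
    have h1 : dist (gridChir (lam n) (h n) (u n) p) w < ε / 2 := by rw [dist_eq_norm]; exact hwd
    linarith [dist_triangle (z p) (gridChir (lam n) (h n) (u n) p) w]
  rwa [W.finite_toSet.isClosed.closure_eq] at hcl

/-! ### Rigidity in the vertical direction -/

/-- The rescaled vertical energy of a column. -/
def colE (lam h : ℝ) (u : ℤ × ℤ → E3) (j : ℤ) : ℝ :=
  ∑ m ∈ rows lam, ‖u (j, m + 1) - u (j, m)‖ ^ 2 / h ^ 2

lemma colE_nonneg (lam h : ℝ) (u : ℤ × ℤ → E3) (j : ℤ) : 0 ≤ colE lam h u j :=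
  Finset.sum_nonneg fun _ _ => by positivity

/-- The sum of `colE` over the columns is at most `C / κ`, so `colE / λ` has bounded integral in
`x`, and Fatou makes its lower limit finite almost everywhere. Two neighbouring columns are needed
since the chirality involves both. -/
lemma LowEnergy.ae_frequently_colE (H : LowEnergy G lam h u κ C) :
    ∀ᵐ x ∂volI, ∃ c : ℝ, ∃ᶠ n in atTop,
      colE (lam n) (h n) (u n) ⌊x / lam n⌋ + colE (lam n) (h n) (u n) (⌊x / lam n⌋ + 1) ≤
        c * lam n := by
  classical
  set F : ℕ → ℤ → ℝ≥0∞ := fun n j => if j ∈ cols (lam n) then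
    ENNReal.ofReal (colE (lam n) (h n) (u n) j / lam n) else 0 with hF
  have hm1 : ∀ n, Measurable fun x : ℝ => F n ⌊x / lam n⌋ := fun n =>
    (Measurable.of_discrete (f := F n)).comp (measurable_floor_div _)
  have hm2 : ∀ n, Measurable fun x : ℝ => F n (⌊x / lam n⌋ + 1) := fun n =>
    (Measurable.of_discrete (f := fun j => F n (j + 1))).comp (measurable_floor_div _)
  have hsum : ∀ n, ENNReal.ofReal (lam n) * ∑' j, F n j ≤ ENNReal.ofReal (C / κ) := by
    intro n
    have hl := H.lam_pos n
    have hh := H.h_pos n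
    have hκ := H.κ_pos
    rw [tsum_eq_sum (s := cols (lam n)) (f := F n) fun i hi => if_neg hi,
      Finset.sum_congr rfl fun j hj => (if_pos hj : F n j =
        ENNReal.ofReal (colE (lam n) (h n) (u n) j / lam n)),
      ← ENNReal.ofReal_sum_of_nonneg fun i _ => div_nonneg (colE_nonneg _ _ _ _) hl.le,
      ← ENNReal.ofReal_mul hl.le]
    refine ENNReal.ofReal_le_ofReal ?_
    rw [← Finset.sum_div, mul_div_cancel₀ _ hl.ne', le_div_iff₀ hκ]
    refine le_trans (le_of_eq ?_) (H.ver n)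
    simp only [colE, verE]
    rw [Finset.sum_product, Finset.mul_sum, Finset.sum_mul]
    refine Finset.sum_congr rfl fun j _ => ?_
    rw [Finset.mul_sum, Finset.sum_mul]
    refine Finset.sum_congr rfl fun m _ => ?_
    ring
  have hle : ∀ n, ∫⁻ x, (F n ⌊x / lam n⌋ + F n (⌊x / lam n⌋ + 1)) ∂volI ≤
      ENNReal.ofReal (C / κ) + ENNReal.ofReal (C / κ) := by
    intro n
    rw [lintegral_add_left (hm1 n)]
    refine add_le_add ((lintegral_floor_le (H.lam_pos n) _).trans (hsum n))
      ((lintegral_floor_le (H.lam_pos n) fun j => F n (j + 1)).trans (le_trans (le_of_eq ?_) (hsum n)))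
    rw [(Equiv.addRight (1 : ℤ)).tsum_eq (F n) |>.symm]
    rfl
  have hfin : ∫⁻ x, liminf (fun n => F n ⌊x / lam n⌋ + F n (⌊x / lam n⌋ + 1)) atTop ∂volI < ⊤ := by
    refine lt_of_le_of_lt ((lintegral_liminf_le fun n => (hm1 n).add (hm2 n)).trans
      (liminf_le_liminf (Eventually.of_forall hle))) ?_
    rw [liminf_const]
    exact ENNReal.add_lt_top.2 ⟨ENNReal.ofReal_lt_top, ENNReal.ofReal_lt_top⟩
  filter_upwards [ae_lt_top (Measurable.liminf fun n => (hm1 n).add (hm2 n)) hfin.ne,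
    ae_restrict_mem measurableSet_Ioo] with x hx hx1
  obtain ⟨c, hc, hlt⟩ := ENNReal.lt_iff_exists_nnreal_btwn.1 hx
  refine ⟨c, ((frequently_lt_of_liminf_lt (by isBoundedDefault) hc).and_eventually
    (eventually_floor H.lam_pos H.lam_lim hx1 3)).mono fun n ⟨hn, hn1, hn2⟩ => ?_⟩
  have hl := H.lam_pos n
  push_cast at hn2
  simp only [hF, Pi.add_apply] at hn
  rw [if_pos (by rw [cols, Finset.mem_Icc]; omega), if_pos (by rw [cols, Finset.mem_Icc]; omega),
    ← ENNReal.ofReal_add (div_nonneg (colE_nonneg _ _ _ _) hl.le)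
      (div_nonneg (colE_nonneg _ _ _ _) hl.le), ← add_div] at hn
  rw [← ENNReal.ofReal_coe_nnreal, ENNReal.ofReal_lt_ofReal_iff', div_lt_iff₀ hl] at hn
  exact hn.1.le

lemma norm_sub_sq_le_sum (X : ℕ → E3) (N : ℕ) :
    ‖X N - X 0‖ ^ 2 ≤ N * ∑ k ∈ Finset.range N, ‖X (k + 1) - X k‖ ^ 2 := by
  rw [← Finset.sum_range_sub]
  calc ‖∑ k ∈ Finset.range N, (X (k + 1) - X k)‖ ^ 2
      ≤ (∑ k ∈ Finset.range N, ‖X (k + 1) - X k‖) ^ 2 := by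
        gcongr; exact norm_sum_le _ _
    _ ≤ _ := by
        have := sq_sum_le_card_mul_sum_sq (s := Finset.range N) (f := fun k => ‖X (k + 1) - X k‖)
        rwa [Finset.card_range] at this

lemma norm_chir_sub_sq_le {h : ℝ} (hh : 0 < h) {a b a' b' : E3} (hb : ‖b‖ = 1) (ha' : ‖a'‖ = 1) :
    ‖chir h a' b' - chir h a b‖ ^ 2 ≤ 2 * (‖a' - a‖ ^ 2 / h ^ 2 + ‖b' - b‖ ^ 2 / h ^ 2) := by
  have h1 : h • (chir h a' b' - chir h a b) = cross (a' - a) b + cross a' (b' - b) := by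
    rw [smul_sub, ← chir_eq hh, ← chir_eq hh, cross_sub_left, cross_sub_right]; abel
  have h2 : h * ‖chir h a' b' - chir h a b‖ ≤ ‖a' - a‖ + ‖b' - b‖ := by
    have e : ‖h • (chir h a' b' - chir h a b)‖ = h * ‖chir h a' b' - chir h a b‖ := by
      rw [norm_smul, Real.norm_of_nonneg hh.le]
    rw [← e, h1]
    refine (norm_add_le _ _).trans (add_le_add ?_ ?_)
    · simpa [hb] using norm_cross_le (a' - a) b
    · simpa [ha'] using norm_cross_le a' (b' - b)
  rw [← add_div, mul_div_assoc', le_div_iff₀ (by positivity)]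
  have h3 : (h * ‖chir h a' b' - chir h a b‖) ^ 2 ≤ (‖a' - a‖ + ‖b' - b‖) ^ 2 := by gcongr
  nlinarith [sq_nonneg (‖a' - a‖ - ‖b' - b‖)]

/-- Cauchy–Schwarz over the at most `(y' - y) / λ + 1` vertical steps, each of which changes the
chirality by at most the two spin increments divided by `h`. -/
lemma norm_column_sub_sq_le {lam h : ℝ} (hl : 0 < lam) (hh : 0 < h) {u : ℤ × ℤ → E3}
    (hu : ∀ i, ‖u i‖ = 1) (j : ℤ) {y y' : ℝ} (hyy : y ≤ y') (hy : 1 ≤ ⌊y / lam⌋)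
    (hy' : ⌊y' / lam⌋ ≤ side lam) :
    ‖chir h (u (j, ⌊y' / lam⌋)) (u (j + 1, ⌊y' / lam⌋)) -
        chir h (u (j, ⌊y / lam⌋)) (u (j + 1, ⌊y / lam⌋))‖ ^ 2 ≤
      ((y' - y) / lam + 1) * (2 * (colE lam h u j + colE lam h u (j + 1))) := by
  have hfl : ⌊y / lam⌋ ≤ ⌊y' / lam⌋ := Int.floor_le_floor (by gcongr)
  obtain ⟨N, hN⟩ := Int.eq_ofNat_of_zero_le (sub_nonneg.2 hfl)
  set m := ⌊y / lam⌋ with hm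
  have hm' : ⌊y' / lam⌋ = m + N := by omega
  have key := norm_sub_sq_le_sum (fun k => chir h (u (j, m + k)) (u (j + 1, m + k))) N
  simp only [Nat.cast_zero, add_zero] at key
  rw [hm']
  have hNle : (N : ℝ) ≤ (y' - y) / lam + 1 := by
    have h1 := Int.floor_le (y' / lam)
    have h2 := Int.lt_floor_add_one (y / lam)
    rw [hm'] at h1
    push_cast at h1
    rw [sub_div]
    linarith
  have hsum : ∑ k ∈ Finset.range N, ‖chir h (u (j, m + (k + 1 : ℕ))) (u (j + 1, m + (k + 1 : ℕ))) -
      chir h (u (j, m + k)) (u (j + 1, m + k))‖ ^ 2 ≤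
      2 * (colE lam h u j + colE lam h u (j + 1)) := by
    have hsub : ∀ f : ℤ → ℝ, (∀ i, 0 ≤ f i) →
        ∑ k ∈ Finset.range N, f (m + k) ≤ ∑ i ∈ rows lam, f i := by
      intro f hf
      rw [← Finset.sum_image (s := Finset.range N) (g := fun k : ℕ => m + (k : ℤ)) (f := f)
        fun a _ b _ hab => by simpa using hab]
      refine Finset.sum_le_sum_of_subset_of_nonneg (fun i hi => ?_) fun i _ _ => hf i
      obtain ⟨k, hk, rfl⟩ := Finset.mem_image.1 hi
      have := Finset.mem_range.1 hk
      rw [rows, Finset.mem_Icc]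
      omega
    have h1 := hsub (fun i => ‖u (j, i + 1) - u (j, i)‖ ^ 2 / h ^ 2) fun i => by positivity
    have h2 := hsub (fun i => ‖u (j + 1, i + 1) - u (j + 1, i)‖ ^ 2 / h ^ 2) fun i => by positivity
    rw [← colE] at h1 h2
    refine le_trans ?_ (mul_le_mul_of_nonneg_left (add_le_add h1 h2) zero_le_two)
    rw [← Finset.sum_add_distrib, Finset.mul_sum]
    refine Finset.sum_le_sum fun k _ => ?_
    have := norm_chir_sub_sq_le hh (a := u (j, m + k)) (b := u (j + 1, m + k))
      (a' := u (j, m + (k + 1 : ℕ))) (b' := u (j + 1, m + (k + 1 : ℕ))) (hu _) (hu _)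
    push_cast at this ⊢
    simpa only [add_assoc] using this
  refine key.trans ?_
  gcongr

lemma exists_mem_Ioo_of_ae {P : ℝ → Prop} (h : ∀ᵐ y ∂volI, P y) {a b : ℝ} (ha : 0 ≤ a) (hab : a < b)
    (hb : b ≤ 1) : ∃ y ∈ Ioo a b, P y := by
  have h1 : ∀ᵐ y ∂volume.restrict (Ioo a b), P y :=
    ae_mono (Measure.restrict_mono (Ioo_subset_Ioo ha hb) le_rfl) h
  have : (ae (volume.restrict (Ioo a b))).NeBot := by
    rw [ae_neBot, Ne, Measure.restrict_eq_zero, Real.volume_Ioo]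
    simpa using hab
  obtain ⟨y, hy, hy'⟩ := (h1.and (ae_restrict_mem measurableSet_Ioo)).exists
  exact ⟨y, hy', hy⟩

/-- Points of `Y` are found in every subinterval, so two of them are joined through intermediate
points at distance less than `r`; each step gains at least `r / 2`. -/
lemma eq_of_locally_eq {X : Type*} {f : ℝ → X} {Y : Set ℝ} (hY : ∀ᵐ y ∂volI, y ∈ Y)
    (hY0 : Y ⊆ Ioo 0 1) {r : ℝ} (hr : 0 < r)
    (hf : ∀ y ∈ Y, ∀ y' ∈ Y, y ≤ y' → y' - y < r → f y = f y') :
    ∀ y ∈ Y, ∀ y' ∈ Y, y ≤ y' → f y = f y' := by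
  have key : ∀ k : ℕ, ∀ y ∈ Y, ∀ y' ∈ Y, y ≤ y' → y' - y < k * (r / 2) → f y = f y' := by
    intro k
    induction k with
    | zero => intro y _ y' _ h1 h2; simp at h2; linarith
    | succ k ih =>
      intro y hy y' hy' h1 h2
      by_cases hlt : y' - y < r
      · exact hf y hy y' hy' h1 hlt
      rw [not_lt] at hlt
      have b0 := hY0 hy
      have b1 := hY0 hy'
      obtain ⟨y'', h3, h4⟩ := exists_mem_Ioo_of_ae hY (a := y' - r) (b := y' - r / 2)
        (by linarith [b0.1]) (by linarith) (by linarith [b1.2])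
      push_cast at h2
      rw [ih y hy y'' h4 (by linarith [h3.1]) (by linarith [h3.2])]
      exact hf y'' h4 y' hy' (by linarith [h3.2]) (by linarith [h3.1])
  intro y hy y' hy' h1
  obtain ⟨k, hk⟩ := exists_nat_gt ((y' - y) / (r / 2))
  rw [div_lt_iff₀ (by positivity)] at hk
  exact key k y hy y' hy' h1 hk

/-- On almost every column the energy is at most `c λ` infinitely often, while two heights are about
`(y' - y) / λ` steps apart. The powers of `λ` cancel and `‖z(x, y') - z(x, y)‖² ≤ 2 (|c| + 1) (y' -
y)`. Values in separated wells are then locally constant in `y`. -/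
theorem LowEnergy.indepOfY (H : LowEnergy G lam h u κ C) (hG : IsPenalty G) (hW : IsWells G W)
    (hlim : ∀ᵐ p ∂volOmega, Tendsto (fun n => gridChir (lam n) (h n) (u n) p) atTop (𝓝 (z p))) :
    ∃ z₀ : ℝ → E3, ∀ᵐ p ∂volOmega, z p = z₀ (p 0) := by
  obtain ⟨d, hd, hsep⟩ := exists_separation W
  have hmem := H.ae_mem hG hW hlim
  have hconst : ∀ᵐ x ∂volI, ∃ a, ∀ᵐ y ∂volI, z (pt x y) = a := by
    filter_upwards [H.ae_frequently_colE, ae_ae_fst hlim, ae_ae_fst hmem] with x ⟨c, hc⟩ hxl hxm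
    set Y : Set ℝ := {y | y ∈ Ioo (0 : ℝ) 1 ∧ z (pt x y) ∈ W ∧
      Tendsto (fun n => gridChir (lam n) (h n) (u n) (pt x y)) atTop (𝓝 (z (pt x y)))} with hYdef
    have hY : ∀ᵐ y ∂volI, y ∈ Y := by
      filter_upwards [hxl, hxm, ae_restrict_mem measurableSet_Ioo] with y h1 h2 h3
        using ⟨h3, h2, h1⟩
    have hloc : ∀ y ∈ Y, ∀ y' ∈ Y, y ≤ y' → y' - y < d ^ 2 / (2 * (|c| + 1)) →
        z (pt x y) = z (pt x y') := by
      intro y hy y' hy' hyy hlt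
      by_contra hne
      have hdist := hsep _ hy'.2.1 _ hy.2.1 (Ne.symm hne)
      have hle : ‖z (pt x y') - z (pt x y)‖ ^ 2 ≤ (y' - y + 0) * (2 * (|c| + 1)) := by
        have t1 := ((hy'.2.2.sub hy.2.2).norm).pow 2
        have t2 : Tendsto (fun n => (y' - y + lam n) * (2 * (|c| + 1))) atTop
            (𝓝 ((y' - y + 0) * (2 * (|c| + 1)))) :=
          (tendsto_const_nhds.add H.lam_lim).mul_const _
        refine le_of_tendsto_of_tendsto_of_frequently t1 t2 ?_
        refine (hc.and_eventually ((eventually_floor H.lam_pos H.lam_lim hy.1 0).and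
          (eventually_floor H.lam_pos H.lam_lim hy'.1 0))).mono fun n ⟨hn, hn1, hn2⟩ => ?_
        have hl := H.lam_pos n
        have := norm_column_sub_sq_le hl (H.h_pos n) (H.unit n) ⌊x / lam n⌋ hyy hn1.1
          (by simpa using hn2.2)
        refine this.trans ?_
        have hc' : c ≤ |c| + 1 := by linarith [le_abs_self c]
        calc ((y' - y) / lam n + 1) * (2 * (colE (lam n) (h n) (u n) ⌊x / lam n⌋ +
              colE (lam n) (h n) (u n) (⌊x / lam n⌋ + 1)))
            ≤ ((y' - y) / lam n + 1) * (2 * ((|c| + 1) * lam n)) := by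
              have h0 : 0 ≤ (y' - y) / lam n + 1 := by
                have := div_nonneg (sub_nonneg.2 hyy) hl.le
                linarith
              gcongr
              exact hn.trans (by gcongr)
          _ = (y' - y + lam n) * (2 * (|c| + 1)) := by field_simp
      rw [lt_div_iff₀ (by positivity)] at hlt
      have : d ^ 2 ≤ ‖z (pt x y') - z (pt x y)‖ ^ 2 := by gcongr
      linarith
    have heq := eq_of_locally_eq (f := fun y => z (pt x y)) hY (fun y hy => hy.1)
      (by positivity) hloc
    obtain ⟨y₀, hy₀⟩ := hY.exists
    refine ⟨z (pt x y₀), ?_⟩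
    filter_upwards [hY] with y hy
    rcases le_total y y₀ with h' | h'
    · exact heq y hy y₀ hy₀ h'
    · exact (heq y₀ hy₀ y hy h').symm
  -- The average over the column is a measurable representative of the constant value, which allows
  -- passing from almost every column to almost every point.
  refine ⟨fun x => ∫ y, z (pt x y) ∂volI, ?_⟩
  rw [ae_volOmega]
  have hzm : StronglyMeasurable fun q : ℝ × ℝ => z (pt q.1 q.2) :=
    (Lp.stronglyMeasurable z).comp_measurable measurable_pt
  have hz₀ : StronglyMeasurable fun x : ℝ => ∫ y, z (pt x y) ∂volI := hzm.integral_prod_right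
  refine (Measure.ae_prod_iff_ae_ae (measurableSet_eq_fun hzm.measurable
    (hz₀.measurable.comp measurable_fst))).2 ?_
  filter_upwards [hconst] with x ⟨a, ha⟩
  have : ∫ y, z (pt x y) ∂volI = a := by
    rw [integral_congr_ae ha]; simp
  simp only [Function.comp_apply, this]
  exact ha

end HelicalXY

end

section

namespace HelicalXY

variable {G : E3 → ℝ} {W : Finset E3} {lam h : ℕ → ℝ} {u : ℕ → ℤ × ℤ → E3} {κ C : ℝ} {z : L1Omega}
  {z₀ : ℝ → E3}

instance : IsProbabilityMeasure volI := ⟨by simp⟩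

/-! ### Chains of transitions along a row -/

/-- The energy of a row. -/
def rowE (lam h : ℝ) (G : E3 → ℝ) (u : ℤ × ℤ → E3) (m : ℤ) : ℝ :=
  ∑ j ∈ cols lam, siteE h G (u (j, m)) (u (j + 1, m)) (u (j + 2, m))

lemma rowE_nonneg {lam h : ℝ} (hh : 0 < h) (hG : ∀ x, 0 ≤ G x) (u : ℤ × ℤ → E3) (m : ℤ) :
    0 ≤ rowE lam h G u m :=
  Finset.sum_nonneg fun _ _ => siteE_nonneg hh hG _ _ _

lemma sum_Ico_chain (s : ℕ → ℝ) {A : ℕ → ℕ} {m : ℕ} (hA : ∀ i < m, A i ≤ A (i + 1)) :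
    A 0 ≤ A m ∧
      ∑ i ∈ Finset.range m, ∑ j ∈ Finset.Ico (A i) (A (i + 1)), s j = ∑ j ∈ Finset.Ico (A 0) (A m), s j := by
  induction m with
  | zero => simp
  | succ m ih =>
    obtain ⟨h1, h2⟩ := ih fun i hi => hA i (by omega)
    have h3 := hA m (by omega)
    exact ⟨h1.trans h3, by rw [Finset.sum_range_succ, h2, Finset.sum_Ico_consecutive _ h1 h3]⟩

/-- The pieces between consecutive columns `A i` are disjoint stretches of one row, so their
energies add up to at most `rowE`. -/
lemma sum_transition_le {lam h : ℝ} (hh : 0 < h) (hG : IsPenalty G) {u : ℤ × ℤ → E3}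
    {C ε : ℝ} (hε : 0 ≤ ε) {M : ℤ} {A : ℕ → ℕ} {m : ℕ} {P : ℕ → E3}
    (hchain : ∀ (U : ℕ → E3) (N : ℕ), (∀ j, ∃ i, U j = u i) → chainE h G U N ≤ C → ∀ i < m,
      U 0 = u (A i, M) → U 1 = u (A i + 1, M) → U N = u (A (i + 1), M) →
      U (N + 1) = u (A (i + 1) + 1, M) →
      transition G (P i) (P (i + 1)) ≤ ENNReal.ofReal (chainE h G U N) + ENNReal.ofReal ε)
    (hA : ∀ i < m, A i ≤ A (i + 1)) (hA0 : 1 ≤ A 0) (hA1 : A m + 2 ≤ side lam)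
    (hrow : rowE lam h G u M ≤ C) :
    ∑ i ∈ Finset.range m, transition G (P i) (P (i + 1)) ≤
      ENNReal.ofReal (rowE lam h G u M + m * ε) := by
  set s : ℕ → ℝ := fun j => siteE h G (u (j, M)) (u (j + 1, M)) (u (j + 2, M)) with hs
  have hs0 : ∀ j, 0 ≤ s j := fun j => siteE_nonneg hh hG.nonneg _ _ _
  have hsum : ∑ i ∈ Finset.range m, ∑ j ∈ Finset.Ico (A i) (A (i + 1)), s j ≤ rowE lam h G u M := by
    rw [(sum_Ico_chain s hA).2, rowE,
      ← Finset.sum_image (s := Finset.Ico (A 0) (A m)) (g := fun k : ℕ => (k : ℤ))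
        (f := fun j : ℤ => siteE h G (u (j, M)) (u (j + 1, M)) (u (j + 2, M)))
        fun a _ b _ hab => by simpa using hab]
    refine Finset.sum_le_sum_of_subset_of_nonneg (fun i hi => ?_) fun i _ _ =>
      siteE_nonneg hh hG.nonneg _ _ _
    obtain ⟨k, hk, rfl⟩ := Finset.mem_image.1 hi
    have := Finset.mem_Ico.1 hk
    rw [cols, Finset.mem_Icc]
    omega
  have heach : ∀ i ∈ Finset.range m, transition G (P i) (P (i + 1)) ≤
      ENNReal.ofReal (∑ j ∈ Finset.Ico (A i) (A (i + 1)), s j) + ENNReal.ofReal ε := by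
    intro i hi
    have hi' := Finset.mem_range.1 hi
    have hAi := hA i hi'
    have e : chainE h G (fun k => u ((A i : ℤ) + k, M)) (A (i + 1) - A i) =
        ∑ j ∈ Finset.Ico (A i) (A (i + 1)), s j := by
      rw [chainE, Finset.sum_Ico_eq_sum_range]
      refine Finset.sum_congr rfl fun k _ => ?_
      simp only [hs]
      push_cast
      simp only [add_assoc]
    have := hchain (fun k => u ((A i : ℤ) + k, M)) (A (i + 1) - A i) (fun j => ⟨_, rfl⟩) ?_ i hi'
      (by simp) (by simp) (by congr 2; omega) (by congr 2; omega)
    · rwa [e] at this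
    · rw [e]
      exact ((Finset.single_le_sum (f := fun i => ∑ j ∈ Finset.Ico (A i) (A (i + 1)), s j)
        (fun i _ => Finset.sum_nonneg fun j _ => hs0 j) hi).trans hsum).trans hrow
  refine (Finset.sum_le_sum heach).trans ?_
  rw [Finset.sum_add_distrib, ← ENNReal.ofReal_sum_of_nonneg fun i _ =>
    Finset.sum_nonneg fun j _ => hs0 j, Finset.sum_const, Finset.card_range, nsmul_eq_mul,
    ← ENNReal.ofReal_natCast, ← ENNReal.ofReal_mul (Nat.cast_nonneg _),
    ← ENNReal.ofReal_add (Finset.sum_nonneg fun i _ => Finset.sum_nonneg fun j _ => hs0 j)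
      (by positivity)]
  exact ENNReal.ofReal_le_ofReal (by linarith)

/-- The integral of the row energies over `y` is at most `C`. Fatou and the mean value property give
a height, outside any null set, whose row energy has lower limit at most `C`. -/
lemma LowEnergy.exists_row (H : LowEnergy G lam h u κ C) (hG : IsPenalty G) {P : ℝ → Prop}
    (hP : ∀ᵐ y ∂volI, P y) : ∃ y ∈ Ioo (0 : ℝ) 1, P y ∧ ∀ ε > 0, ∃ᶠ n in atTop,
      rowE (lam n) (h n) G (u n) ⌊y / lam n⌋ < C + ε := by
  classical
  set F : ℕ → ℤ → ℝ≥0∞ := fun n m => if m ∈ rows (lam n) then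
    ENNReal.ofReal (rowE (lam n) (h n) G (u n) m) else 0 with hF
  have hFm : ∀ n, Measurable fun y : ℝ => F n ⌊y / lam n⌋ := fun n =>
    (Measurable.of_discrete (f := F n)).comp (measurable_floor_div _)
  have hle : ∀ n, ∫⁻ y, F n ⌊y / lam n⌋ ∂volI ≤ ENNReal.ofReal C := by
    intro n
    have hl := H.lam_pos n
    refine (lintegral_floor_le hl _).trans ?_
    rw [tsum_eq_sum (s := rows (lam n)) (f := F n) fun i hi => if_neg hi,
      Finset.sum_congr rfl fun m hm => (if_pos hm : F n m =
        ENNReal.ofReal (rowE (lam n) (h n) G (u n) m)),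
      ← ENNReal.ofReal_sum_of_nonneg fun i _ => rowE_nonneg (H.h_pos n) hG.nonneg _ _,
      ← ENNReal.ofReal_mul hl.le]
    refine ENNReal.ofReal_le_ofReal (le_trans (le_of_eq ?_) (H.hor n))
    simp only [rowE, horE]
    rw [Finset.sum_product_right]
  have hint : ∫⁻ y, liminf (fun n => F n ⌊y / lam n⌋) atTop ∂volI ≤ ENNReal.ofReal C := by
    refine (lintegral_liminf_le hFm).trans ((liminf_le_liminf (Eventually.of_forall hle)).trans ?_)
    rw [liminf_const]
  obtain ⟨y, hy, hy'⟩ := exists_notMem_null_le_lintegral (μ := volI)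
    (Measurable.liminf hFm).aemeasurable
    (ae_iff.1 (hP.and (ae_restrict_mem measurableSet_Ioo)))
  have hy0 : P y ∧ y ∈ Ioo (0 : ℝ) 1 := by simpa using hy
  refine ⟨y, hy0.2, hy0.1, fun ε hε => ?_⟩
  have hlt : liminf (fun n => F n ⌊y / lam n⌋) atTop < ENNReal.ofReal (C + ε) :=
    (hy'.trans hint).trans_lt ((ENNReal.ofReal_lt_ofReal_iff
      (by linarith [H.nonneg hG])).2 (by linarith))
  refine ((frequently_lt_of_liminf_lt (by isBoundedDefault) hlt).and_eventually
    (eventually_floor H.lam_pos H.lam_lim hy0.2 1)).mono fun n ⟨hn, hn1, hn2⟩ => ?_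
  simp only [hF] at hn
  push_cast at hn2
  rw [if_pos (by rw [rows, Finset.mem_Icc]; omega), ENNReal.ofReal_lt_ofReal_iff'] at hn
  exact hn.1

/-- On one good row the chirality converges at almost every `x`, so at the finitely many points of a
jump chain it is eventually close to the wells, and `HelicalXY.exists_chain_bound` applies between
them. The row is fixed first, so `L` works for all chains. -/
theorem LowEnergy.exists_chain_bound (H : LowEnergy G lam h u κ C) (hG : IsPenalty G)
    (hW : IsWells G W)
    (hlim : ∀ᵐ p ∂volOmega, Tendsto (fun n => gridChir (lam n) (h n) (u n) p) atTop (𝓝 (z p)))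
    (hz : ∀ᵐ p ∂volOmega, z p = z₀ (p 0)) :
    ∃ L ⊆ Ioo (0 : ℝ) 1, (∀ᵐ t ∂volI, t ∈ L) ∧ (∀ t ∈ L, z₀ t ∈ W) ∧
      ∀ m t, IsJumpChain z₀ L m t →
        ∑ i ∈ Finset.range m, transition G (z₀ (t i)) (z₀ (t (i + 1))) ≤ ENNReal.ofReal C := by
  obtain ⟨y, hy, ⟨hyl, hyz⟩, hrow⟩ := H.exists_row hG ((ae_ae_snd hlim).and (ae_ae_snd hz))
  refine ⟨{x | x ∈ Ioo (0 : ℝ) 1 ∧ z₀ x ∈ W ∧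
    Tendsto (fun n => gridChir (lam n) (h n) (u n) (pt x y)) atTop (𝓝 (z₀ x))},
    fun x hx => hx.1, ?_, fun x hx => hx.2.1, fun m t ht => ?_⟩
  · filter_upwards [hyl, hyz, ae_mem_of_indep hz (H.ae_mem hG hW hlim),
      ae_restrict_mem measurableSet_Ioo] with x h1 h2 h3 h4
    refine ⟨h4, h3, ?_⟩
    rw [h2] at h1
    exact h1
  have key : ∀ ε ∈ Ioo (0 : ℝ) 1, ∑ i ∈ Finset.range m, transition G (z₀ (t i)) (z₀ (t (i + 1))) ≤
      ENNReal.ofReal (C + ε + m * ε) := by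
    intro ε hε
    obtain ⟨η, hη, h₀, hh₀, hbound⟩ := HelicalXY.exists_chain_bound hG hW hε.1 (C + 1)
    have hev : ∀ᶠ n in atTop, ∀ i ≤ m, (1 ≤ ⌊t i / lam n⌋ ∧ ⌊t i / lam n⌋ + 2 ≤ side (lam n)) ∧
        ‖gridChir (lam n) (h n) (u n) (pt (t i) y) - z₀ (t i)‖ < η := by
      have : ∀ i ∈ Finset.range (m + 1), ∀ᶠ n in atTop,
          (1 ≤ ⌊t i / lam n⌋ ∧ ⌊t i / lam n⌋ + 2 ≤ side (lam n)) ∧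
          ‖gridChir (lam n) (h n) (u n) (pt (t i) y) - z₀ (t i)‖ < η := by
        intro i hi
        have hti := ht.1 i (Nat.lt_succ_iff.1 (Finset.mem_range.1 hi))
        refine (eventually_floor H.lam_pos H.lam_lim hti.1 2).and ?_
        have := (hti.2.2.sub_const (z₀ (t i))).norm
        rw [sub_self, norm_zero] at this
        exact this.eventually (gt_mem_nhds hη)
      filter_upwards [(Finset.eventually_all _).2 this] with n hn i hi
      exact hn i (Finset.mem_range.2 (Nat.lt_succ_iff.2 hi))
    obtain ⟨n, hn, hn1, hn2⟩ := ((hrow ε hε.1).and_eventually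
      (hev.and (H.h_lim.eventually (gt_mem_nhds hh₀)))).exists
    have hl := H.lam_pos n
    set A : ℕ → ℕ := fun i => ⌊t i / lam n⌋.toNat with hA
    have hAi : ∀ i ≤ m, (A i : ℤ) = ⌊t i / lam n⌋ := fun i hi =>
      Int.toNat_of_nonneg (by have := (hn1 i hi).1.1; omega)
    have := sum_transition_le (lam := lam n) (h := h n) (H.h_pos n) hG (u := u n) (C := C + 1)
      hε.1.le (M := ⌊y / lam n⌋) (A := A) (m := m) (P := fun i => z₀ (t i)) ?_ ?_ ?_ ?_
      (by linarith [hε.2])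
    · exact this.trans (ENNReal.ofReal_le_ofReal (by linarith))
    · intro U N hU hE i hi h0 h1 hN hN1
      refine hbound (h n) (H.h_pos n) hn2 U N (fun j => ?_) hE _ (ht.1 i hi.le).2.1 _
        (ht.1 (i + 1) hi).2.1 ?_ ?_
      · obtain ⟨i', hi'⟩ := hU j
        rw [hi']; exact H.unit n i'
      · rw [h0, h1, hAi i hi.le]; exact (hn1 i hi.le).2
      · rw [hN, hN1, hAi (i + 1) hi]; exact (hn1 (i + 1) hi).2
    · intro i hi
      have h1 := hAi i hi.le
      have h2 := hAi (i + 1) hi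
      have : ⌊t i / lam n⌋ ≤ ⌊t (i + 1) / lam n⌋ :=
        Int.floor_le_floor (by have := (ht.2 i hi).1.le; gcongr)
      omega
    · have h1 := hAi 0 (Nat.zero_le _)
      have := (hn1 0 (Nat.zero_le _)).1.1
      omega
    · rw [hAi m le_rfl]; exact (hn1 m le_rfl).1.2
  have hlim' : Tendsto (fun ε : ℝ => ENNReal.ofReal (C + ε + m * ε)) (𝓝[>] 0)
      (𝓝 (ENNReal.ofReal (C + 0 + m * 0))) := by
    refine ENNReal.tendsto_ofReal (tendsto_nhdsWithin_of_tendsto_nhds ?_)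
    exact (by fun_prop : Continuous fun ε : ℝ => C + ε + m * ε).tendsto 0
  rw [mul_zero, add_zero, add_zero] at hlim'
  refine ge_of_tendsto hlim' ?_
  filter_upwards [Ioo_mem_nhdsGT one_pos] with ε hε using key ε hε

/-- Bounded variation is not assumed but derived: each jump costs at least `τ`, so jump chains have
length at most `C / τ` and `z` is a step function. -/
theorem LowEnergy.limitEnergy_le {k : ℕ} {q : Fin k → E3} (hq : ∀ l, ‖q l‖ = 1)
    (hGzero : {x | G x = 0} = lines q) (H : LowEnergy G lam h u κ C) (hG : IsPenalty G)
    (hlim : ∀ᵐ p ∂volOmega, Tendsto (fun n => gridChir (lam n) (h n) (u n) p) atTop (𝓝 (z p))) :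
    limitEnergy q G z ≤ ENNReal.ofReal C := by
  have hW := isWells_wellSet hq hGzero
  obtain ⟨z₀, hz⟩ := H.indepOfY hG hW hlim
  obtain ⟨L, hL0, hL, hLW, hchain⟩ := H.exists_chain_bound hG hW hlim hz
  obtain ⟨τ, hτ, hlow⟩ := hW.exists_le_transition hG
  have hK : ∀ m t, IsJumpChain z₀ L m t → m ≤ ⌊C / τ⌋₊ := by
    intro m t ht
    have h1 : (m : ℝ≥0∞) * ENNReal.ofReal τ ≤ ENNReal.ofReal C := by
      refine le_trans ?_ (hchain m t ht)
      rw [← nsmul_eq_mul, ← Finset.card_range m, ← Finset.sum_const, Finset.card_range]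
      refine Finset.sum_le_sum fun i hi => ?_
      have hi' := Finset.mem_range.1 hi
      exact hlow _ (hLW _ (ht.1 i hi'.le)) _ (hLW _ (ht.1 (i + 1) hi')) (ht.2 i hi').2
    rw [← ENNReal.ofReal_natCast, ← ENNReal.ofReal_mul (Nat.cast_nonneg _),
      ENNReal.ofReal_le_ofReal_iff (H.nonneg hG)] at h1
    exact Nat.le_floor ((le_div_iff₀ hτ).2 h1)
  obtain ⟨L', hLL, hL', hrec⟩ := exists_recurrent (W := (wellSet q : Set E3))
    (wellSet q).countable_toSet hLW hL
  have hsub : ∀ m t, IsJumpChain z₀ L' m t → IsJumpChain z₀ L m t := fun m t ht =>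
    ⟨fun i hi => hLL (ht.1 i hi), ht.2⟩
  obtain ⟨m, x, t, hs, ht⟩ := exists_isStep hL' (hLL.trans hL0) hrec
    fun m t ht => hK m t (hsub m t ht)
  rw [hs.limitEnergy_eq hq (fun i hi => mem_wellSet.1 (hLW _ (hLL (ht.1 i hi)))) hz G]
  exact hchain m t (hsub m t ht)

end HelicalXY

end

section

namespace HelicalXY

/-! ### The lower bound -/

theorem limitEnergy_le_liminf {k : ℕ} {q : Fin k → E3} (hq : ∀ l, ‖q l‖ = 1) {G : E3 → ℝ}
    (hG : IsPenalty G) (hGzero : {x | G x = 0} = lines q) {lam del J₂ : ℕ → ℝ}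
    (hlam : ∀ n, 0 < lam n) (hlam0 : Tendsto lam atTop (𝓝 0)) (hdel : ∀ n, 0 < del n)
    (hdel0 : Tendsto del atTop (𝓝 0))
    (hratio : Tendsto (fun n => lam n / Real.sqrt (del n)) atTop (𝓝 0)) {c : ℝ} (hc : 0 < c)
    (hJ₂ : ∀ n, c ≤ J₂ n * (lam n / Real.sqrt (del n))) {z : L1Omega} {zs : ℕ → L1Omega}
    (hz : Tendsto zs atTop (𝓝 z)) :
    limitEnergy q G z ≤ liminf (fun n => energyHG (lam n) (del n) (J₂ n) G (zs n) /
      ENNReal.ofReal (Real.sqrt 2 * lam n * del n ^ (3 / 2 : ℝ))) atTop := by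
  refine le_of_forall_gt_imp_ge_of_dense fun a ha => ?_
  rcases eq_or_ne a ⊤ with rfl | hatop
  · exact le_top
  obtain ⟨C, rfl⟩ : ∃ C : NNReal, (C : ℝ≥0∞) = a := ⟨a.toNNReal, ENNReal.coe_toNNReal hatop⟩
  -- A first subsequence keeps the rescaled energies below `C`, a second one upgrades `L¹`
  -- convergence to convergence almost everywhere.
  obtain ⟨φ₁, hφ₁, hlt₁⟩ := extraction_of_frequently_atTop
    (frequently_lt_of_liminf_lt (by isBoundedDefault) ha)
  obtain ⟨φ₂, hφ₂, hae⟩ := (tendstoInMeasure_of_tendsto_Lp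
    (hz.comp hφ₁.tendsto_atTop)).exists_seq_tendsto_ae
  set φ : ℕ → ℕ := fun k => φ₁ (φ₂ k) with hφ
  have hφt : Tendsto φ atTop atTop := hφ₁.tendsto_atTop.comp hφ₂.tendsto_atTop
  have hs0 : ∀ n, 0 < Real.sqrt 2 * lam n * del n ^ (3 / 2 : ℝ) := fun n => by
    have := hlam n
    have := Real.rpow_pos_of_pos (hdel n) (3 / 2)
    positivity
  have hex : ∀ k, ∃ u : ℤ × ℤ → E3, IsSpinField (lam (φ k)) u ∧
      chirality (lam (φ k)) (del (φ k)) u =ᵐ[volOmega] zs (φ k) ∧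
      energyH (lam (φ k)) (del (φ k)) (J₂ (φ k)) u + penalty (lam (φ k)) (del (φ k)) G u <
        (Real.sqrt 2 * lam (φ k) * del (φ k) ^ (3 / 2 : ℝ)) * C := by
    intro k
    have h1 := hlt₁ (φ₂ k)
    rw [ENNReal.div_lt_iff (Or.inl (ENNReal.ofReal_pos.2 (hs0 _)).ne')
      (Or.inl ENNReal.ofReal_ne_top), energyHG] at h1
    simp only [iInf_lt_iff] at h1
    obtain ⟨u, hu, huz, hlt⟩ := h1
    refine ⟨u, hu, huz, ?_⟩
    rw [← ENNReal.ofReal_coe_nnreal, ← ENNReal.ofReal_mul C.coe_nonneg,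
      ENNReal.ofReal_lt_ofReal_iff', mul_comm (C : ℝ)] at hlt
    exact hlt.1
  choose u hu huz hE using hex
  classical
  set e : E3 := EuclideanSpace.single 0 1 with he
  -- Off the lattice the spins are arbitrary; a fixed unit vector makes all values unit without
  -- changing energy or chirality.
  set u' : ℕ → ℤ × ℤ → E3 := fun k i => if i ∈ lattice (lam (φ k)) then u k i else e with hu'
  have huu : ∀ k, ∀ i ∈ lattice (lam (φ k)), u k i = u' k i := fun k i hi => (if_pos hi).symm
  set h : ℕ → ℝ := fun k => Real.sqrt (2 * del (φ k)) with hh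
  have hhpos : ∀ k, 0 < h k := fun k => Real.sqrt_pos.2 (by have := hdel (φ k); positivity)
  have hhs : ∀ k, h k = Real.sqrt 2 * Real.sqrt (del (φ k)) := fun k => Real.sqrt_mul zero_le_two _
  have h2 : 0 < Real.sqrt 2 := by positivity
  have hbound : ∀ k, horE (lam (φ k)) (h k) G (u' k) ≤ C ∧
      c / Real.sqrt 2 / h k ^ 2 * verE (lam (φ k)) (u' k) ≤ C := by
    intro k
    have hE := hE k
    rw [energy_eq (hlam _) (hdel _) rfl G, mul_lt_mul_iff_right₀ (hs0 _)] at hE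
    obtain ⟨e1, e2⟩ := energy_congr (h := h k) (G := G) (hlam (φ k)) (huu k)
    rw [← e1, ← e2]
    have n1 := horE_nonneg (hlam (φ k)) (hhpos k) hG.nonneg (u k)
    have n2 := verE_nonneg (lam (φ k)) (u k)
    have hs : 0 < Real.sqrt (del (φ k)) := Real.sqrt_pos.2 (hdel _)
    -- The assumption on `J₂` reads `J₂ λ ≥ c √δ = (c / √2) h`.
    have hκ : c / Real.sqrt 2 / h k ^ 2 ≤ J₂ (φ k) * lam (φ k) / h k ^ 3 := by
      have hk := hhpos k
      rw [div_le_div_iff₀ (by positivity) (by positivity), pow_succ (h k) 2, ← mul_assoc,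
        mul_comm (J₂ (φ k) * lam (φ k)), mul_comm _ (h k), ← mul_assoc, mul_comm (h k)]
      have h3 : c / Real.sqrt 2 * h k ≤ J₂ (φ k) * lam (φ k) := by
        have := hJ₂ (φ k)
        rw [← mul_div_assoc, le_div_iff₀ hs] at this
        rw [hhs]
        calc c / Real.sqrt 2 * (Real.sqrt 2 * Real.sqrt (del (φ k))) = c * Real.sqrt (del (φ k)) := by
              field_simp
          _ ≤ _ := this
      nlinarith [sq_nonneg (h k)]
    have h4 := mul_le_mul_of_nonneg_right hκ n2
    have h5 : 0 ≤ c / Real.sqrt 2 / h k ^ 2 * verE (lam (φ k)) (u k) := by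
      have := hhpos k; positivity
    exact ⟨by linarith, by linarith⟩
  have H : LowEnergy G (fun k => lam (φ k)) h u' (c / Real.sqrt 2) C :=
    { lam_pos := fun k => hlam _
      lam_lim := hlam0.comp hφt
      h_pos := hhpos
      h_lim := by
        have := (Real.continuous_sqrt.tendsto _).comp ((hdel0.comp hφt).const_mul 2)
        rw [mul_zero, Real.sqrt_zero] at this
        exact this
      ratio := by
        have := (hratio.comp hφt).div_const (Real.sqrt 2)
        rw [zero_div] at this
        refine this.congr fun k => ?_
        rw [hhs, Function.comp_apply, div_div, mul_comm]
      unit := fun k i => by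
        simp only [hu']
        split_ifs with hi
        · exact (hu k).1 i hi
        · simp [he]
      κ_pos := by positivity
      hor := fun k => (hbound k).1
      ver := fun k => (hbound k).2 }
  have hlim : ∀ᵐ p ∂volOmega,
      Tendsto (fun k => gridChir (lam (φ k)) (h k) (u' k) p) atTop (𝓝 (z p)) := by
    filter_upwards [hae, ae_all_iff.2 huz, ae_restrict_mem measurableSet_Omega] with p hp hpz hpΩ
    obtain ⟨hx, hy⟩ := mem_Omega.1 hpΩ
    refine hp.congr' ?_
    filter_upwards [eventually_floor H.lam_pos H.lam_lim hx 1,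
      eventually_floor H.lam_pos H.lam_lim hy 0] with k h1 h2
    push_cast at h1 h2
    show zs (φ k) p = _
    have m1 : (⌊p 0 / lam (φ k)⌋, ⌊p 1 / lam (φ k)⌋) ∈ lattice (lam (φ k)) :=
      (mem_lattice_iff (hlam _) _).2 ⟨⟨h1.1, by simp only; omega⟩, h2.1, by simp only; omega⟩
    have m2 : (⌊p 0 / lam (φ k)⌋ + 1, ⌊p 1 / lam (φ k)⌋) ∈ lattice (lam (φ k)) :=
      (mem_lattice_iff (hlam _) _).2 ⟨⟨by simp only; omega, h1.2⟩, h2.1, by simp only; omega⟩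
    rw [← hpz k, chirality, if_pos ⟨m1, m2⟩, gridChir, huu k _ m1, huu k _ m2, chir_eq (hhpos k),
      smul_smul, inv_mul_cancel₀ (hhpos k).ne', one_smul]
  rw [← ENNReal.ofReal_coe_nnreal]
  exact H.limitEnergy_le hq hGzero hG hlim

end HelicalXY

end

section

namespace HelicalXY

/-! ### Recovery sequences -/

/-- Diagonal argument: for each `n` a point is chosen that almost minimizes the larger of its
distance to `z` and the excess of energy; the hypothesis says that this infimum tends to zero. -/
lemma exists_recovery {X : Type*} [PseudoEMetricSpace X] {F : ℕ → X → ℝ≥0∞} {a : ℝ≥0∞} {z : X}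
    (h : ∀ ε : ℝ, 0 < ε → ∀ᶠ n in atTop, ∃ x, edist x z ≤ ENNReal.ofReal ε ∧
      F n x ≤ a + ENNReal.ofReal ε) :
    ∃ xs : ℕ → X, Tendsto xs atTop (𝓝 z) ∧ limsup (fun n => F n (xs n)) atTop ≤ a := by
  set g : ℕ → ℝ≥0∞ := fun n => ⨅ x, max (edist x z) (F n x - a) with hg
  have hg0 : Tendsto g atTop (𝓝 0) := by
    rw [ENNReal.tendsto_nhds_zero]
    intro ε hε
    obtain ⟨r, hr, hrε⟩ := ENNReal.lt_iff_exists_real_btwn.1 hε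
    filter_upwards [h r (ENNReal.ofReal_pos.1 hrε.1)] with n ⟨x, h1, h2⟩
    exact (iInf_le _ x).trans ((max_le h1 (tsub_le_iff_left.2 h2)).trans hrε.2.le)
  -- The slack `1 / n` is infinite for `n = 0` and positive always, so a near minimizer exists
  -- whether or not the infimum is attained.
  have hex : ∀ n, ∃ x, max (edist x z) (F n x - a) ≤ g n + (n : ℝ≥0∞)⁻¹ := by
    intro n
    by_cases hn : g n = ⊤
    · exact ⟨z, by rw [hn, top_add]; exact le_top⟩
    · obtain ⟨x, hx⟩ := iInf_lt_iff.1 (ENNReal.lt_add_right hn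
        (ENNReal.inv_ne_zero.2 (ENNReal.natCast_ne_top n)))
      exact ⟨x, hx.le⟩
  choose xs hxs using hex
  have hb : Tendsto (fun n : ℕ => g n + (n : ℝ≥0∞)⁻¹) atTop (𝓝 0) := by
    simpa using hg0.add ENNReal.tendsto_inv_nat_nhds_zero
  refine ⟨xs, ?_, ?_⟩
  · rw [tendsto_iff_edist_tendsto_0]
    exact tendsto_of_tendsto_of_tendsto_of_le_of_le tendsto_const_nhds hb (fun _ => zero_le)
      fun n => (le_max_left _ _).trans (hxs n)
  · have hle : ∀ n, F n (xs n) ≤ a + (g n + (n : ℝ≥0∞)⁻¹) := fun n =>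
      tsub_le_iff_left.1 ((le_max_right _ _).trans (hxs n))
    have ht : Tendsto (fun n : ℕ => a + (g n + (n : ℝ≥0∞)⁻¹)) atTop (𝓝 (a + 0)) :=
      tendsto_const_nhds.add hb
    rw [add_zero] at ht
    exact (limsup_le_limsup (Eventually.of_forall hle)).trans ht.limsup_eq.le

lemma measurable_chirality (lam del : ℝ) (u : ℤ × ℤ → E3) : Measurable (chirality lam del u) := by
  classical
  have hm : Measurable fun p : E2 => (⌊p 0 / lam⌋, ⌊p 1 / lam⌋) :=
    ((measurable_floor_div _).comp (by fun_prop)).prodMk ((measurable_floor_div _).comp (by fun_prop))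
  exact (Measurable.of_discrete (f := fun i : ℤ × ℤ =>
    if i ∈ lattice lam ∧ (i.1 + 1, i.2) ∈ lattice lam then
      (Real.sqrt (2 * del))⁻¹ • cross (u i) (u (i.1 + 1, i.2)) else 0)).comp hm

/-! ### Spin fields sampled from a curve. -/

section Pulse

variable {G : E3 → ℝ} {p : ℕ → E3} {r : ℕ} {y : ℕ → ℝ} {L M θ₀ E : ℝ} {u v f : ℝ → E3}

/-- The spin field that samples a curve in every row. -/
def sampled (u : ℝ → E3) (θ : ℝ) (i : ℤ × ℤ) : E3 := u (i.1 * θ)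

lemma verE_sampled (lam θ : ℝ) : verE lam (sampled u θ) = 0 :=
  Finset.sum_eq_zero fun i _ => by simp [sampled]

/-- All rows carry the same sampled chain, bounded by `SampleBound`, and `λ` times the number of
rows is at most `1`. -/
lemma horE_sampled_le (hP : IsPulse G p r y L M θ₀ E u v f) (hE : 0 ≤ E) {lam θ : ℝ} (hl : 0 < lam)
    (hθ : 0 < θ) (hθ₀ : θ < θ₀) : horE lam (chord θ) G (sampled u θ) ≤ E := by
  have hs := hP.sample θ hθ hθ₀ θ (side lam - 2).toNat
  have hrow : ∀ m, ∑ j ∈ cols lam, siteE (chord θ) G (sampled u θ (j, m)) (sampled u θ (j + 1, m))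
      (sampled u θ (j + 2, m)) ≤ E := by
    intro m
    refine le_trans (le_of_eq ?_) hs
    have hc : cols lam = (Finset.range (side lam - 2).toNat).image fun k : ℕ => 1 + (k : ℤ) := by
      ext j
      simp only [cols, Finset.mem_Icc, Finset.mem_image, Finset.mem_range]
      constructor
      · rintro ⟨h1, h2⟩
        exact ⟨(j - 1).toNat, by omega, by omega⟩
      · rintro ⟨k, hk, rfl⟩
        omega
    rw [hc, Finset.sum_image fun a _ b _ hab => by simpa using hab, chainE]
    refine Finset.sum_congr rfl fun k _ => ?_
    simp only [sampled]
    push_cast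
    congr 2 <;> ring
  rw [horE, Finset.sum_product_right]
  rcases lt_or_ge (side lam) 1 with h1 | h1
  · rw [rows, Finset.Icc_eq_empty (by omega), Finset.sum_empty, mul_zero]
    exact hE
  calc lam * ∑ m ∈ rows lam, ∑ j ∈ cols lam, siteE (chord θ) G (sampled u θ (j, m))
        (sampled u θ (j + 1, m)) (sampled u θ (j + 2, m))
      ≤ lam * ∑ _m ∈ rows lam, E := by
        gcongr with m _
        exact hrow m
    _ = lam * (side lam - 1) * E := by
        rw [Finset.sum_const, rows, Int.card_Icc, nsmul_eq_mul, ← mul_assoc]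
        congr 2
        have : ((side lam - 1 + 1 - 1).toNat : ℤ) = side lam - 1 := by omega
        exact_mod_cast this
    _ ≤ 1 * E := by
        gcongr
        nlinarith [side_mul_le hl]
    _ = E := one_mul E

/-- The first and the last pair of spins of a row are sampled from rotations, so both scalar
products equal `cos θ`, whatever the axes. This is why the curve must rotate near both ends. -/
lemma isSpinField_sampled (hP : IsPulse G p r y L M θ₀ E u v f) (hp : ∀ i, ‖p i‖ = 1) {lam θ : ℝ}
    (hl : 0 < lam) (hθ : 0 < θ) (h0 : 0 < r → 2 * θ ≤ y 0)
    (h1 : 0 < r → y (r - 1) + L ≤ (side lam - 1) * θ) : IsSpinField lam (sampled u θ) := by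
  refine ⟨fun i _ => hP.curve.unit _ trivial, fun a b m ha hb _ => ?_⟩
  have ha1 := (mem_unit_iff hl a).1 ha.1
  have hb1 := (mem_unit_iff hl b).1 hb.1
  have ea : a = 1 := le_antisymm (ha.2 ((mem_unit_iff hl 1).2 ⟨le_rfl, by omega⟩)) ha1.1
  have eb : b = side lam := le_antisymm hb1.2 (hb.2 ((mem_unit_iff hl _).2 ⟨by omega, le_rfl⟩))
  have hfirst : inner ℝ (u (1 * θ + θ)) (u (1 * θ)) = Real.cos θ := by
    refine hP.curve.inner_sample (hp 0) hθ.le fun τ hτ => hP.well 0 (Nat.zero_le _) τ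
      (fun h => absurd h (lt_irrefl _)) fun h => ?_
    have := hτ.2
    linarith [h0 h]
  have hlast : inner ℝ (u ((side lam - 1) * θ + θ)) (u ((side lam - 1) * θ)) = Real.cos θ :=
    hP.curve.inner_sample (hp r) hθ.le fun τ hτ => hP.well r le_rfl τ
      (fun h => (h1 h).trans hτ.1) fun h => absurd h (lt_irrefl _)
  rw [ea, eb]
  simp only [sampled]
  push_cast
  rw [show (2 : ℝ) * θ = 1 * θ + θ by ring,
    show (side lam : ℝ) * θ = (side lam - 1) * θ + θ by ring, hfirst, hlast]

lemma norm_chirality_sampled_le (hP : IsPulse G p r y L M θ₀ E u v f) (lam : ℝ) {del θ : ℝ}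
    (hθ : 0 < θ) (hθ1 : θ ≤ 1) (hh : Real.sqrt (2 * del) = chord θ) (x : E2) :
    ‖chirality lam del (sampled u θ) x‖ ≤ 2 * M := by
  have hM : 0 ≤ M := (norm_nonneg _).trans (hP.bound 0)
  obtain ⟨hc, -, -⟩ := chord_bounds hθ hθ1
  rw [chirality]
  split_ifs
  · rw [hh, chir_eq hc, smul_smul, inv_mul_cancel₀ hc.ne', one_smul, chir]
    refine (norm_cross_le _ _).trans ?_
    simp only [sampled]
    rw [hP.curve.unit _ trivial, one_mul]
    push_cast
    rw [add_mul, one_mul]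
    exact hP.curve.norm_dq_sample_le hP.bound hθ hθ1 _
  · rw [norm_zero]; positivity

/-- For a sampled rotation `u t × u (t + θ) = sin θ • p`, and `sin θ / (2 sin (θ/2)) = cos (θ/2)`.
-/
lemma chirality_sampled_eq (hP : IsPulse G p r y L M θ₀ E u v f) (hp : ∀ i, ‖p i‖ = 1)
    {lam del θ : ℝ} (hl : 0 < lam) (hθ : 0 < θ) (hθ1 : θ ≤ 1) (hh : Real.sqrt (2 * del) = chord θ)
    {x : E2} (hx : 1 ≤ ⌊x 0 / lam⌋ ∧ ⌊x 0 / lam⌋ + 1 ≤ side lam)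
    (hy : 1 ≤ ⌊x 1 / lam⌋ ∧ ⌊x 1 / lam⌋ ≤ side lam) {i : ℕ} (hi : i ≤ r)
    (h0 : 0 < i → y (i - 1) + L ≤ ⌊x 0 / lam⌋ * θ) (h1 : i < r → (⌊x 0 / lam⌋ + 1) * θ ≤ y i) :
    chirality lam del (sampled u θ) x = Real.cos (θ / 2) • p i := by
  obtain ⟨hc, -, -⟩ := chord_bounds hθ hθ1
  have m1 : (⌊x 0 / lam⌋, ⌊x 1 / lam⌋) ∈ lattice lam :=
    (mem_lattice_iff hl _).2 ⟨⟨hx.1, by simp only; omega⟩, hy⟩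
  have m2 : (⌊x 0 / lam⌋ + 1, ⌊x 1 / lam⌋) ∈ lattice lam :=
    (mem_lattice_iff hl _).2 ⟨⟨by simp only; omega, hx.2⟩, hy⟩
  have key := hP.curve.cross_sample (hp i) (t := ⌊x 0 / lam⌋ * θ) hθ.le fun τ hτ =>
    hP.well i hi τ (fun h => (h0 h).trans hτ.1) fun h => by
      have := h1 h
      have := hτ.2
      linarith
  rw [chirality, if_pos ⟨m1, m2⟩]
  simp only [sampled]
  push_cast
  rw [add_mul, one_mul, key, hh, smul_smul]
  congr 1
  have : Real.sin θ = chord θ * Real.cos (θ / 2) := by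
    rw [chord, ← Real.sin_two_mul, mul_div_cancel₀ _ two_ne_zero]
  rw [this, inv_mul_cancel_left₀ hc.ne']

end Pulse

end HelicalXY

end

section

namespace HelicalXY

/-! ### Construction of the recovery sequence. -/

lemma chord_two_arcsin {h : ℝ} (h0 : 0 < h) (h1 : h ≤ 1) : chord (2 * Real.arcsin (h / 2)) = h := by
  rw [chord, mul_div_cancel_left₀ _ two_ne_zero, Real.sin_arcsin (by linarith) (by linarith)]
  ring

/-- The jump points of a step function extend to a sequence with gaps bounded from below. -/
lemma IsStep.exists_nodes {z₀ : ℝ → E3} {m : ℕ} {x : ℕ → ℝ} {P : ℕ → E3} (h : IsStep z₀ m x P) :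
    ∃ X : ℕ → ℝ, (∀ i ≤ m + 1, X i = x i) ∧ ∃ g > 0, ∀ i, X i + g ≤ X (i + 1) := by
  obtain ⟨i₀, hi₀, hmin⟩ := (Finset.range (m + 1)).exists_min_image (fun i => x (i + 1) - x i)
    ⟨0, by simp⟩
  refine ⟨fun i => if i ≤ m + 1 then x i else 1 + (i - (m + 1)), fun i hi => if_pos hi,
    min 1 (x (i₀ + 1) - x i₀), ?_, fun i => ?_⟩
  · exact lt_min one_pos (sub_pos.2 (h.lt i₀ (Nat.lt_succ_iff.1 (Finset.mem_range.1 hi₀))))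
  · beta_reduce
    rcases lt_trichotomy i (m + 1) with hi | rfl | hi
    · rw [if_pos hi.le, if_pos (by omega)]
      have := hmin i (Finset.mem_range.2 hi)
      have := min_le_right 1 (x (i₀ + 1) - x i₀)
      linarith
    · rw [if_pos le_rfl, if_neg (by omega), h.one]
      have := min_le_left 1 (x (i₀ + 1) - x i₀)
      push_cast
      linarith
    · rw [if_neg (by omega), if_neg (by omega)]
      have := min_le_left 1 (x (i₀ + 1) - x i₀)
      push_cast
      linarith

lemma mul_floor_bounds {lam : ℝ} (hl : 0 < lam) (s : ℝ) :
    s - lam ≤ lam * ⌊s / lam⌋ ∧ lam * (⌊s / lam⌋ + 1) ≤ s + lam := by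
  have h1 := Int.floor_le (s / lam)
  have h2 := Int.lt_floor_add_one (s / lam)
  rw [le_div_iff₀ hl] at h1
  rw [div_lt_iff₀ hl] at h2
  constructor <;> nlinarith

/-- For finite energy `z` is a step function with jumps of finite cost, and a pulse through its
values, sampled in every row, is almost optimal. It takes the right value away from the jumps and is
bounded, so dominated convergence gives `L¹` convergence. -/
theorem exists_recovery_sequence {k : ℕ} {q : Fin k → E3} (hq : ∀ l, ‖q l‖ = 1) {G : E3 → ℝ}
    (hG : IsPenalty G) (hGzero : {x | G x = 0} = lines q) {lam del J₂ : ℕ → ℝ}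
    (hlam : ∀ n, 0 < lam n) (hlam0 : Tendsto lam atTop (𝓝 0)) (hdel : ∀ n, 0 < del n)
    (hdel0 : Tendsto del atTop (𝓝 0))
    (hratio : Tendsto (fun n => lam n / Real.sqrt (del n)) atTop (𝓝 0)) (z : L1Omega) :
    ∃ xs : ℕ → L1Omega, Tendsto xs atTop (𝓝 z) ∧
      limsup (fun n => energyHG (lam n) (del n) (J₂ n) G (xs n) /
        ENNReal.ofReal (Real.sqrt 2 * lam n * del n ^ (3 / 2 : ℝ))) atTop ≤ limitEnergy q G z := by
  by_cases htop : limitEnergy q G z = ⊤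
  · exact ⟨fun _ => z, tendsto_const_nhds, by rw [htop]; exact le_top⟩
  have hcond : MemBV (wells q) z ∧ IndepOfY z := by
    by_contra hc
    exact htop (if_neg hc)
  obtain ⟨⟨hTV, hmem⟩, z₀, hz⟩ := hcond
  have hW := isWells_wellSet hq hGzero
  obtain ⟨m, x, P, hs, hPW⟩ := exists_isStep_of_totalVariation (W := wellSet q) hW.norm hz
    (hmem.mono fun p hp => mem_wellSet.2 hp) hTV
  have hval := hs.limitEnergy_eq hq (fun i hi => mem_wellSet.1 (hPW i hi)) hz G
  have hfin : ∀ i < m, transition G (P i) (P (i + 1)) ≠ ⊤ := fun i hi => by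
    rw [hval, ENNReal.sum_eq_top] at htop
    push Not at htop
    exact htop i (Finset.mem_range.2 hi)
  rw [hval]
  refine exists_recovery (X := L1Omega) (F := fun n x => energyHG (lam n) (del n) (J₂ n) G x /
    ENNReal.ofReal (Real.sqrt 2 * lam n * del n ^ (3 / 2 : ℝ))) fun ε hε => ?_
  -- the profile
  set ε' : ℝ := ε / (2 * m + 1) with hε'
  have hε'0 : 0 < ε' := by positivity
  -- The values are prolonged by the last one, so that every index is a well, as `exists_pulse`
  -- expects.
  set p : ℕ → E3 := fun i => P (min i m) with hp
  have hpP : ∀ i ≤ m, p i = P i := fun i hi => by simp only [hp, min_eq_left hi]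
  have hpW : ∀ i, p i ∈ wellSet q := fun i => hPW _ (min_le_right _ _)
  have hp1 : ∀ i, ‖p i‖ = 1 := fun i => hW.norm _ (hpW i)
  set E : ℕ → ℝ := fun i => (transition G (p i) (p (i + 1))).toReal + ε' with hE
  have hE0 : ∀ i, 0 ≤ E i := fun i => add_nonneg ENNReal.toReal_nonneg hε'0.le
  have hconn : ∀ i < m, Connects G (p i) (p (i + 1)) (ENNReal.ofReal (E i)) := by
    intro i hi
    refine connects_of_transition_lt hG.cont (hp1 i) (hW.zero _ (hpW i)) (hp1 _)
      (hW.zero _ (hpW _)) ?_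
    have hne : transition G (p i) (p (i + 1)) ≠ ⊤ := by
      rw [hpP i hi.le, hpP (i + 1) hi]; exact hfin i hi
    rw [ENNReal.lt_ofReal_iff_toReal_lt hne]
    simp only [hE]
    linarith
  obtain ⟨θ₀, L, M, hθ₀, -, -, hpulse⟩ := exists_pulse hG hp1 (fun i => hW.zero _ (hpW i)) hE0 hε'0 m
    hconn
  set Etot : ℝ := (∑ i ∈ Finset.range m, E i) + m * ε' with hEtot
  have hEtot0 : 0 ≤ Etot := add_nonneg (Finset.sum_nonneg fun i _ => hE0 i) (by positivity)
  have hEle : ENNReal.ofReal Etot ≤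
      (∑ i ∈ Finset.range m, transition G (P i) (P (i + 1))) + ENNReal.ofReal ε := by
    -- Each transition loses `ε'` twice, in the choice of an almost optimal curve and in its
    -- sampling.
    have e1 : Etot = (∑ i ∈ Finset.range m, (transition G (P i) (P (i + 1))).toReal) +
        2 * m * ε' := by
      simp only [hEtot, hE]
      rw [Finset.sum_add_distrib, Finset.sum_const, Finset.card_range, nsmul_eq_mul]
      have : ∑ i ∈ Finset.range m, (transition G (p i) (p (i + 1))).toReal =
          ∑ i ∈ Finset.range m, (transition G (P i) (P (i + 1))).toReal :=
        Finset.sum_congr rfl fun i hi => by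
          have := Finset.mem_range.1 hi
          rw [hpP i this.le, hpP (i + 1) this]
      rw [this]; ring
    have e2 : 2 * m * ε' ≤ ε := by
      rw [hε', ← mul_div_assoc, div_le_iff₀ (by positivity)]
      nlinarith
    rw [e1, ENNReal.ofReal_add (Finset.sum_nonneg fun _ _ => ENNReal.toReal_nonneg) (by positivity),
      ENNReal.ofReal_sum_of_nonneg fun _ _ => ENNReal.toReal_nonneg]
    refine add_le_add (le_of_eq (Finset.sum_congr rfl fun i hi => ?_)) (ENNReal.ofReal_le_ofReal e2)
    exact ENNReal.ofReal_toReal (hfin i (Finset.mem_range.1 hi))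
  -- the scales
  obtain ⟨X, hXx, g, hg, hgap⟩ := hs.exists_nodes
  set h : ℕ → ℝ := fun n => Real.sqrt (2 * del n) with hh
  have hhpos : ∀ n, 0 < h n := fun n => Real.sqrt_pos.2 (by have := hdel n; positivity)
  have hh0 : Tendsto h atTop (𝓝 0) := by
    have := (Real.continuous_sqrt.tendsto _).comp (hdel0.const_mul 2)
    rw [mul_zero, Real.sqrt_zero] at this
    exact this
  -- The angle with chord `h`, for which sampled rotations have zero energy.
  set θ : ℕ → ℝ := fun n => 2 * Real.arcsin (h n / 2) with hθ
  have hθpos : ∀ n, 0 < θ n := fun n =>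
    mul_pos two_pos (Real.arcsin_pos.2 (by have := hhpos n; positivity))
  have hθ0 : Tendsto θ atTop (𝓝 0) := by
    have := ((Real.continuous_arcsin.tendsto _).comp (hh0.div_const 2)).const_mul 2
    rw [zero_div, Real.arcsin_zero, mul_zero] at this
    exact this
  -- The column at abscissa `x` is sampled at time `x Λ`. Since `λ / h → 0`, `Λ` tends to infinity:
  -- jump times move apart, while every transition fits into a time `L`.
  set Λ : ℕ → ℝ := fun n => θ n / lam n with hΛ
  have hθΛ : ∀ n, θ n = lam n * Λ n := fun n => by
    have := (hlam n).ne'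
    simp only [hΛ]; field_simp
  have hΛpos : ∀ n, 0 < Λ n := fun n => div_pos (hθpos n) (hlam n)
  have hchord : ∀ᶠ n in atTop, θ n ≤ 1 ∧ θ n < θ₀ ∧ Real.sqrt (2 * del n) = chord (θ n) := by
    filter_upwards [hθ0.eventually (ge_mem_nhds one_pos), hθ0.eventually (gt_mem_nhds hθ₀),
      hh0.eventually (ge_mem_nhds one_pos)] with n h1 h2 h3
    exact ⟨h1, h2, (chord_two_arcsin (hhpos n) h3).symm⟩
  have hΛtop : Tendsto Λ atTop atTop := by
    have h1 : Tendsto (fun n => lam n / h n) atTop (𝓝 0) := by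
      have := hratio.div_const (Real.sqrt 2)
      rw [zero_div] at this
      refine this.congr fun n => ?_
      simp only [hh]
      rw [Real.sqrt_mul zero_le_two, div_div, mul_comm (Real.sqrt (del n))]
    have h2 : Tendsto (fun n => (lam n / h n)⁻¹) atTop atTop :=
      Tendsto.inv_tendsto_nhdsGT_zero (tendsto_nhdsWithin_iff.2
        ⟨h1, Eventually.of_forall fun n => div_pos (hlam n) (hhpos n)⟩)
    refine tendsto_atTop_mono' _ ?_ h2
    filter_upwards [hchord] with n hn
    obtain ⟨-, hle, -⟩ := chord_bounds (hθpos n) hn.1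
    rw [← hn.2.2] at hle
    rw [inv_div]
    exact div_le_div_of_nonneg_right hle (hlam n).le
  -- A transition begun at abscissa `a` is over before any larger abscissa `b`, even after moving
  -- back by `κ` columns to account for floors and the boundary.
  have hfar : ∀ {a b : ℝ} (κ : ℝ), a < b → ∀ᶠ n in atTop, a * Λ n + L ≤ (b - κ * lam n) * Λ n := by
    intro a b κ hab
    have h1 : Tendsto (fun n => b - κ * lam n - a) atTop (𝓝 (b - κ * 0 - a)) :=
      (tendsto_const_nhds.sub (hlam0.const_mul κ)).sub_const a
    rw [mul_zero, sub_zero] at h1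
    filter_upwards [(h1.pos_mul_atTop (sub_pos.2 hab) hΛtop).eventually_ge_atTop L] with n hn
    linarith
  -- the spin fields
  have hex : ∀ n, ∃ u v f : ℝ → E3, L ≤ g * Λ n →
      IsPulse G p m (fun i => X (i + 1) * Λ n) L M θ₀ Etot u v f := by
    intro n
    by_cases hn : L ≤ g * Λ n
    · obtain ⟨u, v, f, H⟩ := hpulse (fun i => X (i + 1) * Λ n) fun i => by
        have h1 := mul_le_mul_of_nonneg_right (hgap (i + 1)) (hΛpos n).le
        rw [add_mul] at h1
        linarith
      exact ⟨u, v, f, fun _ => H⟩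
    · exact ⟨0, 0, 0, fun h => absurd h hn⟩
  choose u v f hpul using hex
  have hgood : ∀ᶠ n in atTop, L ≤ g * Λ n := (hΛtop.const_mul_atTop hg).eventually_ge_atTop L
  set w : ℕ → E2 → E3 := fun n => chirality (lam n) (del n) (sampled (u n) (θ n)) with hw
  have hwm : ∀ n, Measurable (w n) := fun n => measurable_chirality _ _ _
  have hwb : ∀ᶠ n in atTop, ∀ s, ‖w n s‖ ≤ 2 * M := by
    filter_upwards [hchord, hgood] with n h1 h2 s
    exact norm_chirality_sampled_le (hpul n h2) (lam n) (hθpos n) h1.1 h1.2.2 s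
  have hspin : ∀ᶠ n in atTop, IsSpinField (lam n) (sampled (u n) (θ n)) := by
    have hx1 : 0 < x 1 := by rw [← hs.zero]; exact hs.lt 0 (Nat.zero_le _)
    have hxm : x m < 1 := by rw [← hs.one]; exact hs.lt m le_rfl
    have hl2 : ∀ᶠ n in atTop, 2 * lam n ≤ x 1 := by
      have := hlam0.const_mul 2
      rw [mul_zero] at this
      exact this.eventually (ge_mem_nhds hx1)
    filter_upwards [hgood, hl2, hfar 2 hxm] with n h1 h2 h3
    refine isSpinField_sampled (hpul n h1) hp1 (hlam n) (hθpos n) (fun _ => ?_) fun hm => ?_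
    · rw [hXx 1 (by omega), hθΛ n]
      nlinarith [hΛpos n]
    · rw [Nat.sub_add_cancel hm, hXx m (by omega)]
      refine h3.trans ?_
      rw [hθΛ n, ← mul_assoc]
      refine mul_le_mul_of_nonneg_right ?_ (hΛpos n).le
      have h4 : 1 / lam n ≤ (side (lam n) : ℝ) + 1 := by
        rw [side]; push_cast; linarith [Int.le_ceil (1 / lam n)]
      rw [div_le_iff₀ (hlam n)] at h4
      linarith
  -- convergence
  have hconv : ∀ᵐ s ∂volOmega, Tendsto (fun n => w n s) atTop (𝓝 (z s)) := by
    have hall : ∀ᵐ s : E2, ∀ i ≤ m, s ∈ Omega → s 0 ∈ Ioo (x i) (x (i + 1)) → z s = P i := by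
      rw [ae_all_iff]; intro i
      rw [eventually_imp_distrib_left]
      exact hs.ae_plane hz
    have hne : ∀ᵐ t : ℝ, ∀ i, t ≠ x (i + 1) := ae_all_iff.2 fun i => by simp [ae_iff]
    filter_upwards [ae_restrict_of_ae hall, ae_of_fst (ae_restrict_of_ae hne),
      ae_restrict_mem measurableSet_Omega] with s h1 h2 h3
    obtain ⟨hs0, hs1⟩ := mem_Omega.1 h3
    rcases hs.exists_mem hs0 with ⟨i, hi, hsi⟩ | ⟨i, -, hsi⟩
    swap
    · exact (h2 i hsi).elim
    rw [h1 i hi h3 hsi, ← hpP i hi]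
    have ht : Tendsto (fun n => Real.cos (θ n / 2) • p i) atTop (𝓝 ((1 : ℝ) • p i)) := by
      have := (Real.continuous_cos.tendsto _).comp (hθ0.div_const 2)
      rw [zero_div, Real.cos_zero] at this
      exact this.smul_const _
    rw [one_smul] at ht
    refine ht.congr' ?_
    have hl1 : ∀ᶠ n in atTop, lam n ≤ x (i + 1) - s 0 :=
      hlam0.eventually (ge_mem_nhds (sub_pos.2 hsi.2))
    filter_upwards [hchord, hgood, eventually_floor hlam hlam0 hs0 1,
      eventually_floor hlam hlam0 hs1 0, hfar 1 hsi.1, hl1] with n e1 e2 e3 e4 e5 e6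
    obtain ⟨f1, f2⟩ := mul_floor_bounds (hlam n) (s 0)
    refine (chirality_sampled_eq (hpul n e2) hp1 (hlam n) (hθpos n) e1.1 e1.2.2
      (by simpa using e3) (by simpa using e4) hi (fun hi0 => ?_) fun him => ?_).symm
    · rw [Nat.sub_add_cancel hi0, hXx i (by omega)]
      refine e5.trans ?_
      rw [hθΛ n, ← mul_assoc]
      exact mul_le_mul_of_nonneg_right (by linarith) (hΛpos n).le
    · rw [hXx (i + 1) (by omega), hθΛ n, ← mul_assoc]
      exact mul_le_mul_of_nonneg_right (by linarith) (hΛpos n).le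
  have hD : Tendsto (fun n => ∫⁻ s, ‖w n s - z s‖ₑ ∂volOmega) atTop (𝓝 0) := by
    have h0 : ∫⁻ _ : E2, (0 : ℝ≥0∞) ∂volOmega = 0 := lintegral_zero
    rw [← h0]
    refine tendsto_lintegral_filter_of_dominated_convergence
      (fun _ => ENNReal.ofReal (2 * M + 1)) (Eventually.of_forall fun n =>
        ((hwm n).sub (Lp.stronglyMeasurable z).measurable).enorm) ?_ ?_ ?_
    · filter_upwards [hwb] with n hn
      filter_upwards [hmem] with s hs'
      rw [← ofReal_norm]
      refine ENNReal.ofReal_le_ofReal ((norm_sub_le _ _).trans (add_le_add (hn s) ?_))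
      exact (hW.norm _ (mem_wellSet.2 hs')).le
    · rw [lintegral_const]
      exact ENNReal.mul_ne_top ENNReal.ofReal_ne_top (measure_ne_top _ _)
    · filter_upwards [hconv] with s hs'
      have := (hs'.sub_const (z s)).enorm
      rwa [sub_self, enorm_zero] at this
  -- conclusion
  filter_upwards [hchord, hgood, hwb, hspin,
    hD.eventually (ge_mem_nhds (ENNReal.ofReal_pos.2 hε))] with n h1 h2 h3 h4 h5
  have hLp : MemLp (w n) 1 volOmega :=
    MemLp.of_bound (hwm n).aestronglyMeasurable (2 * M) (ae_of_all _ h3)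
  have hs0 : 0 < Real.sqrt 2 * lam n * del n ^ (3 / 2 : ℝ) := by
    have := hlam n
    have := Real.rpow_pos_of_pos (hdel n) (3 / 2)
    positivity
  refine ⟨hLp.toLp (w n), ?_, ?_⟩
  · rw [Lp.edist_def, eLpNorm_congr_ae (hLp.coeFn_toLp.sub EventuallyEq.rfl),
      eLpNorm_one_eq_lintegral_enorm]
    exact h5
  · refine (ENNReal.div_le_of_le_mul ?_).trans hEle
    refine (iInf_le_of_le (sampled (u n) (θ n)) (iInf₂_le_of_le h4 hLp.coeFn_toLp.symm le_rfl)).trans ?_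
    -- Sampling does not depend on the row, so the vertical energy is zero and the size of `J₂`
    -- plays no role.
    rw [← ENNReal.ofReal_mul hEtot0, energy_eq (hlam n) (hdel n) rfl, verE_sampled, mul_zero, add_zero,
      h1.2.2, mul_comm]
    exact ENNReal.ofReal_le_ofReal (mul_le_mul_of_nonneg_right
      (horE_sampled_le (hpul n h2) hEtot0 (hlam n) (hθpos n) h1.2.1) hs0.le)

end HelicalXY

end

end

/-! ### The theorem. -/

theorem theorem4p2
    (k : ℕ) (hk : 1 ≤ k) (q : Fin k → HelicalXY.E3)
    (hq : ∀ l, ‖q l‖ = 1) (hqinj : Function.Injective q)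
    (G : HelicalXY.E3 → ℝ) (hGnonneg : ∀ x, 0 ≤ G x)
    (hGcont : ContinuousOn G {0}ᶜ)
    (hGhom : ∀ (t : ℝ) (x : HelicalXY.E3), 0 < t → G (t • x) = G x)
    (hGzero : {x | G x = 0} = HelicalXY.lines q)
    (lam del J₂ : ℕ → ℝ)
    (hlam : ∀ n, 0 < lam n) (hlam0 : Tendsto lam atTop (𝓝 0))
    (hdel : ∀ n, 0 < del n) (hdel0 : Tendsto del atTop (𝓝 0))
    (hratio : Tendsto (fun n => lam n / Real.sqrt (del n)) atTop (𝓝 0))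
    (c : ℝ) (hc : 0 < c) (hJ₂ : ∀ n, c ≤ J₂ n * (lam n / Real.sqrt (del n))) :
    HelicalXY.GammaConverges
      (fun n z => HelicalXY.energyHG (lam n) (del n) (J₂ n) G z /
        ENNReal.ofReal (Real.sqrt 2 * lam n * del n ^ (3 / 2 : ℝ)))
      (HelicalXY.limitEnergy q G) := by
  have h0 : G 0 = 0 := by
    have : (0 : HelicalXY.E3) ∈ {x | G x = 0} := by
      rw [hGzero]
      -- With at least one line the origin lies in the zero set, so `G 0 = 0`.
      exact mem_iUnion.2 ⟨⟨0, hk⟩, zero_mem _⟩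
    exact this
  have hG : HelicalXY.IsPenalty G := ⟨hGcont, hGnonneg, hGhom, h0⟩
  exact ⟨fun z zs hz => HelicalXY.limitEnergy_le_liminf hq hG hGzero hlam hlam0 hdel hdel0 hratio hc
      hJ₂ hz,
    fun z => HelicalXY.exists_recovery_sequence hq hG hGzero hlam hlam0 hdel hdel0 hratio z⟩
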